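/- **Setting.** Let $A$ be the path algebra over $\mathbb F_2$ of the quiver with vertices $\iota_0,\iota_1$, arrows $\rho_1,\rho_3$ from $\iota_0$ to $\iota_1$ and $\rho_2,\rho_4$ from $\iota_1$ to $\iota_0$, modulo $\rho_2\rho_1=\rho_3\rho_2=\rho_4\rho_3=\rho_1\rho_4=0$. It has basis $\iota_0,\iota_1$ and the chords $\rho_{i,i+1,\dots,i+n}=\rho_i\rho_{i+1}\cdots\rho_{i+n}$ ($i\in\mathbb Z/4$, $n\ge 0$). Let $k=\mathbb F_2\iota_0\oplus\mathbb F_2\iota_1$ and $A[U]=A\otimes\mathbb F_2[U]$. *The $A_\infty$-algebra $\mathcal A^0_-$.* It has underlying $k$-bimodule $A[U]$ and $U$-multilinear operations: $\mu_2$ is the product, and for $n\ne 2$ and basis elements $b_1,\dots,b_n$ of $A$, $\mu_n(b_1,\dots,b_n)$ is the sum of the outputs of all tiling patterns of weight zero with chord sequence $b_1\otimes\dots\otimes b_n$. Such a pattern is a tree with at least one internal vertex, embedded in the disk with its leaves on the boundary, one of which is the root, all internal vertices being 4-valent. The quadrants around each vertex are labelled by $4,3,2,1$ in counterclockwise cyclic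 order, so that for an oriented edge from $v_1$ to $v_2$ the labels $p$, $q$ of the quadrants at $v_1$, $v_2$ on its right satisfy $q\equiv p+1 \pmod 4$. Moreover, the pattern is either centered (nothing else), or left- or right-extended: finitely many (at least one) 2-valent vertices are inserted on the edge at the root, with labelled sectors on its left, respectively its right (when it is oriented towards the root), subject to the same rule along edges. The leaves and the root cut the boundary circle into intervals; reading counterclockwise from the root, each interval gives the product of the $\rho$'s of the labelled sectors visible from it, and these products form the chord sequence. The output is $U^d$, $d$ the number of 4-valent vertices, times the left idempotent of the first chord if the pattern is centered, and times the product of the $\rho$'s of the 2-valent sectors otherwise. *Weighted algebras.* A (strictly unital) weighted $A_\infty$-algebra over $k$ on a $k$-bimodule $B\supset k$ consists of $k$-bimodule maps $\mu_n^w\colon B^{\otimes_k n}\to B$ ($n,w\ge 0$) with $\mu_0^0=0$, $\mu_2^0(r,b)=rb$, $\mu_2^0(b,r)=br$ for $r\in k$, $\mu_n^w(\dots,r,\dots)=0$ for $r\in k$ and $(n,w)\neq(2,0)$, and $$\sum_{u+v=w}\ \sum_{p+q=n+1}\ \sum_{i=0}^{n-q}\mu_p^u(a_1,\dots,a_i,\mu_q^v(a_{i+1},\dots,a_{i+q}),a_{i+q+1},\dots,a_n)=0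 .$$ A weighted deformation of $\mathcal A^0_-$ is a weighted $A_\infty$-algebra on $A[U]$ over $k$ (not required to be $U$-linear) with $\mu^0_n=\mu_n$ for all $n$. A homomorphism of weighted deformations is a strictly unital family $f_n^w\colon A[U]^{\otimes_k n}\to A[U]$ of $k$-bimodule maps with $f_1^0=\mathrm{id}$, $f_n^0=0$ for $n\ne1$, satisfying the weighted $A_\infty$-homomorphism relations $$\sum_{u+v=w} f^u(\dots,\mu^v(\dots),\dots)+\sum_{m\ge 0}\ \sum_{u+w_1+\dots+w_m=w}\bar\mu^u(f^{w_1}(\dots),\dots,f^{w_m}(\dots))=0 ;$$ it is an isomorphism if it has a two-sided inverse homomorphism. *Gradings.* Let $G$ be the set of $(m;a,b)\in(\tfrac12\mathbb Z)^3$ with $a+b\in\mathbb Z$ and $m+\tfrac{(2a+1)(a+b+1)+1}{2}\in\mathbb Z$, with product $(m;a,b)(n;c,d)=(m+n+ad-bc;a+c,b+d)$, and $\Gamma=G\times\mathbb Z$. Grade $A[U]$ multiplicatively by $\gamma(\iota_0)=\gamma(\iota_1)=1$, $\gamma(\rho_1)=(-\tfrac12;\tfrac12,-\tfrac12)\times0$,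 $\gamma(\rho_2)=(-\tfrac12;\tfrac12,\tfrac12)\times0$, $\gamma(\rho_3)=(-\tfrac12;-\tfrac12,\tfrac12)\times0$, $\gamma(\rho_4)=(-\tfrac32;-\tfrac12,-\tfrac12)\times1$, $\gamma(U)=(-2;0,0)\times1$. Put $\lambda_d=(1;0,0)\times0$ and $\lambda_w=(0;0,0)\times1$. A weighted deformation is $\Gamma$-graded if each $\mu_n^w$ has degree $\lambda_d^{n-2}\lambda_w^w$, and a homomorphism is $\Gamma$-graded if each $f_n^w$ has degree $\lambda_d^{n-1}\lambda_w^w$. **Theorem.** Up to isomorphism there is a unique $\Gamma$-graded weighted deformation $\mathcal A_-$ of $\mathcal A^0_-$ with $$\mu_0^1=\rho_{1234}+\rho_{2341}+\rho_{3412}+\rho_{4123}.$$ That is, such a deformation exists, and any two of them are isomorphic, by a $\Gamma$-graded isomorphism of weighted deformations (whose weight-zero part is the identity) with $\Gamma$-graded inverse. -/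

import Mathlib

/-!
Weighted `A∞`-algebras over a ground ring `k` of characteristic two, and the torus algebra.

Operations on tensor powers over `k` are encoded as functions on lists: a map
`A ⊗_k ⋯ ⊗_k A → A` for every number of inputs is the same as a function `List A → A` that is
additive in every entry and compatible with the `k`-bimodule structure (`IsMultilinear`).
-/

namespace WeightedAInfinity

variable {A : Type*} [Ring A] [Algebra (ZMod 2) A]

/-- `φ` restricts, on lists of each length `n`, to a map of `k`-bimodules `A^{⊗_k n} → A`. -/
structure IsMultilinear (k : Subalgebra (ZMod 2) A) (φ : List A → A) : Prop where
  map_add : ∀ (l₁ l₂ : List A) (a b : A),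
    φ (l₁ ++ (a + b) :: l₂) = φ (l₁ ++ a :: l₂) + φ (l₁ ++ b :: l₂)
  balanced : ∀ (l₁ l₂ : List A) (a b : A), ∀ r ∈ k,
    φ (l₁ ++ (a * r) :: b :: l₂) = φ (l₁ ++ a :: (r * b) :: l₂)
  left_linear : ∀ (l : List A) (a : A), ∀ r ∈ k, φ ((r * a) :: l) = r * φ (a :: l)
  right_linear : ∀ (l : List A) (a : A), ∀ r ∈ k, φ (l ++ [a * r]) = φ (l ++ [a]) * r
  nullary : ∀ r ∈ k, r * φ [] = φ [] * r

/-- The sum, over all ways `l = l₁ ++ m ++ l₂` of selecting a string `m` of consecutive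
(possibly no) entries of `l` and over all `u + v = W`, of `f^u (l₁, μ^v(m), l₂)`. -/
def insertSum (f μ : ℕ → List A → A) (W : ℕ) (l : List A) : A :=
  ∑ uv ∈ Finset.HasAntidiagonal.antidiagonal W, ∑ i ∈ Finset.range (l.length + 1),
    ∑ q ∈ Finset.range (l.length - i + 1),
      f uv.1 (l.take i ++ [μ uv.2 ((l.drop i).take q)] ++ l.drop (i + q))

/-- All sequences `((w₁, l₁), …, (w_m, l_m))` of `m` weighted blocks with `w₁ + ⋯ + w_m = W`
and `l₁ ++ ⋯ ++ l_m = l`; blocks may be empty. -/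
def blocks : (m W : ℕ) → (l : List A) → List (List (ℕ × List A))
  | 0, 0, [] => [[]]
  | 0, _, _ => []
  | m + 1, W, l =>
      (List.range (W + 1)).flatMap fun w =>
        (List.range (l.length + 1)).flatMap fun q =>
          (blocks m (W - w) (l.drop q)).map fun B => (w, l.take q) :: B

/-- The sum of `g^a (f^{w₁}(l₁), …, f^{w_m}(l_m))` over all `m`, all `l₁ ++ ⋯ ++ l_m = l` and all
`a + w₁ + ⋯ + w_m = W`. This is used for families with `f^0() = 0`, so that only the terms in
which no block is `(0, [])` matter; these have `m ≤ l.length + W`. -/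
def composeSum (g f : ℕ → List A → A) (W : ℕ) (l : List A) : A :=
  ∑ ab ∈ Finset.HasAntidiagonal.antidiagonal W, ∑ m ∈ Finset.range (l.length + W + 1),
    ((blocks m ab.2 l).map fun B => g ab.1 (B.map fun p => f p.1 p.2)).sum

/-- A strictly unital weighted `A∞`-algebra over the ground ring `k`, with underlying
`k`-bimodule `A`; `op w l` is the operation `μ_n^w` with `n = l.length`.
(The characteristic is two, so there are no signs.) -/
structure WeightedAlgebra (k : Subalgebra (ZMod 2) A) where
  op : ℕ → List A → A
  multilinear : ∀ w, IsMultilinear k (op w)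
  op_zero_nil : op 0 [] = 0
  op_unit_left : ∀ r ∈ k, ∀ a : A, op 0 [r, a] = r * a
  op_unit_right : ∀ r ∈ k, ∀ a : A, op 0 [a, r] = a * r
  op_unit : ∀ (w : ℕ) (l : List A), (l.length ≠ 2 ∨ w ≠ 0) → (∃ r ∈ l, r ∈ k) → op w l = 0
  relation : ∀ (W : ℕ) (l : List A), insertSum op op W l = 0

/-- A strictly unital homomorphism of weighted `A∞`-algebras with the same underlying bimodule;
`map w l` is the component `f_n^w` with `n = l.length`. -/
structure Hom {k : Subalgebra (ZMod 2) A} (X Y : WeightedAlgebra k) where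
  map : ℕ → List A → A
  multilinear : ∀ w, IsMultilinear k (map w)
  map_zero_nil : map 0 [] = 0
  map_unit : ∀ r ∈ k, map 0 [r] = r
  map_unit_eq_zero : ∀ (w : ℕ) (l : List A), (l.length ≠ 1 ∨ w ≠ 0) → (∃ r ∈ l, r ∈ k) →
    map w l = 0
  relation : ∀ (W : ℕ) (l : List A),
    insertSum map X.op W l + composeSum Y.op map W l = 0

/-- The components of the identity homomorphism of the undeformed algebra. -/
def idZero : List A → A
  | [a] => a
  | _ => 0

/-- The components of the identity homomorphism. -/
def idMap : ℕ → List A → A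
  | 0 => idZero
  | _ + 1 => fun _ => 0

/-- `X` is a weighted deformation of the `A∞`-algebra with operations `μ` (on the same
underlying bimodule): its weight-zero operations are `μ`. -/
def IsDeformationOf {k : Subalgebra (ZMod 2) A} (X : WeightedAlgebra k) (μ : List A → A) : Prop :=
  X.op 0 = μ

/-- A homomorphism of deformations: its weight-zero part is the identity. -/
def Hom.IsOverIdentity {k : Subalgebra (ZMod 2) A} {X Y : WeightedAlgebra k}
    (f : Hom X Y) : Prop :=
  f.map 0 = idZero

/-- `f` and `g` are mutually inverse homomorphisms. -/
def Hom.IsInverse {k : Subalgebra (ZMod 2) A} {X Y : WeightedAlgebra k}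
    (f : Hom X Y) (g : Hom Y X) : Prop :=
  composeSum g.map f.map = idMap ∧ composeSum f.map g.map = idMap

/-- `φ` has degree `c` on lists of length `n`, where `c` depends on `n` only: it sends
homogeneous elements of degrees `g₁, …, g_n` to a homogeneous element of degree `c n g₁ ⋯ g_n`. -/
def HasDegree {Γ : Type*} [Group Γ] (𝒜 : Γ → Submodule (ZMod 2) A) (φ : List A → A)
    (c : ℕ → Γ) : Prop :=
  ∀ l : List (A × Γ), (∀ p ∈ l, p.1 ∈ 𝒜 p.2) →
    φ (l.map Prod.fst) ∈ 𝒜 (c l.length * (l.map Prod.snd).prod)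

/-- `(Γ, lamD, lamW)`-graded weighted algebras: `μ_n^w` has degree `lamD^(n-2) lamW^w`. -/
def WeightedAlgebra.IsGraded {Γ : Type*} [Group Γ] {k : Subalgebra (ZMod 2) A}
    (X : WeightedAlgebra k) (𝒜 : Γ → Submodule (ZMod 2) A) (lamD lamW : Γ) : Prop :=
  ∀ w : ℕ, HasDegree 𝒜 (X.op w) fun n => lamD ^ ((n : ℤ) - 2) * lamW ^ w

/-- Graded homomorphisms: `f_n^w` has degree `lamD^(n-1) lamW^w`. -/
def Hom.IsGraded {Γ : Type*} [Group Γ] {k : Subalgebra (ZMod 2) A} {X Y : WeightedAlgebra k}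
    (f : Hom X Y) (𝒜 : Γ → Submodule (ZMod 2) A) (lamD lamW : Γ) : Prop :=
  ∀ w : ℕ, HasDegree 𝒜 (f.map w) fun n => lamD ^ ((n : ℤ) - 1) * lamW ^ w

end WeightedAInfinity

namespace TorusAlgebra

/-! ### The associative algebra -/

/-- The basis of the path algebra with relations: the idempotents `ι_0`, `ι_1` and the chords
`chord i n = ρ_i ρ_{i+1} ⋯ ρ_{i+n}` (length `n + 1`), with `i` taken mod 4, so `ρ_4 = chord 0 0`. -/
inductive Basic : Type
  | idem (e : Fin 2)
  | chord (i : ZMod 4) (n : ℕ)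

/-- The vertex of the quiver at which the arrow `ρ_i` starts; `ρ_1`, `ρ_3` start at `ι_0`
and end at `ι_1`, while `ρ_2`, `ρ_4` start at `ι_1` and end at `ι_0`. -/
def source (i : ZMod 4) : Fin 2 := if i = 1 ∨ i = 3 then 0 else 1

/-- The vertex at which a chord ends: it is where the next arrow in cyclic order starts. -/
def target (i : ZMod 4) (n : ℕ) : Fin 2 := source (i + n + 1)

/-- The product of basis elements, `none` standing for zero. The relations
`ρ_2 ρ_1 = ρ_3 ρ_2 = ρ_4 ρ_3 = ρ_1 ρ_4 = 0` leave only the products `ρ_i ρ_{i+1}` of arrows. -/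
def Basic.mul : Basic → Basic → Option Basic
  | .idem e, .idem f => if e = f then some (.idem e) else none
  | .idem e, .chord i n => if e = source i then some (.chord i n) else none
  | .chord i n, .idem f => if target i n = f then some (.chord i n) else none
  | .chord i n, .chord j m => if j = i + n + 1 then some (.chord i (n + m + 1)) else none

/-- The `𝔽₂`-vector space with basis `U^m b`, where `m : ℕ` and `b` is a basis element of the path
algebra with relations: the algebra obtained from the latter by adjoining the variable `U`. -/
def Alg : Type := (ℕ × Basic) →₀ ZMod 2

noncomputable instance : AddCommGroup Alg := inferInstanceAs (AddCommGroup ((ℕ × Basic) →₀ ZMod 2))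
noncomputable instance : Module (ZMod 2) Alg :=
  inferInstanceAs (Module (ZMod 2) ((ℕ × Basic) →₀ ZMod 2))

/-- The basis element `U^m b`. -/
noncomputable def monomial (m : ℕ) (b : Basic) : Alg := Finsupp.single (m, b) 1

/-- `U^m` times a basis element or zero. -/
noncomputable def monomialOption (m : ℕ) : Option Basic → Alg
  | some b => monomial m b
  | none => 0

/-- The product `(U^m a) (U^n b)`. -/
noncomputable def basisMul (x y : ℕ × Basic) : Alg := monomialOption (x.1 + y.1) (x.2.mul y.2)

/-- The bilinear extension of the product. -/
noncomputable def mulHom : Alg →ₗ[ZMod 2] Alg →ₗ[ZMod 2] Alg :=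
  Finsupp.linearCombination (ZMod 2) fun x : ℕ × Basic =>
    (Finsupp.linearCombination (ZMod 2) fun y : ℕ × Basic => basisMul x y :
      ((ℕ × Basic) →₀ ZMod 2) →ₗ[ZMod 2] Alg)

theorem mulHom_monomial (m n : ℕ) (a b : Basic) :
    mulHom (monomial m a) (monomial n b) = monomialOption (m + n) (a.mul b) := by
  unfold mulHom monomial
  erw [Finsupp.linearCombination_single, one_smul, Finsupp.linearCombination_single, one_smul]
  rfl

theorem Alg.induction {P : Alg → Prop} (zero : P 0) (add : ∀ a b, P a → P b → P (a + b))
    (mono : ∀ m b, P (monomial m b)) (a : Alg) : P a := by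
  refine Finsupp.induction_linear (motive := P) a zero add ?_
  rintro ⟨m, b⟩ c
  have h : c = 0 ∨ c = 1 := by revert c; decide
  rcases h with rfl | rfl
  · rw [Finsupp.single_zero]; exact zero
  · exact mono m b

theorem Basic.mul_assoc (a b c : Basic) :
    (a.mul b).bind (fun x => x.mul c) = (b.mul c).bind (fun x => a.mul x) := by
  have t : ∀ (i : ZMod 4) (n m : ℕ), target i (n + m + 1) = target (i + n + 1) m := by
    intro i n m
    unfold target
    congr 1
    push_cast
    ring
  have s : ∀ (i : ZMod 4) (n : ℕ), source (i + n + 1) = target i n := fun _ _ => rfl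
  rcases a with e | ⟨i, n⟩ <;> rcases b with f | ⟨j, m⟩ <;> rcases c with g | ⟨l, p⟩ <;>
    simp only [Basic.mul]
  all_goals (split_ifs <;> simp_all)
  all_goals first
    | (rintro rfl; simp_all; done)
    | (constructor <;> ring)
    | (intro h; subst h; rename_i h; exact h (by ring))

theorem mulHom_option_monomial (m n : ℕ) (o : Option Basic) (c : Basic) :
    mulHom (monomialOption m o) (monomial n c) =
      monomialOption (m + n) (o.bind fun x => x.mul c) := by
  cases o with
  | none => simp [monomialOption]
  | some x => exact mulHom_monomial m n x c

theorem mulHom_monomial_option (m n : ℕ) (a : Basic) (o : Option Basic) :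
    mulHom (monomial m a) (monomialOption n o) =
      monomialOption (m + n) (o.bind fun x => a.mul x) := by
  cases o with
  | none => simp [monomialOption]
  | some x => exact mulHom_monomial m n a x

theorem mulHom_assoc (a b c : Alg) : mulHom (mulHom a b) c = mulHom a (mulHom b c) := by
  refine Alg.induction (P := fun a => mulHom (mulHom a b) c = mulHom a (mulHom b c))
    (by simp) (fun x y hx hy => by simp [hx, hy]) (fun m x => ?_) a
  refine Alg.induction
    (P := fun b => mulHom (mulHom (monomial m x) b) c = mulHom (monomial m x) (mulHom b c))
    (by simp) (fun x y hx hy => by simp [hx, hy]) (fun n y => ?_) b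
  refine Alg.induction
    (P := fun c => mulHom (mulHom (monomial m x) (monomial n y)) c =
      mulHom (monomial m x) (mulHom (monomial n y) c))
    (by simp) (fun x y hx hy => by simp [hx, hy]) (fun p z => ?_) c
  rw [mulHom_monomial, mulHom_monomial, mulHom_option_monomial, mulHom_monomial_option,
    Basic.mul_assoc, Nat.add_assoc]

/-- The idempotents `ι_0` and `ι_1`. -/
noncomputable def iota (e : Fin 2) : Alg := monomial 0 (.idem e)

theorem mulHom_one (a : Alg) : mulHom a (iota 0 + iota 1) = a := by
  refine Alg.induction (P := fun a => mulHom a (iota 0 + iota 1) = a)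
    (by simp) (fun x y hx hy => ?_) (fun m x => ?_) a
  · rw [map_add mulHom, LinearMap.add_apply, hx, hy]
  · rw [map_add, iota, iota, mulHom_monomial, mulHom_monomial]
    cases x with
    | idem e => fin_cases e <;> simp [Basic.mul, monomialOption]
    | chord i n =>
      simp only [Basic.mul]
      generalize target i n = e
      fin_cases e <;> simp [monomialOption]

theorem one_mulHom (a : Alg) : mulHom (iota 0 + iota 1) a = a := by
  refine Alg.induction (P := fun a => mulHom (iota 0 + iota 1) a = a)
    (by simp) (fun x y hx hy => ?_) (fun m x => ?_) a
  · rw [map_add, hx, hy]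
  · rw [map_add, LinearMap.add_apply, iota, iota, mulHom_monomial, mulHom_monomial]
    cases x with
    | idem e => fin_cases e <;> simp [Basic.mul, monomialOption]
    | chord i n =>
      simp only [Basic.mul]
      generalize source i = e
      fin_cases e <;> simp [monomialOption]

noncomputable instance : Ring Alg :=
  { (inferInstance : AddCommGroup Alg) with
    mul := fun a b => mulHom a b
    one := iota 0 + iota 1
    left_distrib := fun a b c => map_add (mulHom a) b c
    right_distrib := fun a b c => by
      change mulHom (a + b) c = mulHom a c + mulHom b c
      rw [map_add, LinearMap.add_apply]
    zero_mul := fun a => by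
      change mulHom 0 a = 0
      rw [map_zero, LinearMap.zero_apply]
    mul_zero := fun a => map_zero (mulHom a)
    mul_assoc := mulHom_assoc
    one_mul := one_mulHom
    mul_one := mulHom_one }

noncomputable instance : Algebra (ZMod 2) Alg :=
  Algebra.ofModule
    (fun r a b => by
      change mulHom (r • a) b = r • mulHom a b
      rw [map_smul, LinearMap.smul_apply])
    (fun r a b => (mulHom a).map_smul r b)

/-- The ground ring, spanned by the two idempotents (so isomorphic to `𝔽₂ ⊕ 𝔽₂`). -/
noncomputable def ground : Subalgebra (ZMod 2) Alg := Algebra.adjoin (ZMod 2) {iota 0, iota 1}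

/-- The chord `ρ_i ρ_{i+1} ⋯ ρ_{i+n}` as an element of the algebra. -/
noncomputable def rho (i : ZMod 4) (n : ℕ) : Alg := monomial 0 (.chord i n)

/-! ### The undeformed `A∞`-algebra

Its higher operations count planar trees in the disk all of whose internal vertices are
4-valent. Such a tree, with a distinguished leaf (the root), is a planar tree in which every
internal vertex has three ordered children; these are listed in the counterclockwise order around
the vertex, starting after the edge towards the root. The quadrants around an internal vertex,
counterclockwise starting after the edge towards the root, carry labels `i, i-1, i-2, i-3`,
and if an edge points from `v₁` to `v₂`, the labels `p`, `q` of the quadrants at `v₁`, `v₂` on its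
right side satisfy `q = p + 1`, so that a labelling is determined by its value on one quadrant. -/

/-- Rooted planar trees all of whose internal vertices have valence four. -/
inductive PlaneTree : Type
  | leaf
  | node (first second third : PlaneTree)

/-- The number of internal vertices. -/
def PlaneTree.size : PlaneTree → ℕ
  | .leaf => 0
  | .node a b c => a.size + b.size + c.size + 1

/-- Concatenates two sequences of words, merging the last word of the first one with the first
word of the second one. -/
def glue {α : Type*} : List (List α) → List (List α) → List (List α)
  | [], v => v
  | [x], [] => [x]
  | [x], y :: v => (x ++ y) :: v
  | x :: x' :: u, v => x :: glue (x' :: u) v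

/-- Walk once counterclockwise around the tree, starting and ending at the root. The leaves cut the
boundary of the disk into intervals; this is the sequence, over the intervals, of the words formed
by the labels of the quadrants visible along the interval. The first quadrant is labelled `i`. -/
def PlaneTree.words : PlaneTree → ZMod 4 → List (List (ZMod 4))
  | .leaf, _ => [[], []]
  | .node a b c, i =>
      glue [[i]] <| glue (a.words (i + 1)) <| glue [[i - 1]] <| glue (b.words i) <|
        glue [[i - 2]] <| glue (c.words (i - 1)) [[i - 3]]

/-- The chain of 2-valent vertices inserted on the edge at the root; `left n` and `right n` stand
for `n + 1` such vertices, whose sectors on the left (respectively right) of the edge, oriented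
towards the root, are labelled. -/
inductive RootExtension : Type
  | centered
  | left (n : ℕ)
  | right (n : ℕ)

/-- A tiling pattern whose graph is a tree with at least one 4-valent vertex; `label` is the label
of the first quadrant, counterclockwise from the root, of the vertex next to the root. -/
structure TilingPattern : Type where
  first : PlaneTree
  second : PlaneTree
  third : PlaneTree
  label : ZMod 4
  extension : RootExtension

namespace TilingPattern

/-- The 4-valent tree of the pattern. -/
def tree (p : TilingPattern) : PlaneTree := .node p.first p.second p.third

/-- The `n + 1` labels `i, i + 1, …, i + n` of the chord `ρ_i ⋯ ρ_{i+n}`. -/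
def run (i : ZMod 4) (n : ℕ) : List (ZMod 4) := (List.range (n + 1)).map fun j : ℕ => i + (j : ZMod 4)

/-- The chord sequence, each chord being given by the word of its labels. The additional sectors of
a left (right) extended pattern are seen at the start of the first (end of the last) interval. -/
def chordWords (p : TilingPattern) : List (List (ZMod 4)) :=
  match p.extension with
  | .centered => p.tree.words p.label
  | .left n => glue [run (p.label - (n + 1)) n] (p.tree.words p.label)
  | .right n => glue (p.tree.words p.label) [run (p.label - 2) n]

/-- The output element, without its power of `U`: an idempotent for a centered pattern, and the
chord read off from the additional sectors for an extended one. -/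
def output (p : TilingPattern) : Basic :=
  match p.extension with
  | .centered => .idem (source p.label)
  | .left n => .chord (p.label - (n + 1)) n
  | .right n => .chord (p.label - 2) n

end TilingPattern

/-- The word of labels of a basis element (empty for an idempotent; the words in the chord sequence
of a tiling pattern are never empty). -/
def Basic.word : Basic → List (ZMod 4)
  | .idem _ => []
  | .chord i n => TilingPattern.run i n

/-- The tiling patterns with given chord sequence. -/
def patterns (l : List Basic) : Set TilingPattern := {p | p.chordWords = l.map Basic.word}

theorem flatten_glue {α : Type*} (u v : List (List α)) :
    (glue u v).flatten = u.flatten ++ v.flatten := by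
  fun_induction glue u v <;> simp_all

theorem PlaneTree.length_flatten_words (t : PlaneTree) (i : ZMod 4) :
    (t.words i).flatten.length = 4 * t.size := by
  induction t generalizing i with
  | leaf => simp [words, size]
  | node a b c ha hb hc => simp [words, size, flatten_glue, ha, hb, hc]; ring

theorem PlaneTree.finite_size_le (N : ℕ) : {t : PlaneTree | t.size ≤ N}.Finite := by
  induction N with
  | zero =>
    refine (Set.finite_singleton PlaneTree.leaf).subset ?_
    rintro (_ | ⟨a, b, c⟩) h
    · rfl
    · simp [size] at h
  | succ N ih =>
    refine ((Set.finite_singleton PlaneTree.leaf).union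
      (((ih.prod (ih.prod ih)).image fun x => PlaneTree.node x.1 x.2.1 x.2.2))).subset ?_
    rintro (_ | ⟨a, b, c⟩) h
    · exact Or.inl rfl
    · simp only [size, Set.mem_ofPred_eq] at h
      refine Or.inr ⟨(a, b, c), ⟨?_, ?_, ?_⟩, rfl⟩ <;> simp only [Set.mem_ofPred_eq] <;> omega

theorem patterns_finite (l : List Basic) : (patterns l).Finite := by
  set N := (l.map Basic.word).flatten.length with hN
  have hT := PlaneTree.finite_size_le N
  have hE : (Set.range fun x : Fin (N + 1) ⊕ Fin (N + 1) ⊕ Unit =>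
      Sum.elim (fun n => RootExtension.left n.1)
        (Sum.elim (fun n => RootExtension.right n.1) fun _ => .centered) x).Finite :=
    Set.finite_range _
  refine (((hT.prod (hT.prod hT)).prod ((Set.finite_univ (α := ZMod 4)).prod hE)).image
    fun x => TilingPattern.mk x.1.1 x.1.2.1 x.1.2.2 x.2.1 x.2.2).subset ?_
  rintro ⟨a, b, c, i, e⟩ h
  have h' : (TilingPattern.chordWords ⟨a, b, c, i, e⟩).flatten.length = N :=
    congrArg (fun w => w.flatten.length) h
  have key : a.size + b.size + c.size ≤ N ∧
      ∃ x : Fin (N + 1) ⊕ Fin (N + 1) ⊕ Unit, Sum.elim (fun n => RootExtension.left n.1)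
        (Sum.elim (fun n => RootExtension.right n.1) fun _ => .centered) x = e := by
    cases e with
    | centered =>
      simp only [TilingPattern.chordWords, TilingPattern.tree, PlaneTree.length_flatten_words,
        PlaneTree.size] at h'
      exact ⟨by omega, Sum.inr (Sum.inr ()), rfl⟩
    | left n =>
      simp only [TilingPattern.chordWords, TilingPattern.tree, flatten_glue, List.length_append,
        PlaneTree.length_flatten_words, PlaneTree.size, TilingPattern.run] at h'
      simp only [List.flatten_cons, List.flatten_nil, List.append_nil, List.length_map,
        List.length_range] at h'
      exact ⟨by omega, Sum.inl ⟨n, by omega⟩, rfl⟩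
    | right n =>
      simp only [TilingPattern.chordWords, TilingPattern.tree, flatten_glue, List.length_append,
        PlaneTree.length_flatten_words, PlaneTree.size, TilingPattern.run] at h'
      simp only [List.flatten_cons, List.flatten_nil, List.append_nil, List.length_map,
        List.length_range] at h'
      exact ⟨by omega, Sum.inr (Sum.inl ⟨n, by omega⟩), rfl⟩
  obtain ⟨hs, hx⟩ := key
  refine ⟨((a, b, c), (i, e)), ⟨⟨?_, ?_, ?_⟩, Set.mem_univ _, hx⟩, rfl⟩ <;>
    simp only [Set.mem_ofPred_eq] <;> omega

/-- The operations of the undeformed algebra on `U^{m_1} b_1, …, U^{m_n} b_n`: the product if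
`n = 2`; otherwise the sum, over the tiling patterns with chord sequence `b_1, …, b_n`, of
`U^{m_1 + ⋯ + m_n + d}` times the output, where `d` is the number of 4-valent vertices. -/
noncomputable def basisOp : List (ℕ × Basic) → Alg
  | [x, y] => basisMul x y
  | l => ∑ p ∈ (patterns_finite (l.map Prod.snd)).toFinset,
      monomial ((l.map Prod.fst).sum + p.tree.size) p.output

/-- The multilinear extension of a function of lists of basis elements. -/
noncomputable def multilinearExtension : (List (ℕ × Basic) → Alg) → List Alg → Alg
  | φ, [] => φ []
  | φ, a :: l => Finsupp.sum (a : (ℕ × Basic) →₀ ZMod 2) fun x c =>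
      c • multilinearExtension (fun xs => φ (x :: xs)) l

/-- The operations `μ_n` of the undeformed `A∞`-algebra. -/
noncomputable def undeformedOp : List Alg → Alg := multilinearExtension basisOp

/-! ### The grading -/

/-- Triples `(m; a, b)` of rational numbers, with the product
`(m; a, b) (n; c, d) = (m + n + ad - bc; a + c, b + d)`. -/
@[ext]
structure Triple : Type where
  m : ℚ
  a : ℚ
  b : ℚ

namespace Triple

instance : Mul Triple :=
  ⟨fun g h => ⟨g.m + h.m + g.a * h.b - g.b * h.a, g.a + h.a, g.b + h.b⟩⟩
instance : One Triple := ⟨⟨0, 0, 0⟩⟩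
instance : Inv Triple := ⟨fun g => ⟨-g.m, -g.a, -g.b⟩⟩

theorem mul_def (g h : Triple) :
    g * h = ⟨g.m + h.m + g.a * h.b - g.b * h.a, g.a + h.a, g.b + h.b⟩ := rfl
theorem one_def : (1 : Triple) = ⟨0, 0, 0⟩ := rfl
theorem inv_def (g : Triple) : g⁻¹ = ⟨-g.m, -g.a, -g.b⟩ := rfl

instance : Group Triple :=
  Group.ofLeftAxioms
    (fun g h k => by
      simp only [mul_def, Triple.mk.injEq]
      refine ⟨by ring, by ring, by ring⟩)
    (fun g => by simp [mul_def, one_def])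
    (fun g => by
      simp only [mul_def, one_def, inv_def, Triple.mk.injEq]
      refine ⟨by ring, by ring, by ring⟩)

end Triple

/-- The rational number `x` is an integer. -/
def IsInt (x : ℚ) : Prop := ∃ z : ℤ, (z : ℚ) = x

/-- The intermediate grading group: the triples `(m; a, b)` in `(½ℤ)³` with `a + b ∈ ℤ` and
`m + ((2a + 1)(a + b + 1) + 1) / 2 ∈ ℤ`. -/
def gradingGroup : Subgroup Triple where
  carrier := {g | IsInt (2 * g.m) ∧ IsInt (2 * g.a) ∧ IsInt (2 * g.b) ∧ IsInt (g.a + g.b) ∧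
    IsInt (g.m + ((2 * g.a + 1) * (g.a + g.b + 1) + 1) / 2)}
  one_mem' := by
    simp only [Triple.one_def, Set.mem_ofPred_eq]
    refine ⟨⟨0, ?_⟩, ⟨0, ?_⟩, ⟨0, ?_⟩, ⟨0, ?_⟩, ⟨1, ?_⟩⟩ <;> norm_num
  mul_mem' := by
    rintro ⟨m, a, b⟩ ⟨n, c, d⟩ ⟨⟨M, hM⟩, ⟨x, hx⟩, ⟨y, hy⟩, ⟨s, hs⟩, ⟨f, hf⟩⟩
      ⟨⟨N, hN⟩, ⟨z, hz⟩, ⟨w, hw⟩, ⟨t, ht⟩, ⟨g, hg⟩⟩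
    simp only [Triple.mul_def, Set.mem_ofPred_eq] at *
    obtain rfl : m = M / 2 := by linarith
    obtain rfl : n = N / 2 := by linarith
    obtain rfl : a = x / 2 := by linarith
    obtain rfl : c = z / 2 := by linarith
    obtain rfl : b = s - x / 2 := by linarith
    obtain rfl : d = t - z / 2 := by linarith
    refine ⟨⟨M + N + x * t - s * z, ?_⟩, ⟨x + z, ?_⟩, ⟨y + w, ?_⟩, ⟨s + t, ?_⟩,
      ⟨f + g - 1 + x * t, ?_⟩⟩
    · push_cast; ring
    · push_cast; ring
    · push_cast; linarith
    · push_cast; ring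
    · push_cast; rw [hf, hg]; ring
  inv_mem' := by
    rintro ⟨m, a, b⟩ ⟨⟨M, hM⟩, ⟨x, hx⟩, ⟨y, hy⟩, ⟨s, hs⟩, ⟨f, hf⟩⟩
    simp only [Triple.inv_def, Set.mem_ofPred_eq] at *
    obtain rfl : m = M / 2 := by linarith
    obtain rfl : a = x / 2 := by linarith
    obtain rfl : b = s - x / 2 := by linarith
    refine ⟨⟨-M, ?_⟩, ⟨-x, ?_⟩, ⟨-y, ?_⟩, ⟨-s, ?_⟩, ⟨2 + x * s - f, ?_⟩⟩
    · push_cast; ring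
    · push_cast; ring
    · push_cast; linarith
    · push_cast; ring
    · push_cast; rw [hf]; ring

/-- The grading group `Γ`: the product of the intermediate grading group with `ℤ` (the winding
number), the latter written multiplicatively. -/
abbrev Gam : Type := gradingGroup × Multiplicative ℤ

/-- The element `(m; a, b) × n` of `Γ`. -/
def gam (m a b : ℚ) (n : ℤ) (h : (⟨m, a, b⟩ : Triple) ∈ gradingGroup) : Gam :=
  (⟨⟨m, a, b⟩, h⟩, Multiplicative.ofAdd n)

/-- The degrees of `ρ_1`, `ρ_2`, `ρ_3` and `ρ_4` (the last one being indexed by `0`). -/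
def arrowDegree (i : ZMod 4) : Gam :=
  if i = 1 then gam (-1/2) (1/2) (-1/2) 0
    ⟨⟨-1, by norm_num⟩, ⟨1, by norm_num⟩, ⟨-1, by norm_num⟩, ⟨0, by norm_num⟩, ⟨1, by norm_num⟩⟩
  else if i = 2 then gam (-1/2) (1/2) (1/2) 0
    ⟨⟨-1, by norm_num⟩, ⟨1, by norm_num⟩, ⟨1, by norm_num⟩, ⟨1, by norm_num⟩, ⟨2, by norm_num⟩⟩
  else if i = 3 then gam (-1/2) (-1/2) (1/2) 0
    ⟨⟨-1, by norm_num⟩, ⟨-1, by norm_num⟩, ⟨1, by norm_num⟩, ⟨0, by norm_num⟩, ⟨0, by norm_num⟩⟩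
  else gam (-3/2) (-1/2) (-1/2) 1
    ⟨⟨-3, by norm_num⟩, ⟨-1, by norm_num⟩, ⟨-1, by norm_num⟩, ⟨-1, by norm_num⟩, ⟨-1, by norm_num⟩⟩

/-- The degree of `U`. -/
def uDegree : Gam := gam (-2) 0 0 1
  ⟨⟨-4, by norm_num⟩, ⟨0, by norm_num⟩, ⟨0, by norm_num⟩, ⟨0, by norm_num⟩, ⟨-1, by norm_num⟩⟩

/-- The distinguished central element `λ_d = (1; 0, 0) × 0`. -/
def lamD : Gam := gam 1 0 0 0
  ⟨⟨2, by norm_num⟩, ⟨0, by norm_num⟩, ⟨0, by norm_num⟩, ⟨0, by norm_num⟩, ⟨2, by norm_num⟩⟩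

/-- The distinguished central element `λ_w = (0; 0, 0) × 1`. -/
def lamW : Gam := gam 0 0 0 1
  ⟨⟨0, by norm_num⟩, ⟨0, by norm_num⟩, ⟨0, by norm_num⟩, ⟨0, by norm_num⟩, ⟨1, by norm_num⟩⟩

/-- The degree of a basis element: idempotents have trivial degree, and the degree of a chord is
the product of the degrees of its arrows. -/
def Basic.degree : Basic → Gam
  | .idem _ => 1
  | .chord i n => ((TilingPattern.run i n).map arrowDegree).prod

/-- The homogeneous elements of degree `g`: the span of the `U^m b` with
`deg(U)^m deg(b) = g`. -/
noncomputable def homogeneous (g : Gam) : Submodule (ZMod 2) Alg :=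
  Submodule.span (ZMod 2)
    {x | ∃ (m : ℕ) (b : Basic), uDegree ^ m * b.degree = g ∧ x = monomial m b}

end TorusAlgebra

/-! ### Sums over cuts of lists -/

/-! Existence and uniqueness both follow from obstruction theory in the normalized Hochschild
complex of `undeformedOp`, whose differential is `differential φ = insOp undeformedOp φ + insOp φ
undeformedOp`. In the bar degree every input is shifted by `lamD`. Operations of weight `W` then
have degree `lam (-1) W` and components of homomorphisms degree `lam 0 W`, whatever the number of
inputs. Once the relation holds below weight `W`, the terms of weight `W` without the unknown
operation form a cocycle of degree `lam (-2) W`, and the operation has to be a primitive of it.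
Likewise the first failure of a homomorphism relation is a cocycle of degree `lam (-1) W`, and the
next component has to be a primitive. In characteristic two no signs occur.

Primitives come from a discrete Morse matching on words in the basis `U^m b`. A basis element is
written as a product of primes, first the `U`s and then the arrows, and `up` splits the first prime
off the first letter that can be split. Counting factors and inversions gives a size for which the
matching is acyclic: up to smaller words and words that do not split, the differential of `φ` on `up
w` is the value of `φ` on `w` (`differential_up`). Solving for these values recursively gives
`primitive`, and a cocycle that vanishes on all words that do not split is zero. The words that
neither split nor arise by splitting are the critical ones: descending sequences of arrows `ρ_j,
ρ_{j-1}, …`, possibly followed by a `U`.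

The grading excludes nearly all critical words. Four descending arrows have bar degree `lamW` and
four ascending ones the degree of `U`. For a critical word with `4 * q + r` arrows and `u` letters
`U`, a value of a map of degree `lam (-e) W` can be non-zero only if `2 * W + u + 2 * q` equals `1 +
e` (for `r = 0`) or `e` (for `r = 1` or `r = 3`); see `exceptional_of_coeff_ne_zero`. For positive
`W` this leaves weight one only: the empty word if `e = 1`, and `U`, one arrow or three arrows if `e
= 2`. In the first case the cocycle takes as its value the sum of the two curvatures, which agree by
hypothesis. In the second case it is the differential of the curvature. This vanishes on one letter
because the sum of the four chords of length four is central, and on three arrows because a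
left-extended and a right-extended pattern have the same output (`differential_curvature_three`).
From weight two on no condition remains.

The same matching proves the `A∞`-relation in weight zero, on which the square of the differential
being zero depends. The defect is a cocycle for formal reasons (`differential_defect`), so only
words that do not split matter. Linearity over `U` removes the `U`s. What remains are descending
arrows, possibly followed by an ascending chord and an arbitrary tail, and there the relation
expresses that a tiling pattern can be cut at an edge of its root vertex (`sum_graft`,
`defect_ascending`). -/

namespace ListCalculus

open Finset

variable {E F M N : Type*}

/-- The sum of `Φ a b` over all ways `l = a ++ b` of cutting `l` in two. -/
def cutSum [AddCommMonoid M] (Φ : List E → List E → M) (l : List E) : M :=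
  ∑ i ∈ range (l.length + 1), Φ (l.take i) (l.drop i)

section Cut

variable [AddCommMonoid M] [AddCommMonoid N]

@[simp]
theorem cutSum_nil (Φ : List E → List E → M) : cutSum Φ [] = Φ [] [] := by
  simp [cutSum]

theorem cutSum_cons (Φ : List E → List E → M) (x : E) (l : List E) :
    cutSum Φ (x :: l) = Φ [] (x :: l) + cutSum (fun a b => Φ (x :: a) b) l := by
  unfold cutSum
  rw [List.length_cons, sum_range_succ', add_comm]
  simp

theorem cutSum_congr {Φ Ψ : List E → List E → M} {l : List E}
    (h : ∀ a b, a ++ b = l → Φ a b = Ψ a b) : cutSum Φ l = cutSum Ψ l :=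
  sum_congr rfl fun i _ => h _ _ (List.take_append_drop i l)

theorem cutSum_add (Φ Ψ : List E → List E → M) (l : List E) :
    cutSum (fun a b => Φ a b + Ψ a b) l = cutSum Φ l + cutSum Ψ l :=
  sum_add_distrib

theorem cutSum_zero (l : List E) : cutSum (fun _ _ => (0 : M)) l = 0 :=
  sum_const_zero

theorem cutSum_eq_zero {Φ : List E → List E → M} {l : List E}
    (h : ∀ a b, a ++ b = l → Φ a b = 0) : cutSum Φ l = 0 := by
  rw [cutSum_congr h, cutSum_zero]

theorem map_cutSum (g : M →+ N) (Φ : List E → List E → M) (l : List E) :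
    g (cutSum Φ l) = cutSum (fun a b => g (Φ a b)) l :=
  map_sum g _ _

theorem cutSum_apply {ι : Type*} (Φ : List E → List E → ι → M) (l : List E) (i : ι) :
    cutSum Φ l i = cutSum (fun a b => Φ a b i) l :=
  Finset.sum_apply i _ _

theorem cutSum_sum {ι : Type*} (s : Finset ι) (Φ : ι → List E → List E → M) (l : List E) :
    cutSum (fun a b => ∑ i ∈ s, Φ i a b) l = ∑ i ∈ s, cutSum (Φ i) l :=
  sum_comm

/-- Both sides run over the cuts of `l` into three consecutive pieces. -/
theorem cutSum_cut (Φ : List E → List E → List E → M) (l : List E) :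
    cutSum (fun a r => cutSum (fun b c => Φ a b c) r) l =
      cutSum (fun r c => cutSum (fun a b => Φ a b c) r) l := by
  induction l generalizing Φ with
  | nil => simp
  | cons x l ih =>
    rw [cutSum_cons, cutSum_cons, cutSum_cons, cutSum_nil, ih]
    simp only [cutSum_cons, cutSum_add]
    rw [add_assoc]

theorem cutSum_append_cons (Φ : List E → List E → M) (a b : List E) (x : E) :
    cutSum Φ (a ++ x :: b) = cutSum (fun p q => Φ p (q ++ x :: b)) a +
      cutSum (fun p q => Φ (a ++ x :: p) q) b := by
  induction a generalizing Φ with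
  | nil => simp [cutSum_cons]
  | cons y a ih =>
    rw [List.cons_append, cutSum_cons, ih, cutSum_cons]
    simp [add_assoc]

theorem cutSum_left_nil (g : List E → M) (l : List E) :
    cutSum (fun a b => if a = [] then g b else 0) l = g l := by
  cases l with
  | nil => simp
  | cons x l => simp [cutSum_cons, cutSum_zero]

theorem cutSum_right_nil (g : List E → M) (l : List E) :
    cutSum (fun a b => if b = [] then g a else 0) l = g l := by
  induction l generalizing g with
  | nil => simp
  | cons x l ih => simp [cutSum_cons, ih fun a => g (x :: a)]

end Cut

/-! ### Families indexed by weights -/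

section Conv

open HasAntidiagonal

/-- The convolution of `h : E → (ℕ → M)` with an `E`-valued power series. -/
def conv [AddCommMonoid M] (h : E → ℕ → M) (e : ℕ → E) : ℕ → M := fun W =>
  ∑ uv ∈ antidiagonal W, h (e uv.1) uv.2

section

variable [AddCommMonoid M]

theorem conv_add_left (h k : E → ℕ → M) (e : ℕ → E) :
    conv (fun x => h x + k x) e = conv h e + conv k e := by
  funext W
  simp [conv, sum_add_distrib]

theorem conv_zero_left (e : ℕ → E) : conv (fun _ => (0 : ℕ → M)) e = 0 := by
  funext W
  simp [conv]

theorem conv_sum_left {ι : Type*} (s : Finset ι) (h : ι → E → ℕ → M) (e : ℕ → E) :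
    conv (fun x => ∑ i ∈ s, h i x) e = ∑ i ∈ s, conv (h i) e := by
  funext W
  simp only [conv, Finset.sum_apply]
  exact sum_comm

theorem conv_cutSum (Φ : E → List F → List F → ℕ → M) (l : List F) (e : ℕ → E) :
    conv (fun x => cutSum (Φ x) l) e = cutSum (fun a b => conv (fun x => Φ x a b) e) l :=
  conv_sum_left _ (fun i x => Φ x (l.take i) (l.drop i)) e

theorem conv_comm (h : E → F → ℕ → M) (e : ℕ → E) (f : ℕ → F) :
    conv (fun x => conv (fun y => h x y) f) e = conv (fun y => conv (fun x => h x y) e) f := by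
  funext W
  simp only [conv]
  rw [Finset.sum_sigma', Finset.sum_sigma']
  refine Finset.sum_bij' (fun x _ => ⟨(x.2.1, x.1.1 + x.2.2), (x.1.1, x.2.2)⟩)
    (fun x _ => ⟨(x.2.1, x.1.1 + x.2.2), (x.1.1, x.2.2)⟩) ?_ ?_ ?_ ?_ ?_
  all_goals rintro ⟨⟨a, b⟩, ⟨c, d⟩⟩ h
  all_goals simp only [mem_sigma, HasAntidiagonal.mem_antidiagonal] at h ⊢
  · exact ⟨by omega, trivial⟩
  · exact ⟨by omega, trivial⟩
  · obtain ⟨h1, h2⟩ := h; subst h2; rfl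
  · obtain ⟨h1, h2⟩ := h; subst h2; rfl

end

section

variable [AddCommMonoid E] [AddCommMonoid M]

theorem conv_add_right (h : E →+ (ℕ → M)) (e f : ℕ → E) :
    conv h (e + f) = conv h e + conv h f := by
  funext W
  simp [conv, sum_add_distrib]

theorem conv_zero_right (h : E →+ (ℕ → M)) : conv h (0 : ℕ → E) = 0 := by
  funext W
  simp [conv]

theorem conv_sum_right {ι : Type*} (s : Finset ι) (h : E →+ (ℕ → M)) (e : ι → ℕ → E) :
    conv h (∑ i ∈ s, e i) = ∑ i ∈ s, conv h (e i) := by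
  funext W
  simp only [conv, Finset.sum_apply, map_sum]
  exact sum_comm

theorem conv_cutSum_right (h : E →+ (ℕ → M)) (Φ : List F → List F → ℕ → E)
    (l : List F) : conv h (cutSum Φ l) = cutSum (fun a b => conv h (Φ a b)) l :=
  conv_sum_right _ h (fun i => Φ (l.take i) (l.drop i))

/-- Associativity of convolution. Additivity of `h` is what allows it to be applied to the inner sum
termwise. -/
theorem conv_conv (h : E →+ (ℕ → M)) (k : F → ℕ → E) (e : ℕ → F) :
    conv h (conv k e) = conv (fun y => conv h (k y)) e := by
  funext W
  simp only [conv, map_sum, Finset.sum_apply]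
  rw [Finset.sum_sigma', Finset.sum_sigma']
  refine Finset.sum_bij' (fun x _ => ⟨(x.2.1, x.2.2 + x.1.2), (x.2.2, x.1.2)⟩)
    (fun x _ => ⟨(x.1.1 + x.2.1, x.2.2), (x.1.1, x.2.1)⟩) ?_ ?_ ?_ ?_ ?_
  all_goals rintro ⟨⟨a, b⟩, ⟨c, d⟩⟩ h
  all_goals simp only [mem_sigma, HasAntidiagonal.mem_antidiagonal] at h ⊢
  · exact ⟨by omega, trivial⟩
  · exact ⟨by omega, trivial⟩
  · obtain ⟨h1, h2⟩ := h; subst h2; rfl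
  · obtain ⟨h1, h2⟩ := h; subst h2; rfl

theorem conv_single (h : E →+ (ℕ → M)) (x : E) : conv h (Pi.single 0 x) = h x := by
  funext W
  rw [conv, Finset.sum_eq_single (0, W)]
  · simp
  · rintro ⟨u, v⟩ huv hne
    have : u ≠ 0 := by
      rintro rfl
      simp at huv
      exact hne (by simp [huv])
    simp [Pi.single_eq_of_ne this]
  · simp

end

/-- The functions on lists that are additive in every entry. -/
def EntryAdditive [Add E] [Add M] (φ : List E → M) : Prop :=
  ∀ a b x y, φ (a ++ (x + y) :: b) = φ (a ++ x :: b) + φ (a ++ y :: b)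

/-- An entrywise additive function as a function of the entry between `a` and `b`. -/
def EntryAdditive.slot [AddGroup E] [AddGroup M] {φ : List E → M} (h : EntryAdditive φ)
    (a b : List E) : E →+ M :=
  AddMonoidHom.mk' (fun x => φ (a ++ x :: b)) (h a b)

@[simp]
theorem EntryAdditive.slot_apply [AddGroup E] [AddGroup M] {φ : List E → M}
    (h : EntryAdditive φ) (a b : List E) (x : E) : h.slot a b x = φ (a ++ x :: b) := rfl

theorem EntryAdditive.zero_entry [AddGroup E] [AddGroup M] {φ : List E → M}
    (h : EntryAdditive φ) (a b : List E) : φ (a ++ 0 :: b) = 0 :=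
  (h.slot a b).map_zero

theorem EntryAdditive.cons [Add E] [Add M] {φ : List E → M} (h : EntryAdditive φ) (x : E) :
    EntryAdditive fun l => φ (x :: l) := fun a b y z => h (x :: a) b y z

theorem EntryAdditive.cutSum [Add E] [AddCommMonoid M] {Φ : List E → List E → M}
    (h₁ : ∀ b, EntryAdditive fun a => Φ a b) (h₂ : ∀ a, EntryAdditive (Φ a)) :
    EntryAdditive (cutSum Φ) := by
  intro a b x y
  simp only [cutSum_append_cons]
  rw [cutSum_congr fun p q _ => h₂ p q b x y, cutSum_congr fun p q _ => h₁ q a p x y,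
    cutSum_add, cutSum_add]
  abel

theorem EntryAdditive.conv [Add E] [AddCommMonoid M] {h : F → List E → ℕ → M}
    (hh : ∀ x, EntryAdditive (h x)) (e : ℕ → F) :
    EntryAdditive fun l => conv (fun x => h x l) e := by
  intro a b x y
  simp only [hh _ a b x y, conv_add_left]

theorem EntryAdditive.conv_right [Add E] [AddCommGroup M][AddCommGroup F]
    (h : F →+ (ℕ → M)) {k : List E → ℕ → F}
    (hk : EntryAdditive k) : EntryAdditive fun l => ListCalculus.conv h (k l) := by
  intro a b x y
  simp only [hk a b x y, conv_add_right]

end Conv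

/-! ### Insertion -/

section Ins

variable [AddCommMonoid M]

/-- The sum of `φ (a, μ c, b)` over all `l = a ++ c ++ b`, weights being added. -/
def ins (μ : List E → ℕ → E) (φ : List E → ℕ → M) (l : List E) : ℕ → M :=
  cutSum (fun a r => cutSum (fun c b => conv (fun x => φ (a ++ x :: b)) (μ c)) r) l

/-- The part of `ins` in which the selected string is an initial one. -/
def insHead (μ : List E → ℕ → E) (φ : List E → ℕ → M) (l : List E) : ℕ → M :=
  cutSum (fun c b => conv (fun x => φ (x :: b)) (μ c)) l

theorem ins_nil (μ : List E → ℕ → E) (φ : List E → ℕ → M) :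
    ins μ φ [] = insHead μ φ [] := by
  simp [ins, insHead]

theorem ins_cons (μ : List E → ℕ → E) (φ : List E → ℕ → M) (y : E) (l : List E) :
    ins μ φ (y :: l) = insHead μ φ (y :: l) + ins μ (fun r => φ (y :: r)) l := by
  rw [ins, cutSum_cons]
  rfl

theorem ins_add_right (μ : List E → ℕ → E) (φ ψ : List E → ℕ → M) (l : List E) :
    ins μ (fun r => φ r + ψ r) l = ins μ φ l + ins μ ψ l := by
  simp only [ins, conv_add_left, cutSum_add]

theorem ins_zero_right (μ : List E → ℕ → E) (l : List E) :
    ins μ (fun _ => (0 : ℕ → M)) l = 0 := by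
  simp only [ins, conv_zero_left, cutSum_zero]

theorem ins_conv_left (μ : List E → ℕ → E) (h : F → List E → ℕ → M) (e : ℕ → F)
    (l : List E) :
    ins μ (fun r => conv (fun x => h x r) e) l = conv (fun x => ins μ (h x) l) e := by
  simp only [ins, conv_cutSum]
  exact cutSum_congr fun a r _ => cutSum_congr fun c b _ => conv_comm _ _ _

theorem ins_conv_right [AddCommMonoid N] (μ : List E → ℕ → E) (h : M →+ (ℕ → N))
    (k : List E → ℕ → M) (l : List E) :
    ins μ (fun r => conv h (k r)) l = conv h (ins μ k l) := by
  simp only [ins, conv_cutSum_right, conv_conv]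

theorem insHead_cutSum (μ : List E → ℕ → E) (Φ : List E → List E → ℕ → M) (l : List E) :
    insHead μ (cutSum Φ) l = insHead μ (Φ []) l +
      cutSum (fun a b => insHead μ (fun r => Φ r b) a) l := by
  have h := cutSum_cut (fun c p q => conv (fun x => Φ (x :: p) q) (μ c)) l
  simp only [insHead, cutSum_cons, conv_add_left, conv_cutSum, cutSum_add]
  rw [h]

/-- The Leibniz rule: when the list containing the inserted letter is cut in two, that letter lies
in the left or in the right piece. -/
theorem ins_cutSum (μ : List E → ℕ → E) (Φ : List E → List E → ℕ → M) (l : List E) :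
    ins μ (cutSum Φ) l = cutSum (fun a b => ins μ (fun r => Φ r b) a) l +
      cutSum (fun a b => ins μ (Φ a) b) l := by
  induction l generalizing Φ with
  | nil => simp [ins_nil, insHead, cutSum_cons, conv_add_left, add_comm]
  | cons y l ih =>
    rw [ins_cons, insHead_cutSum, cutSum_cons (fun a b => insHead μ (fun r => Φ r b) a),
      cutSum_cons (fun a b => ins μ (fun r => Φ r b) a), cutSum_cons (fun a b => ins μ (Φ a) b),
      ins_nil]
    simp only [ins_cons, cutSum_cons, ins_add_right, ih, cutSum_add]
    abel

/-- The two strings selected by successive insertions are either nested or disjoint. Disjoint pairs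
arise in both orders and cancel in characteristic two, while nested pairs are insertions of `ins μ
μ`. This is the statement that the square of the coderivation of the bar construction belonging to
`μ` is the coderivation belonging to `ins μ μ`. -/
theorem ins_ins [AddCommGroup F] [AddCommGroup N] [Module (ZMod 2) N] {μ : List F → ℕ → F}
    {φ : List F → ℕ → N} (hφ : EntryAdditive φ) (l : List F) :
    ins μ (ins μ φ) l = ins (ins μ μ) φ l := by
  have h₁ : ∀ a r, ins μ (fun r => cutSum (fun c b => conv (fun x => φ (a ++ x :: b)) (μ c)) r) r =
      cutSum (fun c b => conv (fun x => φ (a ++ x :: b)) (ins μ μ c)) r +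
      cutSum (fun c b => conv (fun x => ins μ (fun r => φ (a ++ x :: r)) b) (μ c)) r := by
    intro a r
    refine (ins_cutSum μ (fun c b => conv (fun x => φ (a ++ x :: b)) (μ c)) r).trans ?_
    congr 1
    · exact cutSum_congr fun c b _ => ins_conv_right μ (hφ.slot a b) μ c
    · exact cutSum_congr fun c b _ => ins_conv_left μ (fun x r => φ (a ++ x :: r)) (μ c) b
  -- Insertions to the left of the marked string correspond to insertions to the right of it, with
  -- the roles of the two strings exchanged.
  have h₂ : cutSum (fun a r => ins μ (fun a => cutSum (fun c b =>
        conv (fun x => φ (a ++ x :: b)) (μ c)) r) a) l =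
      cutSum (fun a r => cutSum (fun c b =>
        conv (fun x => ins μ (fun r => φ (a ++ x :: r)) b) (μ c)) r) l := by
    have e₁ : ∀ a r, ins μ (fun a => cutSum (fun c b => conv (fun x => φ (a ++ x :: b)) (μ c)) r) a
        = cutSum (fun a₁ s => cutSum (fun c₁ a₂ => cutSum (fun c b => conv (fun y => conv (fun x =>
          φ (a₁ ++ y :: (a₂ ++ x :: b))) (μ c)) (μ c₁)) r) s) a := by
      intro a r
      simp only [ins, conv_cutSum, List.append_assoc, List.cons_append]
    have e₂ : ∀ a r, cutSum (fun c b => conv (fun x => ins μ (fun r => φ (a ++ x :: r)) b) (μ c)) r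
        = cutSum (fun c b => cutSum (fun b₁ s => cutSum (fun c₁ b₂ => conv (fun y => conv (fun x =>
          φ (a ++ y :: (b₁ ++ x :: b₂))) (μ c₁)) (μ c)) s) b) r := by
      intro a r
      simp only [ins, conv_cutSum]
    simp only [e₁, e₂]
    rw [← cutSum_cut]
    refine cutSum_congr fun a r _ => ?_
    rw [← cutSum_cut]
  have h := ins_cutSum μ (fun a r => cutSum (fun c b => conv (fun x => φ (a ++ x :: b)) (μ c)) r) l
  refine h.trans ?_
  simp only [h₁, cutSum_add]
  rw [h₂]
  rw [add_comm, add_assoc, ZModModule.add_self, add_zero]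
  rfl

theorem EntryAdditive.ins [AddCommGroup F] [AddCommGroup N] {μ : List F → ℕ → F}
    {φ : List F → ℕ → N} (hμ : EntryAdditive μ) (hφ : EntryAdditive φ) :
    EntryAdditive (ins μ φ) := by
  refine EntryAdditive.cutSum (fun r => ?_) fun a => ?_
  · intro p q x y
    simp only [List.append_assoc, List.cons_append, hφ p _ x y, conv_add_left, cutSum_add]
  · refine EntryAdditive.cutSum (fun b => ?_) fun c => ?_
    · exact EntryAdditive.conv_right (hφ.slot a b) hμ
    · intro p q x y
      have := fun z => hφ (a ++ z :: p) q x y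
      simp only [List.append_assoc, List.cons_append] at this
      simp only [this, conv_add_left]

end Ins

end ListCalculus

/-! ### Pullback along a family: the coalgebra map of the bar construction -/

namespace ListCalculus

open Finset

variable {E F M N : Type*}

section Pull

section

variable [AddCommMonoid M]

/-- The sum of `φ (f b₁, …, f bₘ)` over all ways `l = b₁ ++ ⋯ ++ bₘ` of cutting `l` into non-empty
blocks. -/
def pull (f : List E → ℕ → F) : (List F → ℕ → M) → List E → ℕ → M
  | φ, [] => φ []
  | φ, x :: l => ∑ i ∈ range (l.length + 1),
      pull f (fun r => conv (fun y => φ (y :: r)) (f (x :: l.take i))) (l.drop i)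
termination_by _ l => l.length
decreasing_by simp

@[simp]
theorem pull_nil (f : List E → ℕ → F) (φ : List F → ℕ → M) : pull f φ [] = φ [] := by
  rw [pull]

theorem pull_cons (f : List E → ℕ → F) (φ : List F → ℕ → M) (x : E) (l : List E) :
    pull f φ (x :: l) = cutSum (fun c d =>
      pull f (fun r => conv (fun y => φ (y :: r)) (f (x :: c))) d) l := by
  rw [pull, cutSum]

theorem pull_zero (f : List E → ℕ → F) (l : List E) :
    pull f (fun _ => (0 : ℕ → M)) l = 0 := by
  induction h : l.length using Nat.strong_induction_on generalizing l with
  | _ n ih =>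
    cases l with
    | nil => simp
    | cons x l =>
      subst h
      rw [pull_cons]
      refine cutSum_eq_zero fun c d hcd => ?_
      simp only [conv_zero_left]
      exact ih d.length (by simp [← hcd]) d rfl

theorem pull_add (f : List E → ℕ → F) (φ ψ : List F → ℕ → M) (l : List E) :
    pull f (fun r => φ r + ψ r) l = pull f φ l + pull f ψ l := by
  induction h : l.length using Nat.strong_induction_on generalizing l φ ψ with
  | _ n ih =>
    cases l with
    | nil => simp
    | cons x l =>
      subst h
      rw [pull_cons, pull_cons, pull_cons, ← cutSum_add]
      refine cutSum_congr fun c d hcd => ?_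
      simp only [conv_add_left]
      exact ih d.length (by simp [← hcd]) _ _ d rfl

theorem pull_conv_left {G : Type*} (f : List E → ℕ → F) (h : G → List F → ℕ → M) (e : ℕ → G)
    (l : List E) :
    pull f (fun r => conv (fun x => h x r) e) l = conv (fun x => pull f (h x) l) e := by
  induction hl : l.length using Nat.strong_induction_on generalizing l h with
  | _ n ih =>
    cases l with
    | nil => simp
    | cons x l =>
      subst hl
      simp only [pull_cons, conv_cutSum]
      refine cutSum_congr fun c d hcd => ?_
      rw [← ih d.length (by simp [← hcd]) _ d rfl]
      congr 1
      funext r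
      exact conv_comm _ _ _

theorem pull_conv_right {L : Type*} [AddCommMonoid N] (f : List E → ℕ → L) (h : M →+ (ℕ → N))
    (k : List L → ℕ → M) (l : List E) :
    pull f (fun r => conv h (k r)) l = conv h (pull f k l) := by
  induction hl : l.length using Nat.strong_induction_on generalizing l k with
  | _ n ih =>
    cases l with
    | nil => simp
    | cons x l =>
      subst hl
      simp only [pull_cons, conv_cutSum_right]
      refine cutSum_congr fun c d hcd => ?_
      rw [← ih d.length (by simp [← hcd]) _ d rfl]
      congr 1
      funext r
      exact (conv_conv _ _ _).symm

theorem pull_delta (f : List E → ℕ → F) (v : ℕ → M) (l : List E) :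
    pull f (fun r => if r = [] then v else 0) l = if l = [] then v else 0 := by
  cases l with
  | nil => simp
  | cons x l =>
    rw [pull_cons]
    simp only [reduceCtorEq, if_false, conv_zero_left, pull_zero, cutSum_zero]

end

section

variable [AddCommGroup F] [AddCommGroup M]

/-- The function `r ↦ φ (e, r)`, where `e` is a power series. -/
def consConv (φ : List F → ℕ → M) (e : ℕ → F) (r : List F) : ℕ → M :=
  conv (fun y => φ (y :: r)) e

theorem EntryAdditive.consConv {φ : List F → ℕ → M} (hφ : EntryAdditive φ) (e : ℕ → F) :
    EntryAdditive (consConv φ e) :=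
  EntryAdditive.conv (fun x => hφ.cons x) e

theorem consConv_zero {φ : List F → ℕ → M} (hφ : EntryAdditive φ) :
    consConv φ (0 : ℕ → F) = fun _ => 0 := by
  funext r
  exact conv_zero_right (hφ.slot [] r)

theorem consConv_add {φ : List F → ℕ → M} (hφ : EntryAdditive φ) (e e' : ℕ → F) :
    consConv φ (e + e') = fun r => consConv φ e r + consConv φ e' r := by
  funext r
  exact conv_add_right (hφ.slot [] r) e e'

/-- Since `f []` vanishes, the first block may be allowed to be empty. This gives a recursion that
does not distinguish the first letter and is therefore compatible with `cutSum`. -/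
theorem pull_eq {f : List E → ℕ → F} (hf : f [] = 0) {φ : List F → ℕ → M}
    (hφ : EntryAdditive φ) (l : List E) :
    pull f φ l = (if l = [] then φ [] else 0) +
      cutSum (fun c d => pull f (consConv φ (f c)) d) l := by
  cases l with
  | nil => simp [hf, consConv_zero hφ]
  | cons x l =>
    rw [pull_cons, cutSum_cons, hf, consConv_zero hφ, pull_zero]
    simp
    rfl

/-- `x ↦ pull f (φ (x, ·)) l` as an additive map. -/
def pullSlot {φ : List F → ℕ → M} (hφ : EntryAdditive φ) (f : List E → ℕ → F) (l : List E) :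
    F →+ (ℕ → M) :=
  AddMonoidHom.mk' (fun x => pull f (fun r => φ (x :: r)) l) fun x y => by
    rw [← pull_add]
    congr 1
    funext r
    exact hφ [] r x y

theorem pull_consConv {φ : List F → ℕ → M} (hφ : EntryAdditive φ) (f : List E → ℕ → F)
    (e : ℕ → F) (l : List E) : pull f (consConv φ e) l = conv (pullSlot hφ f l) e :=
  pull_conv_left f (fun x r => φ (x :: r)) e l

theorem EntryAdditive.pull [Add E] {f : List E → ℕ → F} (hf : EntryAdditive f)
    (hf0 : f [] = 0) {φ : List F → ℕ → M} (hφ : EntryAdditive φ) : EntryAdditive (pull f φ) := by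
  suffices h : ∀ n : ℕ, ∀ φ : List F → ℕ → M, EntryAdditive φ → ∀ a b x y,
      (a ++ x :: b).length = n → ListCalculus.pull f φ (a ++ (x + y) :: b) =
        ListCalculus.pull f φ (a ++ x :: b) + ListCalculus.pull f φ (a ++ y :: b) from
    fun a b x y => h _ φ hφ a b x y rfl
  intro n
  induction n using Nat.strong_induction_on with
  | _ n ih =>
    intro φ hφ a b x y hn
    simp only [pull_eq hf0 hφ, cutSum_append_cons]
    have h₁ : ListCalculus.cutSum (fun p q => ListCalculus.pull f (ListCalculus.consConv φ (f p))
          (q ++ (x + y) :: b)) a =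
        ListCalculus.cutSum (fun p q => ListCalculus.pull f (ListCalculus.consConv φ (f p)) (q ++ x :: b)) a +
        ListCalculus.cutSum (fun p q => ListCalculus.pull f (ListCalculus.consConv φ (f p)) (q ++ y :: b)) a := by
      rw [← cutSum_add]
      refine cutSum_congr fun p q hpq => ?_
      rcases p with _ | ⟨z, p⟩
      · simp [hf0, consConv_zero hφ, pull_zero]
      · refine ih _ ?_ _ (hφ.consConv _) q b x y rfl
        subst hpq
        simp at hn ⊢
        omega
    have h₂ : ListCalculus.cutSum (fun p q => ListCalculus.pull f (ListCalculus.consConv φ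
          (f (a ++ (x + y) :: p))) q) b =
        ListCalculus.cutSum (fun p q => ListCalculus.pull f (ListCalculus.consConv φ (f (a ++ x :: p))) q) b +
        ListCalculus.cutSum (fun p q => ListCalculus.pull f (ListCalculus.consConv φ (f (a ++ y :: p))) q) b := by
      rw [← cutSum_add]
      refine cutSum_congr fun p q _ => ?_
      rw [hf a p x y, consConv_add hφ, pull_add]
    rw [h₁, h₂]
    simp
    abel

/-- Pullback is compatible with the comultiplication: cutting the sequence of blocks in two amounts
to cutting the list and dividing both pieces into blocks. -/
theorem pull_cutSum {f : List E → ℕ → F} (hf : f [] = 0) {Φ : List F → List F → ℕ → M}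
    (h₁ : ∀ b, EntryAdditive fun a => Φ a b) (h₂ : ∀ a, EntryAdditive (Φ a)) (l : List E) :
    pull f (cutSum Φ) l = cutSum (fun a b => pull f (fun r => pull f (Φ r) b) a) l := by
  induction hl : l.length using Nat.strong_induction_on generalizing l Φ with
  | _ n ih =>
    subst hl
    have hp : ∀ b, EntryAdditive fun r => pull f (Φ r) b := by
      intro b p q x y
      exact (congrArg (fun φ => pull f φ b) (funext fun r => h₁ r p q x y)).trans
        (pull_add f _ _ b)
    have e₁ : ∀ c, consConv (cutSum Φ) (f c) = fun r => consConv (Φ []) (f c) r +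
        cutSum (fun a b => conv (fun x => Φ (x :: a) b) (f c)) r := by
      intro c
      funext r
      simp only [consConv, cutSum_cons, conv_add_left, conv_cutSum]
    have e₂ : cutSum (fun c d => pull f (cutSum fun a b => conv (fun x => Φ (x :: a) b) (f c)) d) l =
        cutSum (fun c d => cutSum (fun a b =>
          pull f (consConv (fun r => pull f (Φ r) b) (f c)) a) d) l := by
      refine cutSum_congr fun c d hcd => ?_
      -- An empty first block contributes nothing; after a non-empty one the remaining list is
      -- shorter.
      rcases c with _ | ⟨z, c⟩
      · have z₁ : ∀ a b, conv (fun x => Φ (x :: a) b) (f []) = 0 := by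
          intro a b
          rw [hf]
          exact conv_zero_right ((h₁ b).slot [] a)
        have z₂ : ∀ b, consConv (fun r => pull f (Φ r) b) (f []) = fun _ => 0 := by
          intro b
          rw [hf]
          exact consConv_zero (hp b)
        have z₃ : cutSum (fun a b => conv (fun x => Φ (x :: a) b) (f [])) = fun _ => 0 := by
          funext r
          simp only [z₁, cutSum_zero]
        simp only [z₂, z₃, pull_zero, cutSum_zero]
      · rw [ih d.length (by simp [← hcd]) ?_ ?_ d rfl]
        · refine cutSum_congr fun a b _ => ?_
          congr 1
          funext r
          exact pull_conv_left f (fun x => Φ (x :: r)) _ b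
        · intro b
          exact EntryAdditive.conv (fun x => (h₁ b).cons x) _
        · intro a
          exact EntryAdditive.conv (fun x => h₂ (x :: a)) _
    rw [pull_eq hf (EntryAdditive.cutSum h₁ h₂)]
    simp only [e₁, pull_add, cutSum_add]
    rw [e₂, cutSum_cut, ← add_assoc]
    simp only [pull_eq hf (hp _)]
    rw [cutSum_add]
    congr 1
    rw [cutSum_left_nil (fun b => pull f (Φ []) b) l]
    rw [pull_eq hf (h₂ [])]
    simp

theorem pull_eq_fun {f : List E → ℕ → F} (hf : f [] = 0) {φ : List F → ℕ → M}
    (hφ : EntryAdditive φ) :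
    pull f φ = fun l => (if l = [] then φ [] else 0) +
      cutSum (fun c d => pull f (consConv φ (f c)) d) l :=
  funext fun l => pull_eq hf hφ l

/-- The function `e ↦ T (consConv φ e)` for a transformation `T` compatible with convolutions. -/
theorem ins_pull [AddCommGroup E] {f : List E → ℕ → F} (hf0 : f [] = 0) {μ : List E → ℕ → E}
    {φ : List F → ℕ → M} (hφ : EntryAdditive φ) (l : List E) :
    ins μ (pull f φ) l = cutSum (fun c d => pull f (consConv φ (ins μ f c)) d) l +
      cutSum (fun c d => ins μ (pull f (consConv φ (f c))) d) l := by
  rw [pull_eq_fun hf0 hφ, ins_add_right]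
  have h₀ : ins μ (fun l => if l = [] then φ [] else (0 : ℕ → M)) l = 0 := by
    simp [ins, conv_zero_left, cutSum_zero]
  rw [h₀, zero_add]
  -- The Leibniz rule at the end of the first block: the insertion takes place inside that block or
  -- after it.
  refine (ins_cutSum μ (fun c d => pull f (consConv φ (f c)) d) l).trans ?_
  congr 1
  refine cutSum_congr fun c d _ => ?_
  simp only [pull_consConv hφ]
  exact ins_conv_right μ (pullSlot hφ f d) f c

/-- The string of blocks to which `ν` is applied either starts with the first block, and then yields
`pull f ν`, or leaves the first block as it is. -/
theorem pull_ins {f : List E → ℕ → F} (hf0 : f [] = 0) {ν : List F → ℕ → F}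
    (hν : EntryAdditive ν) {φ : List F → ℕ → M} (hφ : EntryAdditive φ) (l : List E) :
    pull f (ins ν φ) l = cutSum (fun c d => pull f (consConv φ (pull f ν c)) d) l +
      cutSum (fun c d => pull f (ins ν (consConv φ (f c))) d) l := by
  have hc : ∀ b, EntryAdditive fun a => consConv φ (ν a) b := fun b =>
    EntryAdditive.conv_right (hφ.slot [] b) hν
  have hd : ∀ a, EntryAdditive (consConv φ (ν a)) := fun a => hφ.consConv _
  have hH : EntryAdditive (insHead ν φ) := EntryAdditive.cutSum hc hd
  have h₁ : pull f (insHead ν φ) l =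
      cutSum (fun c d => pull f (consConv φ (pull f ν c)) d) l := by
    refine (pull_cutSum hf0 hc hd l).trans (cutSum_congr fun a b _ => ?_)
    simp only [pull_consConv hφ]
    exact pull_conv_right f (pullSlot hφ f b) ν a
  rw [pull_eq hf0 (hν.ins hφ), ← h₁, pull_eq hf0 hH, ins_nil, add_assoc, ← cutSum_add]
  congr 1
  refine cutSum_congr fun c d _ => ?_
  rw [← pull_add]
  congr 1
  funext r
  rw [show ins ν (consConv φ (f c)) r = _ from ins_conv_left ν (fun x r => φ (x :: r)) (f c) r]
  simp only [consConv, ins_cons, conv_add_left]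

/-- The homomorphism relation for `f` says that the coalgebra map commutes with the two
coderivations after projection to single letters. Removing the first block and inducting on the
length extends this to all of the bar construction. -/
theorem pull_ins_eq_ins_pull [AddCommGroup E] {f : List E → ℕ → F} (hf0 : f [] = 0)
    {μ : List E → ℕ → E} {ν : List F → ℕ → F} (hν : EntryAdditive ν)
    (h : ∀ l, ins μ f l = pull f ν l) {φ : List F → ℕ → M} (hφ : EntryAdditive φ) (l : List E) :
    pull f (ins ν φ) l = ins μ (pull f φ) l := by
  induction hl : l.length using Nat.strong_induction_on generalizing l φ with
  | _ n ih =>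
    subst hl
    rw [pull_ins hf0 hν hφ, ins_pull hf0 hφ]
    simp only [h]
    congr 1
    refine cutSum_congr fun c d hcd => ?_
    rcases c with _ | ⟨z, c⟩
    · simp only [hf0, consConv_zero hφ]
      rw [show pull f (fun _ : List F => (0 : ℕ → M)) = fun _ => 0 from funext (pull_zero f)]
      rw [show ins ν (fun _ : List F => (0 : ℕ → M)) = fun _ => 0 from funext (ins_zero_right ν)]
      rw [pull_zero, ins_zero_right]
    · exact ih d.length (by simp [← hcd]) (hφ.consConv _) d rfl

/-- Associativity of composition. A block for the composite is a sequence of blocks for `f`, so the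
multiplicativity of `pull f` on cuts reduces the claim to the list after the first block. -/
theorem pull_pull {L : Type*} [AddCommGroup L] {f : List E → ℕ → L}
    (hf0 : f [] = 0) {g : List L → ℕ → F} (hg : EntryAdditive g) (hg0 : g [] = 0)
    {φ : List F → ℕ → M} (hφ : EntryAdditive φ) (l : List E) :
    pull f (pull g φ) l = pull (pull f g) φ l := by
  induction hl : l.length using Nat.strong_induction_on generalizing l φ with
  | _ n ih =>
    subst hl
    have hc : ∀ b, EntryAdditive fun a => pull g (consConv φ (g a)) b := by
      intro b
      simp only [pull_consConv hφ]
      exact EntryAdditive.conv_right (pullSlot hφ g b) hg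
    have hd : ∀ a, EntryAdditive (pull g (consConv φ (g a))) := fun a =>
      EntryAdditive.pull hg hg0 (hφ.consConv _)
    rw [pull_eq_fun hg0 hφ, pull_add, pull_delta, pull_eq (by simp [hg0]) hφ]
    congr 1
    refine (pull_cutSum hf0 hc hd l).trans (cutSum_congr fun a b hab => ?_)
    have e : pull f (fun r => pull f (pull g (consConv φ (g r))) b) a =
        pull f (pull g (consConv φ (pull f g a))) b := by
      -- The contribution of the rest `b`, as an additive function of the first entry. The pullback
      -- over `a` passes through it.
      let K : F →+ (ℕ → M) := AddMonoidHom.mk' (fun x => pull f (pull g fun r => φ (x :: r)) b)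
        fun x y => by
          rw [← pull_add]
          congr 1
          funext s
          rw [← pull_add]
          congr 1
          funext r
          exact hφ [] r x y
      have hK : ∀ e : ℕ → F, pull f (pull g (consConv φ e)) b = conv K e := by
        intro e
        have : pull g (consConv φ e) = fun s => conv (fun x => pull g (fun r => φ (x :: r)) s) e :=
          funext fun s => pull_conv_left g (fun x r => φ (x :: r)) e s
        rw [this]
        exact pull_conv_left f (fun x s => pull g (fun r => φ (x :: r)) s) e b
      simp only [hK]
      exact pull_conv_right f K g a
    rw [e]
    rcases a with _ | ⟨z, a⟩
    · have z₁ : pull f g [] = 0 := by simp [hg0]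
      rw [z₁, consConv_zero hφ, pull_zero]
      rw [show pull g (fun _ : List F => (0 : ℕ → M)) = fun _ => 0 from funext (pull_zero g)]
      rw [pull_zero]
    · exact ih b.length (by simp [← hab]) (hφ.consConv _) b rfl

/-- The components of the identity. -/
def unitFamily : List F → ℕ → F
  | [x] => Pi.single 0 x
  | _ => 0

theorem pull_unitFamily {φ : List F → ℕ → M} (hφ : EntryAdditive φ) (l : List F) :
    pull unitFamily φ l = φ l := by
  induction l generalizing φ with
  | nil => simp
  | cons x l ih =>
    have h : ∀ c, c ≠ [] → (fun r => conv (fun y => φ (y :: r)) (unitFamily (x :: c))) =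
        fun _ => 0 := by
      intro c hc
      obtain ⟨y, c, rfl⟩ := List.exists_cons_of_ne_nil hc
      exact consConv_zero hφ
    have h₀ : (fun r => conv (fun y => φ (y :: r)) (unitFamily [x])) = fun r => φ (x :: r) := by
      funext r
      exact conv_single (hφ.slot [] r) x
    rw [pull_cons]
    cases l with
    | nil => simp [h₀]
    | cons y l =>
      rw [cutSum_cons, h₀, ih (hφ.cons x)]
      simp only [h _ (List.cons_ne_nil _ _), pull_zero, cutSum_zero, add_zero]

theorem pull_unitFamily_right {f : List E → ℕ → F} (hf0 : f [] = 0) (l : List E) :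
    pull f unitFamily l = f l := by
  cases l with
  | nil => simp [hf0, unitFamily]
  | cons x l =>
    have h : ∀ e : ℕ → F, (fun r => conv (fun y => unitFamily (y :: r)) e) =
        fun r => if r = [] then e else 0 := by
      intro e
      funext r
      cases r with
      | nil =>
        funext W
        rw [conv, Finset.sum_eq_single (W, 0)]
        · simp [unitFamily]
        · rintro ⟨u, v⟩ huv hne
          have : v ≠ 0 := by
            rintro rfl
            simp at huv
            exact hne (by simp [huv])
          simp [unitFamily, Pi.single_eq_of_ne this]
        · simp
      | cons z r => simp [unitFamily, conv_zero_left]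
    rw [pull_cons]
    simp only [h, pull_delta]
    exact cutSum_right_nil (fun c => f (x :: c)) l

end

end Pull

end ListCalculus

/-! ### Single weights and terms of lowest weight -/

namespace ListCalculus

open Finset HasAntidiagonal

variable {E F M N : Type*}

section Unweighted

variable [AddCommMonoid M]

/-- The sum of `φ (a, m c, b)` over all `l = a ++ c ++ b`. -/
def insOp (m : List E → E) (φ : List E → M) (l : List E) : M :=
  cutSum (fun a r => cutSum (fun c b => φ (a ++ m c :: b)) r) l

theorem insOp_nil (m : List E → E) (φ : List E → M) : insOp m φ [] = φ [m []] := by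
  simp [insOp]

theorem insOp_cons (m : List E → E) (φ : List E → M) (y : E) (l : List E) :
    insOp m φ (y :: l) = cutSum (fun c b => φ (m c :: b)) (y :: l) +
      insOp m (fun r => φ (y :: r)) l := by
  rw [insOp, cutSum_cons]
  rfl

theorem insOp_zero_right (m : List E → E) (l : List E) : insOp m (fun _ => (0 : M)) l = 0 := by
  simp only [insOp, cutSum_zero]

theorem ins_apply (μ : List E → ℕ → E) (φ : List E → ℕ → M) (l : List E) (W : ℕ) :
    ins μ φ l W = ∑ uv ∈ antidiagonal W,
      insOp (fun c => μ c uv.1) (fun r => φ r uv.2) l := by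
  simp only [ins, insOp, cutSum_apply, conv, cutSum_sum]

end Unweighted

theorem insOp_add_right [AddCommMonoid M] (m : List E → E) (φ ψ : List E → M) (l : List E) :
    insOp m (fun r => φ r + ψ r) l = insOp m φ l + insOp m ψ l := by
  simp only [insOp, cutSum_add]

theorem insOp_add_left [AddCommGroup E] [AddCommGroup M] (m m' : List E → E) {φ : List E → M}
    (hφ : EntryAdditive φ) (l : List E) :
    insOp (fun c => m c + m' c) φ l = insOp m φ l + insOp m' φ l := by
  simp only [insOp, hφ _ _ (m _), cutSum_add]

theorem insOp_zero_left [AddCommGroup E] [AddCommGroup M] {φ : List E → M}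
    (hφ : EntryAdditive φ) (l : List E) : insOp (fun _ => 0) φ l = 0 := by
  simp only [insOp, hφ.zero_entry, cutSum_zero]

theorem EntryAdditive.insOp [AddCommGroup E] [AddCommGroup M] {m : List E → E}
    {φ : List E → M} (hm : EntryAdditive m) (hφ : EntryAdditive φ) :
    EntryAdditive (insOp m φ) := by
  refine EntryAdditive.cutSum (fun r => ?_) fun a => ?_
  · intro p q x y
    simp only [List.append_assoc, List.cons_append, hφ p _ x y, cutSum_add]
  · refine EntryAdditive.cutSum (fun b => ?_) fun c => ?_
    · intro p q x y
      simp only [hm p q x y]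
      exact hφ a b _ _
    · intro p q x y
      have := fun z => hφ (a ++ z :: p) q x y
      simp only [List.append_assoc, List.cons_append] at this
      simp only [this]

/-- The family of operations of which only the one of weight `W` is not zero. -/
theorem EntryAdditive.apply [Add E] [Add M] {φ : List E → ℕ → M} (h : EntryAdditive φ) (w : ℕ) :
    EntryAdditive fun l => φ l w := fun a b x y => congrFun (h a b x y) w

theorem EntryAdditive.of_apply [Add E] [Add M] {φ : List E → ℕ → M}
    (h : ∀ w, EntryAdditive fun l => φ l w) : EntryAdditive φ :=
  fun a b x y => funext fun w => h w a b x y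

theorem consConv_apply_of_vanish [AddCommGroup M] {φ : List F → ℕ → M} {e : ℕ → F} {W : ℕ} {r : List F}
    (h : ∀ y, ∀ u < W, φ (y :: r) u = 0) : consConv φ e r W = φ (e 0 :: r) W := by
  rw [consConv, conv, Finset.sum_eq_single (0, W)]
  · rintro ⟨u, v⟩ huv hne
    have : v < W := by
      rw [HasAntidiagonal.mem_antidiagonal] at huv
      rcases Nat.eq_zero_or_pos u with rfl | hu
      · exact absurd (by simp_all) hne
      · dsimp at huv; omega
    exact h _ v this
  · simp

theorem consConv_apply_eq_zero [AddCommGroup M] {φ : List F → ℕ → M} {e : ℕ → F} {W : ℕ} {r : List F}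
    (h : ∀ y, ∀ u ≤ W, φ (y :: r) u = 0) : consConv φ e r W = 0 := by
  rw [consConv, conv]
  refine Finset.sum_eq_zero ?_
  rintro ⟨u, v⟩ huv
  rw [HasAntidiagonal.mem_antidiagonal] at huv
  exact h _ v (by dsimp at huv; omega)

section Leading

variable [AddCommGroup F] [AddCommGroup M]

theorem consConv_apply_of_vanish_right {φ : List F → ℕ → M} (hφ : EntryAdditive φ) {e : ℕ → F}
    {W : ℕ} (r : List F) (h : ∀ u < W, e u = 0) : consConv φ e r W = φ (e W :: r) 0 := by
  rw [consConv, conv, Finset.sum_eq_single (W, 0)]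
  · rintro ⟨u, v⟩ huv hne
    have : u < W := by
      rw [HasAntidiagonal.mem_antidiagonal] at huv
      rcases Nat.eq_zero_or_pos v with rfl | hu
      · exact absurd (by simp_all) hne
      · dsimp at huv; omega
    dsimp only
    rw [h u this]
    exact congrFun (hφ.zero_entry [] r) v
  · simp

/-- If `ψ` starts in weight `W`, no weight is left for `f`, so only its weight-zero part enters,
which is the identity. -/
theorem pull_apply_of_vanish {f : List F → ℕ → F} (hf : ∀ l, f l 0 = unitFamily l 0)
    {ψ : List F → ℕ → M} (hψ : EntryAdditive ψ) {W : ℕ} (h : ∀ l, ∀ u < W, ψ l u = 0)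
    (l : List F) : pull f ψ l W = ψ l W := by
  induction hl : l.length using Nat.strong_induction_on generalizing l ψ with
  | _ n ih =>
    subst hl
    cases l with
    | nil => simp
    | cons x l =>
      rw [pull_cons, cutSum_apply]
      have key : ∀ c d, c ++ d = l →
          pull f (consConv ψ (f (x :: c))) d W = ψ (f (x :: c) 0 :: d) W := by
        intro c d hcd
        rw [ih d.length (by simp [← hcd]) (hψ.consConv _) ?_ d rfl,
          consConv_apply_of_vanish fun y u hu => h _ u hu]
        intro r u hu
        exact consConv_apply_eq_zero fun y v hv => h _ v (by omega)
      refine (cutSum_congr key).trans ?_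
      simp only [hf]
      cases l with
      | nil => simp [unitFamily]
      | cons y l =>
        rw [cutSum_cons]
        simp only [unitFamily, Pi.zero_apply, Pi.single_eq_same]
        rw [cutSum_eq_zero, add_zero]
        intro a b _
        exact congrFun (hψ.zero_entry [] b) W

/-- The quantitative form of `pull_ins_eq_ins_pull`: if the homomorphism relation fails first in
weight `W`, the failure to commute with the coderivations in that weight is the insertion of the
error into the weight-zero part of `φ`. This is what makes the error a cocycle. -/
theorem pull_ins_add_ins_pull_apply {f : List F → ℕ → F} (hf0 : f [] = 0)
    (hf : ∀ l, f l 0 = unitFamily l 0) {μ ν : List F → ℕ → F} (hν : EntryAdditive ν) {W : ℕ}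
    (he : ∀ l, ∀ u < W, pull f ν l u + ins μ f l u = 0)
    {φ : List F → ℕ → M} (hφ : EntryAdditive φ) (l : List F) :
    pull f (ins ν φ) l W + ins μ (pull f φ) l W =
      insOp (fun c => pull f ν c W + ins μ f c W) (fun r => φ r 0) l := by
  induction hl : l.length using Nat.strong_induction_on generalizing l φ with
  | _ n ih =>
    subst hl
    have h₁ : ∀ c d, pull f (consConv φ (pull f ν c)) d W + pull f (consConv φ (ins μ f c)) d W =
        φ ((pull f ν c W + ins μ f c W) :: d) 0 := by
      intro c d
      rw [← Pi.add_apply, ← pull_add, ← consConv_add hφ,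
        pull_apply_of_vanish hf (hφ.consConv _) _ d,
        consConv_apply_of_vanish_right hφ (e := pull f ν c + ins μ f c) d (he c)]
      · rfl
      · intro r u hu
        rw [consConv_apply_of_vanish_right hφ (e := pull f ν c + ins μ f c) r
          fun v hv => he c v (hv.trans hu)]
        rw [Pi.add_apply, he c u hu]
        exact congrFun (hφ.zero_entry [] r) 0
    rw [pull_ins hf0 hν hφ, ins_pull hf0 hφ]
    simp only [Pi.add_apply, cutSum_apply]
    rw [add_add_add_comm, ← cutSum_add, ← cutSum_add]
    simp only [h₁]
    have h₂ : ∀ c d, c ++ d = l → pull f (ins ν (consConv φ (f c))) d W +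
        ins μ (pull f (consConv φ (f c))) d W = if c = [] then 0 else
          insOp (fun c => pull f ν c W + ins μ f c W) (fun r => φ (f c 0 :: r) 0) d := by
      intro c d hcd
      rcases c with _ | ⟨z, c⟩
      · rw [hf0, consConv_zero hφ]
        rw [show pull f (fun _ : List F => (0 : ℕ → M)) = fun _ => 0 from funext (pull_zero f)]
        rw [show ins ν (fun _ : List F => (0 : ℕ → M)) = fun _ => 0 from funext (ins_zero_right ν)]
        simp [pull_zero, ins_zero_right]
      · rw [ih d.length (by simp [← hcd]) (hφ.consConv _) d rfl]
        simp [consConv, conv]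
    rw [cutSum_congr h₂]
    cases l with
    | nil => simp [insOp_nil]
    | cons x l =>
      rw [insOp_cons, cutSum_cons (fun c d => if c = [] then _ else _)]
      congr 1
      simp only [hf]
      cases l with
      | nil => simp [unitFamily]
      | cons y l =>
        rw [cutSum_cons (fun c d => if x :: c = [] then _ else _), cutSum_eq_zero]
        · simp [unitFamily]
        · intro a b _
          simp only [unitFamily, Pi.zero_apply, reduceCtorEq, if_false]
          have : (fun r => φ ((0 : F) :: r) 0) = fun _ => 0 := by
            funext r
            exact congrFun (hφ.zero_entry [] r) 0
          rw [this, insOp_zero_right]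

end Leading

end ListCalculus

/-! ### The sums in the definitions, as insertions and pullbacks -/

namespace WeightedAInfinity

open ListCalculus Finset HasAntidiagonal

variable {A : Type*} [Ring A]

/-- A family of operations, as a function on lists with values in functions of the weight. -/
def family (φ : ℕ → List A → A) (l : List A) (w : ℕ) : A := φ w l

theorem insertSum_eq (f μ : ℕ → List A → A) (W : ℕ) (l : List A) :
    insertSum f μ W l = ins (family μ) (family f) l W := by
  rw [ins_apply, insertSum, ← Nat.sum_antidiagonal_swap]
  refine sum_congr rfl fun uv _ => ?_
  simp only [insOp, cutSum]
  refine sum_congr rfl fun i _ => ?_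
  rw [List.length_drop]
  refine sum_congr rfl fun q _ => ?_
  simp [family, List.drop_drop]

/-- The part of `composeSum` with `m` blocks. -/
def blockSum (φ : List A → ℕ → A) (f : ℕ → List A → A) (m : ℕ) (l : List A) (W : ℕ) : A :=
  ∑ ab ∈ antidiagonal W,
    ((blocks m ab.2 l).map fun B => φ (B.map fun p => f p.1 p.2) ab.1).sum

theorem list_sum_map_range {M : Type*} [AddCommMonoid M] (n : ℕ) (g : ℕ → M) :
    ((List.range n).map g).sum = ∑ i ∈ range n, g i := by
  induction n with
  | zero => simp
  | succ n ih => simp [List.range_succ, sum_range_succ, ih]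

theorem list_sum_map_flatMap {ι κ M : Type*} [AddCommMonoid M] (L : List ι) (g : ι → List κ)
    (h : κ → M) : ((L.flatMap g).map h).sum = (L.map fun i => ((g i).map h).sum).sum := by
  induction L with
  | nil => simp
  | cons i L ih => simp [ih]

theorem list_sum_map_sum {ι κ M : Type*} [AddCommMonoid M] (L : List ι) (s : Finset κ)
    (h : ι → κ → M) :
    (L.map fun i => ∑ k ∈ s, h i k).sum = ∑ k ∈ s, (L.map fun i => h i k).sum := by
  induction L with
  | nil => simp
  | cons i L ih => simp [ih, sum_add_distrib]

theorem blockSum_succ (φ : List A → ℕ → A) (f : ℕ → List A → A) (m : ℕ) (l : List A) :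
    blockSum φ f (m + 1) l =
      cutSum (fun c d => blockSum (consConv φ (family f c)) f m d) l := by
  funext W
  have h₁ : ∀ b (h : List A → A), ((blocks (m + 1) b l).map fun B =>
      h (B.map fun p => f p.1 p.2)).sum = ∑ q ∈ range (l.length + 1),
        ∑ wv ∈ antidiagonal b, ((blocks m wv.2 (l.drop q)).map fun B =>
          h (f wv.1 (l.take q) :: B.map fun p => f p.1 p.2)).sum := by
    intro b h
    simp only [blocks, list_sum_map_flatMap, list_sum_map_range, List.map_map]
    rw [sum_comm]
    refine sum_congr rfl fun q _ => ?_
    rw [Nat.sum_antidiagonal_eq_sum_range_succ_mk]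
    rfl
  rw [cutSum_apply]
  simp only [blockSum]
  rw [sum_congr rfl fun ab _ => h₁ ab.2 fun L => φ L ab.1, sum_comm]
  refine sum_congr rfl fun q _ => ?_
  simp only [consConv, conv, list_sum_map_sum]
  rw [Finset.sum_sigma', Finset.sum_sigma']
  refine Finset.sum_bij' (fun x _ => ⟨(x.2.1 + x.1.1, x.2.2), (x.2.1, x.1.1)⟩)
    (fun x _ => ⟨(x.2.2, x.2.1 + x.1.2), (x.2.1, x.1.2)⟩) ?_ ?_ ?_ ?_ ?_
  all_goals rintro ⟨⟨a, b⟩, ⟨c, d⟩⟩ h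
  all_goals simp only [mem_sigma, HasAntidiagonal.mem_antidiagonal] at h ⊢
  · exact ⟨by omega, trivial⟩
  · exact ⟨by omega, trivial⟩
  · obtain ⟨h1, h2⟩ := h; subst h2; rfl
  · obtain ⟨h1, h2⟩ := h; subst h2; rfl
  · rfl

/-- A family without nullary components annihilates all terms with an empty block. Hence at most
`l.length` blocks contribute, and the bound on `m` in `composeSum` loses nothing. -/
theorem composeSum_eq {g f : ℕ → List A → A} (hg : EntryAdditive (family g))
    (hf0 : ∀ w, f w [] = 0) (W : ℕ) (l : List A) :
    composeSum g f W l = pull (family f) (family g) l W := by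
  have hf : family f [] = 0 := funext hf0
  have hz : ∀ m l, blockSum (fun _ => (0 : ℕ → A)) f m l = 0 := by
    intro m l
    funext W
    simp [blockSum]
  -- The bound on the number of blocks only has to exceed the length of the list, which makes
  -- induction on the bound possible: splitting off a non-empty first block lowers both.
  have key : ∀ (N : ℕ) (φ : List A → ℕ → A), EntryAdditive φ → ∀ l : List A, l.length < N →
      ∑ m ∈ range N, blockSum φ f m l = pull (family f) φ l := by
    intro N
    induction N with
    | zero => intro φ _ l hl; omega
    | succ N ih =>
      intro φ hφ l hl
      rw [sum_range_succ', pull_eq hf hφ]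
      simp only [blockSum_succ, ← cutSum_sum]
      rw [add_comm]
      congr 1
      · funext W
        cases l with
        | nil =>
          rw [blockSum, Finset.sum_eq_single (W, 0)]
          · simp [blocks]
          · rintro ⟨u, v⟩ huv hne
            have : v ≠ 0 := by
              rintro rfl
              simp at huv
              exact hne (by simp [huv])
            obtain ⟨v, rfl⟩ := Nat.exists_eq_succ_of_ne_zero this
            simp [blocks]
          · simp
        | cons x l =>
          simp [blockSum, blocks]
      · refine cutSum_congr fun c d hcd => ?_
        rcases c with _ | ⟨z, c⟩
        · rw [hf, consConv_zero hφ, pull_zero]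
          simp [hz]
        · exact ih _ (hφ.consConv _) d (by simp [← hcd] at hl; omega)
  rw [← key (l.length + W + 1) _ hg l (by omega), composeSum, Finset.sum_apply, sum_comm]
  rfl

end WeightedAInfinity

/-! ### Letters, coefficients and multilinear functions on the torus algebra -/

namespace TorusAlgebra

open ListCalculus

/-- The indices `(m, b)` of the basis `U^m b`. -/
abbrev Letter : Type := ℕ × Basic

/-- The basis element with index `x`. -/
noncomputable def mono (x : Letter) : Alg := monomial x.1 x.2

/-- The coefficient of a basis element. -/
noncomputable def coeff (y : Letter) : Alg →+ ZMod 2 :=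
  (Finsupp.applyAddHom y : ((ℕ × Basic) →₀ ZMod 2) →+ ZMod 2)

theorem alg_ext {a b : Alg} (h : ∀ y, coeff y a = coeff y b) : a = b :=
  Finsupp.ext (f := a) (g := b) h

open Classical in
theorem coeff_mono (x y : Letter) : coeff y (mono x) = if x = y then 1 else 0 :=
  Finsupp.single_apply

theorem eq_of_coeff_mono_ne_zero {x y : Letter} (h : coeff y (mono x) ≠ 0) : x = y := by
  classical
  rw [coeff_mono] at h
  by_contra hne
  simp [hne] at h

/-- The basis elements occurring in an element of the algebra. -/
noncomputable def supp (a : Alg) : Finset Letter :=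
  Finsupp.support (a : (ℕ × Basic) →₀ ZMod 2)

theorem mem_supp {a : Alg} {x : Letter} : x ∈ supp a ↔ coeff x a ≠ 0 :=
  Finsupp.mem_support_iff

theorem sum_supp (a : Alg) : ∑ x ∈ supp a, mono x = a := by
  have h : ∀ x ∈ supp a, mono x = Finsupp.single x (coeff x a) := by
    intro x hx
    have h1 : ∀ c : ZMod 2, c ≠ 0 → c = 1 := by decide
    rw [h1 _ (mem_supp.1 hx)]
    rfl
  rw [Finset.sum_congr rfl h]
  exact Finsupp.sum_single (a : (ℕ × Basic) →₀ ZMod 2)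

section Additive

variable {M : Type*} [AddCommGroup M]

theorem EntryAdditive.sum_supp {φ : List Alg → M} (hφ : EntryAdditive φ) (p q : List Alg)
    (e : Alg) : φ (p ++ e :: q) = ∑ x ∈ supp e, φ (p ++ mono x :: q) := by
  conv_lhs => rw [← TorusAlgebra.sum_supp e]
  exact map_sum (hφ.slot p q) _ _

theorem EntryAdditive.ext_mono {φ ψ : List Alg → M} (hφ : EntryAdditive φ)
    (hψ : EntryAdditive ψ) (h : ∀ l : List Letter, φ (l.map mono) = ψ (l.map mono)) : φ = ψ := by
  have key : ∀ (l : List Alg) (p : List Letter), φ (p.map mono ++ l) = ψ (p.map mono ++ l) := by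
    intro l
    induction l with
    | nil => intro p; simpa using h p
    | cons a l ih =>
      intro p
      rw [EntryAdditive.sum_supp hφ, EntryAdditive.sum_supp hψ]
      refine Finset.sum_congr rfl fun x _ => ?_
      simpa using ih (p ++ [x])
  funext l
  exact key l []

theorem EntryAdditive.eq_zero {φ : List Alg → M} (hφ : EntryAdditive φ)
    (h : ∀ l : List Letter, φ (l.map mono) = 0) (l : List Alg) : φ l = 0 :=
  congrFun (EntryAdditive.ext_mono (ψ := fun _ => 0) hφ (fun _ _ _ _ => by simp) h) l

theorem EntryAdditive.exists_coeff {φ : List Alg → Alg} (hφ : EntryAdditive φ) {p q : List Alg}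
    {e : Alg} {y : Letter} (h : coeff y (φ (p ++ e :: q)) ≠ 0) :
    ∃ x, coeff x e ≠ 0 ∧ coeff y (φ (p ++ mono x :: q)) ≠ 0 := by
  rw [EntryAdditive.sum_supp hφ, map_sum] at h
  obtain ⟨x, hx, hxy⟩ := Finset.exists_ne_zero_of_sum_ne_zero h
  exact ⟨x, mem_supp.1 hx, hxy⟩

end Additive

theorem exists_of_cutSum_ne_zero {E M : Type*} [AddCommMonoid M] {Φ : List E → List E → M}
    {l : List E} (h : cutSum Φ l ≠ 0) : ∃ a b, a ++ b = l ∧ Φ a b ≠ 0 := by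
  by_contra hc
  push Not at hc
  exact h (cutSum_eq_zero hc)

theorem cutSum_map {E F M : Type*} [AddCommMonoid M] (Φ : List F → List F → M) (f : E → F)
    (l : List E) : cutSum Φ (l.map f) = cutSum (fun a b => Φ (a.map f) (b.map f)) l := by
  simp [cutSum, List.map_take, List.map_drop]

theorem insOp_map {E F M : Type*} [AddCommMonoid M] (m : List F → F) (φ : List F → M) (f : E → F)
    (l : List E) : insOp m φ (l.map f) = cutSum (fun a r => cutSum (fun c b =>
      φ (a.map f ++ m (c.map f) :: b.map f)) r) l := by
  simp only [insOp, cutSum_map]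

theorem multilinearExtension_add (φ : List Letter → Alg) : 
    EntryAdditive (multilinearExtension φ) := by
  intro p
  induction p generalizing φ with
  | nil =>
    intro q x y
    exact Finsupp.sum_add_index' (f := x) (g := y) (by simp) (by intros; rw [add_smul])
  | cons a p ih =>
    intro q x y
    simp only [List.cons_append, multilinearExtension, ih, smul_add]
    exact Finsupp.sum_add

theorem multilinearExtension_mono (φ : List Letter → Alg) (l : List Letter) :
    multilinearExtension φ (l.map mono) = φ l := by
  induction l generalizing φ with
  | nil => rfl
  | cons x l ih =>
    rw [List.map_cons, multilinearExtension]
    refine (Finsupp.sum_single_index (by simp)).trans ?_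
    rw [ih, one_smul]

/-! ### Products and degrees of letters -/

/-- The vertex at which a basis element starts. -/
def Basic.src : Basic → Fin 2
  | .idem e => e
  | .chord i _ => source i

/-- The vertex at which a basis element ends. -/
def Basic.tgt : Basic → Fin 2
  | .idem e => e
  | .chord i n => target i n

/-- The product of basis elements, `none` standing for zero. -/
def Letter.mul (x y : Letter) : Option Letter := (x.2.mul y.2).map fun b => (x.1 + y.1, b)

theorem mono_mul_mono (x y : Letter) : mono x * mono y = (Letter.mul x y).elim 0 mono := by
  refine (mulHom_monomial x.1 y.1 x.2 y.2).trans ?_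
  unfold Letter.mul
  cases x.2.mul y.2 <;> rfl

theorem Basic.mul_eq_some {a b c : Basic} (h : a.mul b = some c) :
    a.tgt = b.src ∧ c.src = a.src ∧ c.tgt = b.tgt := by
  rcases a with e | ⟨i, n⟩ <;> rcases b with f | ⟨j, m⟩ <;>
    simp only [Basic.mul, Option.ite_none_right_eq_some, Option.some.injEq] at h <;>
    obtain ⟨h1, rfl⟩ := h <;> simp only [Basic.src, Basic.tgt]
  · simp [h1]
  · simp [h1]
  · simp [h1]
  · subst h1
    refine ⟨rfl, trivial, ?_⟩
    unfold target
    congr 1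
    push_cast
    ring

theorem Letter.mul_eq_some {x y z : Letter} (h : Letter.mul x y = some z) :
    x.2.tgt = y.2.src ∧ z.2.src = x.2.src ∧ z.2.tgt = y.2.tgt ∧ z.1 = x.1 + y.1 ∧
      x.2.mul y.2 = some z.2 := by
  unfold Letter.mul at h
  obtain ⟨b, hb, rfl⟩ := Option.map_eq_some_iff.1 h
  obtain ⟨h1, h2, h3⟩ := Basic.mul_eq_some hb
  exact ⟨h1, h2, h3, rfl, hb⟩

theorem run_add (i : ZMod 4) (n m : ℕ) : TilingPattern.run i (n + m + 1) =
    TilingPattern.run i n ++ TilingPattern.run (i + n + 1) m := by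
  unfold TilingPattern.run
  rw [show n + m + 1 + 1 = (n + 1) + (m + 1) by ring, List.range_add, List.map_append,
    List.map_map]
  congr 1
  refine List.map_congr_left fun j _ => ?_
  simp only [Function.comp]
  push_cast
  ring

theorem Basic.degree_mul {a b c : Basic} (h : a.mul b = some c) :
    c.degree = a.degree * b.degree := by
  rcases a with e | ⟨i, n⟩ <;> rcases b with f | ⟨j, m⟩ <;>
    simp only [Basic.mul, Option.ite_none_right_eq_some, Option.some.injEq] at h <;>
    obtain ⟨h1, rfl⟩ := h <;> simp only [Basic.degree, one_mul, mul_one]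
  rw [run_add, List.map_append, List.prod_append, h1]

theorem gam_ext {g h : Gam} (hm : g.1.1.m = h.1.1.m) (ha : g.1.1.a = h.1.1.a)
    (hb : g.1.1.b = h.1.1.b) (hn : g.2.toAdd = h.2.toAdd) : g = h :=
  Prod.ext (Subtype.ext (Triple.ext hm ha hb)) hn

theorem gam_mul (g h : Gam) : (g * h).1.1 = g.1.1 * h.1.1 := rfl

/-- The only source of non-commutativity is the term `ad - bc`, which vanishes if one factor has
both of these components zero. -/
theorem gam_central {m : ℚ} {n : ℤ} (hm : (⟨m, 0, 0⟩ : Triple) ∈ gradingGroup) (g : Gam) :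
    gam m 0 0 n hm * g = g * gam m 0 0 n hm := by
  refine gam_ext ?_ ?_ ?_ ?_
  · simp [Triple.mul_def, gam, add_comm]
  · simp [Triple.mul_def, gam]
  · simp [Triple.mul_def, gam]
  · simp [gam, add_comm]

theorem commute_lamD (g : Gam) : Commute lamD g := gam_central _ g
theorem commute_lamW (g : Gam) : Commute lamW g := gam_central _ g
theorem commute_uDegree (g : Gam) : Commute uDegree g := gam_central _ g

/-- The central element `λ_d^k λ_w^w`. -/
def lam (k : ℤ) (w : ℕ) : Gam := lamD ^ k * lamW ^ w

theorem commute_lam (k : ℤ) (w : ℕ) (g : Gam) : Commute (lam k w) g :=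
  ((commute_lamD g).zpow_left k).mul_left ((commute_lamW g).pow_left w)

theorem lam_mul (k k' : ℤ) (w w' : ℕ) : lam k w * lam k' w' = lam (k + k') (w + w') := by
  unfold lam
  rw [zpow_add, pow_add, mul_assoc, mul_assoc]
  congr 1
  rw [← mul_assoc, ← mul_assoc, ((commute_lamW _).pow_left w).eq]

theorem lam_zero : lam 0 0 = 1 := by simp [lam]

/-- The degree of a basis element. -/
def Letter.degree (x : Letter) : Gam := uDegree ^ x.1 * x.2.degree

/-- The degree of a basis element in the bar construction. -/
def Letter.barDegree (x : Letter) : Gam := lamD * Letter.degree x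

theorem Letter.degree_mul {x y z : Letter} (h : Letter.mul x y = some z) :
    Letter.degree z = Letter.degree x * Letter.degree y := by
  obtain ⟨-, -, -, h1, h2⟩ := Letter.mul_eq_some h
  rw [Letter.degree, Letter.degree, Letter.degree, h1, Basic.degree_mul h2, pow_add, mul_assoc,
    mul_assoc, ← mul_assoc (uDegree ^ y.1), ((commute_uDegree _).pow_left y.1).eq, mul_assoc]

/-! ### Paths and graded functions -/

/-- The list `l` of basis elements is composable, with product running from `s` to `t`, and its
degree in the bar construction is `g`. -/
def IsPath : List Letter → Gam → Fin 2 → Fin 2 → Prop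
  | [], g, s, t => g = 1 ∧ s = t
  | x :: l, g, s, t => x.2.src = s ∧ ∃ h, g = Letter.barDegree x * h ∧ IsPath l h x.2.tgt t

theorem isPath_append {a b : List Letter} {g : Gam} {s t : Fin 2} :
    IsPath (a ++ b) g s t ↔ ∃ g₁ g₂ r, g = g₁ * g₂ ∧ IsPath a g₁ s r ∧ IsPath b g₂ r t := by
  induction a generalizing g s with
  | nil =>
    constructor
    · intro h
      exact ⟨1, g, s, by simp, ⟨rfl, rfl⟩, h⟩
    · rintro ⟨g₁, g₂, r, rfl, ⟨rfl, rfl⟩, h⟩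
      simpa using h
  | cons x a ih =>
    constructor
    · rintro ⟨hs, h, rfl, hp⟩
      obtain ⟨g₁, g₂, r, rfl, h1, h2⟩ := ih.1 hp
      exact ⟨_, g₂, r, (mul_assoc _ _ _).symm, ⟨hs, g₁, rfl, h1⟩, h2⟩
    · rintro ⟨g₁, g₂, r, rfl, ⟨hs, h, rfl, h1⟩, h2⟩
      exact ⟨hs, _, mul_assoc _ _ _, ih.2 ⟨_, _, _, rfl, h1, h2⟩⟩

theorem isPath_singleton {x : Letter} {g : Gam} {s t : Fin 2} :
    IsPath [x] g s t ↔ g = Letter.barDegree x ∧ x.2.src = s ∧ x.2.tgt = t := by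
  simp only [IsPath]
  constructor
  · rintro ⟨h1, h, rfl, rfl, h2⟩
    exact ⟨by simp, h1, h2⟩
  · rintro ⟨rfl, h1, h2⟩
    exact ⟨h1, 1, by simp, rfl, h2⟩

/-- Replaces a composable string by a basis element with the same ends. -/
theorem isPath_replace {a b c c' : List Letter} {z : Gam} (hz : ∀ g, Commute z g)
    (hc : ∀ g s t, IsPath c g s t → IsPath c' (z * g) s t) {g : Gam} {s t : Fin 2}
    (h : IsPath (a ++ (c ++ b)) g s t) : IsPath (a ++ (c' ++ b)) (z * g) s t := by
  obtain ⟨g₁, g₂, r, rfl, h1, h2⟩ := isPath_append.1 h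
  obtain ⟨g₃, g₄, q, rfl, h3, h4⟩ := isPath_append.1 h2
  refine isPath_append.2 ⟨g₁, z * g₃ * g₄, r, ?_, h1, isPath_append.2 ⟨_, g₄, q, rfl, hc _ _ _ h3, h4⟩⟩
  rw [← mul_assoc, ← mul_assoc, ← mul_assoc, (hz g₁).eq]
  simp only [mul_assoc]

/-- The function `φ` on lists, restricted to basis elements, is a map of `k`-bimodules of degree
`c` on the bar construction. -/
def IsGradedAt (c : Gam) (φ : List Alg → Alg) (l : List Letter) : Prop :=
  ∀ y, coeff y (φ (l.map mono)) ≠ 0 → ∃ g, IsPath l g y.2.src y.2.tgt ∧ Letter.barDegree y = c * g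

/-- See `IsGradedAt`. -/
def IsGradedMap (c : Gam) (φ : List Alg → Alg) : Prop := ∀ l, IsGradedAt c φ l

/-- The function `φ` vanishes if one of its entries is an idempotent. -/
def IsNormalized (φ : List Alg → Alg) : Prop :=
  ∀ l : List Letter, (∃ e, ((0, .idem e) : Letter) ∈ l) → φ (l.map mono) = 0

theorem IsGradedMap.add {c : Gam} {φ ψ : List Alg → Alg} (hφ : IsGradedMap c φ)
    (hψ : IsGradedMap c ψ) : IsGradedMap c fun l => φ l + ψ l := by
  intro l y hy
  by_cases h : coeff y (φ (l.map mono)) = 0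
  · refine hψ l y fun h' => hy ?_
    rw [map_add, h, h', add_zero]
  · exact hφ l y h

theorem IsGradedMap.zero {c : Gam} : IsGradedMap c fun _ => 0 := by
  intro l y hy
  simp at hy

theorem IsGradedMap.sum {ι : Type*} {c : Gam} (s : Finset ι) {φ : ι → List Alg → Alg}
    (hφ : ∀ i ∈ s, IsGradedMap c (φ i)) : IsGradedMap c fun l => ∑ i ∈ s, φ i l := by
  intro l y hy
  rw [map_sum] at hy
  obtain ⟨i, hi, h⟩ := Finset.exists_ne_zero_of_sum_ne_zero hy
  exact hφ i hi l y h

/-- A graded function remains graded after a graded insertion in one entry. -/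
theorem isPath_of_entry {c c' : Gam} (hc : ∀ g, Commute c g) {e : List Letter} {x : Letter}
    (hx : ∃ g, IsPath e g x.2.src x.2.tgt ∧ Letter.barDegree x = c * g) {a b : List Letter}
    {y : Letter}
    (hy : ∃ g, IsPath (a ++ x :: b) g y.2.src y.2.tgt ∧ Letter.barDegree y = c' * g) :
    ∃ g, IsPath (a ++ (e ++ b)) g y.2.src y.2.tgt ∧ Letter.barDegree y = c * c' * g := by
  obtain ⟨g, hg, hyg⟩ := hy
  obtain ⟨k, hk, hxk⟩ := hx
  refine ⟨c⁻¹ * g, ?_, ?_⟩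
  · refine isPath_replace (c := [x]) (fun g => (hc g).inv_left) ?_ hg
    intro g s t h
    obtain ⟨rfl, rfl, rfl⟩ := isPath_singleton.1 h
    rw [hxk, inv_mul_cancel_left]
    exact hk
  · rw [hyg, (hc c').eq, mul_assoc, mul_inv_cancel_left]

theorem IsGradedMap.insOp {c c' : Gam} (hc : ∀ g, Commute c g) {m φ : List Alg → Alg}
    (hm : IsGradedMap c m) (hφ : EntryAdditive φ) (hφ' : IsGradedMap c' φ) :
    IsGradedMap (c * c') (insOp m φ) := by
  intro l y hy
  simp only [insOp_map, map_cutSum] at hy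
  obtain ⟨a, r, rfl, h⟩ := exists_of_cutSum_ne_zero hy
  obtain ⟨e, b, rfl, h'⟩ := exists_of_cutSum_ne_zero h
  obtain ⟨x, hx, hxy⟩ := EntryAdditive.exists_coeff hφ h'
  refine isPath_of_entry hc (hm e x hx) (hφ' (a ++ x :: b) y ?_)
  simpa using hxy

end TorusAlgebra

/-! ### Chord sequences of tiling patterns -/

namespace TorusAlgebra

open ListCalculus TilingPattern

theorem source_sub_two (i : ZMod 4) : source (i - 2) = source i := by
  revert i; decide

theorem run_zero (i : ZMod 4) : run i 0 = [i] := by simp [run]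

theorem run_succ (i : ZMod 4) (n : ℕ) : run i (n + 1) = i :: run (i + 1) n := by
  have := run_add i 0 n
  rw [run_zero] at this
  simpa using this

/-- A sequence of words as one string, every word being followed by the separator `none`. -/
def tokens (ws : List (List (ZMod 4))) : List (Option (ZMod 4)) :=
  ws.flatMap fun w => w.map some ++ [none]

theorem tokens_nil : tokens [] = [] := rfl

theorem tokens_cons (w : List (ZMod 4)) (ws : List (List (ZMod 4))) :
    tokens (w :: ws) = w.map some ++ none :: tokens ws := by
  simp [tokens]

theorem tokens_append (u v : List (List (ZMod 4))) : tokens (u ++ v) = tokens u ++ tokens v := by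
  simp [tokens]

theorem map_some_append_none_inj {w w' : List (ZMod 4)} {σ σ' : List (Option (ZMod 4))}
    (h : w.map some ++ none :: σ = w'.map some ++ none :: σ') : w = w' ∧ σ = σ' := by
  induction w generalizing w' with
  | nil =>
    cases w' with
    | nil => simpa using h
    | cons _ _ => simp at h
  | cons a w ih =>
    cases w' with
    | nil => simp at h
    | cons b w' =>
      simp only [List.map_cons, List.cons_append, List.cons.injEq, Option.some.injEq] at h
      obtain ⟨rfl, h⟩ := h
      obtain ⟨rfl, h'⟩ := ih h
      exact ⟨rfl, h'⟩

theorem tokens_injective {ws ws' : List (List (ZMod 4))} (h : tokens ws = tokens ws') :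
    ws = ws' := by
  induction ws generalizing ws' with
  | nil =>
    cases ws' with
    | nil => rfl
    | cons w _ => simp [tokens_cons, tokens_nil] at h
  | cons w ws ih =>
    cases ws' with
    | nil => simp [tokens_cons, tokens_nil] at h
    | cons w' ws' =>
      rw [tokens_cons, tokens_cons] at h
      obtain ⟨rfl, h'⟩ := map_some_append_none_inj h
      rw [ih h']

/-- In the encoding as strings, gluing merely deletes one separator. Merging of words thus becomes
concatenation, which is easier to invert. -/
theorem tokens_glue {u v : List (List (ZMod 4))} {x : List (Option (ZMod 4))}
    (hu : tokens u = x ++ [none]) (hv : v ≠ []) : tokens (glue u v) = x ++ tokens v := by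
  fun_induction glue u v generalizing x with
  | case1 v => simp [tokens_nil] at hu
  | case2 => exact absurd rfl hv
  | case3 w y v =>
    rw [tokens_cons, tokens_nil, List.append_left_inj] at hu
    rw [tokens_cons, tokens_cons, ← hu]
    simp
  | case4 w w' u v ih =>
    rw [tokens_cons] at hu
    obtain ⟨x', hx'⟩ : ∃ x', tokens (w' :: u) = x' ++ [none] := by
      refine ⟨(tokens (w' :: u)).dropLast, ?_⟩
      have hne : tokens (w' :: u) ≠ [] := by simp [tokens_cons]
      have := congrArg List.getLast? hu
      rw [List.getLast?_append, List.getLast?_cons_of_ne_nil hne, List.getLast?_concat] at this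
      conv_lhs => rw [← List.dropLast_append_getLast hne]
      rw [List.getLast?_eq_getLast_of_ne_nil hne] at this
      simpa using this
    rw [tokens_cons, ih hx' hv]
    rw [hx', ← List.cons_append, ← List.append_assoc, List.append_left_inj] at hu
    rw [← hu]
    simp

/-- The string of a tree, without the last separator. -/
def PlaneTree.tokens : PlaneTree → ZMod 4 → List (Option (ZMod 4))
  | .leaf, _ => [none]
  | .node a b c, i =>
      some i :: (a.tokens (i + 1) ++ some (i - 1) :: (b.tokens i ++ some (i - 2) ::
        (c.tokens (i - 1) ++ [some (i - 3)])))

theorem glue_ne_nil {u v : List (List (ZMod 4))} (h : u ≠ []) : glue u v ≠ [] := by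
  fun_induction glue u v <;> simp_all

theorem tokens_glue_single {w : List (ZMod 4)} {v : List (List (ZMod 4))} (hv : v ≠ []) :
    tokens (glue [w] v) = w.map some ++ tokens v :=
  tokens_glue (by simp [tokens_cons, tokens_nil]) hv

theorem PlaneTree.words_ne_nil (t : PlaneTree) (i : ZMod 4) : t.words i ≠ [] := by
  cases t with
  | leaf => simp [PlaneTree.words]
  | node a b c => exact glue_ne_nil (by simp)

theorem PlaneTree.tokens_words (t : PlaneTree) (i : ZMod 4) :
    TorusAlgebra.tokens (t.words i) = t.tokens i ++ [none] := by
  induction t generalizing i with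
  | leaf => rfl
  | node a b c ha hb hc =>
    have n1 : ∀ (t : PlaneTree) (i : ZMod 4) (v : List (List (ZMod 4))), glue (t.words i) v ≠ [] :=
      fun t i v => glue_ne_nil (t.words_ne_nil i)
    have n2 : ∀ (w : List (ZMod 4)) (v : List (List (ZMod 4))), glue [w] v ≠ [] :=
      fun w v => glue_ne_nil (by simp)
    rw [PlaneTree.words, tokens_glue_single (n1 _ _ _), tokens_glue (ha _) (n2 _ _),
      tokens_glue_single (n1 _ _ _), tokens_glue (hb _) (n2 _ _), tokens_glue_single (n1 _ _ _),
      tokens_glue (hc _) (by simp), tokens_cons, tokens_nil, PlaneTree.tokens]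
    simp

/-- The string of the chord sequence of a tiling pattern. -/
def TilingPattern.tokens (p : TilingPattern) : List (Option (ZMod 4)) :=
  match p.extension with
  | .centered => p.tree.tokens p.label ++ [none]
  | .left n => (run (p.label - (n + 1)) n).map some ++ (p.tree.tokens p.label ++ [none])
  | .right n => p.tree.tokens p.label ++ ((run (p.label - 2) n).map some ++ [none])

theorem TilingPattern.tokens_chordWords (p : TilingPattern) :
    TorusAlgebra.tokens p.chordWords = p.tokens := by
  unfold TilingPattern.chordWords TilingPattern.tokens
  cases p.extension with
  | centered => exact p.tree.tokens_words _
  | left n =>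
    exact (tokens_glue_single (p.tree.words_ne_nil _)).trans (by rw [p.tree.tokens_words])
  | right n =>
    exact (tokens_glue (p.tree.tokens_words _) (by simp)).trans (by simp [tokens_cons, tokens_nil])

/-- The string of a sequence of basis elements. -/
def basicTokens (l : List Basic) : List (Option (ZMod 4)) := tokens (l.map Basic.word)

theorem basicTokens_nil : basicTokens [] = [] := rfl

theorem basicTokens_cons (b : Basic) (l : List Basic) :
    basicTokens (b :: l) = b.word.map some ++ none :: basicTokens l := tokens_cons _ _

theorem basicTokens_append (l l' : List Basic) :
    basicTokens (l ++ l') = basicTokens l ++ basicTokens l' := by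
  simp [basicTokens, tokens_append]

/-- A sequence of words can be recovered from its string. Membership becomes an equality of strings,
from which common prefixes can be cancelled. -/
theorem mem_patterns {l : List Basic} {p : TilingPattern} :
    p ∈ patterns l ↔ p.tokens = basicTokens l := by
  rw [← p.tokens_chordWords]
  exact ⟨fun h => congrArg TorusAlgebra.tokens h, fun h => tokens_injective h⟩

/-! ### Descending chord sequences -/

/-- Reading a string of labels and separators: labels ascend inside a word, and the label after a
separator is one less than the label before it. The state is the label expected next, and whether
a separator is admissible. -/
def Walk : ZMod 4 → Bool → List (Option (ZMod 4)) → ZMod 4 → Bool → Prop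
  | r, f, [], r', f' => r = r' ∧ f = f'
  | r, _, some e :: σ, r', f' => e = r ∧ Walk (r + 1) true σ r' f'
  | r, f, none :: σ, r', f' => f = true ∧ Walk (r - 2) false σ r' f'

theorem Walk.append {σ τ : List (Option (ZMod 4))} {r r₁ r' : ZMod 4} {f f₁ f' : Bool}
    (h : Walk r f σ r₁ f₁) (h' : Walk r₁ f₁ τ r' f') : Walk r f (σ ++ τ) r' f' := by
  induction σ generalizing r f with
  | nil => obtain ⟨rfl, rfl⟩ := h; exact h'
  | cons x σ ih =>
    cases x with
    | none => exact ⟨h.1, ih h.2⟩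
    | some e => exact ⟨h.1, ih h.2⟩

theorem walk_run_iff {i r r' : ZMod 4} {f f' : Bool} {n : ℕ} {σ : List (Option (ZMod 4))} :
    Walk r f ((run i n).map some ++ σ) r' f' ↔ i = r ∧ Walk (r + n + 1) true σ r' f' := by
  induction n generalizing i r f with
  | zero => simp [run_zero, Walk]
  | succ n ih =>
    rw [run_succ, List.map_cons, List.cons_append]
    simp only [Walk, ih]
    constructor
    · rintro ⟨rfl, -, h⟩
      refine ⟨rfl, ?_⟩
      convert h using 1
      push_cast; ring
    · rintro ⟨rfl, h⟩
      refine ⟨rfl, rfl, ?_⟩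
      convert h using 1
      push_cast; ring

theorem PlaneTree.walk_node {a b c : PlaneTree} {i : ZMod 4}
    (ha : ∃ f, Walk (i + 1) true (a.tokens (i + 1)) (i + 1 - 2) f)
    (hb : ∃ f, Walk i true (b.tokens i) (i - 2) f)
    (hc : ∃ f, Walk (i - 1) true (c.tokens (i - 1)) (i - 1 - 2) f) (f : Bool) :
    Walk i f ((PlaneTree.node a b c).tokens i) (i - 2) true := by
  obtain ⟨f₁, ha⟩ := ha
  obtain ⟨f₂, hb⟩ := hb
  obtain ⟨f₃, hc⟩ := hc
  refine ⟨rfl, ha.append ⟨by ring, ?_⟩⟩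
  rw [show i + 1 - 2 + 1 = i by ring]
  refine hb.append ⟨rfl, ?_⟩
  rw [show i - 2 + 1 = i - 1 by ring]
  exact hc.append ⟨by ring, by ring, rfl⟩

/-- A tree changes the expected label by the same amount as a leaf, from `i` to `i - 2`. Around a
vertex the expected label is restored to that of each next quadrant, so the string of every tree
obeys the rule. -/
theorem PlaneTree.walk (t : PlaneTree) (i : ZMod 4) :
    ∃ f, Walk i true (t.tokens i) (i - 2) f := by
  induction t generalizing i with
  | leaf => exact ⟨false, rfl, rfl, rfl⟩
  | node a b c ha hb hc => exact ⟨true, PlaneTree.walk_node (ha _) (hb _) (hc _) true⟩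

theorem TilingPattern.walk_tree (p : TilingPattern) (f : Bool) :
    Walk p.label f (p.tree.tokens p.label) (p.label - 2) true :=
  PlaneTree.walk_node (p.first.walk _) (p.second.walk _) (p.third.walk _) f

/-- The first label of the chord sequence. -/
def TilingPattern.initial (p : TilingPattern) : ZMod 4 :=
  match p.extension with
  | .left n => p.label - (n + 1)
  | _ => p.label

/-- The label which is two less than the one expected after the chord sequence. -/
def TilingPattern.final (p : TilingPattern) : ZMod 4 :=
  match p.extension with
  | .right n => p.label + (n + 1)
  | _ => p.label

theorem sub_two_sub_two (i : ZMod 4) : i - 2 - 2 = i := by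
  revert i; decide

theorem TilingPattern.walk (p : TilingPattern) : Walk p.initial false p.tokens p.final false := by
  have h := p.walk_tree
  unfold TilingPattern.initial TilingPattern.final TilingPattern.tokens
  cases p.extension with
  | centered => exact (h _).append ⟨rfl, sub_two_sub_two _, rfl⟩
  | left n =>
    refine walk_run_iff.2 ⟨rfl, ?_⟩
    rw [show p.label - (n + 1) + n + 1 = p.label by ring]
    exact (h _).append ⟨rfl, sub_two_sub_two _, rfl⟩
  | right n =>
    refine (h _).append (walk_run_iff.2 ⟨rfl, rfl, ?_, rfl⟩)
    have := sub_two_sub_two (p.label + (n + 1))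
    change p.label - 2 + n + 1 - 2 = p.label + (n + 1)
    rw [← this]
    ring

/-- The chords in `l` start at `r`, each following chord starting one below the end of the one
before it. -/
def IsDescending : ZMod 4 → List Basic → ZMod 4 → Prop
  | r, [], r' => r = r'
  | r, b :: l, r' => ∃ n : ℕ, b = .chord r n ∧ IsDescending (r + n - 1) l r'

theorem isDescending_of_walk {l : List Basic} {r r' : ZMod 4}
    (h : Walk r false (basicTokens l) r' false) : IsDescending r l r' := by
  induction l generalizing r with
  | nil => exact h.1
  | cons b l ih =>
    rw [basicTokens_cons] at h
    cases b with
    | idem e => exact absurd h.1 (by simp)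
    | chord i n =>
      obtain ⟨rfl, -, h⟩ := walk_run_iff.1 h
      refine ⟨n, rfl, ih ?_⟩
      convert h using 1
      ring

/-- The main restriction on chord sequences. It excludes idempotents and ascending neighbours, and
it makes chord sequences composable. -/
theorem isDescending_of_mem_patterns {l : List Basic} {p : TilingPattern} (h : p ∈ patterns l) :
    IsDescending p.initial l p.final := by
  refine isDescending_of_walk ?_
  rw [← mem_patterns.1 h]
  exact p.walk

/-! ### The degree of a tiling pattern -/

/-- The degree of a string of labels and separators. -/
def tokensDegree (σ : List (Option (ZMod 4))) : Gam := (σ.map fun x => x.elim lamD arrowDegree).prod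

theorem tokensDegree_append (σ τ : List (Option (ZMod 4))) :
    tokensDegree (σ ++ τ) = tokensDegree σ * tokensDegree τ := by
  simp [tokensDegree]

theorem tokensDegree_cons (x : Option (ZMod 4)) (σ : List (Option (ZMod 4))) :
    tokensDegree (x :: σ) = x.elim lamD arrowDegree * tokensDegree σ := by
  simp [tokensDegree]

theorem tokensDegree_nil : tokensDegree [] = 1 := rfl

theorem tokensDegree_map_some (w : List (ZMod 4)) :
    tokensDegree (w.map some) = (w.map arrowDegree).prod := by
  simp [tokensDegree, Function.comp_def]

theorem tokensDegree_word (b : Basic) : tokensDegree (b.word.map some) = b.degree := by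
  rw [tokensDegree_map_some]
  cases b <;> rfl

theorem tokensDegree_run (i : ZMod 4) (n : ℕ) :
    tokensDegree ((run i n).map some) = (Basic.chord i n).degree :=
  tokensDegree_word (.chord i n)

/-- The degree count for a single vertex, which consumes four arrows and produces a `U`. The degrees
of arrows do not commute, so each starting label is computed separately. -/
theorem arrowDegree_cycle (i : ZMod 4) :
    lamD ^ 2 * (arrowDegree i * arrowDegree (i - 1) * arrowDegree (i - 2) * arrowDegree (i - 3)) =
      uDegree := by
  have h : i = 0 ∨ i = 1 ∨ i = 2 ∨ i = 3 := by revert i; decide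
  have d : ∀ i j : ZMod 4, decide (i = j) = decide (i.val = j.val) := by decide
  have e : (0 : ZMod 4) - 1 = 3 ∧ (0 : ZMod 4) - 2 = 2 ∧ (0 : ZMod 4) - 3 = 1 ∧
    (1 : ZMod 4) - 1 = 0 ∧ (1 : ZMod 4) - 2 = 3 ∧ (1 : ZMod 4) - 3 = 2 ∧
    (2 : ZMod 4) - 1 = 1 ∧ (2 : ZMod 4) - 2 = 0 ∧ (2 : ZMod 4) - 3 = 3 ∧
    (3 : ZMod 4) - 1 = 2 ∧ (3 : ZMod 4) - 2 = 1 ∧ (3 : ZMod 4) - 3 = 0 := by decide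
  obtain ⟨e1, e2, e3, e4, e5, e6, e7, e8, e9, e10, e11, e12⟩ := e
  have f : (0 : ZMod 4) ≠ 1 ∧ (0 : ZMod 4) ≠ 2 ∧ (0 : ZMod 4) ≠ 3 ∧ (2 : ZMod 4) ≠ 1 ∧
    (3 : ZMod 4) ≠ 1 ∧ (3 : ZMod 4) ≠ 2 := by decide
  obtain ⟨f1, f2, f3, f4, f5, f6⟩ := f
  rcases h with rfl | rfl | rfl | rfl <;>
    simp only [e1, e2, e3, e4, e5, e6, e7, e8, e9, e10, e11, e12, arrowDegree, f1, f2, f3, f4, f5,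
      f6, if_true, if_false] <;>
    refine gam_ext ?_ ?_ ?_ ?_ <;> simp [gam, Triple.mul_def, uDegree, lamD, pow_two] <;> norm_num

theorem mul_central_mul {G : Type*} [Group G] {z₁ z₂ z₃ : G} (h₁ : ∀ g, Commute z₁ g)
    (h₂ : ∀ g, Commute z₂ g) (h₃ : ∀ g, Commute z₃ g) (x₁ x₂ x₃ x₄ : G) :
    x₁ * (z₁ * (x₂ * (z₂ * (x₃ * (z₃ * x₄))))) = z₁ * z₂ * z₃ * (x₁ * x₂ * x₃ * x₄) := by
  rw [← (h₃ x₃).left_comm, ← (h₂ x₂).left_comm, ← (h₁ x₁).left_comm, ← (h₃ x₂).left_comm,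
    ← (h₂ x₁).left_comm, ← (h₃ x₁).left_comm]
  simp only [mul_assoc]

theorem lamD_mul_uDegree_mul (k n k' n' : ℕ) : lamD ^ k * uDegree ^ n * (lamD ^ k' * uDegree ^ n') =
    lamD ^ (k + k') * uDegree ^ (n + n') := by
  rw [pow_add, pow_add, mul_assoc, mul_assoc, ((commute_uDegree _).pow_left n).left_comm]

theorem commute_lamD_mul_uDegree (k n : ℕ) (g : Gam) : Commute (lamD ^ k * uDegree ^ n) g :=
  ((commute_lamD g).pow_left k).mul_left ((commute_uDegree g).pow_left n)

/-- Subtrees have central degrees, which can be moved to the front. At a vertex three factors `lamD`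
and the four arrows then combine to `lamD` times the degree of `U`. -/
theorem PlaneTree.tokensDegree_tokens (t : PlaneTree) (i : ZMod 4) :
    tokensDegree (t.tokens i) = lamD ^ 1 * uDegree ^ t.size := by
  induction t generalizing i with
  | leaf => simp [PlaneTree.tokens, PlaneTree.size, tokensDegree_cons, tokensDegree_nil]
  | node a b c ha hb hc =>
    have hz := commute_lamD_mul_uDegree 1
    simp only [PlaneTree.tokens, PlaneTree.size, tokensDegree_cons, tokensDegree_nil,
      tokensDegree_append, ha, hb, hc, Option.elim_some, mul_one]
    have e : lamD ^ 1 * uDegree ^ (a.size + b.size + c.size + 1) =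
        lamD ^ 1 * uDegree ^ (a.size + b.size + c.size) * uDegree := by
      rw [pow_succ uDegree, mul_assoc]
    rw [mul_central_mul (hz _) (hz _) (hz _), lamD_mul_uDegree_mul, lamD_mul_uDegree_mul, e,
      ← arrowDegree_cycle i, ← mul_assoc _ (lamD ^ 2)]
    congr 1
    rw [← ((commute_lamD _).pow_left 2).eq, ← mul_assoc (lamD ^ 2) (lamD ^ 1), ← pow_add]

theorem TilingPattern.tokensDegree_tokens (p : TilingPattern) :
    tokensDegree p.tokens = lamD ^ 2 * uDegree ^ p.tree.size * p.output.degree := by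
  have hz := commute_lamD_mul_uDegree 1 p.tree.size
  have hu : lamD ^ 2 * uDegree ^ p.tree.size = lamD ^ 1 * uDegree ^ p.tree.size * lamD := by
    rw [(hz _).eq, ← mul_assoc, pow_two, pow_one]
  have hn : tokensDegree [none] = lamD := by simp [tokensDegree]
  unfold TilingPattern.tokens TilingPattern.output
  cases p.extension with
  | centered =>
    simp only [tokensDegree_append, PlaneTree.tokensDegree_tokens, hn, hu, Basic.degree, mul_one]
  | left n =>
    simp only [tokensDegree_append, PlaneTree.tokensDegree_tokens, hn, hu, tokensDegree_run]
    exact ((hz _).mul_left (commute_lamD _)).eq.symm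
  | right n =>
    simp only [tokensDegree_append, PlaneTree.tokensDegree_tokens, hn, hu, tokensDegree_run]
    rw [← (commute_lamD _).eq, mul_assoc _ lamD]

/-- The total degree of a sequence of basis elements in the bar construction. -/
def totalDegree (l : List Letter) : Gam := (l.map Letter.barDegree).prod

theorem totalDegree_eq (l : List Letter) :
    totalDegree l = uDegree ^ (l.map Prod.fst).sum * tokensDegree (basicTokens (l.map Prod.snd)) := by
  induction l with
  | nil => simp [totalDegree, basicTokens_nil, tokensDegree_nil]
  | cons x l ih =>
    simp only [totalDegree, List.map_cons, List.prod_cons, List.sum_cons] at ih ⊢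
    rw [ih, basicTokens_cons, tokensDegree_append, tokensDegree_cons, tokensDegree_word,
      Letter.barDegree, Letter.degree, pow_add]
    have hc := fun g => (commute_uDegree g).pow_left (l.map Prod.fst).sum
    have hx := fun g => (commute_uDegree g).pow_left x.1
    simp only [Option.elim_none]
    rw [← mul_assoc (x.2.degree), ← (commute_lamD x.2.degree).eq, mul_assoc _ (uDegree ^ _) (_ * _),
      (hc _).left_comm]
    simp only [mul_assoc]
    rw [(hx lamD).left_comm]

/-- A descending chord starts two labels before the one with which the preceding chord would
continue, and `source` depends on the label modulo two only. -/
theorem isPath_of_isDescending {l : List Letter} {r r' : ZMod 4}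
    (h : IsDescending r (l.map Prod.snd) r') : IsPath l (totalDegree l) (source r) (source r') := by
  induction l generalizing r with
  | nil => exact ⟨rfl, congrArg source h⟩
  | cons x l ih =>
    obtain ⟨n, hx, h⟩ := h
    have hs : source (r + n - 1) = x.2.tgt := by
      rw [hx, Basic.tgt, target, ← source_sub_two]
      congr 1
      ring_nf
      rfl
    refine ⟨by rw [hx]; rfl, _, rfl, ?_⟩
    rw [← hs]
    exact ih h

/-! ### The undeformed operations -/

/-- The product on pairs, and zero on lists of any other length. -/
noncomputable def binary : List Alg → Alg
  | [a, b] => a * b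
  | _ => 0

/-- The sum over tiling patterns in the definition of the operations. -/
noncomputable def basisTiling (l : List Letter) : Alg :=
  ∑ p ∈ (patterns_finite (l.map Prod.snd)).toFinset,
    mono ((l.map Prod.fst).sum + p.tree.size, p.output)

/-- The operations which count tiling patterns. -/
noncomputable def tiling : List Alg → Alg := multilinearExtension basisTiling

theorem tiling_mono (l : List Letter) : tiling (l.map mono) = basisTiling l :=
  multilinearExtension_mono _ _

theorem entryAdditive_tiling : EntryAdditive tiling := multilinearExtension_add _

theorem entryAdditive_undeformedOp : EntryAdditive undeformedOp := multilinearExtension_add _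

theorem binary_eq_zero {l : List Alg} (h : l.length ≠ 2) : binary l = 0 := by
  match l with
  | [] => rfl
  | [_] => rfl
  | [_, _] => exact absurd rfl h
  | _ :: _ :: _ :: _ => rfl

theorem entryAdditive_binary : EntryAdditive binary := by
  intro p q x y
  match p, q with
  | [], [] => simp [binary_eq_zero]
  | [], [b] => exact add_mul x y b
  | [a], [] => exact mul_add a x y
  | [], _ :: _ :: _ => simp [binary_eq_zero]
  | [_], _ :: _ => simp [binary_eq_zero]
  | _ :: _ :: _, _ => simp [binary_eq_zero]

theorem count_none_tokens (t : PlaneTree) (i : ZMod 4) :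
    (t.tokens i).count none = 2 * t.size + 1 := by
  induction t generalizing i with
  | leaf => rfl
  | node a b c ha hb hc =>
    simp [PlaneTree.tokens, PlaneTree.size, ha, hb, hc]
    ring

theorem count_none_map_some (w : List (ZMod 4)) : (w.map some).count none = 0 := by
  simp [List.count_eq_zero]

theorem count_none_basicTokens (l : List Basic) : (basicTokens l).count none = l.length := by
  induction l with
  | nil => rfl
  | cons b l ih => simp [basicTokens_cons, count_none_map_some, ih]

theorem TilingPattern.count_none_tokens (p : TilingPattern) :
    p.tokens.count none = 2 * p.tree.size + 2 := by
  unfold TilingPattern.tokens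
  cases p.extension <;>
    simp [TorusAlgebra.count_none_tokens, count_none_map_some]

/-- Every input contributes one separator, and a vertex adds two of them. The number of inputs
therefore determines the power of `U`, and at least four inputs are needed. -/
theorem length_of_mem_patterns {l : List Basic} {p : TilingPattern} (h : p ∈ patterns l) :
    l.length = 2 * p.tree.size + 2 := by
  rw [← count_none_basicTokens, ← mem_patterns.1 h, p.count_none_tokens]

theorem TilingPattern.size_pos (p : TilingPattern) : 0 < p.tree.size := Nat.succ_pos _

theorem undeformedOp_eq (l : List Alg) : undeformedOp l = binary l + tiling l := by
  refine congrFun (EntryAdditive.ext_mono (φ := undeformedOp) (ψ := fun l => binary l + tiling l)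
    entryAdditive_undeformedOp ?_ fun l => ?_) l
  · intro p q x y
    simp only [entryAdditive_binary p q x y, entryAdditive_tiling p q x y]
    abel
  · rw [undeformedOp, multilinearExtension_mono, tiling_mono]
    match l with
    | [] => exact (zero_add _).symm
    | [_] => exact (zero_add _).symm
    | _ :: _ :: _ :: _ => exact (zero_add _).symm
    | [x, y] =>
      have : basisTiling [x, y] = 0 := by
        refine Finset.sum_eq_zero fun p hp => ?_
        have := length_of_mem_patterns ((Set.Finite.mem_toFinset _).1 hp)
        have := p.size_pos
        simp only [List.map_cons, List.map_nil, List.length_cons, List.length_nil] at *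
        omega
      rw [this, add_zero]
      exact (mulHom_monomial x.1 y.1 x.2 y.2).symm

theorem exists_pattern {l : List Letter} {y : Letter} (h : coeff y (tiling (l.map mono)) ≠ 0) :
    ∃ p ∈ patterns (l.map Prod.snd), y = ((l.map Prod.fst).sum + p.tree.size, p.output) := by
  rw [tiling_mono, basisTiling, map_sum] at h
  obtain ⟨p, hp, hy⟩ := Finset.exists_ne_zero_of_sum_ne_zero h
  exact ⟨p, (Set.Finite.mem_toFinset _).1 hp, (eq_of_coeff_mono_ne_zero hy).symm⟩

theorem tiling_eq_zero {l : List Letter} (h : ∀ p, p ∉ patterns (l.map Prod.snd)) :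
    tiling (l.map mono) = 0 := by
  refine alg_ext fun y => ?_
  rw [map_zero]
  by_contra hy
  obtain ⟨p, hp, -⟩ := exists_pattern hy
  exact h p hp

theorem exists_mul_of_coeff {x x' y : Letter} (h : coeff y (mono x * mono x') ≠ 0) :
    Letter.mul x x' = some y := by
  rw [mono_mul_mono] at h
  cases hm : Letter.mul x x' with
  | none => simp [hm] at h
  | some z =>
    rw [hm] at h
    rw [eq_of_coeff_mono_ne_zero h]

theorem TilingPattern.source_initial (p : TilingPattern) : source p.initial = p.output.src := by
  unfold TilingPattern.initial TilingPattern.output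
  cases p.extension with
  | centered => rfl
  | left n => rfl
  | right n => exact (source_sub_two _).symm

theorem TilingPattern.source_final (p : TilingPattern) : source p.final = p.output.tgt := by
  unfold TilingPattern.final TilingPattern.output
  cases p.extension with
  | centered => rfl
  | left n =>
    rw [Basic.tgt, target]
    congr 1
    ring
  | right n =>
    rw [Basic.tgt, target, ← source_sub_two]
    congr 1
    ring

theorem isGradedMap_tiling : IsGradedMap (lam (-1) 0) tiling := by
  intro l y hy
  obtain ⟨p, hp, rfl⟩ := exists_pattern hy
  refine ⟨totalDegree l, ?_, ?_⟩
  · have := isPath_of_isDescending (isDescending_of_mem_patterns hp)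
    rwa [p.source_initial, p.source_final] at this
  · rw [totalDegree_eq, ← mem_patterns.1 hp, p.tokensDegree_tokens, lam, Letter.barDegree,
      Letter.degree, pow_add, pow_zero, mul_one, zpow_neg_one, mul_assoc (lamD ^ 2),
      ((commute_uDegree _).pow_left (l.map Prod.fst).sum).left_comm, pow_two, mul_assoc lamD lamD,
      inv_mul_cancel_left, mul_assoc]

theorem isGradedMap_binary : IsGradedMap (lam (-1) 0) binary := by
  intro l y hy
  match l with
  | [] => simp [binary_eq_zero] at hy
  | [_] => simp [binary_eq_zero] at hy
  | _ :: _ :: _ :: _ => simp [binary_eq_zero] at hy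
  | [x, x'] =>
    have h := exists_mul_of_coeff hy
    obtain ⟨h1, h2, h3, -, -⟩ := Letter.mul_eq_some h
    refine ⟨Letter.barDegree x * (Letter.barDegree x' * 1), ⟨h2.symm, _, rfl, h1.symm, 1, rfl, rfl, h3.symm⟩, ?_⟩
    rw [Letter.barDegree, Letter.degree_mul h, lam, zpow_neg_one, pow_zero, mul_one, mul_one,
      Letter.barDegree, mul_assoc lamD, inv_mul_cancel_left, Letter.barDegree,
      (commute_lamD _).left_comm]

theorem isGradedMap_undeformedOp : IsGradedMap (lam (-1) 0) undeformedOp := by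
  have : undeformedOp = fun l => binary l + tiling l := funext undeformedOp_eq
  rw [this]
  exact isGradedMap_binary.add isGradedMap_tiling

theorem not_mem_patterns_of_idem {l : List Basic} {e : Fin 2} (h : .idem e ∈ l)
    (p : TilingPattern) : p ∉ patterns l := by
  have key : ∀ {l : List Basic} {r r' : ZMod 4}, IsDescending r l r' → Basic.idem e ∉ l := by
    intro l
    induction l with
    | nil => simp
    | cons b l ih =>
      rintro r r' ⟨n, rfl, h⟩
      simp [ih h]
  exact fun hp => key (isDescending_of_mem_patterns hp) h

theorem isNormalized_tiling : IsNormalized tiling := by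
  rintro l ⟨e, he⟩
  exact tiling_eq_zero (not_mem_patterns_of_idem (List.mem_map.2 ⟨_, he, rfl⟩))

theorem tiling_eq_zero_of_length {l : List Alg} (h : l.length < 4) : tiling l = 0 := by
  have key := EntryAdditive.eq_zero (φ := fun l => if l.length < 4 then tiling l else 0) ?_
    (fun l => ?_) l
  · simpa [h] using key
  · intro p q x y
    have h := entryAdditive_tiling p q x y
    simp only [List.length_append, List.length_cons] at *
    split_ifs
    · exact h
    · simp
  · split_ifs with h
    · refine tiling_eq_zero fun p hp => ?_
      have := length_of_mem_patterns hp
      have := p.size_pos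
      simp only [List.length_map] at *
      omega
    · rfl

theorem undeformedOp_eq_zero_of_length {l : List Alg} (h : l.length < 2) : undeformedOp l = 0 := by
  rw [undeformedOp_eq, binary_eq_zero (by omega), tiling_eq_zero_of_length (by omega), add_zero]

theorem undeformedOp_pair (a b : Alg) : undeformedOp [a, b] = a * b := by
  rw [undeformedOp_eq, tiling_eq_zero_of_length (by simp), add_zero]
  rfl

/-! ### Multiplication by powers of `U` -/

/-- The power `U^k` as an element of the algebra. -/
noncomputable def uPow (k : ℕ) : Alg := monomial k (.idem 0) + monomial k (.idem 1)

theorem uPow_mul_mono (k : ℕ) (x : Letter) : uPow k * mono x = mono (k + x.1, x.2) := by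
  have h : ∀ e, monomial k (.idem e) * mono x = if e = x.2.src then mono (k + x.1, x.2) else 0 := by
    intro e
    refine (mulHom_monomial k x.1 (.idem e) x.2).trans ?_
    cases x.2 with
    | idem f =>
      by_cases h : e = f <;> simp [Basic.mul, Basic.src, h] <;> rfl
    | chord i n =>
      by_cases h : e = source i <;> simp [Basic.mul, Basic.src, h] <;> rfl
  rw [uPow, add_mul, h, h]
  generalize x.2.src = f
  fin_cases f <;> simp

theorem uPow_mul_uPow_mul (k k' : ℕ) (a : Alg) : uPow k * (uPow k' * a) = uPow (k + k') * a := by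
  refine Alg.induction (P := fun a => uPow k * (uPow k' * a) = uPow (k + k') * a) (by simp)
    (fun x y hx hy => by simp only [mul_add, hx, hy]) (fun m b => ?_) a
  change uPow k * (uPow k' * mono (m, b)) = uPow (k + k') * mono (m, b)
  simp only [uPow_mul_mono, add_assoc]

/-- The basis element of the path algebra underlying a basis element. -/
def Letter.base (x : Letter) : Letter := (0, x.2)

/-- Linearity over the polynomials in `U`. -/
def IsULinear (φ : List Alg → Alg) : Prop :=
  ∀ l : List Letter, φ (l.map mono) =
    uPow (l.map Prod.fst).sum * φ ((l.map Letter.base).map mono)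

theorem IsULinear.entry {φ : List Alg → Alg} (hφ : EntryAdditive φ) (h : IsULinear φ) (k : ℕ)
    (p q : List Letter) (a : Alg) : φ (p.map mono ++ (uPow k * a) :: q.map mono) =
      uPow ((p.map Prod.fst).sum + k + (q.map Prod.fst).sum) *
        φ ((p.map Letter.base).map mono ++ a :: (q.map Letter.base).map mono) := by
  refine Alg.induction (P := fun a => φ (p.map mono ++ (uPow k * a) :: q.map mono) =
      uPow ((p.map Prod.fst).sum + k + (q.map Prod.fst).sum) *
        φ ((p.map Letter.base).map mono ++ a :: (q.map Letter.base).map mono)) ?_ ?_ ?_ a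
  · simp only [mul_zero, hφ.zero_entry]
  · intro a b ha hb
    simp only [mul_add, hφ _ _ (uPow k * a), hφ _ _ a, ha, hb]
  · intro m b
    have h1 := h (p ++ (k + m, b) :: q)
    have h2 := h (p.map Letter.base ++ (m, b) :: q.map Letter.base)
    have h3 : ∀ l : List Letter, (l.map Letter.base).map Letter.base = l.map Letter.base :=
      fun l => by simp [Function.comp_def, Letter.base]
    have h4 : ∀ l : List Letter, ((l.map Letter.base).map Prod.fst).sum = 0 :=
      fun l => by simp [Function.comp_def, Letter.base]
    simp only [List.map_append, List.map_cons, List.sum_append, List.sum_cons, h3, h4] at h1 h2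
    change φ (p.map mono ++ (uPow k * mono (m, b)) :: q.map mono) =
      _ * φ (_ ++ mono (m, b) :: _)
    rw [uPow_mul_mono, h1, h2, uPow_mul_uPow_mul]
    simp only [Letter.base]
    congr 2
    ring

theorem isULinear_binary : IsULinear binary := by
  intro l
  match l with
  | [] => simp [binary_eq_zero]
  | [_] => simp [binary_eq_zero]
  | _ :: _ :: _ :: _ => simp [binary_eq_zero]
  | [x, y] =>
    change mono x * mono y = uPow (x.1 + (y.1 + 0)) * (mono (0, x.2) * mono (0, y.2))
    rw [mono_mul_mono, mono_mul_mono, Letter.mul, Letter.mul]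
    cases x.2.mul y.2 with
    | none => simp
    | some b => exact (uPow_mul_mono _ (0, b)).symm

theorem isULinear_tiling : IsULinear tiling := by
  intro l
  have h : ((l.map Letter.base).map Prod.fst).sum = 0 := by
    simp [Function.comp_def, Letter.base]
  have h' : (l.map Letter.base).map Prod.snd = l.map Prod.snd := by
    simp [Function.comp_def, Letter.base]
  simp only [tiling_mono, basisTiling, h, h', Finset.mul_sum, uPow_mul_mono, zero_add]

theorem IsULinear.add {φ ψ : List Alg → Alg} (hφ : IsULinear φ) (hψ : IsULinear ψ) :
    IsULinear fun l => φ l + ψ l := by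
  intro l
  simp only [mul_add, hφ l, hψ l]

theorem isULinear_undeformedOp : IsULinear undeformedOp := by
  have : undeformedOp = fun l => binary l + tiling l := funext undeformedOp_eq
  rw [this]
  exact isULinear_binary.add isULinear_tiling

theorem IsULinear.insOp {m φ : List Alg → Alg} (hm : IsULinear m) (hφ : EntryAdditive φ)
    (h : IsULinear φ) : IsULinear (insOp m φ) := by
  intro l
  rw [insOp_map, insOp_map, cutSum_map, ← AddMonoidHom.coe_mulLeft, map_cutSum]
  refine cutSum_congr fun a r hl => ?_
  rw [cutSum_map, map_cutSum]
  refine cutSum_congr fun c b hr => ?_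
  subst hr hl
  rw [hm c, IsULinear.entry hφ h, AddMonoidHom.coe_mulLeft]
  simp only [List.map_append, List.sum_append, add_assoc]

end TorusAlgebra

/-! ### A matching on words of basis elements -/

namespace TorusAlgebra

open ListCalculus

/-- The number of arrows in a basis element. -/
def Letter.len (x : Letter) : ℕ :=
  match x.2 with
  | .idem _ => 0
  | .chord _ n => n + 1

/-- The number of arrows and `U`s in a basis element; it vanishes for the idempotents only. -/
def Letter.weight (x : Letter) : ℕ := x.1 + Letter.len x

theorem Letter.len_mul {x y z : Letter} (h : Letter.mul x y = some z) :
    Letter.len z = Letter.len x + Letter.len y := by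
  obtain ⟨-, -, -, -, h⟩ := Letter.mul_eq_some h
  obtain ⟨m, b⟩ := x
  obtain ⟨n, c⟩ := y
  obtain ⟨k, d⟩ := z
  cases b <;> cases c <;>
    simp only [Basic.mul, Option.ite_none_right_eq_some, Option.some.injEq] at h <;>
    obtain ⟨-, rfl⟩ := h <;> simp only [Letter.len] <;> ring

theorem Letter.fst_mul {x y z : Letter} (h : Letter.mul x y = some z) : z.1 = x.1 + y.1 :=
  (Letter.mul_eq_some h).2.2.2.1

theorem Letter.weight_mul {x y z : Letter} (h : Letter.mul x y = some z) :
    Letter.weight z = Letter.weight x + Letter.weight y := by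
  rw [Letter.weight, Letter.weight, Letter.weight, Letter.len_mul h, Letter.fst_mul h]
  ring

/-- Splits off the first factor `U` or `ρ_i` of a basis element, if there are further factors. -/
def Letter.split : Letter → Option (Letter × Letter)
  | (0, .idem _) => none
  | (1, .idem _) => none
  | (m + 2, .idem e) => some ((1, .idem e), (m + 1, .idem e))
  | (0, .chord _ 0) => none
  | (0, .chord i (n + 1)) => some ((0, .chord i 0), (0, .chord (i + 1) n))
  | (m + 1, .chord i n) => some ((1, .idem (source i)), (m, .chord i n))

/-- The pair `p`, `x` arises by splitting. -/
def IsNormalPair (p x : Letter) : Prop := ∃ z, Letter.split z = some (p, x)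

/-- The possible first factors of a splitting. -/
inductive IsPrime : Letter → Prop
  | u (e : Fin 2) : IsPrime (1, .idem e)
  | arrow (i : ZMod 4) : IsPrime (0, .chord i 0)

theorem isPrime_of_split_eq_none {x : Letter} (h : Letter.split x = none)
    (hx : 0 < Letter.weight x) : IsPrime x := by
  match x, h, hx with
  | (0, .idem _), _, hx => exact absurd hx (by simp [Letter.weight, Letter.len])
  | (1, .idem e), _, _ => exact .u e
  | (0, .chord i 0), _, _ => exact .arrow i

theorem split_cases {z p x : Letter} (h : Letter.split z = some (p, x)) :
    (∃ m e, z = (m + 2, .idem e) ∧ p = (1, .idem e) ∧ x = (m + 1, .idem e)) ∨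
    (∃ i n, z = (0, .chord i (n + 1)) ∧ p = (0, .chord i 0) ∧ x = (0, .chord (i + 1) n)) ∨
    (∃ m i n, z = (m + 1, .chord i n) ∧ p = (1, .idem (source i)) ∧ x = (m, .chord i n)) := by
  match z, h with
  | (m + 2, .idem e), h =>
    simp only [Letter.split, Option.some.injEq, Prod.mk.injEq] at h
    exact Or.inl ⟨m, e, rfl, h.1.symm, h.2.symm⟩
  | (0, .chord i (n + 1)), h =>
    simp only [Letter.split, Option.some.injEq, Prod.mk.injEq] at h
    exact Or.inr (Or.inl ⟨i, n, rfl, h.1.symm, h.2.symm⟩)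
  | (m + 1, .chord i n), h =>
    simp only [Letter.split, Option.some.injEq, Prod.mk.injEq] at h
    exact Or.inr (Or.inr ⟨m, i, n, rfl, h.1.symm, h.2.symm⟩)

theorem mul_of_split {z p x : Letter} (h : Letter.split z = some (p, x)) :
    Letter.mul p x = some z := by
  rcases split_cases h with ⟨m, e, rfl, rfl, rfl⟩ | ⟨i, n, rfl, rfl, rfl⟩ |
    ⟨m, i, n, rfl, rfl, rfl⟩ <;> simp [Letter.mul, Basic.mul] <;> ring

theorem split_fst_of_split {z p x : Letter} (h : Letter.split z = some (p, x)) :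
    Letter.split p = none := by
  rcases split_cases h with ⟨m, e, rfl, rfl, rfl⟩ | ⟨i, n, rfl, rfl, rfl⟩ |
    ⟨m, i, n, rfl, rfl, rfl⟩ <;> rfl

theorem weight_of_split {z p x : Letter} (h : Letter.split z = some (p, x)) :
    0 < Letter.weight p ∧ 0 < Letter.weight x := by
  rcases split_cases h with ⟨m, e, rfl, rfl, rfl⟩ | ⟨i, n, rfl, rfl, rfl⟩ |
    ⟨m, i, n, rfl, rfl, rfl⟩ <;> simp [Letter.weight, Letter.len]

theorem len_mul_of_split {z p x : Letter} (h : Letter.split z = some (p, x)) :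
    Letter.len p * x.1 = 0 := by
  rcases split_cases h with ⟨m, e, rfl, rfl, rfl⟩ | ⟨i, n, rfl, rfl, rfl⟩ |
    ⟨m, i, n, rfl, rfl, rfl⟩ <;> simp [Letter.len]

theorem isNormalPair_u {e : Fin 2} {x : Letter} :
    IsNormalPair (1, .idem e) x ↔ x.2.src = e ∧ 0 < Letter.weight x := by
  constructor
  · rintro ⟨z, h⟩
    refine ⟨?_, (weight_of_split h).2⟩
    rcases split_cases h with ⟨m, e, rfl, h, rfl⟩ | ⟨i, n, rfl, h, rfl⟩ |
      ⟨m, i, n, rfl, h, rfl⟩ <;> simp_all [Basic.src]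
  · rintro ⟨rfl, h⟩
    match x, h with
    | (0, .idem e), h => exact absurd h (by simp [Letter.weight, Letter.len])
    | (m + 1, .idem e), _ => exact ⟨(m + 2, .idem e), rfl⟩
    | (m, .chord i n), _ => exact ⟨(m + 1, .chord i n), by cases m <;> rfl⟩

theorem isNormalPair_arrow {i : ZMod 4} {x : Letter} :
    IsNormalPair (0, .chord i 0) x ↔ ∃ n, x = (0, .chord (i + 1) n) := by
  constructor
  · rintro ⟨z, h⟩
    rcases split_cases h with ⟨m, e, rfl, h, rfl⟩ | ⟨i, n, rfl, h, rfl⟩ |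
      ⟨m, i, n, rfl, h, rfl⟩ <;> simp_all
  · rintro ⟨n, rfl⟩
    exact ⟨(0, .chord i (n + 1)), rfl⟩

/-- Splitting the second factor does not change whether a pair is normal. -/
theorem isNormalPair_split_iff {q z p x : Letter} (hq : IsPrime q)
    (h : Letter.split z = some (p, x)) : IsNormalPair q z ↔ IsNormalPair q p := by
  have hw := (weight_of_split h).1
  have hz : 0 < Letter.weight z := by
    rw [Letter.weight_mul (mul_of_split h)]
    omega
  have hs := (Letter.mul_eq_some (mul_of_split h)).2.1
  cases hq with
  | u e => simp only [isNormalPair_u, hs, hw, hz]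
  | arrow i =>
    rw [isNormalPair_arrow, isNormalPair_arrow]
    rcases split_cases h with ⟨m, e, rfl, rfl, rfl⟩ | ⟨i, n, rfl, rfl, rfl⟩ |
      ⟨m, i, n, rfl, rfl, rfl⟩ <;> simp

/-- A nonzero product of a pair that is not normal decreases the number of inversions. -/
theorem len_mul_pos {p x z : Letter} (hp : IsPrime p) (hx : 0 < Letter.weight x)
    (h : Letter.mul p x = some z) (hn : ¬ IsNormalPair p x) : 0 < Letter.len p * x.1 := by
  cases hp with
  | u e =>
    rw [isNormalPair_u] at hn
    exact absurd ⟨(Letter.mul_eq_some h).1.symm, hx⟩ hn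
  | arrow i =>
    rw [isNormalPair_arrow] at hn
    obtain ⟨m, b⟩ := x
    simp only [Letter.len, zero_add, one_mul]
    by_contra h0
    obtain rfl : m = 0 := by omega
    obtain ⟨-, -, -, -, h⟩ := Letter.mul_eq_some h
    cases b with
    | idem e => simp [Letter.weight, Letter.len] at hx
    | chord j n =>
      simp only [Basic.mul, Option.ite_none_right_eq_some, Option.some.injEq] at h
      exact hn ⟨n, by rw [h.1]; simp⟩

open Classical in
/-- Splits the first letter of a word that can be split, unless a normal pair comes before it. -/
noncomputable def up : Option Letter → List Letter → Option (List Letter)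
  | _, [] => none
  | prev, x :: w =>
    if ∃ p ∈ prev, IsNormalPair p x then none
    else match Letter.split x with
      | some y => some (y.1 :: y.2 :: w)
      | none => (up (some x) w).map (x :: ·)

theorem up_of_normal {p x : Letter} (w : List Letter) (h : IsNormalPair p x) :
    up (some p) (x :: w) = none := by
  rw [up, if_pos ⟨p, rfl, h⟩]

theorem up_of_split {prev : Option Letter} {z p x : Letter} (w : List Letter)
    (h : ∀ q ∈ prev, ¬ IsNormalPair q z) (hz : Letter.split z = some (p, x)) :
    up prev (z :: w) = some (p :: x :: w) := by
  rw [up, if_neg (by push Not; exact h), hz]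

theorem up_of_prime {prev : Option Letter} {x : Letter} (w : List Letter)
    (h : ∀ q ∈ prev, ¬ IsNormalPair q x) (hx : Letter.split x = none) :
    up prev (x :: w) = (up (some x) w).map (x :: ·) := by
  rw [up, if_neg (by push Not; exact h), hx]

theorem up_cons_cases {prev : Option Letter} {x : Letter} {w w' : List Letter}
    (h : up prev (x :: w) = some w') : (∀ q ∈ prev, ¬ IsNormalPair q x) ∧
      ((∃ p y, Letter.split x = some (p, y) ∧ w' = p :: y :: w) ∨
        (Letter.split x = none ∧ ∃ v, up (some x) w = some v ∧ w' = x :: v)) := by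
  rw [up] at h
  split_ifs at h with hn
  refine ⟨by push Not at hn; exact hn, ?_⟩
  cases hx : Letter.split x with
  | none =>
    rw [hx] at h
    obtain ⟨v, hv, rfl⟩ := Option.map_eq_some_iff.1 h
    exact Or.inr ⟨rfl, v, hv, rfl⟩
  | some y =>
    rw [hx] at h
    exact Or.inl ⟨y.1, y.2, rfl, (Option.some.inj h).symm⟩

/-- All letters are distinct from the idempotents. -/
def IsReduced (w : List Letter) : Prop := ∀ x ∈ w, 0 < Letter.weight x

/-- All letters are prime, and no two consecutive ones form a normal pair. -/
def IsCritical : Option Letter → List Letter → Prop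
  | _, [] => True
  | prev, x :: w => (∀ q ∈ prev, ¬ IsNormalPair q x) ∧ IsPrime x ∧ IsCritical (some x) w

theorem IsReduced.of_cons {x : Letter} {w : List Letter} (h : IsReduced (x :: w)) :
    0 < Letter.weight x ∧ IsReduced w := by
  simpa [IsReduced] using h

theorem IsReduced.cons {x : Letter} {w : List Letter} (h : 0 < Letter.weight x)
    (hw : IsReduced w) : IsReduced (x :: w) := by
  simpa [IsReduced] using And.intro h hw

theorem IsPrime.weight_pos {x : Letter} (h : IsPrime x) : 0 < Letter.weight x := by
  cases h <;> simp [Letter.weight, Letter.len]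

/-- The matching: with `prev = none` the second alternative is void, and a reduced word splits,
arises by splitting, or is critical. Along the word the preceding prime is remembered, since a
normal pair formed with it is the place where splitting stops and can be undone. -/
theorem up_trichotomy {prev : Option Letter} (hprev : ∀ q ∈ prev, IsPrime q) {w : List Letter}
    (hw : IsReduced w) : (∃ w', up prev w = some w') ∨
      (∃ q ∈ prev, ∃ x v, w = x :: v ∧ IsNormalPair q x) ∨
      (∃ v, IsReduced v ∧ up prev v = some w) ∨ IsCritical prev w := by
  induction w generalizing prev with
  | nil => exact Or.inr (Or.inr (Or.inr trivial))
  | cons x w ih =>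
    obtain ⟨hx, hw⟩ := hw.of_cons
    by_cases hn : ∀ q ∈ prev, ¬ IsNormalPair q x
    swap
    · push Not at hn
      obtain ⟨q, hq, hn⟩ := hn
      exact Or.inr (Or.inl ⟨q, hq, x, w, rfl, hn⟩)
    cases hs : Letter.split x with
    | some y => exact Or.inl ⟨_, up_of_split w hn hs⟩
    | none =>
      have hp := isPrime_of_split_eq_none hs hx
      rcases ih (prev := some x) (by simpa using hp) hw with ⟨w', h⟩ | ⟨q, hq, y, v, rfl, z, hz⟩ |
        ⟨v, hv, h⟩ | h
      · exact Or.inl ⟨x :: w', by rw [up_of_prime w hn hs, h]; rfl⟩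
      -- The tail starts with a letter forming a normal pair with `x`; multiplying the two gives the
      -- word from which this one arises. The preceding prime does not notice the difference between
      -- `x` and the product.
      · obtain rfl : x = q := by simpa using hq
        refine Or.inr (Or.inr (Or.inl ⟨z :: v, ?_, ?_⟩))
        · refine IsReduced.cons ?_ hw.of_cons.2
          rw [Letter.weight_mul (mul_of_split hz)]
          omega
        · exact up_of_split v (fun q hq => by
            rw [isNormalPair_split_iff (hprev q hq) hz]; exact hn q hq) hz
      · refine Or.inr (Or.inr (Or.inl ⟨x :: v, IsReduced.cons hx hv, ?_⟩))
        rw [up_of_prime v hn hs, h]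
        rfl
      · exact Or.inr (Or.inr (Or.inr ⟨hn, hp, h⟩))

/-- The letters before the split one are primes without normal pairs, and the first factor prolongs
this sequence. Words that arise by splitting therefore begin with a critical word. -/
theorem up_eq_some {prev : Option Letter} (hprev : ∀ q ∈ prev, IsPrime q) {w w' : List Letter}
    (hw : IsReduced w) (h : up prev w = some w') :
    ∃ a p x z b, w = a ++ z :: b ∧ w' = a ++ p :: x :: b ∧ Letter.split z = some (p, x) ∧
      IsCritical prev (a ++ [p]) := by
  induction w generalizing prev w' with
  | nil => simp [up] at h
  | cons y w ih =>
    obtain ⟨hn, ⟨p, x, hs, rfl⟩ | ⟨hs, v, hv, rfl⟩⟩ := up_cons_cases h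
    · refine ⟨[], p, x, y, w, rfl, rfl, hs, fun q hq => ?_, ?_, trivial⟩
      · rw [← isNormalPair_split_iff (hprev q hq) hs]
        exact hn q hq
      · exact isPrime_of_split_eq_none (split_fst_of_split hs) (weight_of_split hs).1
    · have hp := isPrime_of_split_eq_none hs hw.of_cons.1
      obtain ⟨a, p, x, z, b, rfl, rfl, h1, h2⟩ := ih (by simpa using hp) hw.of_cons.2 hv
      exact ⟨y :: a, p, x, z, b, rfl, rfl, h1, hn, hp, h2⟩

/-! ### The measure of a word -/

/-- The number of `U`s in a word. -/
def uCount (w : List Letter) : ℕ := (w.map Prod.fst).sum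

/-- The number of pairs of an arrow and a `U` in a later letter. -/
def inversions : List Letter → ℕ
  | [] => 0
  | x :: w => Letter.len x * uCount w + inversions w

/-- The number of factors of a word. -/
def totalWeight (w : List Letter) : ℕ := (w.map Letter.weight).sum

theorem uCount_cons (x : Letter) (w : List Letter) : uCount (x :: w) = x.1 + uCount w := by
  simp [uCount]

theorem totalWeight_cons (x : Letter) (w : List Letter) :
    totalWeight (x :: w) = Letter.weight x + totalWeight w := by
  simp [totalWeight]

/-- The words `v` and `w` have the same number of factors of either kind, and `v` has at most as
many inversions as `w`. -/
structure IsBelow (v w : List Letter) : Prop where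
  uCount_eq : uCount v = uCount w
  totalWeight_eq : totalWeight v = totalWeight w
  inversions_le : inversions v ≤ inversions w

theorem IsBelow.cons {v w : List Letter} (h : IsBelow v w) (x : Letter) :
    IsBelow (x :: v) (x :: w) :=
  ⟨by simp [uCount_cons, h.uCount_eq], by simp [totalWeight_cons, h.totalWeight_eq],
    by simpa [inversions, h.uCount_eq] using h.inversions_le⟩

theorem inversions_mul {x y z : Letter} (h : Letter.mul x y = some z) (w : List Letter) :
    inversions (x :: y :: w) = inversions (z :: w) + Letter.len x * y.1 := by
  simp only [inversions, uCount_cons, Letter.len_mul h]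
  ring

theorem isBelow_mul {x y z : Letter} (h : Letter.mul x y = some z) (a b : List Letter) :
    IsBelow (a ++ z :: b) (a ++ x :: y :: b) := by
  induction a with
  | nil =>
    refine ⟨?_, ?_, ?_⟩
    · simp only [List.nil_append, uCount_cons, Letter.fst_mul h]
      ring
    · simp only [List.nil_append, totalWeight_cons, Letter.weight_mul h]
      ring
    · simp only [List.nil_append, inversions_mul h]
      omega
  | cons t a ih => exact ih.cons t

/-- Splitting creates no inversions: the first factor is a `U`, or it is an arrow and then the
second factor contains no `U`. -/
theorem up_preserves {prev : Option Letter} {w w' : List Letter} (h : up prev w = some w') :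
    w'.length = w.length + 1 ∧ uCount w' = uCount w ∧ totalWeight w' = totalWeight w ∧
      inversions w' = inversions w := by
  induction w generalizing prev w' with
  | nil => simp [up] at h
  | cons y w ih =>
    obtain ⟨-, ⟨p, x, hs, rfl⟩ | ⟨-, v, hv, rfl⟩⟩ := up_cons_cases h
    · have hb := isBelow_mul (mul_of_split hs) [] w
      refine ⟨rfl, hb.uCount_eq.symm, hb.totalWeight_eq.symm, ?_⟩
      rw [inversions_mul (mul_of_split hs), len_mul_of_split hs, add_zero]
    · obtain ⟨h1, h2, h3, h4⟩ := ih hv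
      exact ⟨by simp [h1], by simp [uCount_cons, h2], by simp [totalWeight_cons, h3],
        by simp [inversions, h2, h4]⟩

/-- The sum over all ways of multiplying two neighbouring letters. -/
noncomputable def pairSum : (List Alg → Alg) → List Letter → Alg
  | φ, x :: y :: w => φ (mono x * mono y :: (w.map mono)) +
      pairSum (fun l => φ (mono x :: l)) (y :: w)
  | _, _ => 0

theorem mul_entry_eq_zero {φ : List Alg → Alg} (hφ : EntryAdditive φ) {x y : Letter}
    {b : List Letter}
    (h : ∀ z, Letter.mul x y = some z → φ ((z :: b).map mono) = 0) :
    φ (mono x * mono y :: b.map mono) = 0 := by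
  rw [mono_mul_mono]
  cases hm : Letter.mul x y with
  | none => exact hφ.zero_entry [] _
  | some z => exact h z hm

theorem pairSum_eq_zero {φ : List Alg → Alg} (hφ : EntryAdditive φ) {w : List Letter}
    (h : ∀ a x y b z, w = a ++ x :: y :: b → Letter.mul x y = some z →
      φ ((a ++ z :: b).map mono) = 0) : pairSum φ w = 0 := by
  induction w generalizing φ with
  | nil => rfl
  | cons x w ih =>
    cases w with
    | nil => rfl
    | cons y w =>
      rw [pairSum, mul_entry_eq_zero hφ fun z hz => h [] x y w z rfl hz, zero_add]
      refine ih (hφ.cons _) fun a x' y' b z hw hz => ?_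
      exact h (x :: a) x' y' b z (by rw [hw]; rfl) hz

theorem isNormalPair_of_up {x : Letter} (hx : IsPrime x) {y : Letter} {v w : List Letter}
    (hw : IsReduced w) (h : up (some x) w = some (y :: v)) :
    ¬ IsNormalPair x y ∧ 0 < Letter.weight y := by
  cases w with
  | nil => simp [up] at h
  | cons t w =>
    obtain ⟨hn, ⟨p, x', hs, h⟩ | ⟨-, v', -, h⟩⟩ := up_cons_cases h
    · obtain ⟨rfl, -⟩ := List.cons_eq_cons.1 h
      rw [← isNormalPair_split_iff hx hs]
      exact ⟨hn x rfl, (weight_of_split hs).1⟩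
    · obtain ⟨rfl, -⟩ := List.cons_eq_cons.1 h
      exact ⟨hn _ rfl, hw.of_cons.1⟩

/-- Among the products of neighbours in the split word, exactly one undoes the splitting and returns
`w`. Each of the others is zero, loses an inversion, or leaves a normal pair in place that prevents
further splitting. -/
theorem pairSum_up {prev : Option Letter} (hprev : ∀ q ∈ prev, IsPrime q) {w w' : List Letter}
    (hw : IsReduced w) (h : up prev w = some w') {φ : List Alg → Alg} (hφ : EntryAdditive φ)
    (H : ∀ v : List Letter, v.length + 1 = w'.length → IsBelow v w' →
      (inversions v < inversions w' ∨ up prev v = none) → φ (v.map mono) = 0) :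
    pairSum φ w' = φ (w.map mono) := by
  induction w generalizing prev w' φ with
  | nil => simp [up] at h
  | cons t w ih =>
    obtain ⟨hn, ⟨p, x, hs, rfl⟩ | ⟨hs, v, hv, rfl⟩⟩ := up_cons_cases h
    · have hm := mul_of_split hs
      have hnp : ∀ q ∈ prev, ¬ IsNormalPair q p := fun q hq => by
        rw [← isNormalPair_split_iff (hprev q hq) hs]
        exact hn q hq
      have hsp := split_fst_of_split hs
      rw [pairSum, mono_mul_mono, hm, pairSum_eq_zero (hφ.cons _), add_zero]
      · rfl
      · intro a x₁ y₁ b z hw hz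
        refine H (p :: (a ++ z :: b)) (by simp [hw]; omega) ?_ ?_
        · rw [hw]
          exact isBelow_mul hz (p :: a) b
        cases a with
        | cons x' a =>
          -- The product is taken beyond `x`, so the normal pair `p`, `x` persists.
          obtain ⟨rfl, -⟩ := List.cons_eq_cons.1 hw
          right
          rw [up_of_prime _ hnp hsp, List.cons_append, up_of_normal _ ⟨t, hs⟩]
          rfl
        | nil =>
          obtain ⟨rfl, rfl⟩ := List.cons_eq_cons.1 hw
          -- Here `x` is multiplied by its right neighbour. Either `p` still forms a normal pair
          -- with the product, or `p` is an arrow and the neighbour contains a `U`, which meets an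
          -- arrow of `x` in the product, so that an inversion is lost.
          by_cases hN : IsNormalPair p z
          · right
            rw [up_of_prime _ hnp hsp, List.nil_append, up_of_normal _ hN]
            rfl
          · left
            have h1 := inversions_mul hz b
            have hu := (isBelow_mul hz [] b).uCount_eq
            simp only [List.nil_append] at hu ⊢
            have hp := isPrime_of_split_eq_none hsp (weight_of_split hs).1
            change Letter.len p * uCount (z :: b) + inversions (z :: b) <
              Letter.len p * uCount (x :: y₁ :: b) + inversions (x :: y₁ :: b)
            rw [hu, h1]
            have hpos : 0 < Letter.len x * y₁.1 := by
              have hsrc := (Letter.mul_eq_some hz).2.1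
              have hxw := (weight_of_split hs).2
              have hzw := Letter.weight_mul hz
              cases hp with
              | u e =>
                refine absurd (isNormalPair_u.2 ⟨?_, by omega⟩) hN
                rw [hsrc, (isNormalPair_u.1 ⟨t, hs⟩).1]
              | arrow i =>
                obtain ⟨n, rfl⟩ := isNormalPair_arrow.1 ⟨t, hs⟩
                by_contra h0
                have hy : y₁.1 = 0 := by
                  simpa [Letter.len] using h0
                refine hN (isNormalPair_arrow.2 ?_)
                obtain ⟨m, c⟩ := y₁
                obtain ⟨k, d⟩ := z
                simp only at hy
                subst hy
                obtain ⟨-, -, -, hk, h⟩ := Letter.mul_eq_some hz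
                simp only at hk h
                subst hk
                cases c <;> simp only [Basic.mul, Option.ite_none_right_eq_some,
                  Option.some.injEq] at h <;> exact ⟨_, by rw [← h.2]⟩
            omega
    · have hp := isPrime_of_split_eq_none hs hw.of_cons.1
      have hl := (up_preserves hv).1
      cases v with
      | nil => simp at hl
      | cons y v =>
        -- The letters `t`, `y` do not form a normal pair, so a non-zero product of them has fewer
        -- inversions.
        obtain ⟨hxy, hy⟩ := isNormalPair_of_up hp hw.of_cons.2 hv
        rw [pairSum, mul_entry_eq_zero hφ, zero_add]
        · refine ih (by simpa using hp) hw.of_cons.2 hv (hφ.cons _) fun u hul hu hinv => ?_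
          refine H (t :: u) (by simp [← hul]) (hu.cons t) (hinv.imp (fun h => ?_) fun h => ?_)
          · rw [inversions, inversions, hu.uCount_eq]
            omega
          · rw [up_of_prime _ hn hs, h]
            rfl
        · intro z hz
          refine H (z :: v) (by simp) (isBelow_mul hz [] v) (Or.inl ?_)
          have := len_mul_pos hp hy hz hxy
          rw [inversions_mul hz]
          omega

theorem up_isReduced {prev : Option Letter} {w w' : List Letter} (hw : IsReduced w)
    (h : up prev w = some w') : IsReduced w' := by
  induction w generalizing prev w' with
  | nil => simp [up] at h
  | cons y w ih =>
    obtain ⟨hy, hw⟩ := hw.of_cons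
    obtain ⟨-, ⟨p, x, hs, rfl⟩ | ⟨-, v, hv, rfl⟩⟩ := up_cons_cases h
    · exact IsReduced.cons (weight_of_split hs).1 (IsReduced.cons (weight_of_split hs).2 hw)
    · exact IsReduced.cons hy (ih hw hv)

theorem uCount_append (a b : List Letter) : uCount (a ++ b) = uCount a + uCount b := by
  simp [uCount]

theorem totalWeight_append (a b : List Letter) :
    totalWeight (a ++ b) = totalWeight a + totalWeight b := by
  simp [totalWeight]

theorem inversions_append_le (a b : List Letter) :
    inversions a + inversions b ≤ inversions (a ++ b) := by
  induction a with
  | nil => simp [inversions]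
  | cons x a ih =>
    have : Letter.len x * uCount a ≤ Letter.len x * uCount (a ++ b) :=
      Nat.mul_le_mul_left _ (by rw [uCount_append]; omega)
    simp only [List.cons_append, inversions]
    omega

theorem totalWeight_pos {w : List Letter} (hw : IsReduced w) (h : w ≠ []) : 0 < totalWeight w := by
  cases w with
  | nil => exact absurd rfl h
  | cons x w =>
    have := hw.of_cons.1
    rw [totalWeight_cons]
    omega

/-- The measure by which words of the same length are ordered. -/
def wordSize (w : List Letter) : ℕ := totalWeight w + inversions w

/-- In a reduced word each omitted letter carries positive weight, and omitting letters does not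
increase the number of inversions. -/
theorem wordSize_lt {a c b : List Letter} (h : IsReduced (a ++ (c ++ b))) (hc : c ≠ a ++ (c ++ b)) :
    wordSize c < wordSize (a ++ (c ++ b)) := by
  have h1 := inversions_append_le a (c ++ b)
  have h2 := inversions_append_le c b
  have ha : a ≠ [] → 0 < totalWeight a := totalWeight_pos fun x hx => h x (by simp [hx])
  have hb : b ≠ [] → 0 < totalWeight b := totalWeight_pos fun x hx => h x (by simp [hx])
  have hab : a ≠ [] ∨ b ≠ [] := by
    by_contra hn
    push Not at hn
    obtain ⟨rfl, rfl⟩ := hn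
    simp at hc
  simp only [wordSize, totalWeight_append] at *
  rcases hab with h' | h'
  · have := ha h'
    omega
  · have := hb h'
    omega

/-- The Hochschild differential of the undeformed algebra. -/
noncomputable def differential (φ : List Alg → Alg) (l : List Alg) : Alg :=
  insOp undeformedOp φ l + insOp φ undeformedOp l

/-- Higher operations need at least four inputs and shorten the word by three or more. On such short
lists `φ` vanishes by hypothesis, so only products of neighbours remain. -/
theorem insOp_undeformedOp_left {φ : List Alg → Alg} {w : List Letter}
    (h : ∀ l : List Alg, l.length + 1 < w.length → φ l = 0) (hφ : EntryAdditive φ) :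
    insOp undeformedOp φ (w.map mono) = pairSum φ w := by
  induction w generalizing φ with
  | nil =>
    rw [List.map_nil, insOp_nil, undeformedOp_eq_zero_of_length (by simp)]
    exact hφ.zero_entry [] []
  | cons x w ih =>
    have h0 : ∀ (l b : List Alg), l.length < 2 → φ (undeformedOp l :: b) = 0 := fun l b hl => by
      rw [undeformedOp_eq_zero_of_length hl]
      exact hφ.zero_entry [] b
    rw [List.map_cons, insOp_cons, ih (φ := fun r => φ (mono x :: r))
      (fun l hl => h _ (by simpa using hl)) (hφ.cons _), cutSum_cons, h0 _ _ (by simp), zero_add]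
    cases w with
    | nil => simp [pairSum, h0]
    | cons y w =>
      rw [pairSum]
      congr 1
      rw [List.map_cons, cutSum_cons, h0 _ _ (by simp), zero_add]
      cases w with
      | nil => simp [undeformedOp_pair]
      | cons z w =>
        rw [List.map_cons, cutSum_cons, undeformedOp_pair, cutSum_eq_zero, add_zero]
        intro a b hab
        refine h _ ?_
        have := congrArg List.length hab
        simp only [List.length_append, List.length_map, List.length_cons] at *
        omega

/-- If `φ` consumes the whole word, the outer operation has a single input and is zero. -/
theorem insOp_undeformedOp_right {φ : List Alg → Alg} {w : List Letter}
    (h : ∀ a c b, w = a ++ (c ++ b) → c ≠ w → φ (c.map mono) = 0) :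
    insOp φ undeformedOp (w.map mono) = 0 := by
  rw [insOp_map]
  refine cutSum_eq_zero fun a r har => cutSum_eq_zero fun c b hcb => ?_
  subst hcb har
  by_cases hc : c = a ++ (c ++ b)
  · have := congrArg List.length hc
    simp only [List.length_append] at this
    exact undeformedOp_eq_zero_of_length (by simp; omega)
  · rw [h a c b rfl hc]
    exact entryAdditive_undeformedOp.zero_entry _ _

theorem eq_zero_of_length_lt {φ : List Alg → Alg} (hφ : EntryAdditive φ) {N : ℕ}
    (h : ∀ w : List Letter, w.length < N → φ (w.map mono) = 0) {l : List Alg} (hl : l.length < N) :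
    φ l = 0 := by
  have key := EntryAdditive.eq_zero (φ := fun l => if l.length < N then φ l else 0) ?_
    (fun l => ?_) l
  · simpa [hl] using key
  · intro p q x y
    have h := hφ p q x y
    simp only [List.length_append, List.length_cons] at *
    split_ifs
    · exact h
    · simp
  · split_ifs with hl
    · exact h l (by simpa using hl)
    · rfl

/-- If `φ` vanishes on the words before `w`, and on the words of the same size that do not split,
then its differential on the word `w'` obtained by splitting `w` is its value on `w`. -/
theorem differential_up {w w' : List Letter} (hw : IsReduced w) (h : up none w = some w')
    {φ : List Alg → Alg} (hφ : EntryAdditive φ)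
    (h₁ : ∀ v : List Letter, v.length < w.length → φ (v.map mono) = 0)
    (h₂ : ∀ v : List Letter, v.length = w.length → wordSize v ≤ wordSize w →
      (wordSize v < wordSize w ∨ up none v = none) → φ (v.map mono) = 0) :
    differential φ (w'.map mono) = φ (w.map mono) := by
  obtain ⟨hl, -, ht, hi⟩ := up_preserves h
  have hw' := up_isReduced hw h
  rw [differential, insOp_undeformedOp_left _ hφ, insOp_undeformedOp_right, add_zero]
  · refine pairSum_up (by simp) hw h hφ fun v hv hb hu => h₂ v (by omega) ?_ ?_
    · have := hb.totalWeight_eq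
      have := hb.inversions_le
      rw [wordSize, wordSize]
      omega
    · refine hu.imp (fun h => ?_) id
      have := hb.totalWeight_eq
      rw [wordSize, wordSize]
      omega
  -- A proper string of consecutive letters of `w'` has at most the length of `w`, which has one
  -- letter less. If the lengths agree, its size is strictly smaller.
  · intro a c b hab hc
    subst hab
    have hs := wordSize_lt hw' hc
    have hlen : c.length < w.length ∨ c.length = w.length := by
      simp only [List.length_append] at hl
      by_contra hn
      have ha : a = [] := List.length_eq_zero_iff.1 (by omega)
      have hb : b = [] := List.length_eq_zero_iff.1 (by omega)
      subst ha hb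
      simp at hc
    have e : wordSize (a ++ (c ++ b)) = wordSize w := by rw [wordSize, wordSize, ht, hi]
    rcases hlen with hlen | hlen
    · exact h₁ c hlen
    · exact h₂ c hlen (by omega) (Or.inl (by omega))
  · intro l hll
    exact eq_zero_of_length_lt hφ h₁ (by omega)

end TorusAlgebra

/-! ### Double insertions without weights -/

namespace ListCalculus

variable {E N : Type*}

/-- The weighted identity `ins_ins`, for families concentrated in weight zero. -/
theorem insOp_insOp [AddCommGroup E] [AddCommGroup N] [Module (ZMod 2) N] (m : List E → E)
    {φ : List E → N} (hφ : EntryAdditive φ) (l : List E) :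
    insOp m (insOp m φ) l = insOp (insOp m m) φ l := by
  have key := congrFun (ins_ins (μ := fun l => Pi.single 0 (m l)) (φ := fun l => Pi.single 0 (φ l))
    (fun a b x y => by simp only [hφ a b x y, Pi.single_add]) l) 0
  have h1 : ∀ l, (ins (fun l => (Pi.single 0 (m l) : ℕ → E)) (fun l => (Pi.single 0 (φ l) : ℕ → N)) l) 0
      = insOp m φ l := by
    intro l
    simp [ins_apply]
  have h2 : ∀ l, (ins (fun l => (Pi.single 0 (m l) : ℕ → E)) (fun l => (Pi.single 0 (m l) : ℕ → E)) l) 0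
      = insOp m m l := by
    intro l
    simp [ins_apply]
  rw [ins_apply, ins_apply] at key
  simpa [h1, h2] using key

theorem cutSum_concat [AddCommMonoid N] (Φ : List E → List E → N) (l : List E) (y : E) :
    cutSum Φ (l ++ [y]) = cutSum (fun a b => Φ a (b ++ [y])) l + Φ (l ++ [y]) [] := by
  induction l generalizing Φ with
  | nil => simp [cutSum_cons]
  | cons x l ih => simp only [List.cons_append, cutSum_cons, ih, add_assoc]

end ListCalculus

/-! ### Unitality -/

namespace TorusAlgebra

open ListCalculus

theorem add_self_eq_zero' (a : Alg) : a + a = 0 := by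
  have : (2 : ZMod 2) • a = 0 := by
    rw [show (2 : ZMod 2) = 0 from rfl, zero_smul]
  rwa [two_smul] at this

theorem insOp_binary_left {φ : List Alg → Alg} (hφ : EntryAdditive φ) (w : List Letter) :
    insOp binary φ (w.map mono) = pairSum φ w := by
  induction w generalizing φ with
  | nil =>
    rw [List.map_nil, insOp_nil, binary_eq_zero (by simp)]
    exact hφ.zero_entry [] []
  | cons x w ih =>
    have h0 : ∀ (l b : List Alg), l.length ≠ 2 → φ (binary l :: b) = 0 := fun l b hl => by
      rw [binary_eq_zero hl]
      exact hφ.zero_entry [] b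
    rw [List.map_cons, insOp_cons, ih (φ := fun r => φ (mono x :: r)) (hφ.cons _), cutSum_cons,
      h0 _ _ (by simp), zero_add]
    cases w with
    | nil => simp [pairSum, h0]
    | cons y w =>
      rw [pairSum]
      congr 1
      rw [List.map_cons, cutSum_cons, h0 _ _ (by simp), zero_add]
      cases w with
      | nil => simp [binary]
      | cons z w =>
        rw [List.map_cons, cutSum_cons, cutSum_eq_zero, add_zero]
        · rfl
        · intro a b hab
          exact h0 _ _ (by simp)

/-- A binary product has room for one further letter only, so `φ` consumes all letters but the first
or all but the last. For a single letter the two terms are the insertions of `φ []` after and before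
it. -/
theorem insOp_binary_right (φ : List Alg → Alg) {w : List Letter} {x y : Letter}
    {v l : List Letter} (h₁ : w = x :: v) (h : w = l ++ [y]) : insOp φ binary (w.map mono) =
      mono x * φ (v.map mono) + φ (l.map mono) * mono y := by
  subst h₁
  rw [List.map_cons, insOp_cons, add_comm]
  congr 1
  · rw [← cutSum_left_nil (fun r => mono x * φ r)]
    refine cutSum_congr fun a r _ => ?_
    split_ifs with ha
    · subst ha
      rw [← cutSum_right_nil (fun c => mono x * φ c)]
      refine cutSum_congr fun c b _ => ?_
      split_ifs with hb
      · subst hb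
        rfl
      · exact binary_eq_zero (by simpa using hb)
    · refine cutSum_eq_zero fun c b _ => binary_eq_zero ?_
      have := List.length_pos_iff.2 ha
      simp only [List.length_cons, List.length_append]
      omega
  · rw [← List.map_cons, h, List.map_append, List.map_singleton, cutSum_concat,
      binary_eq_zero (by simp), add_zero, ← cutSum_right_nil (fun c => φ c * mono y)]
    refine cutSum_congr fun c b _ => ?_
    split_ifs with hb
    · subst hb
      rfl
    · exact binary_eq_zero (by simpa using hb)

theorem insOp_binary_right_nil (φ : List Alg → Alg) : insOp φ binary [] = 0 := by
  rw [insOp_nil, binary_eq_zero (by simp)]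

/-- On three letters this is associativity; on all other lists the terms vanish or there are none.
-/
theorem insOp_binary_binary (l : List Alg) : insOp binary binary l = 0 := by
  refine EntryAdditive.eq_zero (entryAdditive_binary.insOp entryAdditive_binary) (fun w => ?_) l
  match w with
  | [] => exact insOp_binary_right_nil _
  | [x] =>
    rw [insOp_binary_right binary (x := x) (v := []) (l := []) (y := x) rfl rfl, binary_eq_zero (by simp)]
    simp
  | [x, y] =>
    rw [insOp_binary_right binary (x := x) (v := [y]) (l := [x]) (y := y) rfl rfl, binary_eq_zero (by simp),
      binary_eq_zero (by simp)]
    simp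
  | [x, y, z] =>
    rw [insOp_binary_right binary (x := x) (v := [y, z]) (l := [x, y]) (y := z) rfl rfl]
    change mono x * (mono y * mono z) + mono x * mono y * mono z = 0
    rw [mul_assoc, add_self_eq_zero']
  | x :: y :: z :: t :: w =>
    rw [insOp_binary_right binary (x := x) (v := y :: z :: t :: w)
      (l := (x :: y :: z :: t :: w).dropLast) (y := (x :: y :: z :: t :: w).getLast (by simp)) rfl
      (List.dropLast_append_getLast _).symm,
      binary_eq_zero (by simp), binary_eq_zero (by simp)]
    simp

/-- The idempotents as letters. -/
def unitLetter (e : Fin 2) : Letter := (0, .idem e)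

theorem unitLetter_mul {e : Fin 2} {x : Letter} (h : x.2.src = e) :
    mono (unitLetter e) * mono x = mono x := by
  obtain ⟨m, b⟩ := x
  rw [mono_mul_mono, unitLetter, Letter.mul]
  cases b <;> simp_all [Basic.mul, Basic.src]

theorem mul_unitLetter {e : Fin 2} {x : Letter} (h : x.2.tgt = e) :
    mono x * mono (unitLetter e) = mono x := by
  obtain ⟨m, b⟩ := x
  rw [mono_mul_mono, unitLetter, Letter.mul]
  cases b <;> simp_all [Basic.mul, Basic.tgt]

theorem IsGradedMap.unit_mul {c : Gam} {φ : List Alg → Alg} (hφ : IsGradedMap c φ) (e : Fin 2)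
    {x : Letter} (l : List Letter) (h : x.2.src = e) :
    mono (unitLetter e) * φ ((x :: l).map mono) = φ ((x :: l).map mono) := by
  rw [← sum_supp (φ ((x :: l).map mono)), Finset.mul_sum]
  refine Finset.sum_congr rfl fun y hy => unitLetter_mul ?_
  obtain ⟨g, hg, -⟩ := hφ (x :: l) y (mem_supp.1 hy)
  rw [← hg.1, h]

theorem IsGradedMap.mul_unit {c : Gam} {φ : List Alg → Alg} (hφ : IsGradedMap c φ) (e : Fin 2)
    {x : Letter} (l : List Letter) (h : x.2.tgt = e) :
    φ ((l ++ [x]).map mono) * mono (unitLetter e) = φ ((l ++ [x]).map mono) := by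
  rw [← sum_supp (φ ((l ++ [x]).map mono)), Finset.sum_mul]
  refine Finset.sum_congr rfl fun y hy => mul_unitLetter ?_
  obtain ⟨g, hg, -⟩ := hφ (l ++ [x]) y (mem_supp.1 hy)
  obtain ⟨g₁, g₂, r, -, -, h2⟩ := isPath_append.1 hg
  rw [← (isPath_singleton.1 h2).2.2, h]

theorem IsGradedMap.nil_comm {c : Gam} {φ : List Alg → Alg} (hφ : IsGradedMap c φ) (e : Fin 2) :
    mono (unitLetter e) * φ [] = φ [] * mono (unitLetter e) := by
  rw [← sum_supp (φ []), Finset.mul_sum, Finset.sum_mul]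
  refine Finset.sum_congr rfl fun y hy => ?_
  obtain ⟨g, ⟨-, hg⟩, -⟩ := hφ [] y (mem_supp.1 hy)
  rw [mono_mul_mono, mono_mul_mono]
  obtain ⟨m, b⟩ := y
  congr 1
  simp only at hg
  cases b with
  | idem f => 
    simp only [Letter.mul, unitLetter, Basic.mul, add_comm]
    by_cases h : e = f
    · subst h; rfl
    · rw [if_neg h, if_neg (Ne.symm h)]
  | chord i n =>
    simp only [Basic.src, Basic.tgt] at hg
    simp only [Letter.mul, unitLetter, Basic.mul, add_comm, hg]
    by_cases h : e = target i n
    · subst h; rfl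
    · rw [if_neg h, if_neg (Ne.symm h)]

theorem IsNormalized.append {φ : List Alg → Alg} (h : IsNormalized φ) (a b : List Letter)
    (e : Fin 2) : φ ((a ++ unitLetter e :: b).map mono) = 0 :=
  h _ ⟨e, by simp [unitLetter]⟩

/-- The sum over products of neighbouring letters, of which one is an idempotent. -/
theorem pairSum_unit_cons {φ : List Alg → Alg} (hφ : EntryAdditive φ) (hn : IsNormalized φ)
    (e : Fin 2) {y : Letter} (h : y.2.src = e) (b : List Letter) :
    pairSum φ (unitLetter e :: y :: b) = φ ((y :: b).map mono) := by
  rw [pairSum, unitLetter_mul h, pairSum_eq_zero (hφ.cons _), add_zero]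
  · rfl
  · intro a x y b z _ _
    exact hn.append [] (a ++ z :: b) e

theorem pairSum_append_unit {φ : List Alg → Alg} (hφ : EntryAdditive φ) (hn : IsNormalized φ)
    (e : Fin 2) {x : Letter} (h : x.2.tgt = e) (a b : List Letter) :
    pairSum φ (a ++ x :: unitLetter e :: b) = φ ((a ++ x :: b).map mono) +
      pairSum (fun l => φ ((a ++ [x]).map mono ++ l)) (unitLetter e :: b) := by
  induction a generalizing φ with
  | nil =>
    rw [List.nil_append, pairSum, mul_unitLetter h]
    rfl
  | cons t a ih =>
    have hn' : IsNormalized fun l => φ (mono t :: l) := by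
      rintro l ⟨f, hf⟩
      exact hn (t :: l) ⟨f, by simp [hf]⟩
    have hz : ∀ y w, a ++ x :: unitLetter e :: b = y :: w →
        φ (mono t * mono y :: w.map mono) = 0 := by
      intro y w hw
      refine mul_entry_eq_zero hφ fun z hz => ?_
      refine hn _ ⟨e, ?_⟩
      cases a with
      | nil =>
        obtain ⟨-, rfl⟩ := List.cons_eq_cons.1 hw
        simp [unitLetter]
      | cons t' a =>
        obtain ⟨-, rfl⟩ := List.cons_eq_cons.1 hw
        simp [unitLetter]
    rw [List.cons_append]
    have := ih (hφ.cons (mono t)) hn'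
    cases hw : a ++ x :: unitLetter e :: b with
    | nil => simp at hw
    | cons y w =>
      rw [pairSum, hz y w hw, zero_add, ← hw, this]
      rfl

/-- The Hochschild differential for the associative algebra preserves normalization. -/
theorem isNormalized_binary {φ : List Alg → Alg} {c : Gam} (hφ : EntryAdditive φ)
    (hn : IsNormalized φ) (hcc : ∀ g, Commute c g) (hg : IsGradedMap c φ) :
    IsNormalized fun l => insOp binary φ l + insOp φ binary l := by
  have hc : IsGradedMap (lam (-1) 0 * c) fun l => insOp binary φ l + insOp φ binary l := by
    refine IsGradedMap.add ?_ ?_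
    · exact isGradedMap_binary.insOp (commute_lam _ _) hφ hg
    · rw [← (hcc _).eq]
      exact hg.insOp hcc entryAdditive_binary isGradedMap_binary
  rintro l ⟨e, he⟩
  obtain ⟨a, b, rfl⟩ := List.append_of_mem he
  refine alg_ext fun y => ?_
  rw [map_zero]
  -- A non-zero value would make the word composable, so that the idempotent acts as a unit on its
  -- neighbours.
  by_contra hy
  obtain ⟨g, hp, -⟩ := hc _ y hy
  refine hy ?_
  change coeff y (insOp binary φ ((a ++ unitLetter e :: b).map mono) +
    insOp φ binary ((a ++ unitLetter e :: b).map mono)) = 0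
  obtain ⟨g₁, g₂, r, -, h1, h2⟩ := isPath_append.1 hp
  rw [insOp_binary_left hφ]
  obtain rfl : e = r := h2.1
  obtain ⟨-, g₃, -, h3⟩ := h2
  -- In the interior of the word, the products of the unit with its two neighbours cancel. At an end
  -- one of them is replaced by the outer product with the unit, and for the unit alone the two
  -- outer products cancel. All other terms still have a unit as an input of `φ`.
  rcases List.eq_nil_or_concat a with rfl | ⟨a, x, rfl⟩
  · cases b with
    | nil =>
      rw [List.nil_append, insOp_binary_right φ (x := unitLetter e) (v := []) (l := []) (y := unitLetter e) rfl rfl]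
      simp only [pairSum, List.map_nil, zero_add]
      rw [hg.nil_comm, add_self_eq_zero', map_zero]
    | cons x b =>
      have hx : x.2.src = e := h3.1
      obtain ⟨b', z, hb⟩ := (List.eq_nil_or_concat (x :: b)).resolve_left (by simp)
      rw [List.concat_eq_append] at hb
      rw [List.nil_append, pairSum_unit_cons hφ hn e hx,
        insOp_binary_right φ (x := unitLetter e) (v := x :: b) (l := unitLetter e :: b') (y := z) rfl
          (by rw [hb]; rfl),
        hg.unit_mul e _ hx, show φ ((unitLetter e :: b').map mono) = 0 from hn.append [] b' e, zero_mul, add_zero, add_self_eq_zero', map_zero]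
  · rw [List.concat_eq_append] at *
    obtain ⟨_, _, _, -, -, h4⟩ := isPath_append.1 h1
    have hx : x.2.tgt = e := (isPath_singleton.1 h4).2.2
    have hax : ∀ b : List Letter, (a ++ [x]) ++ b = a ++ x :: b := fun b => by simp
    rw [hax, pairSum_append_unit hφ hn e hx]
    obtain ⟨t, v, hv⟩ : ∃ t v, a ++ [x] = t :: v := List.exists_cons_of_ne_nil (by simp)
    have hv0 : ∀ b : List Letter, φ ((v ++ unitLetter e :: b).map mono) = 0 := fun b =>
      hn.append v b e
    cases b with
    | nil =>
      rw [insOp_binary_right φ (x := t) (v := v ++ [unitLetter e]) (l := a ++ [x])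
        (y := unitLetter e) (by rw [← hax, hv]; rfl) (by rw [hax]), hg.mul_unit e _ hx, hv0 [],
        mul_zero, zero_add]
      simp only [pairSum, add_zero]
      rw [add_self_eq_zero', map_zero]
    | cons x' b =>
      have hx' : x'.2.src = e := h3.1
      obtain ⟨b', z, hb⟩ := (List.eq_nil_or_concat (x' :: b)).resolve_left (by simp)
      rw [List.concat_eq_append] at hb
      have hn' : IsNormalized fun l => φ ((a ++ [x]).map mono ++ l) := by
        rintro l ⟨f, hf⟩
        beta_reduce
        rw [← List.map_append]
        exact hn _ ⟨f, by simp [hf]⟩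
      have hφ' : EntryAdditive fun l => φ ((a ++ [x]).map mono ++ l) := by
        intro p q y z
        have := hφ ((a ++ [x]).map mono ++ p) q y z
        simpa using this
      rw [insOp_binary_right φ (x := t) (v := v ++ unitLetter e :: x' :: b)
        (l := (a ++ [x]) ++ unitLetter e :: b') (y := z) (by rw [← hax, hv]; rfl)
        (by rw [← hax, hb]; simp), hv0, hn.append, mul_zero, zero_mul, add_zero, add_zero,
        pairSum_unit_cons hφ' hn' e hx', ← hax, List.map_append, add_self_eq_zero', map_zero]

theorem isNormalized_insOp {m φ : List Alg → Alg} (hm : IsNormalized m) (hφ : EntryAdditive φ)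
    (hn : IsNormalized φ) : IsNormalized (insOp m φ) := by
  rintro l ⟨e, he⟩
  rw [insOp_map]
  refine cutSum_eq_zero fun a r har => cutSum_eq_zero fun c b hcb => ?_
  subst hcb har
  simp only [List.mem_append] at he
  by_cases hc : ((0, .idem e) : Letter) ∈ c
  · rw [hm c ⟨e, hc⟩]
    exact hφ.zero_entry _ _
  · by_contra h
    obtain ⟨y, hy⟩ : ∃ y, coeff y (φ (a.map mono ++ m (c.map mono) :: b.map mono)) ≠ 0 := by
      by_contra hcon
      push Not at hcon
      exact h (alg_ext fun y => by rw [hcon, map_zero])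
    obtain ⟨x, -, hx⟩ := EntryAdditive.exists_coeff hφ hy
    refine hx ?_
    rw [← List.map_cons, ← List.map_append, hn _ ⟨e, ?_⟩, map_zero]
    simp only [List.mem_append, List.mem_cons]
    tauto

theorem IsNormalized.add {φ ψ : List Alg → Alg} (hφ : IsNormalized φ) (hψ : IsNormalized ψ) :
    IsNormalized fun l => φ l + ψ l := by
  intro l hl
  simp only [hφ l hl, hψ l hl, add_zero]

theorem insOp_undeformedOp_left_eq {φ : List Alg → Alg} (hφ : EntryAdditive φ) (l : List Alg) :
    insOp undeformedOp φ l = insOp binary φ l + insOp tiling φ l := by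
  rw [← insOp_add_left _ _ hφ, funext undeformedOp_eq]

theorem insOp_undeformedOp_right_eq (φ : List Alg → Alg) (l : List Alg) :
    insOp φ undeformedOp l = insOp φ binary l + insOp φ tiling l := by
  rw [← insOp_add_right, funext undeformedOp_eq]

theorem isNormalized_differential {φ : List Alg → Alg} {c : Gam} (hφ : EntryAdditive φ)
    (hn : IsNormalized φ) (hcc : ∀ g, Commute c g) (hg : IsGradedMap c φ) :
    IsNormalized (differential φ) := by
  intro l hl
  have h1 := isNormalized_binary hφ hn hcc hg l hl
  have h2 := isNormalized_insOp isNormalized_tiling hφ hn l hl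
  have h3 := isNormalized_insOp hn entryAdditive_tiling isNormalized_tiling l hl
  simp only [] at h1
  rw [differential, insOp_undeformedOp_left_eq hφ, insOp_undeformedOp_right_eq, h2, h3, add_zero,
    add_zero, h1]

theorem entryAdditive_differential {φ : List Alg → Alg} (hφ : EntryAdditive φ) :
    EntryAdditive (differential φ) := by
  intro p q x y
  simp only [differential, entryAdditive_undeformedOp.insOp hφ p q x y,
    hφ.insOp entryAdditive_undeformedOp p q x y]
  abel

theorem isGradedMap_differential {φ : List Alg → Alg} {c : Gam} (hφ : EntryAdditive φ)
    (hcc : ∀ g, Commute c g) (hg : IsGradedMap c φ) :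
    IsGradedMap (lam (-1) 0 * c) (differential φ) := by
  refine IsGradedMap.add ?_ ?_
  · exact isGradedMap_undeformedOp.insOp (commute_lam _ _) hφ hg
  · rw [← (hcc _).eq]
    exact hg.insOp hcc entryAdditive_undeformedOp isGradedMap_undeformedOp

/-! ### The defect of the `A∞`-relation -/

/-- The left hand side of the `A∞`-relation for the undeformed operations. -/
noncomputable def defect : List Alg → Alg := insOp undeformedOp undeformedOp

theorem entryAdditive_defect : EntryAdditive defect :=
  entryAdditive_undeformedOp.insOp entryAdditive_undeformedOp

/-- With the defect as double insertion of `undeformedOp`, both terms of the differential are triple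
insertions, equal by `insOp_insOp`. The `A∞`-relation is not used, so this is available for its
proof. -/
theorem differential_defect (l : List Alg) : differential defect l = 0 := by
  rw [differential, defect, insOp_insOp _ entryAdditive_undeformedOp, add_self_eq_zero']

/-- Associativity removes the part with two products. The remainder is grouped so that each part is
visibly normalized: the Hochschild differential of `tiling` for the product alone, and `tiling`
inserted in itself. -/
theorem defect_eq (l : List Alg) : defect l =
    (insOp binary tiling l + insOp tiling binary l) + insOp tiling tiling l := by
  rw [defect, insOp_undeformedOp_left_eq entryAdditive_undeformedOp, insOp_undeformedOp_right_eq,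
    insOp_undeformedOp_right_eq, insOp_binary_binary, zero_add, add_assoc]

theorem isNormalized_defect : IsNormalized defect := by
  have : defect = fun l => (insOp binary tiling l + insOp tiling binary l) + insOp tiling tiling l :=
    funext defect_eq
  rw [this]
  exact (isNormalized_binary entryAdditive_tiling isNormalized_tiling (commute_lam _ _)
    isGradedMap_tiling).add (isNormalized_insOp isNormalized_tiling entryAdditive_tiling
    isNormalized_tiling)

theorem isGradedMap_defect : IsGradedMap (lam (-1) 0 * lam (-1) 0) defect :=
  isGradedMap_undeformedOp.insOp (commute_lam _ _) entryAdditive_undeformedOp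
    isGradedMap_undeformedOp

theorem isULinear_defect : IsULinear defect :=
  isULinear_undeformedOp.insOp entryAdditive_undeformedOp isULinear_undeformedOp

end TorusAlgebra

/-! ### Grafting trees into tiling patterns -/

namespace TorusAlgebra

open ListCalculus TilingPattern

theorem map_run_eq_append {i e : ZMod 4} {n : ℕ} {w w' : List (ZMod 4)}
    (h : run i n = w ++ e :: w') : ∃ m, e :: w' = run e m := by
  induction n generalizing i w with
  | zero =>
    rw [run_zero] at h
    cases w with
    | nil =>
      obtain ⟨rfl, rfl⟩ := List.cons_eq_cons.1 h
      exact ⟨0, (run_zero _).symm⟩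
    | cons _ _ => simp at h
  | succ n ih =>
    cases w with
    | nil =>
      have h' := h
      rw [run_succ] at h
      obtain ⟨rfl, -⟩ := List.cons_eq_cons.1 h
      exact ⟨n + 1, h'.symm⟩
    | cons _ _ =>
      rw [run_succ] at h
      exact ih (List.cons_eq_cons.1 h).2

theorem basicTokens_eq_append {l : List Basic} {e : ZMod 4} {σ τ : List (Option (ZMod 4))}
    (h : basicTokens l = σ ++ some e :: τ) : ∃ c b d w w', l = c ++ b :: d ∧
      b.word = w ++ e :: w' ∧ σ = basicTokens c ++ w.map some ∧
      τ = w'.map some ++ none :: basicTokens d := by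
  induction l generalizing σ with
  | nil => simp [basicTokens_nil] at h
  | cons b l ih =>
    rw [basicTokens_cons] at h
    rcases List.append_eq_append_iff.1 h with ⟨ρ, rfl, h2⟩ | ⟨ρ, h1, h2⟩
    · cases ρ with
      | nil => simp at h2
      | cons t ρ =>
        obtain ⟨rfl, h3⟩ := List.cons_eq_cons.1 h2
        obtain ⟨c, b', d, w, w', rfl, hb, rfl, rfl⟩ := ih h3
        exact ⟨b :: c, b', d, w, w', rfl, hb, by simp [basicTokens_cons], rfl⟩
    · cases ρ with
      | nil => simp at h2
      | cons t ρ =>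
        obtain ⟨rfl, rfl⟩ := List.cons_eq_cons.1 h2
        obtain ⟨w, w₁, hw, rfl, hw1⟩ := List.map_eq_append_iff.1 h1
        obtain ⟨e', w', rfl, he, rfl⟩ := List.map_eq_cons_iff.1 hw1
        obtain rfl : e' = e := Option.some.inj he
        exact ⟨[], b, l, w, w', rfl, hw, by simp [basicTokens_nil], rfl⟩

theorem tree_tokens_none {t : PlaneTree} {i : ZMod 4} {σ τ : List (Option (ZMod 4))}
    (h : t.tokens i ++ σ = none :: τ) : t = .leaf ∧ σ = τ := by
  cases t with
  | leaf => exact ⟨rfl, (List.cons_eq_cons.1 h).2⟩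
  | node a b c => simp [PlaneTree.tokens] at h

theorem tree_tokens_some {t : PlaneTree} {i e : ZMod 4} {σ τ : List (Option (ZMod 4))}
    (h : t.tokens i ++ σ = some e :: τ) : t ≠ .leaf := by
  rintro rfl
  simp [PlaneTree.tokens] at h

theorem initial_of_mem_patterns {p : TilingPattern} {i : ZMod 4} {n : ℕ} {l : List Basic}
    (h : p ∈ patterns (.chord i n :: l)) : p.initial = i := by
  obtain ⟨m, h, -⟩ := isDescending_of_mem_patterns h
  exact (Basic.chord.inj h).1.symm

/-- The output of a centered pattern is an idempotent, and that of a left-extended one starts with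
its initial label `s + 1`. Only right-extended patterns have an output beginning with `s - 1`. -/
theorem output_of_mem_patterns {q : TilingPattern} {s : ZMod 4}
    {σ : List (Option (ZMod 4))} {τ : List (Option (ZMod 4))} (hq : q.initial = s + 1)
    (h : some (s - 1) :: σ = q.output.word.map some ++ none :: τ) :
    ∃ n, q.extension = .right n ∧ q.label = s + 1 ∧ q.output = .chord (s - 1) n := by
  have h2 : s + 1 ≠ s - 1 := (by decide : ∀ s : ZMod 4, s + 1 ≠ s - 1) s
  unfold TilingPattern.initial TilingPattern.output at *
  cases he : q.extension with
  | centered => simp [he, Basic.word] at h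
  | left n =>
    simp only [he, Basic.word] at h hq
    rw [hq] at h
    cases n with
    | zero => simp [run_zero] at h; exact absurd h.1.symm h2
    | succ n => simp [run_succ] at h; exact absurd h.1.symm h2
  | right n =>
    simp only [he] at hq
    refine ⟨n, rfl, hq, ?_⟩
    simp only [hq]
    congr 1
    ring

/-- The contribution of a tiling pattern. -/
noncomputable def TilingPattern.value (p : TilingPattern) : Alg := mono (p.tree.size, p.output)

/-- A way of grafting trees into a class `D` of patterns, between the labels `s` and `s - 1`. -/
structure Graft (s : ZMod 4) (pre : List (Option (ZMod 4))) where
  D : TilingPattern → Prop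
  get : TilingPattern → PlaneTree
  set : TilingPattern → PlaneTree → TilingPattern
  suf : TilingPattern → List (Option (ZMod 4))
  tokens_eq : ∀ p, D p → p.tokens = pre ++ some s :: ((get p).tokens (s + 1) ++ some (s - 1) :: suf p)
  D_set : ∀ p t, D p → D (set p t)
  get_set : ∀ p t, get (set p t) = t
  set_get : ∀ p, set p (get p) = p
  set_set : ∀ p t t', set (set p t) t' = set p t'
  suf_set : ∀ p t, suf (set p t) = suf p
  size_set : ∀ p t, (set p t).tree.size + (get p).size = p.tree.size + t.size
  output_set : ∀ p t, (set p t).output = p.output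

theorem tokens_right {p : TilingPattern} {n : ℕ} (h : p.extension = .right n) :
    p.tokens = p.tree.tokens p.label ++ ((run (p.label - 2) n).map some ++ [none]) := by
  rw [TilingPattern.tokens, h]

theorem map_some_append_none_unique {n m : ℕ} {i : ZMod 4} {σ : List (Option (ZMod 4))}
    (h : σ ++ ((run i n).map some ++ [none]) = σ ++ ((run i m).map some ++ [none])) : n = m := by
  have := congrArg List.length h
  simp [run] at this
  exact this

-- A pattern in the class `D` whose string continues `s` by `s + 1` carries a proper subtree on the
-- edge between its quadrants `s` and `s - 1`. Cutting that edge leaves an outer pattern with a leaf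
-- there and an inner, right-extended pattern, whose output is the chord starting with `s - 1` that
-- the outer one then sees. The powers of `U` add up, as the vertices are distributed among the two.
open Classical in
theorem sum_graft {s : ZMod 4} {pre : List (Option (ZMod 4))} (G : Graft s pre) {L l : List Basic}
    (hL : basicTokens L = pre ++ [some s, none])
    (hD : ∀ p y d, p ∈ patterns (L ++ y :: d) → G.D p) {n : ℕ} {rest : List Basic}
    (hl : basicTokens l = pre ++ some s :: basicTokens (.chord (s + 1) n :: rest)) :
    ∑ p ∈ (patterns_finite l).toFinset.filter G.D, p.value =
      cutSum (fun c d => ∑ q ∈ (patterns_finite c).toFinset,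
        ∑ p ∈ (patterns_finite (L ++ q.output :: d)).toFinset, uPow q.tree.size * p.value)
        (.chord (s + 1) n :: rest) := by
  set R : List Basic := .chord (s + 1) n :: rest with hR
  -- In the outer string a separator follows `s`, so the edge ends in a leaf and the next label is
  -- `s - 1`; this forces the inner pattern to be right-extended.
  have key : ∀ k q p, q ∈ patterns (R.take k) → p ∈ patterns (L ++ q.output :: R.drop k) →
      ∃ n, q.extension = .right n ∧ q.label = s + 1 ∧ q.output = .chord (s - 1) n ∧ G.D p ∧
        G.get p = .leaf ∧ some (s - 1) :: G.suf p =
          (run (s - 1) n).map some ++ none :: basicTokens (R.drop k) := by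
    intro k q p hq hp
    have hDp := hD p _ _ hp
    have h1 := mem_patterns.1 hp
    rw [G.tokens_eq p hDp, basicTokens_append, hL, basicTokens_cons, List.append_assoc,
      List.append_cancel_left_eq] at h1
    obtain ⟨-, h1⟩ := List.cons_eq_cons.1 h1
    obtain ⟨h2, h3⟩ := tree_tokens_none h1
    have hk : 0 < (R.take k).length := by rw [length_of_mem_patterns hq]; omega
    obtain ⟨k, rfl⟩ : ∃ j, k = j + 1 := by
      cases k with
      | zero => simp at hk
      | succ k => exact ⟨k, rfl⟩
    have hi : q.initial = s + 1 := initial_of_mem_patterns (l := rest.take k) (n := n) hq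
    obtain ⟨m, e1, e2, e3⟩ := output_of_mem_patterns hi h3
    exact ⟨m, e1, e2, e3, hDp, h2, by rw [h3, e3]; rfl⟩
  have key2 : ∀ k q n, q.extension = .right n → q.label = s + 1 → q ∈ patterns (R.take k) →
      basicTokens (R.take k) = q.tree.tokens (s + 1) ++ ((run (s - 1) n).map some ++ [none]) := by
    intro k q n h1 h2 h3
    rw [← mem_patterns.1 h3, tokens_right h1, h2, show s + 1 - 2 = s - 1 by ring]
  symm
  simp only [cutSum, Finset.sum_sigma']
  refine Finset.sum_bij (fun x _ => G.set x.2.2 x.2.1.tree) ?_ ?_ ?_ ?_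
  · rintro ⟨k, q, p⟩ hx
    simp only [Finset.mem_sigma, Finset.mem_range, Set.Finite.mem_toFinset, Finset.mem_filter]
      at hx ⊢
    obtain ⟨hk, hq, hp⟩ := hx
    obtain ⟨m, h1, h2, h3, h4, h5, h6⟩ := key k q p hq hp
    refine ⟨mem_patterns.2 ?_, G.D_set _ _ h4⟩
    rw [G.tokens_eq _ (G.D_set _ _ h4), G.get_set, G.suf_set, h6, hl, ← List.take_append_drop k R,
      basicTokens_append, key2 k q m h1 h2 hq, List.take_append_drop]
    simp
  -- The outer pattern is recovered by putting a leaf in place of the subtree. The subtree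
  -- determines the number of inner inputs, and then the string of these determines the length of
  -- the right extension.
  · rintro ⟨k, q, p⟩ hx ⟨k', q', p'⟩ hx' he
    simp only [Finset.mem_sigma, Finset.mem_range, Set.Finite.mem_toFinset] at hx hx' he
    obtain ⟨hk, hq, hp⟩ := hx
    obtain ⟨hk', hq', hp'⟩ := hx'
    obtain ⟨m, h1, h2, h3, h4, h5, h6⟩ := key k q p hq hp
    obtain ⟨m', h1', h2', h3', h4', h5', h6'⟩ := key k' q' p' hq' hp'
    have ht : q.tree = q'.tree := by
      have := congrArg G.get he
      rwa [G.get_set, G.get_set] at this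
    have hpp : p = p' := by
      have := congrArg (fun x => G.set x .leaf) he
      simp only [G.set_set] at this
      rw [← G.set_get p, ← G.set_get p', h5, h5', this]
    have hkk : k = k' := by
      have e1 := length_of_mem_patterns hq
      have e2 := length_of_mem_patterns hq'
      rw [ht] at e1
      rw [List.length_take] at e1 e2
      omega
    subst hkk hpp
    have hmm : m = m' := by
      have e1 := key2 k q m h1 h2 hq
      rw [key2 k q' m' h1' h2' hq', ht] at e1
      exact (map_some_append_none_unique e1).symm
    have : q = q' := by
      obtain ⟨a, b, c, i, e⟩ := q
      obtain ⟨a', b', c', i', e'⟩ := q'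
      simp only [TilingPattern.tree, PlaneTree.node.injEq] at ht h1 h1' h2 h2'
      obtain ⟨rfl, rfl, rfl⟩ := ht
      rw [h1, h1', h2, h2', hmm]
    subst this
    rfl
  -- Conversely, the label `s - 1` after the subtree lies in some chord of the word. The inner word
  -- ends with this chord, whose part from `s - 1` on is the right extension and hence the output
  -- passed to the outer pattern.
  · intro p hp
    simp only [Set.Finite.mem_toFinset, Finset.mem_filter] at hp
    obtain ⟨hp, hDp⟩ := hp
    have h1 := mem_patterns.1 hp
    rw [G.tokens_eq p hDp, hl, List.append_cancel_left_eq] at h1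
    obtain ⟨-, h1⟩ := List.cons_eq_cons.1 h1
    have hne : G.get p ≠ .leaf := by
      refine tree_tokens_some (σ := some (s - 1) :: G.suf p) (i := s + 1) (e := s + 1)
        (τ := (basicTokens R).tail) ?_
      rw [h1, hR, basicTokens_cons, Basic.word]
      cases n with
      | zero => simp [run_zero]
      | succ n => simp [run_succ]
    obtain ⟨c, b, d, w, w', hRc, hb, hσ, hτ⟩ := basicTokens_eq_append h1.symm
    cases b with
    | idem e => simp [Basic.word] at hb
    | chord i m' =>
      obtain ⟨m, hm⟩ := map_run_eq_append hb
      cases ht : G.get p with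
      | leaf => exact absurd ht hne
      | node t₁ t₂ t₃ =>
        have hpl : G.set p .leaf ∈ patterns (L ++ Basic.chord (s - 1) m :: d) := by
          refine mem_patterns.2 ?_
          rw [G.tokens_eq _ (G.D_set _ _ hDp), G.get_set, G.suf_set, basicTokens_append, hL,
            basicTokens_cons, Basic.word, ← hm, hτ]
          simp [PlaneTree.tokens]
        have htake : R.take (c.length + 1) = c ++ [.chord i m'] := by
          rw [hRc]
          simp [List.take_append]
        have hdrop : R.drop (c.length + 1) = d := by
          rw [hRc]
          simp [List.drop_append]
        have hout : TilingPattern.output ⟨t₁, t₂, t₃, s + 1, .right m⟩ = .chord (s - 1) m := by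
          simp only [TilingPattern.output]
          congr 1
          ring
        refine ⟨⟨c.length + 1, ⟨t₁, t₂, t₃, s + 1, .right m⟩, G.set p .leaf⟩, ?_, ?_⟩
        · simp only [Finset.mem_sigma, Finset.mem_range, Set.Finite.mem_toFinset]
          refine ⟨?_, mem_patterns.2 ?_, ?_⟩
          · rw [hRc]
            simp
          · rw [tokens_right rfl, htake, basicTokens_append, basicTokens_cons, Basic.word]
            change run i m' = w ++ _ at hb
            rw [hb, hm]
            simp only [TilingPattern.tree]
            rw [← ht, hσ, show s + 1 - 2 = s - 1 by ring]
            simp [basicTokens_nil]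
          · rw [hout, hdrop]
            exact hpl
        · simp only [TilingPattern.tree, G.set_set]
          rw [← ht, G.set_get]
  · rintro ⟨k, q, p⟩ hx
    simp only [Finset.mem_sigma, Finset.mem_range, Set.Finite.mem_toFinset] at hx
    obtain ⟨hk, hq, hp⟩ := hx
    obtain ⟨m, h1, h2, h3, h4, h5, h6⟩ := key k q p hq hp
    have hs := G.size_set p q.tree
    rw [h5, PlaneTree.size, add_zero] at hs
    rw [TilingPattern.value, TilingPattern.value, uPow_mul_mono, hs, G.output_set, add_comm]

end TorusAlgebra

/-! ### Grafting at the three inputs of the root vertex, and values on descending arrows -/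

namespace TorusAlgebra

open ListCalculus TilingPattern

/-- The sectors added on the right at the root do not lie on the left. -/
def TilingPattern.NotLeft (p : TilingPattern) : Prop := ∀ n, p.extension ≠ .left n

/-- The part of the string of a pattern after that of the tree. -/
def TilingPattern.tail (p : TilingPattern) : List (Option (ZMod 4)) :=
  match p.extension with
  | .right n => (run (p.label - 2) n).map some ++ [none]
  | _ => [none]

theorem TilingPattern.NotLeft.tokens_eq {p : TilingPattern} (h : p.NotLeft) :
    p.tokens = p.tree.tokens p.label ++ p.tail := by
  unfold TilingPattern.tokens TilingPattern.tail
  cases he : p.extension with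
  | centered => rfl
  | left n => exact absurd he (h n)
  | right n => rfl

/-- A left extension makes the first word contain at least two labels. If the first chord is an
arrow, there is no such extension, and the first edge of the root vertex ends in a leaf. -/
theorem notLeft_of_tokens {p : TilingPattern} {s : ZMod 4} {σ : List (Option (ZMod 4))}
    (h : p.tokens = some s :: none :: σ) : p.NotLeft ∧ p.label = s ∧ p.first = .leaf ∧
      some (p.label - 1) :: (p.second.tokens p.label ++ some (p.label - 2) ::
        (p.third.tokens (p.label - 1) ++ some (p.label - 3) :: p.tail)) = σ := by
  have hl : p.NotLeft := by
    intro n hn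
    rw [TilingPattern.tokens, hn] at h
    cases n with
    | zero => simp [run_zero, TilingPattern.tree, PlaneTree.tokens] at h
    | succ n =>
      simp only [run_succ, List.map_cons] at h
      cases n with
      | zero => simp [run_zero] at h
      | succ n => simp [run_succ] at h
  rw [hl.tokens_eq, TilingPattern.tree, PlaneTree.tokens, List.cons_append] at h
  obtain ⟨h1, h2⟩ := List.cons_eq_cons.1 h
  rw [List.append_assoc] at h2
  obtain ⟨h3, h4⟩ := tree_tokens_none h2
  refine ⟨hl, Option.some.inj h1, h3, ?_⟩
  rw [← h4]
  simp

/-- Grafting at the first input. -/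
def graftFirst (s : ZMod 4) : Graft s [] where
  D p := p.NotLeft ∧ p.label = s
  get p := p.first
  set p t := { p with first := t }
  suf p := p.second.tokens p.label ++ some (p.label - 2) ::
    (p.third.tokens (p.label - 1) ++ some (p.label - 3) :: p.tail)
  tokens_eq := by
    rintro p ⟨hl, rfl⟩
    rw [hl.tokens_eq, TilingPattern.tree, PlaneTree.tokens]
    simp
  D_set _ _ h := h
  get_set _ _ := rfl
  set_get _ := rfl
  set_set _ _ _ := rfl
  suf_set _ _ := rfl
  size_set p t := by simp only [TilingPattern.tree, PlaneTree.size]; ring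
  output_set _ _ := rfl

/-- Grafting at the second input. -/
def graftSecond (s : ZMod 4) : Graft s [some (s + 1), none] where
  D p := p.NotLeft ∧ p.label = s + 1 ∧ p.first = .leaf
  get p := p.second
  set p t := { p with second := t }
  suf p := p.third.tokens (p.label - 1) ++ some (p.label - 3) :: p.tail
  tokens_eq := by
    rintro p ⟨hl, h1, h2⟩
    rw [hl.tokens_eq, TilingPattern.tree, PlaneTree.tokens, h1, h2, PlaneTree.tokens,
      show s + 1 - 1 = s by ring, show s + 1 - 2 = s - 1 by ring]
    simp
  D_set _ _ h := h
  get_set _ _ := rfl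
  set_get _ := rfl
  set_set _ _ _ := rfl
  suf_set _ _ := rfl
  size_set p t := by simp only [TilingPattern.tree, PlaneTree.size]; ring
  output_set _ _ := rfl

/-- Grafting at the third input. -/
def graftThird (s : ZMod 4) : Graft s [some (s + 2), none, some (s + 1), none] where
  D p := p.NotLeft ∧ p.label = s + 2 ∧ p.first = .leaf ∧ p.second = .leaf
  get p := p.third
  set p t := { p with third := t }
  suf p := p.tail
  tokens_eq := by
    rintro p ⟨hl, h1, h2, h3⟩
    rw [hl.tokens_eq, TilingPattern.tree, PlaneTree.tokens, h1, h2, h3,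
      show s + 2 - 1 = s + 1 by ring, show s + 2 - 2 = s by ring, show s + 2 - 3 = s - 1 by ring]
    simp [PlaneTree.tokens]
  D_set _ _ h := h
  get_set _ _ := rfl
  set_get _ := rfl
  set_set _ _ _ := rfl
  suf_set _ _ := rfl
  size_set p t := by simp only [TilingPattern.tree, PlaneTree.size]; ring
  output_set _ _ := rfl

/-! ### Descending sequences of arrows -/

/-- The sequence of arrows `ρ_j, ρ_{j-1}, …, ρ_{j-k+1}`. -/
def descend : ZMod 4 → ℕ → List Basic
  | _, 0 => []
  | j, k + 1 => .chord j 0 :: descend (j - 1) k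

theorem descend_add (j : ZMod 4) (k l : ℕ) :
    descend j (k + l) = descend j k ++ descend (j - k) l := by
  induction k generalizing j with
  | zero => simp [descend]
  | succ k ih =>
    rw [show k + 1 + l = k + l + 1 by ring, descend, ih, descend, List.cons_append]
    push_cast
    rw [sub_sub, add_comm (1 : ZMod 4)]

theorem length_descend (j : ZMod 4) (k : ℕ) : (descend j k).length = k := by
  induction k generalizing j with
  | zero => rfl
  | succ k ih => simp [descend, ih]

theorem descend_succ (j : ZMod 4) (k : ℕ) :
    descend j (k + 1) = descend j k ++ [.chord (j - k) 0] :=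
  descend_add j k 1

theorem exists_descend {j : ZMod 4} {k : ℕ} {a c b : List Basic}
    (h : descend j k = a ++ (c ++ b)) :
    a = descend j a.length ∧ c = descend (j - a.length) c.length ∧
      b = descend (j - a.length - c.length) b.length := by
  have hk : k = a.length + (c.length + b.length) := by
    rw [← length_descend j k, h]
    simp
  rw [hk, descend_add, descend_add] at h
  obtain ⟨h1, h2⟩ := List.append_inj h (length_descend _ _)
  obtain ⟨h3, h4⟩ := List.append_inj h2 (length_descend _ _)
  exact ⟨h1.symm, h3.symm, h4.symm⟩

theorem basicTokens_arrow (s : ZMod 4) (l : List Basic) :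
    basicTokens (.chord s 0 :: l) = some s :: none :: basicTokens l := by
  rw [basicTokens_cons, Basic.word, run_zero]
  rfl

/-- Three leading arrows use up the three leaves of the root vertex, so the tree has no further
vertex and only the chord closing it up remains. -/
theorem size_of_descend {j : ZMod 4} {l : List Basic} {p : TilingPattern}
    (h : p ∈ patterns (descend j 3 ++ l)) :
    p.first = .leaf ∧ p.second = .leaf ∧ p.third = .leaf ∧ p.NotLeft ∧ p.label = j ∧
      some (j - 3) :: p.tail = basicTokens l := by
  have h1 := mem_patterns.1 h
  simp only [descend, List.cons_append, List.nil_append, basicTokens_arrow] at h1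
  obtain ⟨h2, h3, h4, h5⟩ := notLeft_of_tokens h1
  obtain ⟨-, h5⟩ := List.cons_eq_cons.1 h5
  obtain ⟨h6, h7⟩ := tree_tokens_none h5
  obtain ⟨-, h7⟩ := List.cons_eq_cons.1 h7
  obtain ⟨h8, h9⟩ := tree_tokens_none h7
  rw [h3] at h9
  exact ⟨h4, h6, h8, h2, h3, h9⟩

theorem length_of_descend {j : ZMod 4} {l : List Basic} {p : TilingPattern}
    (h : p ∈ patterns (descend j 3 ++ l)) : l.length = 1 := by
  obtain ⟨h1, h2, h3, -⟩ := size_of_descend h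
  have := length_of_mem_patterns h
  simp only [TilingPattern.tree, h1, h2, h3, PlaneTree.size, List.length_append,
    length_descend] at this
  omega

/-- At least four inputs are needed, and three leading arrows allow exactly one more. -/
theorem eq_of_mem_patterns_descend {j : ZMod 4} {k : ℕ} {p : TilingPattern}
    (h : p ∈ patterns (descend j k)) : k = 4 := by
  have h4 : 4 ≤ k := by
    have := length_of_mem_patterns h
    have := p.size_pos
    rw [length_descend] at *
    omega
  obtain ⟨l, rfl⟩ := Nat.exists_eq_add_of_le h4
  rw [show 4 + l = 3 + (l + 1) by ring, descend_add] at h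
  have := length_of_descend h
  rw [length_descend] at this
  omega

/-- The word of letters with given underlying basis elements of the path algebra. -/
def baseWord (l : List Basic) : List Letter := l.map (Prod.mk 0)

theorem baseWord_append (l l' : List Basic) : baseWord (l ++ l') = baseWord l ++ baseWord l' :=
  List.map_append

theorem snd_baseWord (l : List Basic) : (baseWord l).map Prod.snd = l := by
  simp [baseWord]

theorem fst_baseWord (l : List Basic) : ((baseWord l).map Prod.fst).sum = 0 := by
  simp [baseWord, Function.comp_def]

theorem tiling_baseWord (l : List Basic) :
    tiling ((baseWord l).map mono) = ∑ p ∈ (patterns_finite l).toFinset, p.value := by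
  rw [tiling_mono, basisTiling]
  simp only [snd_baseWord, fst_baseWord, zero_add]
  rfl

theorem tiling_insert (L d : List Basic) (x : Letter) :
    tiling ((baseWord L).map mono ++ mono x :: (baseWord d).map mono) =
      ∑ p ∈ (patterns_finite (L ++ x.2 :: d)).toFinset, uPow x.1 * p.value := by
  have := tiling_mono (baseWord L ++ x :: baseWord d)
  rw [List.map_append, List.map_cons] at this
  rw [this, basisTiling]
  simp only [List.map_append, List.map_cons, snd_baseWord, List.sum_append, fst_baseWord,
    List.sum_cons, add_zero, zero_add, TilingPattern.value, uPow_mul_mono]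

theorem tiling_insert_tiling (L c d : List Basic) :
    tiling ((baseWord L).map mono ++ tiling ((baseWord c).map mono) :: (baseWord d).map mono) =
      ∑ q ∈ (patterns_finite c).toFinset, ∑ p ∈ (patterns_finite (L ++ q.output :: d)).toFinset,
        uPow q.tree.size * p.value := by
  rw [tiling_baseWord, ← EntryAdditive.slot_apply entryAdditive_tiling, map_sum]
  refine Finset.sum_congr rfl fun q _ => ?_
  exact tiling_insert L d (q.tree.size, q.output)

theorem tiling_baseWord_eq_zero {l : List Basic} (h : ∀ p, p ∉ patterns l) :
    tiling ((baseWord l).map mono) = 0 :=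
  tiling_eq_zero (by rwa [snd_baseWord])

theorem patterns_single {l : List Basic} {p : TilingPattern} (hp : p ∈ patterns l)
    (h : ∀ q ∈ patterns l, q = p) : tiling ((baseWord l).map mono) = p.value := by
  rw [tiling_baseWord]
  refine Finset.sum_eq_single_of_mem p ((Set.Finite.mem_toFinset _).2 hp) fun q hq hne => ?_
  exact absurd (h q ((Set.Finite.mem_toFinset _).1 hq)) hne

theorem tiling_descend_four (j : ZMod 4) :
    tiling ((baseWord (descend j 4)).map mono) = mono (1, .idem (source j)) := by
  refine patterns_single (p := ⟨.leaf, .leaf, .leaf, j, .centered⟩) ?_ fun q hq => ?_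
  · refine mem_patterns.2 ?_
    simp only [TilingPattern.tokens, TilingPattern.tree, PlaneTree.tokens, descend,
      List.cons_append, List.nil_append, basicTokens_arrow, basicTokens_nil]
    rw [show j - 1 - 1 = j - 2 by ring, show j - 2 - 1 = j - 3 by ring]
  · rw [descend_add j 3 1] at hq
    obtain ⟨h1, h2, h3, h4, h5, h6⟩ := size_of_descend hq
    rw [descend, descend, basicTokens_arrow, basicTokens_nil] at h6
    obtain ⟨a, b, c, i, x⟩ := q
    simp only at h1 h2 h3 h5
    subst h1 h2 h3 h5
    cases x with
    | centered => rfl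
    | left n => exact absurd rfl (h4 n)
    | right n => cases n <;> simp [TilingPattern.tail, run_zero, run_succ] at h6

theorem tiling_descend_three (j : ZMod 4) (n : ℕ) :
    tiling ((baseWord (descend j 3 ++ [.chord (j - 3) (n + 1)])).map mono) =
      mono (1, .chord (j - 2) n) := by
  refine patterns_single (p := ⟨.leaf, .leaf, .leaf, j, .right n⟩) ?_ fun q hq => ?_
  · refine mem_patterns.2 ?_
    simp only [TilingPattern.tokens, TilingPattern.tree, PlaneTree.tokens, descend,
      List.cons_append, List.nil_append, basicTokens_nil, basicTokens_cons,
      Basic.word, run_zero, run_succ, List.map_cons, List.map_nil]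
    rw [show j - 1 - 1 = j - 2 by ring, show j - 3 + 1 = j - 2 by ring]
  · obtain ⟨h1, h2, h3, h4, h5, h6⟩ := size_of_descend hq
    rw [basicTokens_cons, basicTokens_nil, Basic.word, run_succ] at h6
    obtain ⟨a, b, c, i, x⟩ := q
    simp only at h1 h2 h3 h5
    subst h1 h2 h3 h5
    cases x with
    | centered => cases n <;> simp [TilingPattern.tail, run_zero, run_succ] at h6
    | left n => exact absurd rfl (h4 n)
    | right m =>
      obtain ⟨-, h6⟩ := List.cons_eq_cons.1 h6
      rw [show i - 3 + 1 = i - 2 by ring] at h6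
      rw [map_some_append_none_unique (σ := []) (n := m) (m := n) (i := i - 2) h6]

/-! ### The `A∞`-relation on sequences of chords -/

theorem isDescending_junction {a d : List Basic} {b : Basic} {i r r' : ZMod 4} {n : ℕ}
    (h : IsDescending r (a ++ .chord i n :: b :: d) r') : ∃ m, b = .chord (i + n - 1) m := by
  induction a generalizing r with
  | nil =>
    obtain ⟨m, h1, k, h2, -⟩ := h
    obtain ⟨rfl, rfl⟩ := Basic.chord.inj h1
    exact ⟨k, h2⟩
  | cons x a ih =>
    obtain ⟨_, _, h⟩ := h
    exact ih h

/-- After the arrow `s` the next chord of a pattern starts with `s - 1`, which differs from `s + 1`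
modulo four. -/
theorem not_mem_patterns_of_ascending (a d : List Basic) (s : ZMod 4) (n : ℕ)
    (p : TilingPattern) : p ∉ patterns (a ++ .chord s 0 :: .chord (s + 1) n :: d) := by
  intro hp
  obtain ⟨m, hm⟩ := isDescending_junction (isDescending_of_mem_patterns hp)
  have h := (Basic.chord.inj hm).1
  have h2 : ∀ s : ZMod 4, s + 1 ≠ s + ((0 : ℕ) : ZMod 4) - 1 := by decide
  exact h2 s h

/-- To the left of `y` all products of neighbours vanish except that of `x` and `y`, and to the
right of it `φ` vanishes on the result, so a single product survives. -/
theorem pairSum_middle {φ : List Alg → Alg} (hφ : EntryAdditive φ) {a b : List Letter}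
    {x y : Letter} (h₁ : ∀ a₁ u v a₂, a ++ [x] = a₁ ++ u :: v :: a₂ → Letter.mul u v = none)
    (h₂ : ∀ c u v d z, y :: b = c ++ u :: v :: d → Letter.mul u v = some z →
      φ ((a ++ x :: c ++ z :: d).map mono) = 0) :
    pairSum φ (a ++ x :: y :: b) = φ (a.map mono ++ mono x * mono y :: b.map mono) := by
  induction a generalizing φ with
  | nil =>
    rw [List.nil_append, pairSum, pairSum_eq_zero (hφ.cons _), add_zero]
    · rfl
    · intro c u v d z h hz
      exact h₂ c u v d z h hz
  | cons t a ih =>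
    obtain ⟨t', a', ha⟩ : ∃ t' a', a ++ x :: y :: b = t' :: a' :=
      List.exists_cons_of_ne_nil (by simp)
    obtain ⟨a'', ha''⟩ : ∃ a'', a ++ [x] = t' :: a'' := by
      cases a with
      | nil =>
        obtain ⟨rfl, -⟩ := List.cons_eq_cons.1 ha
        exact ⟨[], rfl⟩
      | cons u a =>
        obtain ⟨rfl, -⟩ := List.cons_eq_cons.1 ha
        exact ⟨_, rfl⟩
    rw [List.cons_append, ha, pairSum, mul_entry_eq_zero hφ, zero_add, ← ha, ih (hφ.cons _)]
    · rfl
    · intro a₁ u v a₂ h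
      exact h₁ (t :: a₁) u v a₂ (by rw [List.cons_append, h]; rfl)
    · intro c u v d z h hz
      exact h₂ c u v d z h hz
    · intro z hz
      rw [h₁ [] t t' a'' (by rw [List.cons_append, ha'']; rfl)] at hz
      exact absurd hz (by simp)

theorem cutSum_eq_single {E M : Type*} [AddCommMonoid M] {Φ : List E → List E → M}
    (L R : List E) (h : ∀ a b, a ++ b = L ++ R → a ≠ L → Φ a b = 0) :
    cutSum Φ (L ++ R) = Φ L R := by
  rw [cutSum, Finset.sum_eq_single L.length]
  · simp
  · intro i hi hne
    refine h _ _ (List.take_append_drop i _) fun ht => hne ?_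
    have := congrArg List.length ht
    rw [List.length_take] at this
    simp only [Finset.mem_range] at hi
    omega
  · intro hn
    simp at hn

theorem descend_mul_eq_none {j : ZMod 4} {k : ℕ} {a₁ a₂ : List Letter} {u v : Letter}
    (h : baseWord (descend j k) = a₁ ++ u :: v :: a₂) : Letter.mul u v = none := by
  induction k generalizing j a₁ with
  | zero => simp [baseWord, descend] at h
  | succ k ih =>
    cases a₁ with
    | cons t a₁ => exact ih (List.cons_eq_cons.1 h).2
    | nil =>
      cases k with
      | zero => simp [baseWord, descend] at h
      | succ k =>
        simp only [baseWord, descend, List.map_cons, List.nil_append] at h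
        obtain ⟨hu, h⟩ := List.cons_eq_cons.1 h
        obtain ⟨hv, h⟩ := List.cons_eq_cons.1 h
        rw [← hu, ← hv]
        have h2 : ∀ j : ZMod 4, j - 1 ≠ j + ((0 : ℕ) : ZMod 4) + 1 := by decide
        simp only [Letter.mul, Basic.mul, if_neg (h2 j), Option.map_none]

theorem tiling_descend_ne {j : ZMod 4} {k : ℕ} (h : k ≠ 4) :
    tiling ((baseWord (descend j k)).map mono) = 0 :=
  tiling_baseWord_eq_zero fun _ hp => h (eq_of_mem_patterns_descend hp)

/-- The inner value is zero or `U` times an idempotent, and no chord sequence contains an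
idempotent. -/
theorem tiling_entry_descend (j : ZMod 4) (k : ℕ) (a b : List Letter) :
    tiling (a.map mono ++ tiling ((baseWord (descend j k)).map mono) :: b.map mono) = 0 := by
  by_cases hk : k = 4
  · subst hk
    rw [tiling_descend_four]
    have := tiling_eq_zero (l := a ++ (1, .idem (source j)) :: b)
      (not_mem_patterns_of_idem (e := source j) (by simp))
    simpa using this
  · rw [tiling_descend_ne hk]
    exact entryAdditive_tiling.zero_entry _ _

theorem tiling_pairSum {j : ZMod 4} {k n : ℕ} (rest : List Basic) :
    pairSum tiling (baseWord (descend j (k + 1) ++ .chord (j - k + 1) n :: rest)) =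
      tiling ((baseWord (descend j k ++ .chord (j - k) (n + 1) :: rest)).map mono) := by
  have h := pairSum_middle entryAdditive_tiling (a := baseWord (descend j k)) (b := baseWord rest)
    (x := (0, .chord (j - k) 0)) (y := (0, .chord (j - k + 1) n)) ?_ ?_
  · rw [descend_succ, List.append_assoc]
    refine (congrArg (pairSum tiling) ?_).trans (h.trans (congrArg tiling ?_))
    · simp [baseWord]
    · rw [mono_mul_mono]
      simp [baseWord, Letter.mul, Basic.mul]
  · intro a₁ u v a₂ h
    refine descend_mul_eq_none (j := j) (k := k + 1) (a₁ := a₁) (a₂ := a₂) ?_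
    rw [descend_succ, baseWord_append]
    exact h
  · intro c u v d z h hz
    refine tiling_eq_zero fun p => ?_
    have hj : ∃ m c', (c ++ z :: d).map Prod.snd = .chord (j - k + 1) m :: c' := by
      cases c with
      | cons t c =>
        obtain ⟨rfl, -⟩ := List.cons_eq_cons.1 h
        exact ⟨n, _, rfl⟩
      | nil =>
        obtain ⟨rfl, h⟩ := List.cons_eq_cons.1 h
        obtain ⟨-, -, -, -, hz⟩ := Letter.mul_eq_some hz
        obtain ⟨m, v⟩ := v
        cases v with
        | idem e =>
          simp only [Basic.mul, Option.ite_none_right_eq_some, Option.some.injEq] at hz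
          exact ⟨n, _, by rw [List.nil_append, List.map_cons, ← hz.2]⟩
        | chord i m =>
          simp only [Basic.mul, Option.ite_none_right_eq_some, Option.some.injEq] at hz
          exact ⟨_, _, by rw [List.nil_append, List.map_cons, ← hz.2]⟩
    obtain ⟨m, c', hc⟩ := hj
    have : (baseWord (descend j k) ++ (0, Basic.chord (j - k) 0) :: c ++ z :: d).map Prod.snd =
        descend j k ++ .chord (j - k) 0 :: .chord (j - k + 1) m :: c' := by
      rw [List.append_assoc, List.map_append, snd_baseWord, List.cons_append, List.map_cons, hc]
    rw [this]
    exact not_mem_patterns_of_ascending _ _ _ _ _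

theorem tiling_entry_eq_zero {a b : List Letter}
    (h : ∀ x p, p ∉ patterns (a.map Prod.snd ++ x :: b.map Prod.snd)) (e : Alg) :
    tiling (a.map mono ++ e :: b.map mono) = 0 := by
  rw [EntryAdditive.sum_supp entryAdditive_tiling]
  refine Finset.sum_eq_zero fun x _ => ?_
  have := tiling_eq_zero (l := a ++ x :: b) (by simpa using h x.2)
  simpa using this

/-- The ascending pair has to be torn apart: the inner operation must start exactly at its second
member, as otherwise one of the two chord sequences contains the pair or the inner operation sees
only descending arrows. -/
theorem tiling_tiling {j : ZMod 4} {k n : ℕ} (rest : List Basic) :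
    insOp tiling tiling
      ((baseWord (descend j (k + 1) ++ .chord (j - k + 1) n :: rest)).map mono) =
      cutSum (fun c d => tiling ((baseWord (descend j (k + 1))).map mono ++
        tiling ((baseWord c).map mono) :: (baseWord d).map mono))
        (.chord (j - k + 1) n :: rest) := by
  rw [insOp_map, baseWord, cutSum_map, cutSum_eq_single]
  · rw [cutSum_map]
    rfl
  · intro a r har hne
    rw [cutSum_map]
    refine cutSum_eq_zero fun c b hcb => ?_
    subst hcb
    change tiling ((baseWord a).map mono ++ tiling ((baseWord c).map mono) ::
      (baseWord b).map mono) = 0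
    -- The start of the inner string is compared with the end of the descending arrows. An inner
    -- string that starts earlier stops before the ascending chord or swallows the pair; one that
    -- starts later leaves the pair to the outer operation.
    rcases List.append_eq_append_iff.1 har with ⟨a', hL, hR⟩ | ⟨c', ha, hR⟩
    · rcases List.append_eq_append_iff.1 hR with ⟨a'', ha', hb⟩ | ⟨c', hc, hR'⟩
      · rcases List.eq_nil_or_concat a'' with rfl | ⟨a₀, y, rfl⟩
        · rw [ha'] at hL
          rw [(exists_descend hL).2.1]
          exact tiling_entry_descend _ _ _ _
        · rw [List.concat_eq_append] at *
          rw [ha', descend_succ, ← List.append_assoc, ← List.append_assoc] at hL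
          obtain ⟨-, hy⟩ := List.append_inj' hL rfl
          obtain rfl := List.singleton_inj.1 hy
          refine tiling_entry_eq_zero (fun x p => ?_) _
          rw [snd_baseWord, snd_baseWord, hb]
          have := not_mem_patterns_of_ascending (a ++ x :: a₀) rest (j - k) n p
          simpa using this
      · cases c' with
        | nil =>
          rw [List.append_nil] at hc
          subst hc
          rw [← List.append_nil c] at hL
          rw [(exists_descend hL).2.1]
          exact tiling_entry_descend _ _ _ _
        | cons x c' =>
          obtain ⟨rfl, -⟩ := List.cons_eq_cons.1 hR'
          rcases List.eq_nil_or_concat a' with rfl | ⟨a₀, y, rfl⟩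
          · rw [List.append_nil] at hL
            exact absurd hL.symm hne
          · rw [List.concat_eq_append] at *
            rw [descend_succ, ← List.append_assoc] at hL
            obtain ⟨-, hy⟩ := List.append_inj' hL rfl
            obtain rfl := List.singleton_inj.1 hy
            rw [hc, tiling_baseWord_eq_zero]
            · exact entryAdditive_tiling.zero_entry _ _
            · intro p
              have := not_mem_patterns_of_ascending a₀ c' (j - k) n p
              simpa using this
    · cases c' with
      | nil => exact absurd (by simpa using ha) hne
      | cons x c' =>
        obtain ⟨rfl, -⟩ := List.cons_eq_cons.1 hR
        refine tiling_entry_eq_zero (fun x p => ?_) _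
        rw [snd_baseWord, snd_baseWord, ha, descend_succ]
        have := not_mem_patterns_of_ascending (descend j k) (c' ++ x :: b) (j - k) n p
        simpa using this

theorem NotLeft.label_eq {p : TilingPattern} {s : ZMod 4} {l : List Basic} {n : ℕ}
    (h : p ∈ patterns (.chord s n :: l)) (hl : p.NotLeft) : p.label = s := by
  have hi := initial_of_mem_patterns h
  unfold TilingPattern.initial at hi
  cases he : p.extension with
  | left m => exact absurd he (hl m)
  | centered => simpa [he] using hi
  | right m => simpa [he] using hi

/-- Adds one sector on the left at the root. -/
def TilingPattern.extendLeft (p : TilingPattern) : TilingPattern :=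
  { p with extension := match p.extension with
    | .left m => .left (m + 1)
    | _ => .left 0 }

/-- There are no sectors on the right at the root. -/
def TilingPattern.NotRight (p : TilingPattern) : Prop := ∀ n, p.extension ≠ .right n

theorem tokens_extendLeft {p : TilingPattern} (h : p.NotRight) :
    p.extendLeft.tokens = some (p.initial - 1) :: p.tokens := by
  obtain ⟨a, b, c, i, x⟩ := p
  cases x with
  | right n => exact absurd rfl (h n)
  | centered =>
    simp [TilingPattern.extendLeft, TilingPattern.tokens, TilingPattern.tree, run_zero,
      TilingPattern.initial]
  | left n =>
    simp only [TilingPattern.extendLeft, TilingPattern.tokens, TilingPattern.tree, run_succ,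
      TilingPattern.initial, List.map_cons, List.cons_append, Nat.cast_add, Nat.cast_one]
    rw [show i - (n + 1 + 1) = i - (n + 1) - 1 by ring, sub_add_cancel]

theorem extendLeft_injective {p q : TilingPattern} (hp : p.NotRight) (hq : q.NotRight)
    (h : p.extendLeft = q.extendLeft) : p = q := by
  obtain ⟨a, b, c, i, x⟩ := p
  obtain ⟨a', b', c', i', x'⟩ := q
  cases x <;> cases x' <;> simp_all [TilingPattern.extendLeft, TilingPattern.NotRight]

theorem exists_extendLeft {p : TilingPattern} (hp : ¬ p.NotLeft) :
    ∃ q : TilingPattern, q.NotRight ∧ q.extendLeft = p := by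
  obtain ⟨a, b, c, i, x⟩ := p
  cases x with
  | centered => exact absurd (fun n => by simp) hp
  | right m => exact absurd (fun n => by simp) hp
  | left m =>
    cases m with
    | zero => exact ⟨⟨a, b, c, i, .centered⟩, fun n => by simp, rfl⟩
    | succ m => exact ⟨⟨a, b, c, i, .left m⟩, fun n => by simp, rfl⟩

/-- Multiplication by `ρ_s` from the left adds a sector on the left at the root. For a
right-extended pattern the product is zero instead, as the output starts with `s - 1`. -/
theorem arrow_mul_value {q : TilingPattern} {s : ZMod 4} (hi : q.initial = s + 1)
    (h : q.NotRight) : mono (0, .chord s 0) * q.value = q.extendLeft.value := by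
  obtain ⟨a, b, c, i, x⟩ := q
  cases x with
  | right n => exact absurd rfl (h n)
  | centered =>
    obtain rfl : i = s + 1 := hi
    simp [TilingPattern.value, TilingPattern.output, TilingPattern.extendLeft, mono_mul_mono,
      Letter.mul, Basic.mul, target, TilingPattern.tree]
  | left n =>
    replace hi : i - (n + 1) = s + 1 := hi
    have hi' : i - ((n : ZMod 4) + 1 + 1) = s := by linear_combination hi
    simp [TilingPattern.value, TilingPattern.output, TilingPattern.extendLeft, mono_mul_mono,
      Letter.mul, Basic.mul, TilingPattern.tree, hi, hi']

theorem arrow_mul_value_eq_zero {q : TilingPattern} {s : ZMod 4} (hi : q.initial = s + 1)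
    (h : ¬ q.NotRight) : mono (0, .chord s 0) * q.value = 0 := by
  obtain ⟨a, b, c, i, x⟩ := q
  cases x with
  | centered => exact absurd (fun n => by simp) h
  | left m => exact absurd (fun n => by simp) h
  | right n =>
    obtain rfl : i = s + 1 := hi
    have h2 : ∀ s : ZMod 4, s + 1 - 2 ≠ s + 1 := by decide
    simp [TilingPattern.value, TilingPattern.output, mono_mul_mono, Letter.mul, Basic.mul, h2 s]

theorem basicTokens_chord_succ (s : ZMod 4) (n : ℕ) (l : List Basic) :
    basicTokens (.chord s (n + 1) :: l) = some s :: basicTokens (.chord (s + 1) n :: l) := by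
  simp [basicTokens_cons, Basic.word, run_succ]

open Classical in
/-- The patterns extended on the left. -/
theorem sum_left (s : ZMod 4) (n : ℕ) (l : List Basic) :
    ∑ p ∈ (patterns_finite (.chord s (n + 1) :: l)).toFinset.filter (fun p => ¬ p.NotLeft), p.value =
      mono (0, .chord s 0) * tiling ((baseWord (.chord (s + 1) n :: l)).map mono) := by
  rw [tiling_baseWord, Finset.mul_sum]
  have h0 : ∀ q ∈ (patterns_finite (.chord (s + 1) n :: l)).toFinset,
      mono (0, .chord s 0) * q.value ≠ 0 → q.NotRight := by
    intro q hq hne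
    by_contra hr
    exact hne (arrow_mul_value_eq_zero
      (initial_of_mem_patterns ((Set.Finite.mem_toFinset _).1 hq)) hr)
  rw [← Finset.sum_filter_of_ne h0]
  symm
  refine Finset.sum_bij (fun q _ => q.extendLeft) ?_ ?_ ?_ ?_
  · intro q hq
    simp only [Finset.mem_filter, Set.Finite.mem_toFinset] at hq ⊢
    refine ⟨mem_patterns.2 ?_, fun h => ?_⟩
    · rw [tokens_extendLeft hq.2, initial_of_mem_patterns hq.1, add_sub_cancel_right,
        mem_patterns.1 hq.1, basicTokens_chord_succ]
    · unfold TilingPattern.NotLeft TilingPattern.extendLeft at h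
      cases he : q.extension <;> simp [he] at h
  · intro q hq q' hq' h
    simp only [Finset.mem_filter] at hq hq'
    exact extendLeft_injective hq.2 hq'.2 h
  · intro p hp
    simp only [Finset.mem_filter, Set.Finite.mem_toFinset] at hp
    obtain ⟨q, hq, rfl⟩ := exists_extendLeft hp.2
    refine ⟨q, ?_, rfl⟩
    simp only [Finset.mem_filter, Set.Finite.mem_toFinset]
    have := mem_patterns.1 hp.1
    rw [tokens_extendLeft hq, basicTokens_chord_succ] at this
    exact ⟨mem_patterns.2 (List.cons_eq_cons.1 this).2, hq⟩
  · intro q hq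
    simp only [Finset.mem_filter, Set.Finite.mem_toFinset] at hq
    exact arrow_mul_value (initial_of_mem_patterns hq.1) hq.2

theorem notLeft_of_mem_patterns {s : ZMod 4} {l : List Basic} {p : TilingPattern}
    (h : p ∈ patterns (.chord s 0 :: l)) : p.NotLeft ∧ p.label = s ∧ p.first = .leaf ∧
      some (p.label - 1) :: (p.second.tokens p.label ++ some (p.label - 2) ::
        (p.third.tokens (p.label - 1) ++ some (p.label - 3) :: p.tail)) = basicTokens l :=
  notLeft_of_tokens ((mem_patterns.1 h).trans (basicTokens_arrow s l))

theorem notLeft_of_mem_patterns_two {s : ZMod 4} {l : List Basic} {p : TilingPattern}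
    (h : p ∈ patterns (.chord (s + 1) 0 :: .chord s 0 :: l)) :
    p.NotLeft ∧ p.label = s + 1 ∧ p.first = .leaf ∧ p.second = .leaf := by
  obtain ⟨h1, h2, h3, h4⟩ := notLeft_of_mem_patterns h
  rw [basicTokens_arrow] at h4
  obtain ⟨-, h4⟩ := List.cons_eq_cons.1 h4
  exact ⟨h1, h2, h3, (tree_tokens_none h4).1⟩

open Classical in
theorem tiling_graft {s : ZMod 4} {pre : List (Option (ZMod 4))} (G : Graft s pre)
    {L l : List Basic} (hL : basicTokens L = pre ++ [some s, none])
    (hD : ∀ p y d, p ∈ patterns (L ++ y :: d) → G.D p) {n : ℕ} {rest : List Basic}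
    (hl : basicTokens l = pre ++ some s :: basicTokens (.chord (s + 1) n :: rest))
    (hDl : ∀ p ∈ patterns l, G.D p) :
    tiling ((baseWord l).map mono) = cutSum (fun c d => tiling ((baseWord L).map mono ++
        tiling ((baseWord c).map mono) :: (baseWord d).map mono)) (.chord (s + 1) n :: rest) := by
  simp only [tiling_insert_tiling]
  rw [← sum_graft G hL hD hl, tiling_baseWord, Finset.filter_true_of_mem]
  intro p hp
  exact hDl p ((Set.Finite.mem_toFinset _).1 hp)

-- A pattern whose first chord has at least two labels either is left-extended, and then its first
-- sector splits off as a factor of the output, or has a subtree grafted at the first input.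
open Classical in
theorem tiling_graft_first (s : ZMod 4) (n : ℕ) (rest : List Basic) :
    tiling ((baseWord (.chord s (n + 1) :: rest)).map mono) =
      mono (0, .chord s 0) * tiling ((baseWord (.chord (s + 1) n :: rest)).map mono) +
      cutSum (fun c d => tiling ((baseWord [.chord s 0]).map mono ++
        tiling ((baseWord c).map mono) :: (baseWord d).map mono)) (.chord (s + 1) n :: rest) := by
  simp only [tiling_insert_tiling]
  rw [← sum_left, ← sum_graft (graftFirst s) (L := [.chord s 0])
    (l := .chord s (n + 1) :: rest) (basicTokens_arrow s []), tiling_baseWord,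
    ← Finset.sum_filter_add_sum_filter_not _ (fun p => p.NotLeft)]
  · refine Eq.trans (add_comm _ _) ?_
    congr 1
    refine Finset.sum_congr (Finset.filter_congr fun p hp => ?_) fun _ _ => rfl
    exact ⟨fun h => ⟨h, NotLeft.label_eq ((Set.Finite.mem_toFinset _).1 hp) h⟩, fun h => h.1⟩
  · intro p y d hp
    obtain ⟨h1, h2, -⟩ := notLeft_of_mem_patterns hp
    exact ⟨h1, h2⟩
  · rw [basicTokens_chord_succ]
    rfl

theorem tiling_graft_second (s : ZMod 4) (n : ℕ) (rest : List Basic) :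
    tiling ((baseWord (.chord (s + 1) 0 :: .chord s (n + 1) :: rest)).map mono) =
      cutSum (fun c d => tiling ((baseWord [.chord (s + 1) 0, .chord s 0]).map mono ++
        tiling ((baseWord c).map mono) :: (baseWord d).map mono)) (.chord (s + 1) n :: rest) := by
  refine tiling_graft (graftSecond s) ?_ ?_ ?_ ?_
  · simp [basicTokens_arrow, basicTokens_nil]
  · intro p y d hp
    obtain ⟨h1, h2, h3, -⟩ := notLeft_of_mem_patterns hp
    exact ⟨h1, h2, h3⟩
  · rw [basicTokens_arrow, basicTokens_chord_succ]
    rfl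
  · intro p hp
    obtain ⟨h1, h2, h3, -⟩ := notLeft_of_mem_patterns hp
    exact ⟨h1, h2, h3⟩

theorem tiling_graft_third (s : ZMod 4) (n : ℕ) (rest : List Basic) :
    tiling ((baseWord (.chord (s + 2) 0 :: .chord (s + 1) 0 :: .chord s (n + 1) :: rest)).map mono) =
      cutSum (fun c d => tiling ((baseWord [.chord (s + 2) 0, .chord (s + 1) 0, .chord s 0]).map mono ++
        tiling ((baseWord c).map mono) :: (baseWord d).map mono)) (.chord (s + 1) n :: rest) := by
  have e : s + 2 = s + 1 + 1 := by ring
  refine tiling_graft (graftThird s) ?_ ?_ ?_ ?_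
  · simp [basicTokens_arrow, basicTokens_nil]
  · intro p y d hp
    rw [e] at hp
    obtain ⟨h1, h2, h3, h4⟩ := notLeft_of_mem_patterns_two hp
    exact ⟨h1, e ▸ h2, h3, h4⟩
  · rw [basicTokens_arrow, basicTokens_arrow, basicTokens_chord_succ]
    rfl
  · intro p hp
    rw [e] at hp
    obtain ⟨h1, h2, h3, h4⟩ := notLeft_of_mem_patterns_two hp
    exact ⟨h1, e ▸ h2, h3, h4⟩

/-- The right outer product drops out unless the last letter belongs to the ascending pair, for
otherwise the pair is among the inputs of `tiling`. -/
theorem tiling_binary_ascending (j : ZMod 4) (k n : ℕ) (rest : List Basic) :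
    insOp tiling binary
      ((baseWord (descend j (k + 1) ++ .chord (j - k + 1) n :: rest)).map mono) =
      mono (0, .chord j 0) *
        tiling ((baseWord (descend (j - 1) k ++ .chord (j - k + 1) n :: rest)).map mono) +
      (if rest = [] then tiling ((baseWord (descend j (k + 1))).map mono) *
        mono (0, .chord (j - k + 1) n) else 0) := by
  rcases List.eq_nil_or_concat rest with rfl | ⟨rest, y, rfl⟩
  · rw [insOp_binary_right tiling
      (w := baseWord (descend j (k + 1) ++ [Basic.chord (j - k + 1) n])) (x := (0, .chord j 0))
      (v := baseWord (descend (j - 1) k ++ [Basic.chord (j - k + 1) n]))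
      (l := baseWord (descend j (k + 1))) (y := (0, .chord (j - k + 1) n)) rfl
      (by rw [baseWord_append]; rfl), if_pos rfl]
  · rw [List.concat_eq_append, insOp_binary_right tiling
      (w := baseWord (descend j (k + 1) ++ .chord (j - k + 1) n :: (rest ++ [y])))
      (x := (0, .chord j 0))
      (v := baseWord (descend (j - 1) k ++ .chord (j - k + 1) n :: (rest ++ [y])))
      (l := baseWord (descend j (k + 1) ++ .chord (j - k + 1) n :: rest)) (y := (0, y)) rfl
      (by simp [baseWord]), if_neg (by simp)]
    congr 1
    rw [tiling_baseWord_eq_zero, zero_mul]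
    intro p
    rw [descend_succ]
    have := not_mem_patterns_of_ascending (descend j k) rest (j - k) n p
    simpa using this

theorem tiling_tail_ascending (j : ZMod 4) (k n : ℕ) (rest : List Basic) :
    tiling ((baseWord (descend (j - 1) (k + 1) ++
      .chord (j - ((k + 1 : ℕ) : ZMod 4) + 1) n :: rest)).map mono) = 0 := by
  refine tiling_baseWord_eq_zero fun p => ?_
  rw [descend_succ]
  have := not_mem_patterns_of_ascending (descend (j - 1) k) rest (j - 1 - k) n p
  rw [List.append_assoc]
  rwa [show j - ((k + 1 : ℕ) : ZMod 4) + 1 = j - 1 - k + 1 by push_cast; ring]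

/-- The product at the ascending place, `k + 1` arrows into the word, has to cancel against the
other terms. For `k` below three it closes up the quadrant `j - k` of the root vertex, and the
cancellation is the grafting at the corresponding input. A fourth arrow already completes the
vertex. -/
theorem defect_ascending (j : ZMod 4) (k n : ℕ) (rest : List Basic) :
    defect ((baseWord (descend j (k + 1) ++ .chord (j - k + 1) n :: rest)).map mono) = 0 := by
  have hr : ∀ k, k ≠ 3 → (if rest = [] then tiling ((baseWord (descend j (k + 1))).map mono) *
      mono (0, .chord (j - k + 1) n) else 0) = 0 := by
    intro k hk
    rw [tiling_descend_ne (by omega), zero_mul, ite_self]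
  rw [defect_eq, insOp_binary_left entryAdditive_tiling, tiling_pairSum, tiling_tiling,
    tiling_binary_ascending]
  -- Only for `k = 0` does the left outer product contribute, matching the left-extended patterns;
  -- only for `k = 3` can the right one.
  match k with
  | 0 =>
    rw [hr 0 (by omega), add_zero]
    have := tiling_graft_first (j - ((0 : ℕ) : ZMod 4)) n rest
    simp only [Nat.cast_zero, sub_zero] at this
    simp only [descend, List.nil_append, Nat.cast_zero, sub_zero]
    rw [this, add_assoc (_ + _)]
    exact add_self_eq_zero' _
  | 1 =>
    rw [hr 1 (by omega), add_zero, tiling_tail_ascending, mul_zero, add_zero]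
    have := tiling_graft_second (j - ((1 : ℕ) : ZMod 4)) n rest
    simp only [Nat.cast_one, sub_add_cancel] at this
    simp only [descend, List.cons_append, List.nil_append, Nat.cast_one, sub_add_cancel, this]
    exact add_self_eq_zero' _
  | 2 =>
    rw [hr 2 (by omega), add_zero, tiling_tail_ascending, mul_zero, add_zero]
    have := tiling_graft_third (j - ((2 : ℕ) : ZMod 4)) n rest
    simp only [Nat.cast_ofNat, sub_add_cancel, show j - 2 + 1 = j - 1 by ring] at this
    simp only [descend, List.cons_append, List.nil_append, Nat.cast_ofNat, this,
      show j - 1 - 1 = j - 2 by ring, show j - 2 + 1 = j - 1 by ring]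
    exact add_self_eq_zero' _
  | k + 3 =>
    rw [tiling_tail_ascending, mul_zero, zero_add, cutSum_eq_zero, add_zero]
    -- Four arrows followed by one ascending chord: the right-extended pattern gives `U` times this
    -- chord, and so does the centered pattern on the four arrows, multiplied by the chord.
    · by_cases h : k = 0 ∧ rest = []
      · obtain ⟨rfl, rfl⟩ := h
        have h3 : ((0 + 3 : ℕ) : ZMod 4) = 3 := rfl
        rw [if_pos rfl, tiling_descend_four, h3, show (0 + 3) = 3 from rfl, tiling_descend_three,
          show j - 3 + 1 = j - 2 by ring, mono_mul_mono]
        have : source j = source (j - 2) := (source_sub_two j).symm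
        simp [Letter.mul, Basic.mul, this, add_self_eq_zero']
      · have h1 : tiling ((baseWord (descend j (k + 3) ++
            .chord (j - ((k + 3 : ℕ) : ZMod 4)) (n + 1) :: rest)).map mono) = 0 := by
          refine tiling_baseWord_eq_zero fun p hp => ?_
          rw [add_comm k, descend_add, List.append_assoc] at hp
          have := length_of_descend hp
          simp only [List.length_append, length_descend, List.length_cons] at this
          exact h ⟨by omega, List.length_eq_zero_iff.1 (by omega)⟩
        rw [h1, zero_add]
        by_cases hrest : rest = []
        · exact hr (k + 3) fun hk => h ⟨by omega, hrest⟩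
        · rw [if_neg hrest]
    · intro c d _
      rw [tiling_insert_tiling]
      refine Finset.sum_eq_zero fun q _ => Finset.sum_eq_zero fun p hp => ?_
      have hp := (Set.Finite.mem_toFinset _).1 hp
      rw [show k + 3 + 1 = 3 + (k + 1) by ring, descend_add, List.append_assoc] at hp
      have := length_of_descend hp
      simp only [List.length_append, length_descend, List.length_cons] at this
      omega

/-- Products of neighbours vanish, as does `tiling` inserted in itself. The only terms that can be
non-zero are the outer products for five arrows, which agree because `U` commutes with `ρ_j`. -/
theorem defect_descend (j : ZMod 4) (k : ℕ) :
    defect ((baseWord (descend j k)).map mono) = 0 := by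
  have hp : pairSum tiling (baseWord (descend j k)) = 0 := by
    refine pairSum_eq_zero entryAdditive_tiling fun a x y b z h hz => ?_
    rw [descend_mul_eq_none h] at hz
    exact absurd hz (by simp)
  have ht : insOp tiling tiling ((baseWord (descend j k)).map mono) = 0 := by
    rw [insOp_map, baseWord, cutSum_map]
    refine cutSum_eq_zero fun a r har => ?_
    rw [cutSum_map]
    refine cutSum_eq_zero fun c b hcb => ?_
    subst hcb
    change tiling ((baseWord a).map mono ++ tiling ((baseWord c).map mono) ::
      (baseWord b).map mono) = 0
    rw [(exists_descend har.symm).2.1]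
    exact tiling_entry_descend _ _ _ _
  rw [defect_eq, insOp_binary_left entryAdditive_tiling, hp, ht, zero_add, add_zero]
  cases k with
  | zero => exact insOp_binary_right_nil _
  | succ k =>
    rw [insOp_binary_right tiling (w := baseWord (descend j (k + 1))) (x := (0, .chord j 0)) (v := baseWord (descend (j - 1) k))
      (l := baseWord (descend j k)) (y := (0, .chord (j - k) 0)) rfl
      (by rw [descend_succ, baseWord_append]; rfl)]
    by_cases hk : k = 4
    · subst hk
      have h1 : ∀ j : ZMod 4, source (j - 1) = target j 0 := by decide
      have h2 : j - ((4 : ℕ) : ZMod 4) = j := by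
        rw [show ((4 : ℕ) : ZMod 4) = 0 from rfl, sub_zero]
      rw [tiling_descend_four, tiling_descend_four, h2, mono_mul_mono, mono_mul_mono, h1]
      simp [Letter.mul, Basic.mul, add_self_eq_zero']
    · rw [tiling_descend_ne hk, tiling_descend_ne hk, mul_zero, zero_mul, add_zero]

end TorusAlgebra

/-! ### Critical words, and the square of the differential -/

namespace TorusAlgebra

open ListCalculus TilingPattern

theorem eq_baseWord {w : List Letter} (h : uCount w = 0) : w = baseWord (w.map Prod.snd) := by
  induction w with
  | nil => rfl
  | cons x w ih =>
    rw [uCount_cons] at h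
    obtain ⟨m, b⟩ := x
    obtain rfl : m = 0 := by simp only at h; omega
    rw [List.map_cons, baseWord, List.map_cons, ← baseWord, ← ih (by omega)]

/-- At the end of `ρ_i` two arrows start, `ρ_{i+1}` and `ρ_{i-1}`, and the first of them forms a
normal pair with `ρ_i`. A `U` forms a normal pair with every composable letter that is not an
idempotent, so it can only come last. -/
theorem critical_of_some {w : List Letter} {i : ZMod 4} {g : Gam} {t : Fin 2}
    (h : IsCritical (some (0, .chord i 0)) w) (hp : IsPath w g (target i 0) t) :
    ∃ k, w = baseWord (descend (i - 1) k) ∨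
      ∃ e, w = baseWord (descend (i - 1) k) ++ [(1, .idem e)] := by
  induction w generalizing i g with
  | nil => exact ⟨0, Or.inl rfl⟩
  | cons x w ih =>
    obtain ⟨h1, h2, h3⟩ := h
    obtain ⟨hs, g', -, hp⟩ := hp
    cases h2 with
    | u e =>
      refine ⟨0, Or.inr ⟨e, ?_⟩⟩
      cases w with
      | nil => rfl
      | cons y w =>
        obtain ⟨h1, h2, -⟩ := h3
        exact absurd (isNormalPair_u.2 ⟨hp.1, h2.weight_pos⟩) (h1 _ rfl)
    | arrow k =>
      have hk : k ≠ i + 1 := fun hk => h1 _ rfl (isNormalPair_arrow.2 ⟨0, by rw [hk]⟩)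
      have key : ∀ i k : ZMod 4, source k = target i 0 → k ≠ i + 1 → k = i - 1 := by decide
      obtain rfl : k = i - 1 := key i k hs hk
      obtain ⟨k, h | ⟨e, h⟩⟩ := ih h3 hp
      · exact ⟨k + 1, Or.inl (by rw [h]; rfl)⟩
      · exact ⟨k + 1, Or.inr ⟨e, by rw [h]; rfl⟩⟩

/-- The critical words are the descending sequences of arrows, possibly followed by `U`. -/
theorem critical_of_none {w : List Letter} {g : Gam} {s t : Fin 2} (h : IsCritical none w)
    (hp : IsPath w g s t) : ∃ j k, w = baseWord (descend j k) ∨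
      ∃ e, w = baseWord (descend j k) ++ [(1, .idem e)] := by
  cases w with
  | nil => exact ⟨0, 0, Or.inl rfl⟩
  | cons x w =>
    obtain ⟨-, h2, h3⟩ := h
    obtain ⟨-, g', -, hp⟩ := hp
    cases h2 with
    | u e =>
      refine ⟨0, 0, Or.inr ⟨e, ?_⟩⟩
      cases w with
      | nil => rfl
      | cons y w =>
        obtain ⟨h1, h2, -⟩ := h3
        exact absurd (isNormalPair_u.2 ⟨hp.1, h2.weight_pos⟩) (h1 _ rfl)
    | arrow i =>
      obtain ⟨k, h | ⟨e, h⟩⟩ := critical_of_some h3 hp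
      · exact ⟨i, k + 1, Or.inl (by rw [h]; rfl)⟩
      · exact ⟨i, k + 1, Or.inr ⟨e, by rw [h]; rfl⟩⟩

theorem eq_descend_of_none {w : List Letter} {g : Gam} {s t : Fin 2} (h : IsCritical none w)
    (hw : uCount w = 0) (hp : IsPath w g s t) : ∃ j, w = baseWord (descend j w.length) := by
  obtain ⟨j, k, rfl | ⟨e, rfl⟩⟩ := critical_of_none h hp
  · exact ⟨j, by simp [baseWord, length_descend]⟩
  · simp [uCount_append, uCount_cons] at hw

theorem exists_unit_of_not_isReduced {w : List Letter} (h : ¬ IsReduced w) :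
    ∃ e, ((0, .idem e) : Letter) ∈ w := by
  unfold IsReduced at h
  push Not at h
  obtain ⟨⟨m, b⟩, hx, h⟩ := h
  cases b with
  | chord i n => simp [Letter.weight, Letter.len] at h
  | idem e =>
    obtain rfl : m = 0 := by simpa [Letter.weight, Letter.len] using h
    exact ⟨e, hx⟩

theorem exists_coeff_ne_zero {a : Alg} (h : a ≠ 0) : ∃ y, coeff y a ≠ 0 := by
  by_contra hc
  push Not at hc
  exact h (alg_ext fun y => by rw [hc, map_zero])

/-- Without `U`s, a word that arises by splitting consists of descending arrows up to the first
factor, followed by an ascending chord and an arbitrary tail; a critical word consists of descending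
arrows only. These are the words on which the relation has been verified. On words that are not
composable the grading forces the value zero. -/
theorem defect_eq_zero_of_up_eq_none {w : List Letter} (hr : IsReduced w) (hu : uCount w = 0)
    (h : up none w = none) : defect (w.map mono) = 0 := by
  by_contra hne
  obtain ⟨y, hy⟩ := exists_coeff_ne_zero hne
  obtain ⟨g, hp, -⟩ := isGradedMap_defect w y hy
  refine hne ?_
  rcases up_trichotomy (prev := none) (by simp) hr with ⟨w', h'⟩ | ⟨q, hq, -⟩ | ⟨v, hv, h'⟩ | hc
  · rw [h] at h'
    exact absurd h' (by simp)
  · exact absurd hq (by simp)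
  · obtain ⟨a, p, x, z, b, -, rfl, hz, hc⟩ := up_eq_some (by simp) hv h'
    have hap : a ++ p :: x :: b = (a ++ [p]) ++ x :: b := by simp
    rw [hap, uCount_append, uCount_cons] at hu
    rw [hap] at hp
    obtain ⟨_, _, _, -, hp, -⟩ := isPath_append.1 hp
    obtain ⟨j, hj⟩ := eq_descend_of_none hc (by omega) hp
    rw [List.length_append, List.length_singleton] at hj
    have hp' := hj
    rw [descend_succ, baseWord_append] at hp'
    obtain ⟨-, hp'⟩ := List.append_inj' hp' rfl
    obtain rfl : p = _ := List.singleton_inj.1 hp'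
    obtain ⟨n, rfl⟩ := isNormalPair_arrow.1 ⟨z, hz⟩
    have := defect_ascending j a.length n (b.map Prod.snd)
    rw [baseWord_append, ← hj, baseWord, List.map_cons, ← baseWord, ← eq_baseWord (by omega)] at this
    rw [hap]
    exact this
  · obtain ⟨j, hj⟩ := eq_descend_of_none hc hu hp
    rw [hj]
    exact defect_descend _ _

/-- Induction on the length and the measure of words. -/
theorem word_induction {P : List Letter → Prop} (h : ∀ w, (∀ v, v.length < w.length → P v) →
    (∀ v, v.length = w.length → wordSize v < wordSize w → P v) → P w) (w : List Letter) : P w := by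
  have key : ∀ n s (w : List Letter), w.length = n → wordSize w = s → P w := by
    intro n
    induction n using Nat.strong_induction_on with
    | _ n ihn =>
      intro s
      induction s using Nat.strong_induction_on with
      | _ s ihs =>
        rintro w rfl rfl
        exact h w (fun v hv => ihn _ hv _ v rfl rfl) fun v hv hs => ihs _ hs v hv rfl
  exact key _ _ w rfl rfl

theorem totalWeight_eq (w : List Letter) :
    totalWeight w = uCount w + totalWeight (w.map Letter.base) := by
  induction w with
  | nil => rfl
  | cons x w ih =>
    rw [totalWeight_cons, uCount_cons, List.map_cons, totalWeight_cons, ih, Letter.weight]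
    have : Letter.weight (Letter.base x) = Letter.len x := by
      simp [Letter.weight, Letter.base, Letter.len]
    rw [this]
    ring

theorem uCount_base (w : List Letter) : uCount (w.map Letter.base) = 0 := by
  simp [uCount, Letter.base, Function.comp_def]

theorem inversions_base (w : List Letter) : inversions (w.map Letter.base) = 0 := by
  induction w with
  | nil => rfl
  | cons x w ih => rw [List.map_cons, inversions, uCount_base, ih, mul_zero]

/-- The `A∞`-relation for the undeformed operations. -/
theorem defect_eq_zero (l : List Alg) : defect l = 0 := by
  refine EntryAdditive.eq_zero entryAdditive_defect (fun w => ?_) l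
  refine word_induction (P := fun w => defect (w.map mono) = 0) (fun w ih₁ ih₂ => ?_) w
  -- If the word contains a `U`, linearity reduces it to the word without `U`s, which is smaller;
  -- idempotents are excluded by normalization.
  have direct : ∀ v : List Letter, v.length = w.length → wordSize v ≤ wordSize w →
      up none v = none → defect (v.map mono) = 0 := by
    intro v hl hs hv
    by_cases hr : IsReduced v
    · by_cases hu : uCount v = 0
      · exact defect_eq_zero_of_up_eq_none hr hu hv
      · rw [isULinear_defect v, ih₂ _ (by simpa using hl), mul_zero]
        have := totalWeight_eq v
        rw [wordSize, wordSize, inversions_base] at *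
        omega
    · exact isNormalized_defect v (exists_unit_of_not_isReduced hr)
  cases hw : up none w with
  | none => exact direct w rfl le_rfl hw
  | some w' =>
    by_cases hr : IsReduced w
    -- On a word that splits, the value of the defect is the value of its differential on the split
    -- word, which is zero.
    · rw [← differential_up hr hw entryAdditive_defect ih₁ ?_, differential_defect]
      intro v hl hs h
      exact h.elim (fun h => ih₂ v hl h) fun h => direct v hl hs h
    · exact isNormalized_defect w (exists_unit_of_not_isReduced hr)

/-- The polarization of `insOp_insOp`, obtained by applying it to `m + m'`. -/
theorem insOp_insOp_add {m m' φ : List Alg → Alg} (hm : EntryAdditive m) (hm' : EntryAdditive m')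
    (hφ : EntryAdditive φ) (l : List Alg) : insOp m (insOp m' φ) l + insOp m' (insOp m φ) l =
      insOp (insOp m m') φ l + insOp (insOp m' m) φ l := by
  have hs : EntryAdditive fun c => m c + m' c := by
    intro p q x y
    simp only [hm p q x y, hm' p q x y]
    abel
  have h := insOp_insOp (fun c => m c + m' c) hφ l
  have e1 : insOp (fun c => m c + m' c) φ = fun l => insOp m φ l + insOp m' φ l :=
    funext fun l => insOp_add_left _ _ hφ l
  have e2 : insOp (fun c => m c + m' c) (fun c => m c + m' c) = fun l =>
      (insOp m m l + insOp m' m' l) + (insOp m m' l + insOp m' m l) := by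
    funext l
    rw [insOp_add_left _ _ hs, insOp_add_right, insOp_add_right]
    abel
  have ha : ∀ {a b : List Alg → Alg}, EntryAdditive a → EntryAdditive b →
      EntryAdditive fun l => a l + b l := by
    intro a b ha hb p q x y
    simp only [ha p q x y, hb p q x y]
    abel
  rw [e1, e2, insOp_add_right, insOp_add_left _ _ (hm.insOp hφ), insOp_add_left _ _ (hm'.insOp hφ),
    insOp_add_left _ _ hφ, insOp_add_left _ _ hφ, insOp_add_left _ _ hφ, insOp_insOp _ hφ,
    insOp_insOp _ hφ] at h
  generalize insOp (insOp m m) φ l = A at h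
  generalize insOp (insOp m' m') φ l = B at h
  have h' : (A + B) + (insOp m' (insOp m φ) l + insOp m (insOp m' φ) l) =
      (A + B) + (insOp (insOp m m') φ l + insOp (insOp m' m) φ l) := by
    rw [← h]
    abel
  rw [add_comm, add_left_cancel h']

/-- The terms with `undeformedOp` inserted twice vanish by the `A∞`-relation, and the mixed ones
cancel by the polarized identity. -/
theorem differential_differential {φ : List Alg → Alg} (hφ : EntryAdditive φ) (l : List Alg) :
    differential (differential φ) l = 0 := by
  have h := entryAdditive_undeformedOp
  have hd : insOp undeformedOp undeformedOp = fun _ => (0 : Alg) := funext defect_eq_zero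
  have h1 : insOp undeformedOp (insOp undeformedOp φ) l = 0 := by
    rw [insOp_insOp _ hφ, hd, insOp_zero_left hφ]
  have h2 := insOp_insOp_add h hφ h l
  rw [hd, insOp_zero_right, add_zero] at h2
  have e : differential φ = fun l => insOp undeformedOp φ l + insOp φ undeformedOp l := rfl
  rw [differential, e, insOp_add_right, insOp_add_left _ _ h, h1, zero_add, h2, add_self_eq_zero']

end TorusAlgebra

/-! ### Degrees of critical words -/

namespace TorusAlgebra

open ListCalculus TilingPattern

theorem lam_components (k : ℤ) (w : ℕ) : (lam k w).1.1 = ⟨k, 0, 0⟩ ∧ (lam k w).2.toAdd = w := by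
  have h1 : ∀ k : ℕ, (lamD ^ k).1.1 = ⟨k, 0, 0⟩ ∧ (lamD ^ k).2.toAdd = 0 := by
    intro k
    induction k with
    | zero => exact ⟨by simp [Triple.one_def], rfl⟩
    | succ k ih =>
      rw [pow_succ]
      refine ⟨?_, ?_⟩
      · rw [gam_mul, ih.1, Triple.mul_def]
        simp [lamD, gam]
      · rw [Prod.snd_mul, toAdd_mul, ih.2]
        rfl
  have h2 : ∀ k : ℕ, (lamW ^ k).1.1 = ⟨0, 0, 0⟩ ∧ (lamW ^ k).2.toAdd = k := by
    intro k
    induction k with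
    | zero => exact ⟨by simp [Triple.one_def], rfl⟩
    | succ k ih =>
      rw [pow_succ]
      refine ⟨?_, ?_⟩
      · rw [gam_mul, ih.1, Triple.mul_def]
        simp [lamW, gam]
      · rw [Prod.snd_mul, toAdd_mul, ih.2]
        simp [lamW, gam]
  have h3 : (lamD ^ k).1.1 = ⟨k, 0, 0⟩ ∧ (lamD ^ k).2.toAdd = 0 := by
    obtain ⟨n, rfl | rfl⟩ := k.eq_nat_or_neg
    · rw [zpow_natCast]
      simpa using h1 n
    · rw [zpow_neg, zpow_natCast]
      have := h1 n
      refine ⟨?_, ?_⟩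
      · change ((lamD ^ n).1.1)⁻¹ = _
        rw [this.1, Triple.inv_def]
        simp
      · rw [Prod.snd_inv, toAdd_inv, this.2, neg_zero]
  rw [lam, gam_mul, h3.1, (h2 w).1, Triple.mul_def, Prod.snd_mul, toAdd_mul, h3.2, (h2 w).2]
  simp

theorem lam_injective {k k' : ℤ} {w w' : ℕ} (h : lam k w = lam k' w') : k = k' ∧ w = w' := by
  have h1 := (lam_components k w)
  rw [h, (lam_components k' w').1, (lam_components k' w').2] at h1
  simpa [eq_comm] using h1

theorem lamD_eq : lamD = lam 1 0 := by simp [lam]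

theorem uDegree_eq : uDegree = lam (-2) 1 := by
  refine gam_ext ?_ ?_ ?_ ?_ <;> simp only [lam_components] <;> simp [uDegree, gam]

theorem lam_pow (k : ℤ) (w n : ℕ) : lam k w ^ n = lam (n * k) (n * w) := by
  induction n with
  | zero => simp [lam]
  | succ n ih =>
    rw [pow_succ, ih, lam_mul]
    congr 1
    · push_cast; ring
    · ring

/-- The degree of an ascending product of `l` arrows. -/
def ascDegree : ZMod 4 → ℕ → Gam
  | _, 0 => 1
  | i, l + 1 => arrowDegree i * ascDegree (i + 1) l

/-- The degree of a descending sequence of arrows in the bar construction. -/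
def descDegree : ZMod 4 → ℕ → Gam
  | _, 0 => 1
  | j, k + 1 => lamD * arrowDegree j * descDegree (j - 1) k

theorem degree_chord (i : ZMod 4) (n : ℕ) : (Basic.chord i n).degree = ascDegree i (n + 1) := by
  induction n generalizing i with
  | zero => simp [Basic.degree, run_zero, ascDegree]
  | succ n ih =>
    rw [ascDegree, ← ih, Basic.degree, run_succ, List.map_cons, List.prod_cons, Basic.degree]

theorem degree_arrow (j : ZMod 4) : Letter.barDegree (0, .chord j 0) = lamD * arrowDegree j := by
  simp [Letter.barDegree, Letter.degree, degree_chord, ascDegree]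

theorem totalDegree_descend (j : ZMod 4) (k : ℕ) :
    totalDegree (baseWord (descend j k)) = descDegree j k := by
  induction k generalizing j with
  | zero => rfl
  | succ k ih =>
    rw [descDegree, ← ih, ← degree_arrow, totalDegree, totalDegree, descend, baseWord,
      List.map_cons, List.map_cons, List.prod_cons, baseWord]

/-- The four shifts give `lamD ^ 4`, of which `lamD ^ 2` turns the arrows into the degree of `U`,
that is `lam (-2) 1`; the remaining shifts leave `lamW`. -/
theorem descDegree_four (j : ZMod 4) (k : ℕ) : descDegree j (k + 4) = lam 0 1 * descDegree j k := by
  have h : lamD * arrowDegree j * (lamD * arrowDegree (j - 1) * (lamD * arrowDegree (j - 2) *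
      (lamD * arrowDegree (j - 3)))) = lam 0 1 := by
    have hc := arrowDegree_cycle j
    rw [uDegree_eq] at hc
    have h2 : lam 0 1 = lamD ^ 2 * lam (-2) 1 := by
      rw [lamD_eq, lam_pow, lam_mul]
      norm_num
    rw [h2, ← hc]
    have := mul_central_mul (G := Gam) (z₁ := lamD) (z₂ := lamD) (z₃ := lamD) commute_lamD
      commute_lamD commute_lamD (arrowDegree j) (arrowDegree (j - 1)) (arrowDegree (j - 2))
      (arrowDegree (j - 3))
    simp only [mul_assoc] at this ⊢
    rw [this]
    simp only [pow_two, mul_assoc]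
  have e : descDegree j (k + 4) = lamD * arrowDegree j * (lamD * arrowDegree (j - 1) *
      (lamD * arrowDegree (j - 1 - 1) * (lamD * arrowDegree (j - 1 - 1 - 1) *
        descDegree (j - 1 - 1 - 1 - 1) k))) := rfl
  have e1 : j - 1 - 1 = j - 2 := by ring
  have e2 : j - 2 - 1 = j - 3 := by ring
  have e3 : j - 3 - 1 = j := by
    rw [sub_sub, show (3 : ZMod 4) + 1 = 0 from rfl, sub_zero]
  rw [e, e1, e2, e3, ← h]
  simp only [mul_assoc]

theorem ascDegree_cycle (i : ZMod 4) : arrowDegree i * (arrowDegree (i + 1) * (arrowDegree (i + 2) *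
    arrowDegree (i + 3))) = lam (-2) 1 := by
  rw [← uDegree_eq]
  have h : i = 0 ∨ i = 1 ∨ i = 2 ∨ i = 3 := by revert i; decide
  have e : (0 : ZMod 4) + 1 = 1 ∧ (0 : ZMod 4) + 2 = 2 ∧ (0 : ZMod 4) + 3 = 3 ∧
    (1 : ZMod 4) + 1 = 2 ∧ (1 : ZMod 4) + 2 = 3 ∧ (1 : ZMod 4) + 3 = 0 ∧
    (2 : ZMod 4) + 1 = 3 ∧ (2 : ZMod 4) + 2 = 0 ∧ (2 : ZMod 4) + 3 = 1 ∧
    (3 : ZMod 4) + 1 = 0 ∧ (3 : ZMod 4) + 2 = 1 ∧ (3 : ZMod 4) + 3 = 2 := by decide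
  obtain ⟨e1, e2, e3, e4, e5, e6, e7, e8, e9, e10, e11, e12⟩ := e
  have f : (0 : ZMod 4) ≠ 1 ∧ (0 : ZMod 4) ≠ 2 ∧ (0 : ZMod 4) ≠ 3 ∧ (2 : ZMod 4) ≠ 1 ∧
    (3 : ZMod 4) ≠ 1 ∧ (3 : ZMod 4) ≠ 2 := by decide
  obtain ⟨f1, f2, f3, f4, f5, f6⟩ := f
  rcases h with rfl | rfl | rfl | rfl <;>
    simp only [e1, e2, e3, e4, e5, e6, e7, e8, e9, e10, e11, e12, arrowDegree, f1, f2, f3, f4, f5,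
      f6, if_true, if_false] <;>
    refine gam_ext ?_ ?_ ?_ ?_ <;> simp [gam, Triple.mul_def, uDegree] <;> norm_num

theorem ascDegree_four (i : ZMod 4) (l : ℕ) :
    ascDegree i (l + 4) = lam (-2) 1 * ascDegree i l := by
  have e : ascDegree i (l + 4) = arrowDegree i * (arrowDegree (i + 1) * (arrowDegree (i + 1 + 1) *
      (arrowDegree (i + 1 + 1 + 1) * ascDegree (i + 1 + 1 + 1 + 1) l))) := rfl
  have e1 : i + 1 + 1 = i + 2 := by ring
  have e2 : i + 2 + 1 = i + 3 := by ring
  have e3 : i + 3 + 1 = i := by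
    rw [add_assoc, show (3 : ZMod 4) + 1 = 0 from rfl, add_zero]
  rw [e, e1, e2, e3, ← ascDegree_cycle i]
  simp only [mul_assoc]

theorem descDegree_mod (j : ZMod 4) (q r : ℕ) :
    descDegree j (4 * q + r) = lam 0 q * descDegree j r := by
  induction q with
  | zero => simp [lam]
  | succ q ih =>
    rw [show 4 * (q + 1) + r = 4 * q + r + 4 by ring, descDegree_four, ih, ← mul_assoc, lam_mul,
      add_comm 1 q, zero_add]

theorem ascDegree_mod (i : ZMod 4) (p r : ℕ) :
    ascDegree i (4 * p + r) = lam (-2 * p) p * ascDegree i r := by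
  induction p with
  | zero => simp [lam]
  | succ p ih =>
    rw [show 4 * (p + 1) + r = 4 * p + r + 4 by ring, ascDegree_four, ih, ← mul_assoc, lam_mul]
    congr 2
    · push_cast; ring
    · ring

/-- Twice the components `a`, `b` of the degree of an arrow. -/
def arrowVector (i : ZMod 4) : ℤ × ℤ :=
  if i = 1 then (1, -1) else if i = 2 then (1, 1) else if i = 3 then (-1, 1) else (-1, -1)

theorem arrowDegree_vector (i : ZMod 4) :
    2 * (arrowDegree i).1.1.a = (arrowVector i).1 ∧ 2 * (arrowDegree i).1.1.b = (arrowVector i).2 := by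
  unfold arrowDegree arrowVector
  split_ifs <;> constructor <;> norm_num [gam]

/-- The sum of the vectors of an ascending sequence of arrows. -/
def ascVector : ZMod 4 → ℕ → ℤ × ℤ
  | _, 0 => 0
  | i, l + 1 => arrowVector i + ascVector (i + 1) l

/-- The sum of the vectors of a descending sequence of arrows. -/
def descVector : ZMod 4 → ℕ → ℤ × ℤ
  | _, 0 => 0
  | j, k + 1 => arrowVector j + descVector (j - 1) k

theorem ascDegree_vector (i : ZMod 4) (l : ℕ) :
    2 * (ascDegree i l).1.1.a = (ascVector i l).1 ∧ 2 * (ascDegree i l).1.1.b = (ascVector i l).2 := by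
  induction l generalizing i with
  | zero => simp [ascDegree, ascVector, Triple.one_def]
  | succ l ih =>
    have h1 := arrowDegree_vector i
    have h2 := ih (i + 1)
    rw [ascDegree, ascVector, gam_mul, Triple.mul_def, Prod.fst_add, Prod.snd_add]
    push_cast
    exact ⟨by linarith [h1.1, h2.1], by linarith [h1.2, h2.2]⟩

theorem descDegree_vector (j : ZMod 4) (k : ℕ) :
    2 * (descDegree j k).1.1.a = (descVector j k).1 ∧
      2 * (descDegree j k).1.1.b = (descVector j k).2 := by
  induction k generalizing j with
  | zero => simp [descDegree, descVector, Triple.one_def]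
  | succ k ih =>
    have h1 := arrowDegree_vector j
    have h2 := ih (j - 1)
    have h3 : lamD.1.1 = ⟨1, 0, 0⟩ := rfl
    rw [descDegree, descVector, gam_mul, gam_mul, Triple.mul_def, Triple.mul_def, h3, Prod.fst_add,
      Prod.snd_add]
    push_cast
    exact ⟨by linarith [h1.1, h2.1], by linarith [h1.2, h2.2]⟩

/-- Over a full turn the vectors of the arrows cancel, so only the residues of the lengths matter.
Two arrows never match: an ascending and a descending pair with the same initial vertex have
perpendicular vectors. -/
theorem vector_table : ∀ i j : ZMod 4, ∀ r r' : Fin 4, source i = source j →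
    ascVector i r' = descVector j r → (r = 0 ∧ r' = 0) ∨ (r = 1 ∧ r' = 1 ∧ i = j) ∨
      (r = 3 ∧ r' = 3 ∧ i = j - 2) := by
  decide

theorem ascDegree_three (j : ZMod 4) : lamD * ascDegree (j - 2) 3 = descDegree j 3 := by
  have h : j = 0 ∨ j = 1 ∨ j = 2 ∨ j = 3 := by revert j; decide
  have e : (0 : ZMod 4) + 1 = 1 ∧ (0 : ZMod 4) - 2 = 2 ∧ (0 : ZMod 4) - 1 = 3 ∧
    (1 : ZMod 4) + 1 = 2 ∧ (1 : ZMod 4) - 2 = 3 ∧ (1 : ZMod 4) - 1 = 0 ∧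
    (2 : ZMod 4) + 1 = 3 ∧ (2 : ZMod 4) - 2 = 0 ∧ (2 : ZMod 4) - 1 = 1 ∧
    (3 : ZMod 4) + 1 = 0 ∧ (3 : ZMod 4) - 2 = 1 ∧ (3 : ZMod 4) - 1 = 2 := by decide
  obtain ⟨e1, e2, e3, e4, e5, e6, e7, e8, e9, e10, e11, e12⟩ := e
  have f : (0 : ZMod 4) ≠ 1 ∧ (0 : ZMod 4) ≠ 2 ∧ (0 : ZMod 4) ≠ 3 ∧ (2 : ZMod 4) ≠ 1 ∧
    (3 : ZMod 4) ≠ 1 ∧ (3 : ZMod 4) ≠ 2 := by decide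
  obtain ⟨f1, f2, f3, f4, f5, f6⟩ := f
  rcases h with rfl | rfl | rfl | rfl <;>
    simp only [e1, e2, e3, e4, e5, e6, e7, e8, e9, e10, e11, e12, ascDegree, descDegree,
      arrowDegree, f1, f2, f3, f4, f5, f6, if_true, if_false] <;>
    refine gam_ext ?_ ?_ ?_ ?_ <;> simp [gam, Triple.mul_def, lamD] <;> norm_num

/-- Full turns on either side contribute central factors. The components `a` and `b` of the degrees
compare the remainders, and for each admissible remainder the two sides differ by a power of `lamD`,
which turns the rest of the equation into one of integers. -/
theorem lam_mul_ascDegree_eq {a a' : ℤ} {w w' l k : ℕ} {i j : ZMod 4}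
    (hs : source i = source j) (h : lam a w * ascDegree i l = lam a' w' * descDegree j k) :
    ∃ p q r : ℕ, l = 4 * p + r ∧ k = 4 * q + r ∧ w + p = w' + q ∧
      ((r = 0 ∧ a - 2 * p = a') ∨ ((r = 1 ∨ r = 3) ∧ a - 2 * p = a' + 1)) := by
  have hl := Nat.div_add_mod l 4
  have hk := Nat.div_add_mod k 4
  have hr := Nat.mod_lt l (show 0 < 4 by norm_num)
  have hr' := Nat.mod_lt k (show 0 < 4 by norm_num)
  set p := l / 4
  set q := k / 4
  set r := l % 4
  set r' := k % 4
  rw [← hl, ← hk, ascDegree_mod, descDegree_mod, ← mul_assoc, ← mul_assoc, lam_mul, lam_mul] at h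
  have hv : ascVector i r = descVector j r' := by
    have h1 := ascDegree_vector i r
    have h2 := descDegree_vector j r'
    have h3 : ((lam (a + -2 * p) (w + p) * ascDegree i r).1.1).a =
        (lam (a' + 0) (w' + q) * descDegree j r').1.1.a := by rw [h]
    have h4 : ((lam (a + -2 * p) (w + p) * ascDegree i r).1.1).b =
        (lam (a' + 0) (w' + q) * descDegree j r').1.1.b := by rw [h]
    rw [gam_mul, gam_mul, (lam_components _ _).1, (lam_components _ _).1, Triple.mul_def,
      Triple.mul_def] at h3 h4
    simp only [zero_add] at h3 h4
    rw [h3] at h1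
    rw [h4] at h1
    refine Prod.ext ?_ ?_
    · exact_mod_cast h1.1.symm.trans h2.1
    · exact_mod_cast h1.2.symm.trans h2.2
  refine ⟨p, q, r, hl.symm, ?_⟩
  rcases vector_table i j ⟨r', hr'⟩ ⟨r, hr⟩ hs hv with ⟨h1, h2⟩ | ⟨h1, h2, rfl⟩ | ⟨h1, h2, rfl⟩ <;>
    rw [Fin.ext_iff] at h1 h2 <;> simp only at h1 h2
  · rw [h1, h2] at h
    obtain ⟨h3, h4⟩ := lam_injective (mul_right_cancel (h : _ * (1 : Gam) = _ * 1))
    change r' = 0 at h1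
    change r = 0 at h2
    refine ⟨by omega, h4, Or.inl ⟨h2, by omega⟩⟩
  · rw [h1, h2] at h
    have e : descDegree i ((1 : Fin 4) : ℕ) = lam 1 0 * ascDegree i ((1 : Fin 4) : ℕ) := by
      rw [← lamD_eq]
      simp [descDegree, ascDegree]
    rw [e, ← mul_assoc, lam_mul] at h
    obtain ⟨h3, h4⟩ := lam_injective (mul_right_cancel h)
    change r' = 1 at h1
    change r = 1 at h2
    refine ⟨by omega, h4, Or.inr ⟨Or.inl h2, by omega⟩⟩
  · rw [h1, h2] at h
    have e : descDegree j ((3 : Fin 4) : ℕ) = lam 1 0 * ascDegree (j - 2) ((3 : Fin 4) : ℕ) := by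
      rw [← lamD_eq]
      exact (ascDegree_three j).symm
    rw [e, ← mul_assoc, lam_mul] at h
    obtain ⟨h3, h4⟩ := lam_injective (mul_right_cancel h)
    change r' = 3 at h1
    change r = 3 at h2
    refine ⟨by omega, h4, Or.inr ⟨Or.inr h2, by omega⟩⟩

theorem totalDegree_of_isPath {l : List Letter} {g : Gam} {s t : Fin 2} (h : IsPath l g s t) :
    g = totalDegree l := by
  induction l generalizing g s with
  | nil => exact h.1
  | cons x l ih =>
    obtain ⟨-, g', rfl, h⟩ := h
    rw [ih h]
    rfl

theorem exists_ascDegree (b : Basic) : ∃ i l, b.degree = ascDegree i l ∧ source i = b.src := by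
  cases b with
  | idem e =>
    have h : ∀ e, ∃ i, source i = e := by decide
    obtain ⟨i, hi⟩ := h e
    exact ⟨i, 0, rfl, hi⟩
  | chord i n => exact ⟨i, n + 1, degree_chord i n, rfl⟩

theorem totalDegree_append (a b : List Letter) :
    totalDegree (a ++ b) = totalDegree a * totalDegree b := by
  simp [totalDegree]

/-- The critical words on which a map of positive weight and degree `-1` or `-2` may not vanish. -/
theorem exceptional_of_coeff_ne_zero {e : ℤ} (he : e = 1 ∨ e = 2) {W : ℕ} (hW : W ≠ 0)
    {φ : List Alg → Alg} (hφ : IsGradedMap (lam (-e) W) φ) {w : List Letter}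
    (hw : IsCritical none w) {y : Letter} (hy : coeff y (φ (w.map mono)) ≠ 0) :
    W = 1 ∧ ((e = 1 ∧ w = []) ∨ (e = 2 ∧ ((∃ f, w = [(1, .idem f)]) ∨
      (∃ j, w = baseWord (descend j 1)) ∨ ∃ j, w = baseWord (descend j 3)))) := by
  obtain ⟨g, hg, hyg⟩ := hφ w y hy
  obtain ⟨i, l, hi, his⟩ := exists_ascDegree y.2
  rw [Letter.barDegree, Letter.degree, hi, uDegree_eq, lam_pow, lamD_eq, ← mul_assoc, lam_mul] at hyg
  -- Here `u` counts the final letter `U`, of bar degree `lam (-1) 1`. Eliminating the power of `U`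
  -- and the number of turns in the value from the two equations leaves a condition on `W`, `u` and
  -- `q`, whose right side is at most `1 + e`.
  have key : ∀ (j : ZMod 4) (k u : ℕ), source i = source j →
      g = lam (-u) u * descDegree j k → ∃ q r : ℕ, k = 4 * q + r ∧
        ((r = 0 ∧ 2 * W + u + 2 * q = 1 + e) ∨ ((r = 1 ∨ r = 3) ∧ 2 * W + u + 2 * q = e)) := by
    intro j k u hj hgj
    rw [hgj, ← mul_assoc, lam_mul] at hyg
    obtain ⟨p, q, r, -, h1, h2, h3⟩ := lam_mul_ascDegree_eq hj hyg
    exact ⟨q, r, h1, h3.imp (fun h => ⟨h.1, by omega⟩) fun h => ⟨h.1, by omega⟩⟩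
  obtain ⟨j, k, rfl | ⟨f, rfl⟩⟩ := critical_of_none hw hg
  · have hgd := totalDegree_of_isPath hg
    rw [totalDegree_descend] at hgd
    cases k with
    | zero =>
      obtain ⟨q, r, h1, h2⟩ := key i 0 0 rfl (by rw [hgd]; simp [lam, descDegree])
      exact ⟨by omega, Or.inl ⟨by omega, rfl⟩⟩
    | succ k =>
      obtain ⟨q, r, h1, h2⟩ := key j (k + 1) 0 (by rw [his, ← hg.1]; rfl) (by rw [hgd]; simp [lam])
      refine ⟨by omega, Or.inr ⟨by omega, Or.inr ?_⟩⟩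
      have hk : k = 0 ∨ k = 2 := by omega
      rcases hk with rfl | rfl
      · exact Or.inl ⟨j, rfl⟩
      · exact Or.inr ⟨j, rfl⟩
  · have hgd := totalDegree_of_isPath hg
    have hu : totalDegree [(1, .idem f)] = lam (-((1 : ℕ) : ℤ)) 1 := by
      simp only [totalDegree, List.map_cons, List.map_nil, List.prod_cons, List.prod_nil, mul_one,
        Letter.barDegree, Letter.degree, Basic.degree, pow_one, uDegree_eq, lamD_eq, lam_mul]
      norm_num
    rw [totalDegree_append, totalDegree_descend, hu, ← (commute_lam _ _ _).eq] at hgd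
    cases k with
    | zero =>
      obtain ⟨q, r, h1, h2⟩ := key i 0 1 rfl (by rw [hgd]; simp [descDegree])
      exact ⟨by omega, Or.inr ⟨by omega, Or.inl ⟨f, rfl⟩⟩⟩
    | succ k =>
      obtain ⟨q, r, h1, h2⟩ := key j (k + 1) 1 (by rw [his, ← hg.1]; rfl) hgd
      omega

end TorusAlgebra

/-! ### Solving the deformation equation -/

namespace TorusAlgebra

open ListCalculus

theorem isGradedMap_multilinearExtension {c : Gam} {f : List Letter → Alg}
    (h : ∀ l y, coeff y (f l) ≠ 0 → ∃ g, IsPath l g y.2.src y.2.tgt ∧ Letter.barDegree y = c * g) :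
    IsGradedMap c (multilinearExtension f) := by
  intro l y hy
  rw [multilinearExtension_mono] at hy
  exact h l y hy

theorem EntryAdditive.add {φ ψ : List Alg → Alg} (hφ : EntryAdditive φ) (hψ : EntryAdditive ψ) :
    EntryAdditive fun l => φ l + ψ l := by
  intro p q x y
  simp only [hφ p q x y, hψ p q x y]
  abel

theorem differential_add {φ ψ : List Alg → Alg} (l : List Alg) :
    differential (fun l => φ l + ψ l) l = differential φ l + differential ψ l := by
  simp only [differential]
  rw [insOp_add_right, insOp_add_left _ _ entryAdditive_undeformedOp]
  abel

/-- The words before `w`. -/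
def Precedes (v w : List Letter) : Prop :=
  v.length < w.length ∨ (v.length = w.length ∧ wordSize v < wordSize w)

open Classical in
/-- The values of a primitive of `c`, determined by splitting words. -/
noncomputable def primitiveValue (c : List Alg → Alg) (w : List Letter) : Alg :=
  match up none w with
  | none => 0
  | some w' =>
    if IsReduced w then c (w'.map mono) + differential (multilinearExtension fun v =>
      if _h : Precedes v w then primitiveValue c v else 0) (w'.map mono)
    else 0
termination_by (w.length, wordSize w)
decreasing_by
  rcases _h with h | ⟨h, h'⟩
  · exact Prod.Lex.left _ _ h
  · rw [h]
    exact Prod.Lex.right _ h'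

open Classical in
/-- A primitive of `c`, restricted to the words before `w`. -/
noncomputable def truncatedPrimitive (c : List Alg → Alg) (w : List Letter) : List Alg → Alg :=
  multilinearExtension fun v => if Precedes v w then primitiveValue c v else 0

theorem entryAdditive_truncatedPrimitive (c : List Alg → Alg) (w : List Letter) :
    EntryAdditive (truncatedPrimitive c w) := multilinearExtension_add _

theorem primitiveValue_of_none (c : List Alg → Alg) {w : List Letter} (h : up none w = none) :
    primitiveValue c w = 0 := by
  rw [primitiveValue, h]

theorem primitiveValue_of_not_isReduced (c : List Alg → Alg) {w : List Letter}
    (h : ¬ IsReduced w) : primitiveValue c w = 0 := by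
  rw [primitiveValue]
  cases up none w with
  | none => rfl
  | some w' => exact if_neg h

theorem primitiveValue_of_some (c : List Alg → Alg) {w w' : List Letter} (hr : IsReduced w)
    (h : up none w = some w') : primitiveValue c w =
      c (w'.map mono) + differential (truncatedPrimitive c w) (w'.map mono) := by
  rw [primitiveValue, h]
  exact if_pos hr

/-- A primitive of `c`. -/
noncomputable def primitive (c : List Alg → Alg) : List Alg → Alg :=
  multilinearExtension (primitiveValue c)

theorem entryAdditive_primitive (c : List Alg → Alg) : EntryAdditive (primitive c) :=
  multilinearExtension_add _

theorem primitive_mono (c : List Alg → Alg) (w : List Letter) :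
    primitive c (w.map mono) = primitiveValue c w := multilinearExtension_mono _ _

theorem primitive_nil (c : List Alg → Alg) : primitive c [] = 0 :=
  (primitive_mono c []).trans (primitiveValue_of_none c rfl)

theorem isNormalized_primitive (c : List Alg → Alg) : IsNormalized (primitive c) := by
  rintro l ⟨e, he⟩
  rw [primitive_mono]
  refine primitiveValue_of_not_isReduced c fun h => ?_
  have := h _ he
  simp [Letter.weight, Letter.len] at this

/-- The part of the primitive on words not preceding `w` satisfies the hypotheses of
`differential_up`, so its differential on `w'` is its value at `w`. This value was chosen as what
the preceding part leaves missing. -/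
theorem differential_primitive (c : List Alg → Alg) {w w' : List Letter} (hr : IsReduced w)
    (h : up none w = some w') : differential (primitive c) (w'.map mono) = c (w'.map mono) := by
  classical
  have hadd := EntryAdditive.add (entryAdditive_primitive c)
    (entryAdditive_truncatedPrimitive c w)
  have hrest : ∀ v : List Letter, primitive c (v.map mono) + truncatedPrimitive c w (v.map mono) =
      if Precedes v w then 0 else primitiveValue c v := by
    intro v
    rw [primitive_mono, truncatedPrimitive, multilinearExtension_mono]
    split_ifs
    · exact add_self_eq_zero' _
    · exact add_zero _
  have key := differential_up hr h hadd (fun v hv => ?_) (fun v hv _ hs => ?_)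
  · rw [differential_add, hrest, if_neg (by simp [Precedes]), primitiveValue_of_some c hr h] at key
    exact add_right_cancel key
  · rw [hrest]
    exact if_pos (Or.inl hv)
  · rw [hrest]
    rcases hs with hs | hs
    · exact if_pos (Or.inr ⟨hv, hs⟩)
    · rw [primitiveValue_of_none c hs, ite_self]

/-- Undoing a splitting merges two shifted letters into one and thus loses one factor `lamD`. -/
theorem isPath_of_up {w w' : List Letter} (hr : IsReduced w) (h : up none w = some w') {g : Gam}
    {s t : Fin 2} (hp : IsPath w' g s t) : IsPath w (lam (-1) 0 * g) s t := by
  obtain ⟨a, p, x, z, b, rfl, rfl, hz, -⟩ := up_eq_some (by simp) hr h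
  refine isPath_replace (c := [p, x]) (c' := [z]) (commute_lam _ _) ?_ hp
  rintro g s t ⟨rfl, g', rfl, h'⟩
  obtain ⟨rfl, h1, rfl⟩ := isPath_singleton.1 h'
  have hm := mul_of_split hz
  obtain ⟨-, h2, h3, -, -⟩ := Letter.mul_eq_some hm
  refine isPath_singleton.2 ⟨?_, h2, h3⟩
  have e : lam (-1) 0 = lamD⁻¹ := by simp [lam]
  change lam (-1) 0 * (lamD * Letter.degree p * (lamD * Letter.degree x)) = lamD * Letter.degree z
  rw [Letter.degree_mul hm, e, mul_assoc, inv_mul_cancel_left, ← mul_assoc, ← mul_assoc,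
    (commute_lamD _).eq]

theorem isGradedMap_primitive {c : List Alg → Alg} {e : ℤ} {W : ℕ}
    (hc : IsGradedMap (lam (-e) W) c) : IsGradedMap (lam (1 - e) W) (primitive c) := by
  classical
  refine isGradedMap_multilinearExtension fun w => ?_
  refine word_induction (P := fun w => ∀ y, coeff y (primitiveValue c w) ≠ 0 →
    ∃ g, IsPath w g y.2.src y.2.tgt ∧ Letter.barDegree y = lam (1 - e) W * g)
    (fun w ih₁ ih₂ y hy => ?_) w
  by_cases hr : IsReduced w
  swap
  · rw [primitiveValue_of_not_isReduced c hr, map_zero] at hy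
    exact absurd rfl hy
  cases hw : up none w with
  | none =>
    rw [primitiveValue_of_none c hw, map_zero] at hy
    exact absurd rfl hy
  | some w' =>
    have ht : IsGradedMap (lam (1 - e) W) (truncatedPrimitive c w) := by
      refine isGradedMap_multilinearExtension fun v y hy => ?_
      split_ifs at hy with hv
      · exact hv.elim (fun h => ih₁ v h y hy) fun h => ih₂ v h.1 h.2 y hy
      · simp at hy
    have hd := isGradedMap_differential (multilinearExtension_add _) (commute_lam _ _) ht
    rw [lam_mul, zero_add, show -1 + (1 - e) = -e by ring] at hd
    rw [primitiveValue_of_some c hr hw] at hy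
    obtain ⟨g, hg, hyg⟩ := (hc.add hd) w' y hy
    refine ⟨_, isPath_of_up hr hw hg, ?_⟩
    rw [hyg, ← mul_assoc, lam_mul]
    congr 2
    ring

/-- Operations counting patterns need four inputs. These could only arise by inserting `φ []`, which
is zero. -/
theorem differential_of_length_le {φ : List Alg → Alg} (hφ : EntryAdditive φ) (h0 : φ [] = 0)
    {w : List Letter} (hw : w.length ≤ 3) : differential φ (w.map mono) =
      pairSum φ w + insOp φ binary (w.map mono) := by
  have h1 : insOp tiling φ (w.map mono) = 0 := by
    refine cutSum_eq_zero fun a r har => cutSum_eq_zero fun c b hcb => ?_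
    rw [tiling_eq_zero_of_length]
    · exact hφ.zero_entry _ _
    · subst hcb
      have := congrArg List.length har
      simp only [List.length_append, List.length_map] at this
      omega
  have h2 : insOp φ tiling (w.map mono) = 0 := by
    refine cutSum_eq_zero fun a r har => cutSum_eq_zero fun c b hcb => ?_
    rcases eq_or_ne c [] with rfl | hc
    · rw [h0]
      exact entryAdditive_tiling.zero_entry _ _
    · refine tiling_eq_zero_of_length ?_
      subst hcb
      have := congrArg List.length har
      have := List.length_pos_iff.2 hc
      simp only [List.length_append, List.length_map, List.length_cons] at *
      omega
  rw [differential, insOp_undeformedOp_left_eq hφ, insOp_undeformedOp_right_eq, h1, h2,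
    insOp_binary_left hφ]
  simp

theorem differential_eq_zero_of_single {φ : List Alg → Alg} (hφ : EntryAdditive φ) (h0 : φ [] = 0)
    (x : Letter) : differential φ [mono x] = 0 := by
  have := differential_of_length_le hφ h0 (w := [x]) (by simp)
  rw [insOp_binary_right φ (x := x) (v := []) (l := []) (y := x) rfl rfl] at this
  simpa [pairSum, h0] using this

theorem up_descend (j : ZMod 4) (k : ℕ) : up none (baseWord (descend j k)) = none := by
  cases h : up none (baseWord (descend j k)) with
  | none => rfl
  | some w' =>
    exfalso
    have hr : IsReduced (baseWord (descend j k)) := by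
      intro x hx
      obtain ⟨b, hb, rfl⟩ := List.mem_map.1 hx
      have : ∀ (k : ℕ) (j : ZMod 4), b ∈ descend j k → ∃ i, b = .chord i 0 := by
        intro k
        induction k with
        | zero => simp [descend]
        | succ k ih =>
          intro j h
          rcases List.mem_cons.1 h with rfl | h
          · exact ⟨j, rfl⟩
          · exact ih _ h
      obtain ⟨i, rfl⟩ := this k j hb
      simp [Letter.weight, Letter.len]
    obtain ⟨a, p, x, z, b, hw, -, hz, -⟩ := up_eq_some (by simp) hr h
    have hd := congrArg (List.map Prod.snd) hw
    rw [snd_baseWord, List.map_append, List.map_cons, ← List.singleton_append] at hd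
    obtain ⟨-, h2, -⟩ := exists_descend hd
    simp only [List.length_singleton, descend] at h2
    have h3 : z ∈ baseWord (descend j k) := by rw [hw]; simp
    obtain ⟨b', -, rfl⟩ := List.mem_map.1 h3
    obtain rfl := List.singleton_inj.1 h2
    simp [Letter.split] at hz

/-- Neighbouring arrows have product zero, and the outer products involve the primitive on
descending words only, where it is zero because they do not split. -/
theorem differential_primitive_descend (c : List Alg → Alg) (j : ZMod 4) {k : ℕ} (hk : k ≤ 3) :
    differential (primitive c) ((baseWord (descend j k)).map mono) = 0 := by
  have hz : ∀ j k, primitive c ((baseWord (descend j k)).map mono) = 0 := fun j k => by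
    rw [primitive_mono, primitiveValue_of_none c (up_descend j k)]
  rw [differential_of_length_le (entryAdditive_primitive c) (primitive_nil c)
    (by rw [baseWord, List.length_map, length_descend]; exact hk),
    pairSum_eq_zero (entryAdditive_primitive c), zero_add]
  · cases k with
    | zero => exact insOp_binary_right_nil _
    | succ k =>
      have h := insOp_binary_right (primitive c) (w := baseWord (descend j (k + 1)))
        (x := (0, .chord j 0)) (v := baseWord (descend (j - 1) k)) (l := baseWord (descend j k))
        (y := (0, .chord (j - k) 0)) rfl (by rw [descend_succ, baseWord_append]; rfl)
      rw [h, hz, hz]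
      simp
  · intro a x y b z h hm
    rw [descend_mul_eq_none h] at hm
    simp at hm

/-- Every normalized cocycle of positive weight and degree `-1` or `-2` is a coboundary if it
vanishes on the exceptional words. -/
theorem differential_primitive_eq {c : List Alg → Alg} (hc : EntryAdditive c)
    (hn : IsNormalized c) {e : ℤ} (he : e = 1 ∨ e = 2) {W : ℕ} (hW : W ≠ 0)
    (hg : IsGradedMap (lam (-e) W) c) (hd : ∀ l, differential c l = 0)
    (h0 : W = 1 → e = 1 → c [] = 0)
    (hU : W = 1 → e = 2 → ∀ f, c [mono (1, .idem f)] = 0)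
    (hρ : W = 1 → e = 2 → ∀ j k, k = 1 ∨ k = 3 → c ((baseWord (descend j k)).map mono) = 0)
    (l : List Alg) : differential (primitive c) l = c l := by
  have hp := entryAdditive_primitive c
  have hpg := isGradedMap_primitive hg
  -- The error of the primitive is a normalized cocycle of the same degree as `c`.
  set φ : List Alg → Alg := fun l => differential (primitive c) l + c l with hφ
  have hφa : EntryAdditive φ := EntryAdditive.add (entryAdditive_differential hp) hc
  have hφn : IsNormalized φ :=
    (isNormalized_differential hp (isNormalized_primitive c) (commute_lam _ _) hpg).add hn
  have hφg : IsGradedMap (lam (-e) W) φ := by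
    refine IsGradedMap.add ?_ hg
    have := isGradedMap_differential hp (commute_lam _ _) hpg
    rwa [lam_mul, zero_add, show -1 + (1 - e) = -e by ring] at this
  have hφd : ∀ l, differential φ l = 0 := by
    intro l
    rw [hφ, differential_add, differential_differential hp, hd, add_zero]
  have hz : ∀ l, φ l = 0 := by
    refine EntryAdditive.eq_zero hφa fun w => ?_
    refine word_induction (P := fun w => φ (w.map mono) = 0) (fun w ih₁ ih₂ => ?_) w
    -- Words that do not split: on those that arise by splitting the primitive was adjusted to make
    -- the error vanish, and on critical ones the grading leaves the exceptional words only.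
    have direct : ∀ v : List Letter, up none v = none → φ (v.map mono) = 0 := by
      intro v hv
      by_cases hr : IsReduced v
      swap
      · exact hφn v (exists_unit_of_not_isReduced hr)
      rcases up_trichotomy (prev := none) (by simp) hr with ⟨w', h⟩ | ⟨q, h, -⟩ | ⟨u, hu, h⟩ | h
      · rw [hv] at h
        simp at h
      · simp at h
      · change differential (primitive c) _ + _ = 0
        rw [differential_primitive c hu h, add_self_eq_zero']
      · by_contra hne
        obtain ⟨y, hy⟩ : ∃ y, coeff y (φ (v.map mono)) ≠ 0 := by
          by_contra hcon
          push Not at hcon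
          exact hne (alg_ext fun y => by rw [hcon, map_zero])
        refine hne ?_
        change differential (primitive c) _ + _ = 0
        -- On an exceptional word both terms vanish, `c` by hypothesis and the differential because
        -- the primitive is zero on all shorter words that enter.
        obtain ⟨rfl, ⟨rfl, rfl⟩ | ⟨rfl, ⟨f, rfl⟩ | ⟨j, rfl⟩ | ⟨j, rfl⟩⟩⟩ :=
          exceptional_of_coeff_ne_zero he hW hφg h hy
        · have := differential_primitive_descend c 0 (k := 0) (by simp)
          rw [List.map_nil, h0 rfl rfl, add_zero]
          exact this
        · rw [List.map_singleton, hU rfl rfl,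
            differential_eq_zero_of_single hp (primitive_nil c), add_zero]
        · rw [differential_primitive_descend c j (by simp), hρ rfl rfl j 1 (Or.inl rfl), add_zero]
        · rw [differential_primitive_descend c j (by simp), hρ rfl rfl j 3 (Or.inr rfl), add_zero]
    cases hw : up none w with
    | none => exact direct w hw
    | some w' =>
      by_cases hr : IsReduced w
      -- Words that split: the error is closed, and its differential on the split word is its value
      -- here.
      · rw [← differential_up hr hw hφa ih₁ ?_, hφd]
        intro v hl hs h
        exact h.elim (fun h => ih₂ v hl h) fun h => direct v h
      · exact hφn w (exists_unit_of_not_isReduced hr)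
  have h := hz l
  rw [← add_self_eq_zero' (c l)] at h
  exact add_right_cancel h

end TorusAlgebra

/-! ### Bimodule maps and degrees -/

namespace TorusAlgebra

open ListCalculus WeightedAInfinity

theorem hom_ext_mono {M : Type*} [AddCommGroup M] (f g : Alg →+ M)
    (h : ∀ x, f (mono x) = g (mono x)) (a : Alg) : f a = g a := by
  rw [← sum_supp a, map_sum, map_sum]
  exact Finset.sum_congr rfl fun x _ => h x

theorem iota_eq (e : Fin 2) : iota e = mono (unitLetter e) := rfl

theorem iota_mem_ground (e : Fin 2) : iota e ∈ ground := by
  refine Algebra.subset_adjoin ?_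
  have h : e = 0 ∨ e = 1 := by revert e; decide
  rcases h with rfl | rfl <;> simp

theorem iota_mul_iota (e f : Fin 2) : iota e * iota f = if e = f then iota e else 0 := by
  rw [iota_eq, iota_eq, mono_mul_mono]
  simp only [Letter.mul, unitLetter, Basic.mul]
  split_ifs <;> rfl

theorem ground_induction {P : Alg → Prop} (zero : P 0) (add : ∀ a b, P a → P b → P (a + b))
    (iota : ∀ e, P (iota e)) {r : Alg} (hr : r ∈ ground) : P r := by
  have key : ∃ a b : ZMod 2, r = a • TorusAlgebra.iota 0 + b • TorusAlgebra.iota 1 := by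
    refine Algebra.adjoin_induction (p := fun r _ => ∃ a b : ZMod 2,
      r = a • TorusAlgebra.iota 0 + b • TorusAlgebra.iota 1) ?_ ?_ ?_ ?_ hr
    · rintro x (rfl | rfl)
      · exact ⟨1, 0, by simp⟩
      · exact ⟨0, 1, by simp⟩
    · intro r
      refine ⟨r, r, ?_⟩
      rw [Algebra.algebraMap_eq_smul_one, ← smul_add]
      rfl
    · rintro x y - - ⟨a, b, rfl⟩ ⟨c, d, rfl⟩
      refine ⟨a + c, b + d, ?_⟩
      rw [add_smul, add_smul]
      abel
    · rintro x y - - ⟨a, b, rfl⟩ ⟨c, d, rfl⟩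
      refine ⟨a * c, b * d, ?_⟩
      simp only [add_mul, mul_add, smul_mul_smul_comm, iota_mul_iota]
      simp
  obtain ⟨a, b, rfl⟩ := key
  have h : ∀ c : ZMod 2, c = 0 ∨ c = 1 := by decide
  rcases h a with rfl | rfl <;> rcases h b with rfl | rfl <;>
    simp only [zero_smul, one_smul, zero_add, add_zero]
  · exact zero
  · exact iota 1
  · exact iota 0
  · exact add _ _ (iota 0) (iota 1)

theorem mono_mul_iota_of_ne {x : Letter} {e : Fin 2} (h : x.2.tgt ≠ e) : mono x * iota e = 0 := by
  rw [iota_eq, mono_mul_mono]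
  cases hm : Letter.mul x (unitLetter e) with
  | none => rfl
  | some z => exact absurd (Letter.mul_eq_some hm).1 h

theorem iota_mul_mono_of_ne {x : Letter} {e : Fin 2} (h : x.2.src ≠ e) : iota e * mono x = 0 := by
  rw [iota_eq, mono_mul_mono]
  cases hm : Letter.mul (unitLetter e) x with
  | none => rfl
  | some z => exact absurd (Letter.mul_eq_some hm).1.symm h

theorem iota_mul_of_coeff {a : Alg} {e : Fin 2} (h : ∀ y, coeff y a ≠ 0 → y.2.src = e) :
    iota e * a = a := by
  rw [← sum_supp a, Finset.mul_sum]
  exact Finset.sum_congr rfl fun y hy => unitLetter_mul (h y (mem_supp.1 hy))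

theorem mul_iota_of_coeff {a : Alg} {e : Fin 2} (h : ∀ y, coeff y a ≠ 0 → y.2.tgt = e) :
    a * iota e = a := by
  rw [← sum_supp a, Finset.sum_mul]
  exact Finset.sum_congr rfl fun y hy => mul_unitLetter (h y (mem_supp.1 hy))

theorem iota_mul_eq_zero_of_coeff {a : Alg} {e : Fin 2}
    (h : ∀ y, coeff y a ≠ 0 → y.2.src ≠ e) : iota e * a = 0 := by
  rw [← sum_supp a, Finset.mul_sum]
  exact Finset.sum_eq_zero fun y hy => iota_mul_mono_of_ne (h y (mem_supp.1 hy))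

theorem mul_iota_eq_zero_of_coeff {a : Alg} {e : Fin 2}
    (h : ∀ y, coeff y a ≠ 0 → y.2.tgt ≠ e) : a * iota e = 0 := by
  rw [← sum_supp a, Finset.sum_mul]
  exact Finset.sum_eq_zero fun y hy => mono_mul_iota_of_ne (h y (mem_supp.1 hy))

theorem eq_zero_of_coeff {a : Alg} (h : ∀ y, coeff y a = 0) : a = 0 :=
  alg_ext fun y => by rw [h, map_zero]

theorem EntryAdditive.append_right {φ : List Alg → Alg} (hφ : EntryAdditive φ) (r : List Alg) :
    EntryAdditive fun l => φ (l ++ r) := by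
  intro p q x y
  simpa using hφ p (q ++ r) x y

theorem EntryAdditive.append_left {φ : List Alg → Alg} (hφ : EntryAdditive φ) (r : List Alg) :
    EntryAdditive fun l => φ (r ++ l) := by
  intro p q x y
  simpa using hφ (r ++ p) q x y

theorem EntryAdditive.mul_left {φ : List Alg → Alg} (hφ : EntryAdditive φ) (r : Alg) :
    EntryAdditive fun l => r * φ l := by
  intro p q x y
  simp only [hφ p q x y, mul_add]

theorem EntryAdditive.mul_right {φ : List Alg → Alg} (hφ : EntryAdditive φ) (r : Alg) :
    EntryAdditive fun l => φ l * r := by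
  intro p q x y
  simp only [hφ p q x y, add_mul]

/-- The ground ring is spanned by the two idempotents, and compatibility with these only says that
the words with non-zero value are composable and have the same ends as the value. That is part of
`IsGradedMap`. -/
theorem IsGradedMap.isMultilinear {φ : List Alg → Alg} {c : Gam} (hφ : EntryAdditive φ)
    (hg : IsGradedMap c φ) : IsMultilinear ground φ where
  map_add := hφ
  balanced := by
    intro l₁ l₂ a b r hr
    refine ground_induction (P := fun r => φ (l₁ ++ (a * r) :: b :: l₂) =
      φ (l₁ ++ a :: (r * b) :: l₂)) ?_ ?_ (fun e => ?_) hr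
    · rw [mul_zero, zero_mul, hφ.zero_entry]
      have := hφ.zero_entry (l₁ ++ [a]) l₂
      simpa using this.symm
    · intro r s hr hs
      rw [mul_add, add_mul, hφ, hr, hs]
      have := hφ (l₁ ++ [a]) l₂ (r * b) (s * b)
      simpa using this.symm
    · refine congrFun (EntryAdditive.ext_mono (EntryAdditive.append_right hφ _)
        (EntryAdditive.append_right hφ _) fun l₁ => ?_) l₁
      refine hom_ext_mono ((hφ.slot (l₁.map mono) (b :: l₂)).comp (AddMonoidHom.mulRight (iota e)))
        (hφ.slot (l₁.map mono) ((iota e * b) :: l₂)) (fun x => ?_) a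
      change φ (l₁.map mono ++ (mono x * iota e) :: b :: l₂) =
        φ (l₁.map mono ++ mono x :: (iota e * b) :: l₂)
      have h1 := fun z => hom_ext_mono (hφ.slot (l₁.map mono ++ [z]) l₂)
      have h2 : ∀ y : Letter, φ (l₁.map mono ++ (mono x * iota e) :: mono y :: l₂) =
          φ (l₁.map mono ++ mono x :: (iota e * mono y) :: l₂) := by
        intro y
        -- If the idempotent fits exactly one of the two letters, they are not composable and both
        -- sides are zero.
        by_cases hx : x.2.tgt = e <;> by_cases hy : y.2.src = e
        · rw [iota_eq, mul_unitLetter hx, unitLetter_mul hy]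
        all_goals
          have h0 : ∀ z w : Alg, z = 0 ∨ w = 0 → φ (l₁.map mono ++ z :: w :: l₂) = 0 := by
            rintro z w (rfl | rfl)
            · exact hφ.zero_entry _ _
            · have := hφ.zero_entry (l₁.map mono ++ [z]) l₂
              simpa using this
          have hxy : x.2.tgt ≠ y.2.src → φ (l₁.map mono ++ mono x :: mono y :: l₂) = 0 := by
            intro hne
            refine congrFun (EntryAdditive.ext_mono (φ := fun l => φ (l₁.map mono ++ mono x ::
              mono y :: l)) (ψ := fun _ => 0) ?_ (fun _ _ _ _ => by simp) fun l₂ => ?_) l₂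
            · have := EntryAdditive.append_left hφ (l₁.map mono ++ [mono x, mono y])
              simpa using this
            · refine eq_zero_of_coeff fun z => ?_
              by_contra hz
              have e1 : l₁.map mono ++ mono x :: mono y :: l₂.map mono =
                (l₁ ++ x :: y :: l₂).map mono := by simp
              rw [e1] at hz
              obtain ⟨g, hp, -⟩ := hg _ z hz
              obtain ⟨_, _, _, -, -, -, _, -, h3, -⟩ := isPath_append.1 hp
              exact hne h3.symm
        · rw [iota_mul_mono_of_ne hy, h0 _ 0 (Or.inr rfl), iota_eq, mul_unitLetter hx]
          exact hxy fun h => hy (h ▸ hx)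
        · rw [mono_mul_iota_of_ne hx, h0 0 _ (Or.inl rfl), iota_eq, unitLetter_mul hy]
          exact (hxy fun h => hx (h.trans hy)).symm
        · rw [mono_mul_iota_of_ne hx, h0 0 _ (Or.inl rfl), iota_mul_mono_of_ne hy,
            h0 _ 0 (Or.inr rfl)]
      have h3 := hom_ext_mono (hφ.slot (l₁.map mono ++ [mono x * iota e]) l₂)
        ((hφ.slot (l₁.map mono ++ [mono x]) l₂).comp (AddMonoidHom.mulLeft (iota e)))
        (fun y => by simpa [EntryAdditive.slot_apply] using h2 y) b
      simpa [EntryAdditive.slot_apply] using h3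
  left_linear := by
    intro l a r hr
    refine ground_induction (P := fun r => φ ((r * a) :: l) = r * φ (a :: l)) ?_ ?_ (fun e => ?_) hr
    · rw [zero_mul, zero_mul]
      exact hφ.zero_entry [] l
    · intro r s hr hs
      rw [add_mul, add_mul, ← hr, ← hs]
      exact hφ [] l _ _
    · refine hom_ext_mono ((hφ.slot [] l).comp (AddMonoidHom.mulLeft (iota e)))
        ((AddMonoidHom.mulLeft (iota e)).comp (hφ.slot [] l)) (fun x => ?_) a
      refine congrFun (EntryAdditive.ext_mono (φ := fun l => φ ((iota e * mono x) :: l))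
        (ψ := fun l => iota e * φ (mono x :: l)) (hφ.cons _)
        (EntryAdditive.mul_left (hφ.cons _) _) fun l => ?_) l
      have hs : ∀ y, coeff y (φ ((x :: l).map mono)) ≠ 0 → y.2.src = x.2.src := by
        intro y hy
        obtain ⟨g, hp, -⟩ := hg _ y hy
        exact hp.1.symm
      by_cases hx : x.2.src = e
      · rw [iota_eq, unitLetter_mul hx]
        exact (iota_mul_of_coeff fun y hy => (hs y hy).trans hx).symm
      · rw [iota_mul_mono_of_ne hx]
        refine Eq.trans (hφ.zero_entry [] _) ?_
        exact (iota_mul_eq_zero_of_coeff fun y hy h => hx ((hs y hy).symm.trans h)).symm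
  right_linear := by
    intro l a r hr
    refine ground_induction (P := fun r => φ (l ++ [a * r]) = φ (l ++ [a]) * r) ?_ ?_
      (fun e => ?_) hr
    · rw [mul_zero, mul_zero]
      exact hφ.zero_entry l []
    · intro r s hr hs
      rw [mul_add, mul_add, ← hr, ← hs]
      exact hφ l [] _ _
    · refine hom_ext_mono ((hφ.slot l []).comp (AddMonoidHom.mulRight (iota e)))
        ((AddMonoidHom.mulRight (iota e)).comp (hφ.slot l [])) (fun x => ?_) a
      refine congrFun (EntryAdditive.ext_mono (φ := fun l => φ (l ++ [mono x * iota e]))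
        (ψ := fun l => φ (l ++ [mono x]) * iota e) (EntryAdditive.append_right hφ _)
        (EntryAdditive.mul_right (EntryAdditive.append_right hφ _) _) fun l => ?_) l
      have hs : ∀ y, coeff y (φ (l.map mono ++ [mono x])) ≠ 0 → y.2.tgt = x.2.tgt := by
        intro y hy
        rw [← List.map_singleton, ← List.map_append] at hy
        obtain ⟨g, hp, -⟩ := hg _ y hy
        obtain ⟨_, _, _, -, -, h⟩ := isPath_append.1 hp
        exact (isPath_singleton.1 h).2.2.symm
      by_cases hx : x.2.tgt = e
      · rw [iota_eq, mul_unitLetter hx]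
        exact (mul_iota_of_coeff fun y hy => (hs y hy).trans hx).symm
      · rw [mono_mul_iota_of_ne hx]
        refine Eq.trans (hφ.zero_entry _ []) ?_
        exact (mul_iota_eq_zero_of_coeff fun y hy h => hx ((hs y hy).symm.trans h)).symm
  nullary := by
    intro r hr
    refine ground_induction (P := fun r => r * φ [] = φ [] * r) ?_ ?_ (fun e => ?_) hr
    · rw [zero_mul, mul_zero]
    · intro r s hr hs
      rw [add_mul, mul_add, hr, hs]
    · exact hg.nil_comm e

theorem IsNormalized.eq_zero {φ : List Alg → Alg} (hφ : EntryAdditive φ) (hn : IsNormalized φ)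
    {l : List Alg} (h : ∃ r ∈ l, r ∈ ground) : φ l = 0 := by
  obtain ⟨r, hrl, hr⟩ := h
  obtain ⟨a, b, rfl⟩ := List.append_of_mem hrl
  refine ground_induction (P := fun r => φ (a ++ r :: b) = 0) (hφ.zero_entry a b) ?_ (fun e => ?_) hr
  · intro r s hr hs
    rw [hφ, hr, hs, add_zero]
  · refine EntryAdditive.eq_zero (EntryAdditive.append_right hφ (iota e :: b)) (fun a => ?_) a
    have := EntryAdditive.append_left hφ (a.map mono ++ [iota e])
    simp only [List.append_assoc, List.singleton_append] at this
    refine EntryAdditive.eq_zero this (fun b => ?_) b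
    have h := hn.append a b e
    rwa [List.map_append, List.map_cons] at h

theorem isNormalized_of_eq_zero {φ : List Alg → Alg}
    (h : ∀ l, (∃ r ∈ l, r ∈ ground) → φ l = 0) : IsNormalized φ := by
  rintro l ⟨e, he⟩
  exact h _ ⟨iota e, List.mem_map_of_mem he, iota_mem_ground e⟩

/-- The degree of a word. -/
def wordDegree (l : List Letter) : Gam := (l.map Letter.degree).prod

theorem totalDegree_eq_wordDegree (l : List Letter) :
    totalDegree l = lam l.length 0 * wordDegree l := by
  induction l with
  | nil => simp [totalDegree, wordDegree, lam]
  | cons x l ih =>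
    have e : totalDegree (x :: l) = Letter.barDegree x * totalDegree l := rfl
    have e' : wordDegree (x :: l) = Letter.degree x * wordDegree l := rfl
    rw [e, e', ih, Letter.barDegree, lamD_eq, mul_assoc, ← mul_assoc (Letter.degree x),
      ← (commute_lam _ _ _).eq, mul_assoc, ← mul_assoc, lam_mul]
    congr 2
    rw [List.length_cons]
    push_cast
    ring

/-- The shifts of the inputs are central, so they can be collected in one power of `lamD`. The
degree in the bar construction then no longer depends on the number of inputs. -/
theorem degree_eq_iff (y : Letter) (l : List Letter) (d : ℤ) (W : ℕ) :
    Letter.degree y = lam (l.length - d) W * wordDegree l ↔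
      Letter.barDegree y = lam (1 - d) W * totalDegree l := by
  rw [totalDegree_eq_wordDegree, Letter.barDegree, lamD_eq, ← mul_assoc, lam_mul]
  have e : lam (1 - d + l.length) (W + 0) * wordDegree l =
      lam 1 0 * (lam (l.length - d) W * wordDegree l) := by
    rw [← mul_assoc, lam_mul, zero_add, add_zero]
    congr 2
    ring
  rw [e]
  exact mul_left_cancel_iff.symm

/-- Homogeneous entries are replaced by basis elements from left to right; `p` holds those already
replaced. The values `d = 2` and `d = 1` belong to operations and homomorphisms. -/
theorem IsGradedMap.hasDegree {φ : List Alg → Alg} {d : ℤ} {W : ℕ} (hφ : EntryAdditive φ)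
    (hg : IsGradedMap (lam (1 - d) W) φ) :
    HasDegree homogeneous φ fun n => lamD ^ ((n : ℤ) - d) * lamW ^ W := by
  have key : ∀ (l : List (Alg × Gam)) (p : List Letter), (∀ x ∈ l, x.1 ∈ homogeneous x.2) →
      φ (p.map mono ++ l.map Prod.fst) ∈ homogeneous
        (lam ((p.length + l.length : ℕ) - d) W * (wordDegree p * (l.map Prod.snd).prod)) := by
    intro l
    induction l with
    | nil =>
      intro p _
      simp only [List.map_nil, List.append_nil, List.length_nil, List.prod_nil, mul_one, add_zero]
      rw [← sum_supp (φ (p.map mono))]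
      refine Submodule.sum_mem _ fun y hy => Submodule.subset_span ⟨y.1, y.2, ?_, rfl⟩
      obtain ⟨g, hp, hyg⟩ := hg p y (mem_supp.1 hy)
      rw [totalDegree_of_isPath hp] at hyg
      exact (degree_eq_iff y p d W).2 hyg
    | cons x l ih =>
      intro p hx
      have h1 : x.1 ∈ homogeneous x.2 := hx x (by simp)
      rw [List.map_cons]
      refine Submodule.span_induction (p := fun a _ => φ (p.map mono ++ a :: l.map Prod.fst) ∈
        homogeneous (lam ((p.length + (x :: l).length : ℕ) - d) W *
          (wordDegree p * ((x :: l).map Prod.snd).prod))) ?_ ?_ ?_ ?_ h1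
      · rintro a ⟨m, b, hd, rfl⟩
        have := ih (p ++ [(m, b)]) fun y hy => hx y (by simp [hy])
        have hd' : Letter.degree (m, b) = x.2 := hd
        simp only [List.map_append, List.map_singleton, List.append_assoc, List.singleton_append,
          List.length_append, List.length_singleton, wordDegree, List.prod_append,
          List.prod_singleton, hd', mul_assoc] at this
        simp only [List.length_cons, List.map_cons, List.prod_cons, wordDegree]
        rw [show p.length + (l.length + 1) = p.length + 1 + l.length by ring]
        exact this
      · rw [hφ.zero_entry]
        exact Submodule.zero_mem _
      · intro a b _ _ ha hb
        rw [hφ]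
        exact Submodule.add_mem _ ha hb
      · intro c a _ ha
        have h : c = 0 ∨ c = 1 := by revert c; decide
        rcases h with rfl | rfl
        · rw [zero_smul, hφ.zero_entry]
          exact Submodule.zero_mem _
        · rwa [one_smul]
  intro l hl
  have := key l [] hl
  simpa [lam, wordDegree] using this

theorem degree_of_mem_homogeneous {g : Gam} {a : Alg} (h : a ∈ homogeneous g) {y : Letter}
    (hy : coeff y a ≠ 0) : Letter.degree y = g := by
  revert hy
  refine Submodule.span_induction (p := fun a _ => coeff y a ≠ 0 → Letter.degree y = g) ?_ ?_ ?_ ?_ h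
  · rintro x ⟨m, b, hd, rfl⟩ hy
    obtain rfl : (m, b) = y := eq_of_coeff_mono_ne_zero hy
    exact hd
  · simp
  · intro a b _ _ ha hb hab
    rw [map_add] at hab
    by_cases h0 : coeff y a = 0
    · exact hb (by simpa [h0] using hab)
    · exact ha h0
  · intro c a _ ha hca
    have h : ∀ c : ZMod 2, c = 0 ∨ c = 1 := by decide
    rcases h c with rfl | rfl
    · simp at hca
    · exact ha (by rwa [one_smul] at hca)

theorem mono_mem_homogeneous (x : Letter) : mono x ∈ homogeneous (Letter.degree x) :=
  Submodule.subset_span ⟨x.1, x.2, rfl, rfl⟩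

theorem coeff_iota_mul_ne_zero {a : Alg} {e : Fin 2} {y : Letter} (h : coeff y (iota e * a) ≠ 0) :
    y.2.src = e := by
  rw [← sum_supp a, Finset.mul_sum, map_sum] at h
  obtain ⟨x, -, hx⟩ := Finset.exists_ne_zero_of_sum_ne_zero h
  rw [iota_eq] at hx
  have := Letter.mul_eq_some (exists_mul_of_coeff hx)
  exact this.2.1

theorem coeff_mul_iota_ne_zero {a : Alg} {e : Fin 2} {y : Letter} (h : coeff y (a * iota e) ≠ 0) :
    y.2.tgt = e := by
  rw [← sum_supp a, Finset.sum_mul, map_sum] at h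
  obtain ⟨x, -, hx⟩ := Finset.exists_ne_zero_of_sum_ne_zero h
  rw [iota_eq] at hx
  have := Letter.mul_eq_some (exists_mul_of_coeff hx)
  exact this.2.2.1

/-- Words on which a bimodule map does not vanish are composable. -/
theorem exists_isPath {φ : List Alg → Alg} (h : IsMultilinear ground φ) {l : List Letter}
    {y : Letter} (hy : coeff y (φ (l.map mono)) ≠ 0) : ∃ g, IsPath l g y.2.src y.2.tgt := by
  have hφ : EntryAdditive φ := h.map_add
  cases l with
  | nil =>
    refine ⟨1, rfl, ?_⟩
    have h1 : φ [] = φ [] * (iota 0 + iota 1) := (mul_one _).symm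
    rw [List.map_nil] at hy
    have h2 : ∃ e, coeff y (iota e * φ []) ≠ 0 := by
      by_contra hcon
      push Not at hcon
      rw [h1, mul_add, ← h.nullary _ (iota_mem_ground 0), ← h.nullary _ (iota_mem_ground 1), map_add,
        hcon, hcon, add_zero] at hy
      exact hy rfl
    obtain ⟨e, he⟩ := h2
    have he' := he
    rw [h.nullary _ (iota_mem_ground e)] at he'
    rw [coeff_iota_mul_ne_zero he, coeff_mul_iota_ne_zero he']
  | cons x l =>
    have hsrc : x.2.src = y.2.src := by
      have := h.left_linear (l.map mono) (mono x) _ (iota_mem_ground x.2.src)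
      rw [iota_eq, unitLetter_mul rfl] at this
      rw [List.map_cons, this] at hy
      exact (coeff_iota_mul_ne_zero hy).symm
    have key : ∀ (l a : List Letter) (x : Letter),
        coeff y (φ ((a ++ x :: l).map mono)) ≠ 0 → ∃ g, IsPath l g x.2.tgt y.2.tgt := by
      intro l
      induction l with
      | nil =>
        intro a x hy
        refine ⟨1, rfl, ?_⟩
        have := h.right_linear (a.map mono) (mono x) _ (iota_mem_ground x.2.tgt)
        rw [iota_eq, mul_unitLetter rfl] at this
        rw [List.map_append, List.map_singleton, this] at hy
        exact (coeff_mul_iota_ne_zero hy).symm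
      | cons x' l ih =>
        intro a x hy
        obtain ⟨g, hg⟩ := ih (a ++ [x]) x' (by simpa using hy)
        refine ⟨_, ?_, g, rfl, hg⟩
        by_contra hne
        have := h.balanced (a.map mono) (l.map mono) (mono x) (mono x') _ (iota_mem_ground x.2.tgt)
        rw [iota_mul_mono_of_ne hne, iota_eq, mul_unitLetter rfl] at this
        have h0 := hφ.zero_entry (a.map mono ++ [mono x]) (l.map mono)
        rw [List.append_assoc, List.singleton_append] at h0
        rw [List.map_append, List.map_cons, List.map_cons, this, h0, map_zero] at hy
        exact hy rfl
    obtain ⟨g, hg⟩ := key l [] x hy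
    exact ⟨_, hsrc, g, rfl, hg⟩

/-- The degree alone says nothing about composability, which comes from the bimodule structure by
`exists_isPath`. -/
theorem isGradedMap_of_hasDegree {φ : List Alg → Alg} {d : ℤ} {W : ℕ}
    (h : IsMultilinear ground φ)
    (hd : HasDegree homogeneous φ fun n => lamD ^ ((n : ℤ) - d) * lamW ^ W) :
    IsGradedMap (lam (1 - d) W) φ := by
  intro l y hy
  obtain ⟨g, hg⟩ := exists_isPath h hy
  refine ⟨g, hg, ?_⟩
  rw [totalDegree_of_isPath hg, ← degree_eq_iff]
  have := hd (l.map fun x => (mono x, Letter.degree x)) (by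
    intro p hp
    obtain ⟨x, -, rfl⟩ := List.mem_map.1 hp
    exact mono_mem_homogeneous x)
  simp only [List.map_map, Function.comp_def, List.length_map] at this
  exact degree_of_mem_homogeneous this hy

end TorusAlgebra

/-! ### Existence -/

namespace TorusAlgebra

open ListCalculus WeightedAInfinity Finset HasAntidiagonal

/-- The sum of the chords of length four. -/
noncomputable def cycleSum : Alg := ∑ i : ZMod 4, mono (0, .chord i 3)

theorem cycleSum_eq : cycleSum = rho 1 3 + rho 2 3 + rho 3 3 + rho 4 3 := by
  have h : cycleSum = mono (0, .chord 0 3) + mono (0, .chord 1 3) + mono (0, .chord 2 3) +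
      mono (0, .chord 3 3) := Fin.sum_univ_four _
  have h4 : (4 : ZMod 4) = 0 := rfl
  rw [h, h4]
  simp only [rho, mono]
  abel

theorem exists_of_coeff_cycleSum {y : Letter} (h : coeff y cycleSum ≠ 0) :
    ∃ i, y = (0, .chord i 3) := by
  rw [cycleSum, map_sum] at h
  obtain ⟨i, -, hi⟩ := Finset.exists_ne_zero_of_sum_ne_zero h
  exact ⟨i, (eq_of_coeff_mono_ne_zero hi).symm⟩

theorem cast_three_add_one : ((3 : ℕ) : ZMod 4) + 1 = 0 := rfl

/-- Exactly one chord of length four can be multiplied to a given chord from either side, and a full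
turn before or after it gives the same longer chord. -/
theorem mono_mul_cycleSum (x : Letter) : mono x * cycleSum = cycleSum * mono x := by
  rw [cycleSum, Finset.mul_sum, Finset.sum_mul]
  simp only [mono_mul_mono, Letter.mul]
  obtain ⟨m, b⟩ := x
  cases b with
  | idem e =>
    refine Finset.sum_congr rfl fun i _ => ?_
    have ht : target i 3 = source i := by
      rw [target, add_assoc, cast_three_add_one, add_zero]
    simp only [Basic.mul, ht, add_zero, zero_add]
    by_cases he : e = source i
    · subst he; simp
    · rw [if_neg he, if_neg (Ne.symm he)]
  | chord j n =>
    rw [Finset.sum_eq_single (j + n + 1), Finset.sum_eq_single j]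
    · have e : j = j + ((3 : ℕ) : ZMod 4) + 1 := by rw [add_assoc, cast_three_add_one, add_zero]
      simp only [Basic.mul, ← e, if_true, add_zero, zero_add]
      rw [show n + 3 + 1 = 3 + n + 1 by ring]
    · intro i _ hi
      have : j ≠ i + ((3 : ℕ) : ZMod 4) + 1 := by
        rw [add_assoc, cast_three_add_one, add_zero]
        exact hi.symm
      simp only [Basic.mul, if_neg this]
      rfl
    · simp
    · intro i _ hi
      simp only [Basic.mul, if_neg hi]
      rfl
    · simp

/-- The curvature, as an operation without inputs. -/
noncomputable def curvature : List Alg → Alg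
  | [] => cycleSum
  | _ => 0

theorem entryAdditive_curvature : EntryAdditive curvature := by
  intro p q x y
  cases p <;> exact (add_zero _).symm

theorem isNormalized_curvature : IsNormalized curvature := by
  rintro l ⟨e, he⟩
  cases l with
  | nil => simp at he
  | cons x l => rfl

theorem isGradedMap_curvature : IsGradedMap (lam (-1) 1) curvature := by
  intro l y hy
  cases l with
  | cons x l => exact absurd (map_zero _) hy
  | nil =>
    obtain ⟨i, rfl⟩ := exists_of_coeff_cycleSum hy
    refine ⟨1, ⟨rfl, ?_⟩, ?_⟩
    · rw [Basic.src, Basic.tgt, target, add_assoc, cast_three_add_one, add_zero]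
    · have h4 := ascDegree_four i 0
      rw [zero_add, ascDegree, mul_one] at h4
      rw [Letter.barDegree, Letter.degree, degree_chord, h4, lamD_eq, pow_zero, one_mul, lam_mul,
        mul_one]
      norm_num

/-- The curvature has no inputs, so nothing can be inserted into it and it is itself inserted at
every place. -/
theorem differential_curvature (l : List Alg) : differential curvature l =
    cutSum (fun a b => undeformedOp (a ++ cycleSum :: b)) l := by
  have h : insOp undeformedOp curvature l = 0 := by
    refine cutSum_eq_zero fun a r _ => cutSum_eq_zero fun c b _ => ?_
    cases a <;> rfl
  rw [differential, h, zero_add, insOp]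
  refine cutSum_congr fun a r _ => ?_
  cases r with
  | nil => simp [curvature]
  | cons x r =>
    rw [cutSum_cons, cutSum_eq_zero, add_zero]
    · rfl
    · intro c b _
      exact entryAdditive_undeformedOp.zero_entry _ _

theorem differential_curvature_single (x : Letter) : differential curvature [mono x] = 0 := by
  rw [differential_curvature, cutSum_cons, cutSum_nil]
  change undeformedOp [cycleSum, mono x] + undeformedOp [mono x, cycleSum] = 0
  rw [undeformedOp_pair, undeformedOp_pair, mono_mul_cycleSum, add_self_eq_zero']

theorem tiling_insert_cycleSum (a b : List Alg) : tiling (a ++ cycleSum :: b) =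
    ∑ i : ZMod 4, tiling (a ++ mono (0, .chord i 3) :: b) :=
  map_sum (entryAdditive_tiling.slot a b) _ _

/-- A tiling pattern with four chords is extended on the left if its first chord is not an arrow. -/
theorem tiling_chord_succ (s : ZMod 4) (n : ℕ) {rest : List Basic} (h : rest.length = 3) :
    tiling ((baseWord (.chord s (n + 1) :: rest)).map mono) =
      mono (0, .chord s 0) * tiling ((baseWord (.chord (s + 1) n :: rest)).map mono) := by
  rw [tiling_graft_first, cutSum_eq_zero, add_zero]
  intro c d hcd
  by_cases hc : c.length < 4
  · rw [tiling_eq_zero_of_length (l := (baseWord c).map mono) (by simpa [baseWord] using hc)]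
    exact entryAdditive_tiling.zero_entry _ _
  · refine tiling_eq_zero_of_length ?_
    have := congrArg List.length hcd
    simp only [List.length_append, List.length_cons, List.length_map, baseWord] at *
    simp only [List.length_nil]
    omega

theorem tiling_eq_zero_of_not_isDescending {l : List Basic} (h : ∀ r r', ¬ IsDescending r l r') :
    tiling ((baseWord l).map mono) = 0 :=
  tiling_baseWord_eq_zero fun _ hp => h _ _ (isDescending_of_mem_patterns hp)

theorem tiling_chord_eq_zero (a d : List Basic) (i j : ZMod 4) (n m : ℕ) (h : j ≠ i + n - 1) :
    tiling ((baseWord (a ++ .chord i n :: .chord j m :: d)).map mono) = 0 := by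
  refine tiling_eq_zero_of_not_isDescending fun r r' hd => ?_
  obtain ⟨k, hk⟩ := isDescending_junction hd
  exact h (Basic.chord.inj hk).1

/-- The first chord must end with `j + 1` to be continued by `j`. Its first three labels are a left
extension of the vertex consuming the four arrows `j + 1, …, j - 2`, and they form the output. -/
theorem tiling_cycleSum_descend (j : ZMod 4) :
    tiling (cycleSum :: (baseWord (descend j 3)).map mono) = mono (1, .chord (j - 2) 2) := by
  have h := tiling_insert_cycleSum [] ((baseWord (descend j 3)).map mono)
  rw [List.nil_append] at h
  rw [h, Finset.sum_eq_single (j - 2)]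
  · change tiling ((baseWord (.chord (j - 2) 3 :: descend j 3)).map mono) = _
    rw [tiling_chord_succ _ _ (length_descend _ _), tiling_chord_succ _ _ (length_descend _ _),
      tiling_chord_succ _ _ (length_descend _ _)]
    have e : j - 2 + 1 + 1 + 1 = j + 1 := by ring
    have h4 := tiling_descend_four (j + 1)
    rw [descend, add_sub_cancel_right] at h4
    rw [e, h4]
    have e1 : j - 2 + 1 = j - 1 := by ring
    have e2 : j - 1 + 1 = j := by ring
    simp only [e1, e2]
    simp only [mono_mul_mono, Letter.mul, Basic.mul, target, Nat.cast_zero, add_zero, if_true,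
      Option.map_some, Option.elim_some, e2, zero_add, e1]
  · intro i _ hi
    refine tiling_chord_eq_zero [] (descend (j - 1) 2) i j 3 0 fun h => hi ?_
    rw [h]
    push_cast
    ring
  · simp

/-- The last chord must start with `j - 3`. This label completes the vertex, and the other three are
a right extension. -/
theorem tiling_descend_cycleSum (j : ZMod 4) :
    tiling ((baseWord (descend j 3)).map mono ++ [cycleSum]) = mono (1, .chord (j - 2) 2) := by
  rw [tiling_insert_cycleSum, Finset.sum_eq_single (j - 3), ← tiling_descend_three j 2]
  · rw [baseWord_append, List.map_append]
    rfl
  · intro i _ hi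
    refine Eq.trans (congrArg tiling ?_)
      (tiling_chord_eq_zero (descend j 2) [] (j - 2) i 0 3 fun h => hi ?_)
    · rw [show descend j 3 = descend j 2 ++ [.chord (j - 2) 0] from descend_succ j 2]
      simp only [baseWord, List.map_append, List.map_cons, List.map_nil, List.append_assoc,
        List.cons_append, List.nil_append]
    · rw [h]
      push_cast
      ring
  · simp

/-- Inserting the curvature before or after the three arrows gives the same output, and inserting it
between two of them gives no pattern. -/
theorem differential_curvature_three (j : ZMod 4) :
    differential curvature ((baseWord (descend j 3)).map mono) = 0 := by
  have h0 : ∀ a b : List Alg, a.length + b.length = 3 →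
      undeformedOp (a ++ cycleSum :: b) = tiling (a ++ cycleSum :: b) := by
    intro a b h
    rw [undeformedOp_eq, binary_eq_zero, zero_add]
    simp only [List.length_append, List.length_cons]
    omega
  have h1 := tiling_cycleSum_descend j
  have h2 := tiling_descend_cycleSum j
  -- A chord of length four between the arrows `k` and `k - 1` would have to start with `k - 1`, and
  -- would then have to be followed by `k + 1`.
  have hne : ∀ (i k : ZMod 4), (i ≠ k + ((0 : ℕ) : ZMod 4) - 1) ∨ k - 1 ≠ i + ((3 : ℕ) : ZMod 4) - 1 := by
    decide
  have hz : ∀ i, tiling [mono (0, .chord j 0), mono (0, .chord i 3), mono (0, .chord (j - 1) 0),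
      mono (0, .chord (j - 1 - 1) 0)] = 0 := by
    intro i
    rcases hne i j with h | h
    · exact tiling_chord_eq_zero [] [.chord (j - 1) 0, .chord (j - 1 - 1) 0] j i 0 3 h
    · exact tiling_chord_eq_zero [.chord j 0] [.chord (j - 1 - 1) 0] i (j - 1) 3 0 h
  have hz' : ∀ i, tiling [mono (0, .chord j 0), mono (0, .chord (j - 1) 0), mono (0, .chord i 3),
      mono (0, .chord (j - 1 - 1) 0)] = 0 := by
    intro i
    rcases hne i (j - 1) with h | h
    · exact tiling_chord_eq_zero [.chord j 0] [.chord (j - 1 - 1) 0] (j - 1) i 0 3 h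
    · exact tiling_chord_eq_zero [.chord j 0, .chord (j - 1) 0] [] i (j - 1 - 1) 3 0 h
  have h3 := tiling_insert_cycleSum [mono (0, .chord j 0)] [mono (0, .chord (j - 1) 0),
    mono (0, .chord (j - 1 - 1) 0)]
  have h4 := tiling_insert_cycleSum [mono (0, .chord j 0), mono (0, .chord (j - 1) 0)]
    [mono (0, .chord (j - 1 - 1) 0)]
  simp only [List.cons_append, List.nil_append, hz, hz', Finset.sum_const_zero] at h3 h4
  rw [differential_curvature]
  simp only [baseWord, descend, List.map_cons, List.map_nil, cutSum_cons, cutSum_nil] at h1 h2 ⊢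
  rw [h0 _ _ (by simp), h0 _ _ (by simp), h0 _ _ (by simp), h0 _ _ (by simp)]
  simp only [List.cons_append, List.nil_append] at h2 ⊢
  rw [h1, h2, h3, h4, zero_add, zero_add, add_self_eq_zero']

/-- The operations of a weighted deformation with the given curvature. -/
noncomputable def deformedOp : ℕ → List Alg → Alg
  | 0 => undeformedOp
  | 1 => fun l => curvature l + primitive (differential curvature) l
  | W + 2 => primitive fun l => ∑ u : Fin (W + 1),
      insOp (deformedOp (u + 1)) (deformedOp (W + 1 - u)) l

theorem entryAdditive_deformedOp (W : ℕ) : EntryAdditive (deformedOp W) := by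
  match W with
  | 0 =>
    rw [deformedOp]
    exact entryAdditive_undeformedOp
  | 1 =>
    rw [deformedOp]
    exact EntryAdditive.add entryAdditive_curvature (entryAdditive_primitive _)
  | W + 2 =>
    rw [deformedOp]
    exact entryAdditive_primitive _

/-- The sum of the terms of the `A∞`-relation of weight `W` that do not involve weight zero. -/
noncomputable def obstruction (μ : List Alg → ℕ → Alg) (W : ℕ) (l : List Alg) : Alg :=
  ∑ u : Fin (W + 1), insOp (fun c => μ c (u + 1)) (fun c => μ c (W + 1 - u)) l

/-- The two extreme terms of the sum over weights, those with an operation of weight zero, form the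
differential. -/
theorem ins_succ_succ {μ : List Alg → ℕ → Alg} (h0 : ∀ l, μ l 0 = undeformedOp l) (W : ℕ)
    (l : List Alg) : ins μ μ l (W + 2) = differential (fun l => μ l (W + 2)) l +
      obstruction μ W l := by
  rw [ins_apply, Nat.sum_antidiagonal_eq_sum_range_succ_mk, Finset.sum_range_succ,
    Finset.sum_range_succ', obstruction, Finset.sum_range, differential]
  simp only [h0, Nat.sub_self, Nat.sub_zero]
  have e : ∀ u : Fin (W + 1), W + 2 - ((u : ℕ) + 1) = W + 1 - u := fun u => by omega
  simp only [e]
  abel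

/-- The differential of the first possibly not vanishing term of the `A∞`-relation vanishes. -/
theorem differential_ins {μ : List Alg → ℕ → Alg} (hμ : EntryAdditive μ)
    (h0 : ∀ l, μ l 0 = undeformedOp l) {W : ℕ} (h : ∀ l, ∀ u < W, ins μ μ l u = 0)
    (l : List Alg) : differential (fun l => ins μ μ l W) l = 0 := by
  have key := congrFun (ins_ins (μ := μ) hμ l) W
  rw [ins_apply, ins_apply, Finset.sum_eq_single (0, W), Finset.sum_eq_single (W, 0)] at key
  · simp only [h0] at key
    rw [differential, key, add_self_eq_zero']
  · rintro ⟨u, v⟩ huv hne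
    rw [HasAntidiagonal.mem_antidiagonal] at huv
    have hu : u < W := by
      by_contra hu
      exact hne (by simp only [Prod.mk.injEq] at *; omega)
    simp only [fun c => h c u hu]
    exact insOp_zero_left (hμ.apply v) l
  · simp
  · rintro ⟨u, v⟩ huv hne
    rw [HasAntidiagonal.mem_antidiagonal] at huv
    have hv : v < W := by
      by_contra hv
      exact hne (by simp only [Prod.mk.injEq] at *; omega)
    simp only [fun c => h c v hv]
    exact insOp_zero_right _ l
  · simp

theorem ins_apply_zero {μ : List Alg → ℕ → Alg} (h0 : ∀ l, μ l 0 = undeformedOp l)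
    (l : List Alg) : ins μ μ l 0 = 0 := by
  rw [ins_apply, Nat.sum_antidiagonal_eq_sum_range_succ_mk, Finset.sum_range_one]
  simp only [h0]
  exact defect_eq_zero l

theorem ins_apply_one {μ : List Alg → ℕ → Alg} (h0 : ∀ l, μ l 0 = undeformedOp l)
    (l : List Alg) : ins μ μ l 1 = differential (fun l => μ l 1) l := by
  rw [ins_apply, Nat.sum_antidiagonal_eq_sum_range_succ_mk]
  simp [Finset.sum_range_succ, h0, differential]

/-- The grading and normalization of the lower operations make the obstruction a cocycle to which
`differential_primitive_eq` applies. In weight one the exceptional words are checked through the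
explicit curvature; from weight two on there are none. -/
theorem deformedOp_spec (W : ℕ) : IsGradedMap (lam (-1) W) (deformedOp W) ∧
    (W ≠ 0 → IsNormalized (deformedOp W)) ∧ ∀ l, ins (family deformedOp) (family deformedOp) l W = 0 := by
  have hadd : EntryAdditive (family deformedOp) :=
    EntryAdditive.of_apply fun w => entryAdditive_deformedOp w
  have h0 : ∀ l, family deformedOp l 0 = undeformedOp l := fun l => by rw [family, deformedOp]
  induction W using Nat.strong_induction_on with
  | _ W ih =>
  match W with
  | 0 =>
    refine ⟨?_, fun h => absurd rfl h, ins_apply_zero h0⟩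
    rw [deformedOp]
    exact isGradedMap_undeformedOp
  | 1 =>
    have hd := isGradedMap_differential entryAdditive_curvature (commute_lam _ _)
      isGradedMap_curvature
    rw [lam_mul, zero_add, show (-1 : ℤ) + -1 = -2 by ring] at hd
    have hp := isGradedMap_primitive hd
    norm_num at hp
    have e : deformedOp 1 = fun l => curvature l + primitive (differential curvature) l := by
      rw [deformedOp]
    rw [e]
    refine ⟨isGradedMap_curvature.add hp, fun _ => isNormalized_curvature.add
      (isNormalized_primitive _), fun l => ?_⟩
    rw [ins_apply_one h0]
    have e' : (fun l => family deformedOp l 1) = deformedOp 1 := rfl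
    rw [e', e, differential_add, differential_primitive_eq (e := 2) (W := 1)
      (entryAdditive_differential entryAdditive_curvature)
      (isNormalized_differential entryAdditive_curvature isNormalized_curvature (commute_lam _ _)
        isGradedMap_curvature) (Or.inr rfl) one_ne_zero hd
      (differential_differential entryAdditive_curvature), add_self_eq_zero']
    · intro _ h
      omega
    · intro _ _ f
      exact differential_curvature_single _
    · rintro _ _ j k (rfl | rfl)
      · exact differential_curvature_single _
      · exact differential_curvature_three j
  | W + 2 =>
    have e : deformedOp (W + 2) = primitive (obstruction (family deformedOp) W) := by
      rw [deformedOp]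
      rfl
    have hc : EntryAdditive (obstruction (family deformedOp) W) := by
      intro p q x y
      simp only [obstruction, ← Finset.sum_add_distrib]
      exact Finset.sum_congr rfl fun u _ => (hadd.apply _).insOp (hadd.apply _) p q x y
    have hn : IsNormalized (obstruction (family deformedOp) W) := by
      intro l hl
      refine Finset.sum_eq_zero fun u _ => ?_
      exact isNormalized_insOp ((ih (u + 1) (by omega)).2.1 (by omega)) (hadd.apply _)
        ((ih (W + 1 - u) (by omega)).2.1 (by omega)) l hl
    have hg : IsGradedMap (lam (-2) (W + 2)) (obstruction (family deformedOp) W) := by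
      refine IsGradedMap.sum _ fun u _ => ?_
      have := (ih (u + 1) (by omega)).1.insOp (commute_lam _ _) (hadd.apply (W + 1 - u))
        (ih (W + 1 - u) (by omega)).1
      rw [lam_mul, show (u : ℕ) + 1 + (W + 1 - u) = W + 2 by omega] at this
      exact this
    -- The whole relation in weight `W + 2` is closed, since it holds in lower weights. It differs
    -- from the obstruction by a coboundary.
    have hd : ∀ l, differential (obstruction (family deformedOp) W) l = 0 := by
      intro l
      have := differential_ins hadd h0 (W := W + 2) (fun l u hu => (ih u hu).2.2 l) l
      have e : (fun l => ins (family deformedOp) (family deformedOp) l (W + 2)) = fun l =>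
          differential (fun l => family deformedOp l (W + 2)) l +
            obstruction (family deformedOp) W l := funext (ins_succ_succ h0 W)
      rwa [e, differential_add, differential_differential (hadd.apply (W + 2)), zero_add] at this
    refine ⟨?_, fun _ => ?_, fun l => ?_⟩
    · rw [e]
      have := isGradedMap_primitive (e := 2) hg
      rwa [show (1 : ℤ) - 2 = -1 by norm_num] at this
    · rw [e]
      exact isNormalized_primitive _
    · rw [ins_succ_succ h0]
      have e' : (fun l => family deformedOp l (W + 2)) = deformedOp (W + 2) := rfl
      rw [e', e, differential_primitive_eq (e := 2) hc hn (Or.inr rfl) (by omega) hg hd (by omega) (by omega)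
        (by omega), add_self_eq_zero']

/-- A weighted deformation with the given curvature. -/
noncomputable def deformedAlgebra : WeightedAlgebra ground where
  op := deformedOp
  multilinear w := (deformedOp_spec w).1.isMultilinear (entryAdditive_deformedOp w)
  op_zero_nil := by
    rw [deformedOp]
    exact undeformedOp_eq_zero_of_length (by simp)
  op_unit_left r _ a := by rw [deformedOp, undeformedOp_pair]
  op_unit_right r _ a := by rw [deformedOp, undeformedOp_pair]
  op_unit w l h hl := by
    rcases Nat.eq_zero_or_pos w with rfl | hw
    · rw [deformedOp, undeformedOp_eq, binary_eq_zero (by omega), zero_add]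
      exact isNormalized_tiling.eq_zero entryAdditive_tiling hl
    · exact ((deformedOp_spec w).2.1 (by omega)).eq_zero (entryAdditive_deformedOp w) hl
  relation W l := by
    rw [insertSum_eq]
    exact (deformedOp_spec W).2.2 l

theorem deformedAlgebra_isGraded : deformedAlgebra.IsGraded homogeneous lamD lamW := fun w =>
  IsGradedMap.hasDegree (d := 2) (entryAdditive_deformedOp w) (deformedOp_spec w).1

theorem deformedAlgebra_curvature : deformedAlgebra.op 1 [] =
    rho 1 3 + rho 2 3 + rho 3 3 + rho 4 3 := by
  rw [← cycleSum_eq]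
  change deformedOp 1 [] = _
  rw [deformedOp]
  exact (congrArg (cycleSum + ·) (primitive_nil _)).trans (add_zero _)

end TorusAlgebra

/-! ### Dependence of pullbacks on the family pulled back along -/

namespace ListCalculus

open Finset HasAntidiagonal

variable {F M : Type*} [AddCommGroup F] [AddCommGroup M]

theorem insOp_unitFamily (m : List F → F) (l : List F) :
    insOp m (fun r => unitFamily r 0) l = m l := by
  rw [insOp, ← cutSum_left_nil m]
  refine cutSum_congr fun a r _ => ?_
  cases a with
  | nil =>
    rw [if_pos rfl, ← cutSum_right_nil m]
    refine cutSum_congr fun c b _ => ?_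
    cases b <;> simp [unitFamily]
  | cons x a =>
    rw [if_neg (by simp)]
    refine cutSum_eq_zero fun c b _ => ?_
    cases a <;> simp [unitFamily]

/-- Changing a family from weight `W` on changes pullbacks in weight `W` by an insertion. -/
theorem pull_apply_of_agree {f f' : List F → ℕ → F} (hf0 : f [] = 0) (hf0' : f' [] = 0)
    (hf : ∀ l, f l 0 = unitFamily l 0) (hf' : ∀ l, f' l 0 = unitFamily l 0) {W : ℕ}
    (h : ∀ l, ∀ u < W, f' l u = f l u) {φ : List F → ℕ → M} (hφ : EntryAdditive φ) (l : List F) :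
    pull f' φ l W = pull f φ l W + insOp (fun c => f' c W - f c W) (fun r => φ r 0) l := by
  induction hl : l.length using Nat.strong_induction_on generalizing l φ with
  | _ n ih =>
    subst hl
    cases l with
    | nil =>
      rw [pull_nil, pull_nil, insOp_nil, hf0, hf0']
      simp only [Pi.zero_apply, sub_zero]
      exact (add_eq_left.2 (congrFun (hφ.zero_entry [] []) 0)).symm
    | cons x l =>
      rw [pull_cons, pull_cons, insOp_cons, cutSum_cons, hf0, hf0']
      simp only [cutSum_apply, Pi.zero_apply, sub_zero]
      rw [show φ (0 :: x :: l) 0 = 0 from congrFun (hφ.zero_entry [] (x :: l)) 0, zero_add]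
      have key : ∀ c d, c ++ d = l → pull f' (consConv φ (f' (x :: c))) d W =
          (pull f (consConv φ (f (x :: c))) d W + φ ((f' (x :: c) W - f (x :: c) W) :: d) 0) +
            insOp (fun c => f' c W - f c W) (fun r => φ (unitFamily (x :: c) 0 :: r) 0) d := by
        intro c d hcd
        rw [ih d.length (by simp [← hcd]) (hφ.consConv _) d rfl]
        congr 1
        · have e : f' (x :: c) = f (x :: c) + (f' (x :: c) - f (x :: c)) := by abel
          have hz : ∀ u < W, (f' (x :: c) - f (x :: c)) u = 0 := fun u hu => by
            rw [Pi.sub_apply, h _ u hu, sub_self]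
          rw [e, consConv_add hφ, pull_add, Pi.add_apply]
          congr 1
          rw [pull_apply_of_vanish hf (hφ.consConv _) _ d, consConv_apply_of_vanish_right hφ d hz]
          · simp
          · intro r u hu
            rw [consConv_apply_of_vanish_right hφ r fun v hv => hz v (hv.trans hu), hz u hu]
            exact congrFun (hφ.zero_entry [] r) 0
        · have e : (fun r => consConv φ (f' (x :: c)) r 0) =
              fun r => φ (unitFamily (x :: c) 0 :: r) 0 := by
            funext r
            simp [consConv, conv, hf']
          rw [e]
      refine (cutSum_congr key).trans ?_
      rw [cutSum_add, cutSum_add, add_assoc]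
      refine congrArg₂ (· + ·) rfl (congrArg₂ (· + ·) rfl ?_)
      cases l with
      | nil => simp [unitFamily]
      | cons y l =>
        rw [cutSum_cons, cutSum_eq_zero]
        · simp [unitFamily]
        · intro a b _
          have : (fun r => φ (unitFamily (x :: y :: a) 0 :: r) 0) = fun _ => 0 := by
            funext r
            exact congrFun (hφ.zero_entry [] r) 0
          rw [this, insOp_zero_right]

end ListCalculus

/-! ### Gradings and normalization of pullbacks -/

namespace TorusAlgebra

open ListCalculus Finset HasAntidiagonal

/-- The function `φ`, preceded by the entries `p`, is graded. -/
def IsGradedFrom (p : List Letter) (k : ℤ) (φ : List Alg → ℕ → Alg) : Prop :=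
  ∀ (u : ℕ) (l : List Letter) (y : Letter), coeff y (φ (l.map mono) u) ≠ 0 →
    ∃ g, IsPath (p ++ l) g y.2.src y.2.tgt ∧ Letter.barDegree y = lam k u * g

theorem isGradedFrom_nil {k : ℤ} {φ : List Alg → ℕ → Alg} :
    IsGradedFrom [] k φ ↔ ∀ u, IsGradedMap (lam k u) fun l => φ l u := Iff.rfl

/-- The prefix `p` records the inputs consumed by the earlier blocks. After the first block the
function has a fixed first entry, whose degree and ends are those of the inputs recorded. -/
theorem IsGradedFrom.pull {f : List Alg → ℕ → Alg} (hf : IsGradedFrom [] 0 f) {p : List Letter}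
    {k : ℤ} {φ : List Alg → ℕ → Alg} (hφ : EntryAdditive φ) (h : IsGradedFrom p k φ) :
    IsGradedFrom p k (pull f φ) := by
  intro W l
  induction hl : l.length using Nat.strong_induction_on generalizing l p φ W with
  | _ n ih =>
    subst hl
    cases l with
    | nil =>
      intro y hy
      rw [List.map_nil, pull_nil] at hy
      exact h W [] y hy
    | cons x l =>
      intro y hy
      rw [List.map_cons, pull_cons, cutSum_map, cutSum_apply, map_cutSum] at hy
      obtain ⟨c, d, rfl, hcd⟩ := exists_of_cutSum_ne_zero hy
      have hc : IsGradedFrom (p ++ x :: c) k (consConv φ (f (mono x :: c.map mono))) := by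
        intro u r y hy
        simp only [consConv, conv, map_sum] at hy
        obtain ⟨⟨a, b⟩, hab, hy⟩ := Finset.exists_ne_zero_of_sum_ne_zero hy
        rw [HasAntidiagonal.mem_antidiagonal] at hab
        obtain ⟨z, hz, hzy⟩ := EntryAdditive.exists_coeff (hφ.apply b) (p := []) hy
        have h1 := hf a (x :: c) z hz
        have h2 := h b (z :: r) y hzy
        obtain ⟨g, hg, hyg⟩ := isPath_of_entry (commute_lam 0 a) h1 h2
        refine ⟨g, by simpa using hg, ?_⟩
        rw [hyg, lam_mul, zero_add, ← hab]
      obtain ⟨g, hg, hyg⟩ := ih d.length (by simp) (hφ.consConv _) hc W d rfl y hcd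
      exact ⟨g, by simpa using hg, hyg⟩

/-- A normalized strictly unital family, as far as units are concerned. -/
structure IsUnital (f : List Alg → ℕ → Alg) : Prop where
  zero : ∀ l, f l 0 = unitFamily l 0
  pos : ∀ W ≠ 0, IsNormalized fun l => f l W

/-- A unit among the inputs is annihilated by the positive weight part of `f`. The weight-zero part
is the identity and passes the unit on to `φ`, which is normalized in every weight. -/
theorem IsNormalized.pull {f : List Alg → ℕ → Alg} (hf : IsUnital f) {φ : List Alg → ℕ → Alg}
    (hφ : EntryAdditive φ) (h : ∀ W, IsNormalized fun l => φ l W) (W : ℕ) :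
    IsNormalized fun l => pull f φ l W := by
  intro l
  induction hl : l.length using Nat.strong_induction_on generalizing l φ with
  | _ n ih =>
    subst hl
    rintro ⟨e, he⟩
    cases l with
    | nil => simp at he
    | cons x l =>
      beta_reduce
      rw [List.map_cons, pull_cons, cutSum_map, cutSum_apply]
      refine cutSum_eq_zero fun c d hcd => ?_
      by_cases hd : ((0, .idem e) : Letter) ∈ d
      · refine ih d.length (by simp [← hcd]) (hφ.consConv (f (mono x :: c.map mono)))
          (fun u r hr => ?_) d rfl ⟨e, hd⟩
        obtain ⟨e', hr⟩ := hr
        change ∑ ab ∈ antidiagonal u, φ (f (mono x :: c.map mono) ab.1 :: r.map mono) ab.2 = 0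
        refine Finset.sum_eq_zero fun ab _ => eq_zero_of_coeff fun y => ?_
        by_contra hy
        obtain ⟨z, -, hzy⟩ := EntryAdditive.exists_coeff (hφ.apply ab.2) (p := []) hy
        refine hzy ?_
        have := h ab.2 (z :: r) ⟨e', by simp [hr]⟩
        simp only [List.map_cons] at this
        rw [List.nil_append, this, map_zero]
      · have hc : ((0, .idem e) : Letter) ∈ x :: c := by
          rw [← hcd, ← List.cons_append, List.mem_append] at he
          exact he.resolve_right hd
        -- If the unit lies in the first block, only the weight-zero value of `f` on this block
        -- survives.
        have hz : (fun r => conv (fun y => φ (y :: r)) (f (mono x :: c.map mono))) =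
            fun r => φ (unitFamily (mono x :: c.map mono) 0 :: r) := by
          funext r W
          rw [conv, Finset.sum_eq_single (0, W), hf.zero]
          · rintro ⟨u, v⟩ huv hne
            have hu : u ≠ 0 := by
              rintro rfl
              rw [HasAntidiagonal.mem_antidiagonal] at huv
              simp_all
            have := hf.pos u hu (x :: c) ⟨e, hc⟩
            simp only [List.map_cons] at this
            rw [this]
            exact congrFun (hφ.zero_entry [] r) v
          · simp
        rw [hz]
        cases c with
        | nil =>
          obtain rfl : (0, .idem e) = x := by simpa using hc
          have : (fun r => φ (unitFamily (mono (0, .idem e) :: ([] : List Letter).map mono) 0 :: r)) = fun _ => 0 := by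
            refine EntryAdditive.ext_mono (hφ.cons _) (fun _ _ _ _ => by simp) fun r => ?_
            funext u
            exact h u ((0, .idem e) :: r) ⟨e, by simp⟩
          rw [this, pull_zero]
          rfl
        | cons c' c =>
          have : (fun r => φ (unitFamily (mono x :: (c' :: c).map mono) 0 :: r)) = fun _ => 0 := by
            funext r
            exact hφ.zero_entry [] r
          rw [this, pull_zero]
          rfl

end TorusAlgebra

/-! ### Homomorphisms of deformations -/

namespace TorusAlgebra

open ListCalculus WeightedAInfinity Finset HasAntidiagonal

/-- The properties of the operations of a graded weighted deformation. -/
structure IsDeformation (μ : List Alg → ℕ → Alg) : Prop where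
  add : EntryAdditive μ
  zero : ∀ l, μ l 0 = undeformedOp l
  graded : ∀ W, IsGradedMap (lam (-1) W) fun l => μ l W
  normalized : ∀ W ≠ 0, IsNormalized fun l => μ l W
  relation : ∀ l, ins μ μ l = 0

theorem isDeformation_family {X : WeightedAlgebra ground}
    (h : WeightedAInfinity.IsDeformationOf X undeformedOp)
    (hg : X.IsGraded homogeneous lamD lamW) : IsDeformation (family X.op) where
  add := EntryAdditive.of_apply fun w => (X.multilinear w).map_add
  zero l := congrFun h l
  graded W := isGradedMap_of_hasDegree (d := 2) (X.multilinear W) (hg W)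
  normalized W hW := isNormalized_of_eq_zero fun l hl => X.op_unit W l (Or.inr hW) hl
  relation l := by
    funext W
    rw [← insertSum_eq]
    exact X.relation W l

/-- The properties of the component of weight `W` of a graded homomorphism of deformations. -/
structure IsMorphismAt (W : ℕ) (m : List Alg → Alg) : Prop where
  add : EntryAdditive m
  nil : m [] = 0
  graded : IsGradedMap (lam 0 W) m
  zero : W = 0 → ∀ l, m l = unitFamily l 0
  normalized : W ≠ 0 → IsNormalized m

/-- The properties of the components of a graded homomorphism of deformations. -/
def IsMorphism (f : List Alg → ℕ → Alg) : Prop := ∀ W, IsMorphismAt W fun l => f l W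

theorem unitFamily_zero_eq (l : List Alg) : unitFamily l 0 = idZero l := by
  match l with
  | [] => rfl
  | [a] => simp [unitFamily, idZero]
  | _ :: _ :: _ => rfl

theorem family_idMap : family (idMap : ℕ → List Alg → Alg) = unitFamily := by
  funext l W
  cases W with
  | zero => exact (unitFamily_zero_eq l).symm
  | succ W =>
    match l with
    | [] => rfl
    | [a] => simp [unitFamily, family, idMap]
    | _ :: _ :: _ => rfl

theorem isMorphismAt_idZero : IsMorphismAt 0 idZero where
  add := by
    intro p q x y
    match p, q with
    | [], [] => rfl
    | [], _ :: _ => exact (add_zero _).symm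
    | [_], _ => exact (add_zero _).symm
    | _ :: _ :: _, _ => exact (add_zero _).symm
  nil := rfl
  graded := by
    intro l y hy
    match l with
    | [] => exact absurd (map_zero _) hy
    | [x] =>
      obtain rfl : x = y := eq_of_coeff_mono_ne_zero hy
      exact ⟨_, isPath_singleton.2 ⟨rfl, rfl, rfl⟩, by rw [lam_zero, one_mul]⟩
    | _ :: _ :: _ => exact absurd (map_zero _) hy
  zero _ l := (unitFamily_zero_eq l).symm
  normalized h := absurd rfl h

theorem isMorphismAt_zero {W : ℕ} (h : W ≠ 0) : IsMorphismAt W fun _ => 0 where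
  add _ _ _ _ := (add_zero _).symm
  nil := rfl
  graded := IsGradedMap.zero
  zero h' := absurd h' h
  normalized _ _ _ := rfl

namespace IsMorphism

variable {f : List Alg → ℕ → Alg} (hf : IsMorphism f)

include hf

theorem add : EntryAdditive f := EntryAdditive.of_apply fun w => (hf w).add

theorem nil : f [] = 0 := funext fun w => (hf w).nil

theorem zero (l : List Alg) : f l 0 = unitFamily l 0 := (hf 0).zero rfl l

theorem graded : IsGradedFrom [] 0 f := isGradedFrom_nil.2 fun w => (hf w).graded

theorem isUnital : IsUnital f := ⟨hf.zero, fun w hw => (hf w).normalized hw⟩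

end IsMorphism

/-- The components of weight less than `W`. -/
noncomputable def truncate (f : ℕ → List Alg → Alg) (W : ℕ) (l : List Alg) (u : ℕ) : Alg :=
  if u < W then f u l else 0

theorem truncate_of_lt {f : ℕ → List Alg → Alg} {W u : ℕ} (h : u < W) (l : List Alg) :
    truncate f W l u = f u l := if_pos h

theorem truncate_self (f : ℕ → List Alg → Alg) (W : ℕ) (l : List Alg) :
    truncate f W l W = 0 := if_neg (lt_irrefl W)

theorem isMorphism_truncate {f : ℕ → List Alg → Alg} {W : ℕ} (hW : W ≠ 0)
    (h : ∀ u < W, IsMorphismAt u (f u)) : IsMorphism (truncate f W) := by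
  intro u
  by_cases hu : u < W
  · simp only [truncate_of_lt hu]
    exact h u hu
  · simp only [truncate, if_neg hu]
    exact isMorphismAt_zero (by omega)

/-- The left hand side of the relation for a homomorphism `f`. -/
noncomputable def homDefect (μ ν f : List Alg → ℕ → Alg) (W : ℕ) (l : List Alg) : Alg :=
  pull f ν l W + ins μ f l W

theorem differential_zero (l : List Alg) : differential (fun _ => 0) l = 0 := by
  rw [differential, insOp_zero_right, insOp_zero_left entryAdditive_undeformedOp, add_zero]

section

variable {μ ν : List Alg → ℕ → Alg} (hμ : IsDeformation μ) (hν : IsDeformation ν)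

include hμ hν

/-- Changing a homomorphism from weight `W` on affects its relation in weight `W` only through
operations of weight zero, and thereby by a coboundary. Hence the component of weight `W` can repair
a relation whose defect is exact. -/
theorem homDefect_of_agree {f f' : List Alg → ℕ → Alg} (hf : IsMorphism f)
    (hf0 : f' [] = 0) (hf' : ∀ l, f' l 0 = unitFamily l 0) {W : ℕ}
    (h : ∀ l, ∀ u < W, f' l u = f l u) (l : List Alg) : homDefect μ ν f' W l =
      homDefect μ ν f W l + differential (fun c => f' c W - f c W) l := by
  have h1 : ins μ f' l W = ins μ f l W + insOp undeformedOp (fun c => f' c W - f c W) l := by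
    have e : ∀ uv : ℕ × ℕ, insOp (fun c => μ c uv.1) (fun r => f' r uv.2) l =
        insOp (fun c => μ c uv.1) (fun r => f r uv.2) l +
          insOp (fun c => μ c uv.1) (fun r => f' r uv.2 - f r uv.2) l := by
      intro uv
      rw [← insOp_add_right]
      simp
    rw [ins_apply, ins_apply, Finset.sum_congr rfl fun uv _ => e uv, Finset.sum_add_distrib]
    congr 1
    rw [Finset.sum_eq_single (0, W)]
    · simp only [hμ.zero]
    · rintro ⟨u, v⟩ huv hne
      rw [HasAntidiagonal.mem_antidiagonal] at huv
      have hv : v < W := by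
        by_contra hv
        exact hne (by simp only [Prod.mk.injEq] at *; omega)
      simp only [fun r => h r v hv, sub_self]
      exact insOp_zero_right _ l
    · simp
  rw [homDefect, homDefect, h1, pull_apply_of_agree hf.nil hf0 hf.zero hf' h hν.add, differential]
  simp only [hν.zero]
  abel

variable {f : List Alg → ℕ → Alg} (hf : IsMorphism f)

include hf

theorem isGradedMap_homDefect (W : ℕ) : IsGradedMap (lam (-1) W) (homDefect μ ν f W) := by
  refine IsGradedMap.add ?_ ?_
  · exact isGradedFrom_nil.1 (hf.graded.pull hν.add (isGradedFrom_nil.2 hν.graded)) W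
  · simp only [ins_apply]
    refine IsGradedMap.sum _ fun uv huv => ?_
    have := (hμ.graded uv.1).insOp (commute_lam _ _) (hf uv.2).add (hf uv.2).graded
    rw [HasAntidiagonal.mem_antidiagonal] at huv
    rwa [lam_mul, huv, add_zero] at this

theorem entryAdditive_homDefect (W : ℕ) : EntryAdditive (homDefect μ ν f W) :=
  EntryAdditive.add ((EntryAdditive.pull hf.add hf.nil hν.add).apply W)
    ((hμ.add.ins hf.add).apply W)

/-- The failure of `f` to commute with the coderivations is the insertion of the defect, by
`pull_ins_add_ins_pull_apply`. Evaluated on `ν` and combined with the relations for `μ` and `ν`,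
this says that the two insertions forming the differential agree. -/
theorem differential_homDefect {W : ℕ} (h : ∀ l, ∀ u < W, homDefect μ ν f u l = 0)
    (l : List Alg) : differential (homDefect μ ν f W) l = 0 := by
  have key := pull_ins_add_ins_pull_apply hf.nil hf.zero hν.add (W := W) h hν.add l
  have e : ins ν ν = fun _ => 0 := funext hν.relation
  rw [e, pull_zero, Pi.zero_apply, zero_add] at key
  simp only [hν.zero] at key
  have h2 : ins μ (fun l => pull f ν l + ins μ f l) l W =
      insOp undeformedOp (homDefect μ ν f W) l := by
    rw [ins_apply, Finset.sum_eq_single (0, W)]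
    · simp only [hμ.zero]
      rfl
    · rintro ⟨u, v⟩ huv hne
      rw [HasAntidiagonal.mem_antidiagonal] at huv
      have hv : v < W := by
        by_contra hv
        exact hne (by simp only [Prod.mk.injEq] at *; omega)
      have e : (fun r => (pull f ν r + ins μ f r) v) = fun _ => 0 := funext fun r => h r v hv
      rw [e, insOp_zero_right]
    · simp
  have e' : ins μ μ = fun _ => 0 := funext hμ.relation
  rw [ins_add_right, ins_ins hf.add, Pi.add_apply, e', key] at h2
  have h3 : ins (fun _ => (0 : ℕ → Alg)) f l W = 0 := by
    rw [ins_apply]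
    refine Finset.sum_eq_zero fun uv _ => ?_
    exact insOp_zero_left (hf uv.2).add l
  rw [h3, add_zero] at h2
  rw [differential, ← h2]
  exact add_self_eq_zero' _

end

/-- The binary product, in weight zero. -/
noncomputable def binaryFamily (l : List Alg) : ℕ → Alg := Pi.single 0 (binary l)

theorem entryAdditive_binaryFamily : EntryAdditive binaryFamily := by
  intro p q x y
  rw [binaryFamily, entryAdditive_binary p q x y, Pi.single_add]
  rfl

/-- Multiplication from the left, with values in weight zero. -/
noncomputable def mulLeftFamily (z : Alg) : Alg →+ (ℕ → Alg) :=
  (AddMonoidHom.single (fun _ : ℕ => Alg) 0).comp (AddMonoidHom.mulLeft z)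

theorem conv_mulLeftFamily (z : Alg) (e : ℕ → Alg) (W : ℕ) :
    conv (mulLeftFamily z) e W = z * e W := by
  rw [conv, Finset.sum_eq_single (W, 0)]
  · simp [mulLeftFamily]
  · rintro ⟨u, v⟩ huv hne
    have hv : v ≠ 0 := by
      rintro rfl
      rw [HasAntidiagonal.mem_antidiagonal] at huv
      simp_all
    simp [mulLeftFamily, Pi.single_eq_of_ne hv]
  · simp

theorem binaryFamily_cons (z : Alg) (r : List Alg) :
    binaryFamily (z :: r) = conv (mulLeftFamily z) (unitFamily r) := by
  funext W
  rw [conv_mulLeftFamily]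
  match r with
  | [] => simp [binaryFamily, binary, unitFamily]
  | [y] =>
    cases W with
    | zero => simp [binaryFamily, binary, unitFamily]
    | succ W => simp [binaryFamily, binary, unitFamily]
  | _ :: _ :: _ => simp [binaryFamily, binary, unitFamily]

theorem pull_binaryFamily {f : List Alg → ℕ → Alg} (hf0 : f [] = 0) (x : Alg) (l : List Alg)
    (W : ℕ) : pull f binaryFamily (x :: l) W = cutSum (fun c d =>
      ∑ uv ∈ antidiagonal W, f (x :: c) uv.1 * f d uv.2) l := by
  rw [pull_cons, cutSum_apply]
  refine cutSum_congr fun c d _ => ?_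
  rw [pull_conv_left f (fun z r => binaryFamily (z :: r)), conv]
  refine Finset.sum_congr rfl fun uv _ => ?_
  simp only [binaryFamily_cons]
  rw [pull_conv_right, pull_unitFamily_right hf0, conv_mulLeftFamily]

/-- The block containing the unit contributes only in weight zero. The other block then carries the
full weight `W`, in which `f` vanishes. -/
theorem isNormalized_pull_binaryFamily {f : List Alg → ℕ → Alg} (hf0 : f [] = 0)
    (hf : IsUnital f) {W : ℕ} (h : ∀ l, f l W = 0) :
    IsNormalized fun l => pull f binaryFamily l W := by
  rintro l ⟨e, he⟩
  cases l with
  | nil => simp at he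
  | cons x l =>
    beta_reduce
    rw [List.map_cons, pull_binaryFamily hf0, cutSum_map]
    refine cutSum_eq_zero fun c d hcd => Finset.sum_eq_zero ?_
    rintro ⟨u, v⟩ huv
    rw [HasAntidiagonal.mem_antidiagonal] at huv
    rw [← hcd, ← List.cons_append, List.mem_append] at he
    rcases he with he | he
    · rcases Nat.eq_zero_or_pos u with rfl | hu
      · obtain rfl : v = W := by simpa using huv
        rw [h, mul_zero]
      · have := hf.pos u (by omega) (x :: c) ⟨e, he⟩
        simp only [List.map_cons] at this
        rw [this, zero_mul]
    · rcases Nat.eq_zero_or_pos v with rfl | hv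
      · obtain rfl : u = W := by simpa using huv
        rw [h, zero_mul]
      · have := hf.pos v (by omega) d ⟨e, he⟩
        simp only at this
        rw [this, mul_zero]

/-- The product is not normalized and has to be treated apart. Adding it to `ν` cancels it in weight
zero, which leaves a family normalized in every weight. The vanishing of `f` in weight `W` takes
care of the product itself. -/
theorem isNormalized_homDefect {μ ν f : List Alg → ℕ → Alg} (hμ : IsDeformation μ)
    (hν : IsDeformation ν) (hf : IsMorphism f) {W : ℕ} (hW : W ≠ 0) (h : ∀ l, f l W = 0) :
    IsNormalized (homDefect μ ν f W) := by
  refine IsNormalized.add ?_ ?_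
  · have hn := IsNormalized.pull hf.isUnital (φ := fun l => ν l + binaryFamily l) ?_ ?_ W
    · intro l hl
      have h1 := hn l hl
      have h2 := isNormalized_pull_binaryFamily hf.nil hf.isUnital h l hl
      simp only [pull_add, Pi.add_apply] at h1 h2
      rwa [h2, add_zero] at h1
    · intro p q x y
      beta_reduce
      rw [hν.add p q x y, entryAdditive_binaryFamily p q x y]
      abel
    · intro u l hl
      cases u with
      | zero =>
        simp only [Pi.add_apply, hν.zero, binaryFamily, Pi.single_eq_same, undeformedOp_eq]
        rw [isNormalized_tiling l hl, add_zero, add_self_eq_zero']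
      | succ u =>
        have := hν.normalized (u + 1) (by omega) l hl
        simp only at this
        simp [binaryFamily, this]
  · intro l hl
    beta_reduce
    rw [ins_apply]
    refine Finset.sum_eq_zero ?_
    rintro ⟨u, v⟩ huv
    rw [HasAntidiagonal.mem_antidiagonal] at huv
    rcases eq_or_ne v W with rfl | hv
    · simp only [h]
      exact insOp_zero_right _ _
    · have hμu := hμ.normalized u (by omega)
      rcases Nat.eq_zero_or_pos v with rfl | hv0
      · simp only [hf.zero, insOp_unitFamily]
        exact hμu l hl
      · exact isNormalized_insOp hμu (hf v).add ((hf v).normalized (by omega)) l hl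

/-- The components of a homomorphism of deformations. -/
noncomputable def homOp (μ ν : List Alg → ℕ → Alg) : ℕ → List Alg → Alg
  | 0 => idZero
  | W + 1 => primitive (homDefect μ ν (fun l u => if _h : u < W + 1 then homOp μ ν u l else 0) (W + 1))

theorem homOp_succ (μ ν : List Alg → ℕ → Alg) (W : ℕ) : homOp μ ν (W + 1) =
    primitive (homDefect μ ν (truncate (homOp μ ν) (W + 1)) (W + 1)) := by
  rw [homOp]
  rfl

theorem homOp_nil (μ ν : List Alg → ℕ → Alg) (W : ℕ) : homOp μ ν W [] = 0 := by
  cases W with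
  | zero => rw [homOp, idZero]; simp
  | succ W => rw [homOp_succ, primitive_nil]

/-- The components are constructed one weight at a time. The defect of the truncated family is a
normalized cocycle of degree `lam (-1) (W + 1)`, and its primitive is the next component. -/
theorem homOp_spec {μ ν : List Alg → ℕ → Alg} (hμ : IsDeformation μ) (hν : IsDeformation ν)
    (h1 : μ [] 1 = ν [] 1) (W : ℕ) : IsMorphismAt W (homOp μ ν W) ∧
      ∀ l, homDefect μ ν (family (homOp μ ν)) W l = 0 := by
  have hnil : family (homOp μ ν) [] = 0 := funext (homOp_nil μ ν)
  have hzero : ∀ l, family (homOp μ ν) l 0 = unitFamily l 0 := by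
    intro l
    rw [family, homOp, unitFamily_zero_eq]
  induction W using Nat.strong_induction_on with
  | _ W ih =>
  cases W with
  | zero =>
    have e : homOp μ ν 0 = idZero := by rw [homOp]
    refine ⟨by rw [e]; exact isMorphismAt_idZero, fun l => ?_⟩
    rw [homDefect, pull_apply_of_vanish hzero hν.add (by simp), hν.zero, ins_apply,
      Nat.sum_antidiagonal_eq_sum_range_succ_mk, Finset.sum_range_one]
    simp only [hμ.zero, hzero, insOp_unitFamily]
    exact add_self_eq_zero' _
  | succ W =>
    have hF := isMorphism_truncate (f := homOp μ ν) (Nat.succ_ne_zero W) fun u hu => (ih u hu).1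
    have agree : ∀ l, ∀ u < W + 1, family (homOp μ ν) l u = truncate (homOp μ ν) (W + 1) l u :=
      fun l u hu => (truncate_of_lt hu l).symm
    have hlow : ∀ l, ∀ u < W + 1, homDefect μ ν (truncate (homOp μ ν) (W + 1)) u l = 0 := by
      intro l u hu
      have := homDefect_of_agree hμ hν hF hnil hzero (W := u)
        (fun l v hv => agree l v (hv.trans hu)) l
      rw [(ih u hu).2] at this
      simp only [fun l => agree l u hu, sub_self, differential_zero, add_zero] at this
      exact this.symm
    have hg := isGradedMap_homDefect hμ hν hF (W + 1)
    have hn := isNormalized_homDefect hμ hν hF (Nat.succ_ne_zero W)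
      (truncate_self (homOp μ ν) (W + 1))
    have hd := differential_homDefect hμ hν hF hlow
    have hp := differential_primitive_eq (e := 1) (entryAdditive_homDefect hμ hν hF (W + 1)) hn
      (Or.inl rfl) (Nat.succ_ne_zero W) hg hd ?_ (by omega) (by omega)
    · refine ⟨?_, fun l => ?_⟩
      · rw [homOp_succ]
        refine ⟨entryAdditive_primitive _, primitive_nil _, ?_, fun h => absurd h (Nat.succ_ne_zero W),
          fun _ => isNormalized_primitive _⟩
        have := isGradedMap_primitive (e := 1) hg
        rwa [sub_self] at this
      · rw [homDefect_of_agree hμ hν hF hnil hzero agree]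
        simp only [truncate_self, sub_zero]
        have e : (fun c => family (homOp μ ν) c (W + 1)) = homOp μ ν (W + 1) := rfl
        rw [e, homOp_succ, hp]
        exact add_self_eq_zero' _
    -- The only exceptional word is the empty one in weight one, where the defect is the sum of the
    -- two curvatures. This is the one place where their equality is needed.
    · intro hW _
      obtain rfl : W = 0 := by omega
      have hh : homOp μ ν 0 = idZero := by rw [homOp]
      rw [homDefect, pull_nil]
      have e : ins μ (truncate (homOp μ ν) (0 + 1)) [] (0 + 1) = μ [] 1 := by
        rw [ins_apply, Nat.sum_antidiagonal_eq_sum_range_succ_mk]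
        simp only [Finset.sum_range_succ, Finset.sum_range_zero, insOp_nil, truncate, hh]
        simp [idZero]
      rw [e, h1]
      exact add_self_eq_zero' _

end TorusAlgebra

/-! ### Inverses -/

namespace TorusAlgebra

open ListCalculus WeightedAInfinity Finset HasAntidiagonal

theorem isMorphism_unitFamily : IsMorphism unitFamily := by
  rw [← family_idMap]
  intro W
  cases W with
  | zero => exact isMorphismAt_idZero
  | succ W => exact isMorphismAt_zero (Nat.succ_ne_zero W)

theorem unitFamily_apply_of_ne_zero {W : ℕ} (hW : W ≠ 0) (l : List Alg) : unitFamily l W = 0 := by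
  obtain ⟨W, rfl⟩ := Nat.exists_eq_succ_of_ne_zero hW
  rw [← family_idMap]
  rfl

/-- The weight-zero part of `g`, the identity, is not normalized. It is cancelled by adding
`unitFamily`, whose pullback is `f`. -/
theorem isNormalized_pull_of_isMorphism {f g : List Alg → ℕ → Alg} (hf : IsMorphism f)
    (hg : IsMorphism g) {W : ℕ} (hW : W ≠ 0) : IsNormalized fun l => pull f g l W := by
  have hn := IsNormalized.pull hf.isUnital (φ := fun l => g l + unitFamily l) ?_ ?_ W
  · intro l hl
    have h1 := hn l hl
    have h2 := (hf W).normalized hW l hl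
    simp only [pull_add, Pi.add_apply, pull_unitFamily_right hf.nil] at h1 h2
    rwa [h2, add_zero] at h1
  · intro p q x y
    beta_reduce
    rw [hg.add p q x y, isMorphism_unitFamily.add p q x y]
    abel
  · intro u l hl
    rcases eq_or_ne u 0 with rfl | hu
    · simp only [Pi.add_apply, hg.zero]
      exact add_self_eq_zero' _
    · have := (hg u).normalized hu l hl
      simp only [Pi.add_apply, unitFamily_apply_of_ne_zero hu, add_zero] at this ⊢
      exact this

/-- The composite of two homomorphisms. -/
theorem isMorphism_pull {f g : List Alg → ℕ → Alg} (hf : IsMorphism f) (hg : IsMorphism g) :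
    IsMorphism (pull f g) := fun W => {
  add := (EntryAdditive.pull hf.add hf.nil hg.add).apply W
  nil := by rw [pull_nil, hg.nil]; rfl
  graded := isGradedFrom_nil.1 (hf.graded.pull hg.add hg.graded) W
  zero := by
    rintro rfl l
    rw [pull_apply_of_vanish hf.zero hg.add (by simp), hg.zero]
  normalized := isNormalized_pull_of_isMorphism hf hg }

/-- The components of the left inverse of a homomorphism. -/
noncomputable def invOp (f : List Alg → ℕ → Alg) : ℕ → List Alg → Alg
  | 0 => idZero
  | W + 1 => fun l =>
      pull f (fun r u => if _h : u < W + 1 then invOp f u r else 0) l (W + 1)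

theorem invOp_zero (f : List Alg → ℕ → Alg) : invOp f 0 = idZero := by rw [invOp]

theorem invOp_succ (f : List Alg → ℕ → Alg) (W : ℕ) :
    invOp f (W + 1) = fun l => pull f (truncate (invOp f) (W + 1)) l (W + 1) := by
  rw [invOp]
  rfl

section

variable {f : List Alg → ℕ → Alg} (hf : IsMorphism f)

include hf

theorem isMorphism_invOp : IsMorphism (family (invOp f)) := by
  intro W
  change IsMorphismAt W (invOp f W)
  induction W using Nat.strong_induction_on with
  | _ W ih =>
  cases W with
  | zero => rw [invOp_zero]; exact isMorphismAt_idZero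
  | succ W =>
    rw [invOp_succ]
    exact isMorphism_pull hf (isMorphism_truncate (Nat.succ_ne_zero W) ih) (W + 1)

/-- In each positive weight the new component enters the composite unchanged, and it was defined as
the contribution of the lower ones, so that the two cancel. -/
theorem pull_invOp (l : List Alg) : pull f (family (invOp f)) l = unitFamily l := by
  have hg := isMorphism_invOp hf
  funext W
  cases W with
  | zero => exact (isMorphism_pull hf hg).zero l
  | succ W =>
    have hG := isMorphism_truncate (f := invOp f) (Nat.succ_ne_zero W) fun u _ => hg u
    have h := pull_apply_of_vanish hf.zero (W := W + 1)
      (ψ := fun l => family (invOp f) l + truncate (invOp f) (W + 1) l) ?_ ?_ l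
    · simp only [pull_add, Pi.add_apply, truncate_self, add_zero] at h
      have e : family (invOp f) l (W + 1) = pull f (truncate (invOp f) (W + 1)) l (W + 1) :=
        congrFun (invOp_succ f W) l
      rw [e] at h
      rw [unitFamily_apply_of_ne_zero (Nat.succ_ne_zero W)]
      simpa using h
    · intro p q x y
      beta_reduce
      rw [hg.add p q x y, hG.add p q x y]
      abel
    · intro l u hu
      rw [Pi.add_apply, truncate_of_lt hu]
      exact add_self_eq_zero' _

/-- The left inverse has a left inverse in turn, and by associativity the latter equals `f`. -/
theorem pull_invOp_right (l : List Alg) : pull (family (invOp f)) f l = unitFamily l := by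
  have hg := isMorphism_invOp hf
  have hg' := isMorphism_invOp hg
  have h : family (invOp (family (invOp f))) = f := by
    funext l
    rw [← pull_unitFamily_right hf.nil l, ← funext (pull_invOp hg),
      pull_pull hf.nil hg.add hg.nil hg'.add, funext (pull_invOp hf), pull_unitFamily hg'.add]
  have h2 := pull_invOp hg l
  rwa [h] at h2

/-- The coalgebra map of `f` commutes with the coderivations and has a two-sided inverse, which
therefore commutes with them as well. -/
theorem homDefect_invOp {μ ν : List Alg → ℕ → Alg} (hν : IsDeformation ν)
    (h : ∀ W l, homDefect μ ν f W l = 0) (W : ℕ) (l : List Alg) :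
    homDefect ν μ (family (invOp f)) W l = 0 := by
  have hg := isMorphism_invOp hf
  have h1 : ∀ l, ins μ f l = pull f ν l := fun l => funext fun W =>
    add_right_cancel (b := ins μ f l W) ((add_self_eq_zero' _).trans (h W l).symm)
  have h2 : ∀ l, pull f (ins ν (family (invOp f))) l = μ l := by
    intro l
    rw [pull_ins_eq_ins_pull hf.nil hν.add h1 hg.add, funext (pull_invOp hf)]
    funext W
    rw [ins_apply, Finset.sum_eq_single (W, 0)]
    · exact insOp_unitFamily _ l
    · rintro ⟨u, v⟩ huv hne
      rw [HasAntidiagonal.mem_antidiagonal] at huv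
      have hv : v ≠ 0 := by
        rintro rfl
        simp_all
      simp only [unitFamily_apply_of_ne_zero hv]
      exact insOp_zero_right _ l
    · simp
  have h3 : ins ν (family (invOp f)) l = pull (family (invOp f)) μ l := by
    rw [← funext h2, pull_pull hg.nil hf.add hf.nil (hν.add.ins hg.add),
      funext (pull_invOp_right hf), pull_unitFamily (hν.add.ins hg.add)]
  rw [homDefect, h3]
  exact add_self_eq_zero' _

end

/-- A homomorphism of weighted algebras from its components. -/
noncomputable def homOf {X Y : WeightedAlgebra ground} (hY : IsDeformation (family Y.op))
    (f : ℕ → List Alg → Alg) (hf : IsMorphism (family f))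
    (h : ∀ W l, homDefect (family X.op) (family Y.op) (family f) W l = 0) : Hom X Y where
  map := f
  multilinear W := IsGradedMap.isMultilinear (hf W).add (hf W).graded
  map_zero_nil := (hf 0).nil
  map_unit r _ := by
    have := hf.zero [r]
    rw [unitFamily_zero_eq] at this
    exact this
  map_unit_eq_zero W l hl hr := by
    rcases eq_or_ne W 0 with rfl | hW
    · have := hf.zero l
      rw [unitFamily_zero_eq] at this
      refine this.trans ?_
      match l with
      | [] => rfl
      | [_] => simp at hl
      | _ :: _ :: _ => rfl
    · exact ((hf W).normalized hW).eq_zero (hf W).add hr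
  relation W l := by
    rw [insertSum_eq, composeSum_eq hY.add fun w => (hf w).nil, add_comm]
    exact h W l

theorem isOverIdentity_homOf {X Y : WeightedAlgebra ground} (hY : IsDeformation (family Y.op))
    (f : ℕ → List Alg → Alg) (hf : IsMorphism (family f))
    (h : ∀ W l, homDefect (family X.op) (family Y.op) (family f) W l = 0) :
    (homOf hY f hf h).IsOverIdentity :=
  funext fun l => (hf.zero l).trans (unitFamily_zero_eq l)

theorem isGraded_homOf {X Y : WeightedAlgebra ground} (hY : IsDeformation (family Y.op))
    (f : ℕ → List Alg → Alg) (hf : IsMorphism (family f))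
    (h : ∀ W l, homDefect (family X.op) (family Y.op) (family f) W l = 0) :
    (homOf hY f hf h).IsGraded homogeneous lamD lamW := fun W =>
  IsGradedMap.hasDegree (d := 1) (hf W).add (by rw [sub_self]; exact (hf W).graded)

end TorusAlgebra

/-- Up to isomorphism, there is a unique `Γ`-graded weighted deformation of the undeformed torus
`A∞`-algebra with curvature `μ_0^1 = ρ_1234 + ρ_2341 + ρ_3412 + ρ_4123`. -/
theorem mainTheorem4 :
    (∃ X : WeightedAInfinity.WeightedAlgebra TorusAlgebra.ground,
      WeightedAInfinity.IsDeformationOf X TorusAlgebra.undeformedOp ∧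
      X.IsGraded TorusAlgebra.homogeneous TorusAlgebra.lamD TorusAlgebra.lamW ∧
      X.op 1 [] = TorusAlgebra.rho 1 3 + TorusAlgebra.rho 2 3 + TorusAlgebra.rho 3 3 +
        TorusAlgebra.rho 4 3) ∧
    ∀ X Y : WeightedAInfinity.WeightedAlgebra TorusAlgebra.ground,
      WeightedAInfinity.IsDeformationOf X TorusAlgebra.undeformedOp →
      X.IsGraded TorusAlgebra.homogeneous TorusAlgebra.lamD TorusAlgebra.lamW →
      X.op 1 [] = TorusAlgebra.rho 1 3 + TorusAlgebra.rho 2 3 + TorusAlgebra.rho 3 3 +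
        TorusAlgebra.rho 4 3 →
      WeightedAInfinity.IsDeformationOf Y TorusAlgebra.undeformedOp →
      Y.IsGraded TorusAlgebra.homogeneous TorusAlgebra.lamD TorusAlgebra.lamW →
      Y.op 1 [] = TorusAlgebra.rho 1 3 + TorusAlgebra.rho 2 3 + TorusAlgebra.rho 3 3 +
        TorusAlgebra.rho 4 3 →
      ∃ (f : WeightedAInfinity.Hom X Y) (g : WeightedAInfinity.Hom Y X),
        f.IsInverse g ∧ f.IsOverIdentity ∧ g.IsOverIdentity ∧
        f.IsGraded TorusAlgebra.homogeneous TorusAlgebra.lamD TorusAlgebra.lamW ∧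
        g.IsGraded TorusAlgebra.homogeneous TorusAlgebra.lamD TorusAlgebra.lamW := by
  open TorusAlgebra WeightedAInfinity ListCalculus in
  refine ⟨⟨deformedAlgebra, ?_, deformedAlgebra_isGraded, deformedAlgebra_curvature⟩, ?_⟩
  · funext l
    change deformedOp 0 l = _
    rw [deformedOp]
  · intro X Y hX hXg hX1 hY hYg hY1
    have hμ := isDeformation_family hX hXg
    have hν := isDeformation_family hY hYg
    have h1 : family X.op [] 1 = family Y.op [] 1 := hX1.trans hY1.symm
    set F := homOp (family X.op) (family Y.op)
    have hF : IsMorphism (family F) := fun W => (homOp_spec hμ hν h1 W).1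
    have hFr : ∀ W l, homDefect (family X.op) (family Y.op) (family F) W l = 0 :=
      fun W => (homOp_spec hμ hν h1 W).2
    have hG := isMorphism_invOp hF
    refine ⟨homOf hν F hF hFr, homOf hμ (invOp (family F)) hG (homDefect_invOp hF hν hFr),
      ⟨?_, ?_⟩, isOverIdentity_homOf .., isOverIdentity_homOf .., isGraded_homOf _ _ _ _,
      isGraded_homOf _ _ _ _⟩
    · funext W l
      refine (composeSum_eq hG.add (fun w => (hF w).nil) W l).trans ?_
      rw [pull_invOp hF, ← family_idMap]
      rfl
    · funext W l
      refine (composeSum_eq hF.add (fun w => (hG w).nil) W l).trans ?_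
      rw [pull_invOp_right hF, ← family_idMap]
      rfl
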